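/- **Setting.** Let $a>0$, $D>0$, $\mu\in\mathbb R$, and let $W:\mathbb R\to\mathbb R$ be bounded, measurable and $1$-periodic with $\int_0^1W=0$. Let $T_c>0$ be the critical temperature, i.e. the solution of $\frac1a=\int_{\mathbb R}\frac{\tanh((p^2-\mu)/(2T_c))}{p^2-\mu}\frac{dp}{2\pi}$ (assumed to exist). For $h>0$ put $T=T_c(1-Dh^2)$; let $\Delta_0>0$ solve the gap equation $\frac1a=\int_{\mathbb R}\frac{1}{K_T^0(p)}\frac{dp}{2\pi}$, where $K_T^0(p)=E(p)/\tanh(E(p)/(2T))$ and $E(p)=\sqrt{(p^2-\mu)^2+\Delta_0^2}$. An operator on $L^2(\mathbb R)$ is periodic if it commutes with translation by $1$; $\operatorname{Tr}$ denotes the trace per unit volume, $\operatorname{Tr}B=\operatorname{tr}(\chi_{[0,1]}B)$. A state $\Gamma=\begin{pmatrix}\gamma&\alpha\\ \bar\alpha&1-\bar\gamma\end{pmatrix}$ on $L^2(\mathbb R)\oplus L^2(\mathbb R)$ is admissible if $0\le\Gamma\le1$, $\gamma$ and $\alpha$ are periodic and $\operatorname{Tr}(1-\nabla^2)\gamma<\infty$.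 Its energy is $$\mathcal F(\Gamma)=\operatorname{Tr}(-h^2\nabla^2-\mu+h^2W)\gamma+T\operatorname{Tr}\Gamma\ln\Gamma-ah\int_0^1|\alpha(x,x)|^2dx .$$ The translation-invariant minimizer $\Gamma^0$ is the Fourier multiplier with symbol $(1+e^{H^0(hp)/T})^{-1}$, $H^0(p)=\begin{pmatrix}p^2-\mu&-\Delta_0\\-\Delta_0&-p^2+\mu\end{pmatrix}$. Its off-diagonal entry has the integral kernel $\alpha^0((x-y)/h)=\frac{\Delta_0}{2}\int_{\mathbb R}\frac{e^{ip(x-y)}}{K_T^0(hp)}\frac{dp}{2\pi}$. For a periodic operator $\eta$ put $\|\eta\|_{H^1}^2=\operatorname{Tr}[\eta^*(1-h^2\nabla^2)\eta]$. For a $1$-periodic function $\psi$ with Fourier coefficients $\hat\psi(p)$, $p\in2\pi\mathbb Z$, put $\|\psi\|_{H^s}^2=\sum_p(1+p^2)^s|\hat\psi(p)|^2$. **Proposition.** There are constants $C,\epsilon_0>0$, depending only on $\mu,a,D,W$, such that for all $0<h\le\epsilon\le\epsilon_0$ and every admissible $\Gamma$ with $\mathcal F(\Gamma)\le\mathcal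 F(\Gamma^0)$, the kernel of $\alpha=[\Gamma]_{12}$ can be written as $$\alpha(x,y)=\tfrac12(\psi(x)+\psi(y))\,\alpha^0((x-y)/h)+\sigma(x,y),$$ where $\psi\in H^2$ is $1$-periodic, $\|\psi\|_{H^1}\le C$, $\|\psi\|_{H^2}\le C\epsilon h^{-1}$, $\hat\psi(p)=0$ for $|p|\ge\epsilon/h$, and $\|\sigma\|_{H^1}^2\le C\epsilon^{-2}h^3$. Moreover $\sigma=\sigma_1+\sigma_2$ with $\|\sigma_1\|_{H^1}^2\le Ch^3$ and $$\sigma_2(x,y)=\tfrac12(\tilde\psi(x)+\tilde\psi(y))\,\alpha^0((x-y)/h),$$ where $\tilde\psi\in H^1$ is $1$-periodic, $\hat{\tilde\psi}(p)=0$ for $|p|<\epsilon/h$, and $\psi+\tilde\psi=\psi_0$ almost everywhere, with $$\psi_0(y)=\Big(h\int_{\mathbb R}|\alpha^0(x)|^2dx\Big)^{-1}\int_{\mathbb R}\alpha^0((x-y)/h)\,\alpha(x,y)\,dx .$$ -/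

import Mathlib

open MeasureTheory
open scoped FourierTransform ENNReal

noncomputable section

namespace BCS

/-! ### Operators on `L²(ℝ)` and on `L²(ℝ) ⊕ L²(ℝ)` -/

/-- The Hilbert space `L²(ℝ)`. -/
abbrev L2 : Type := Lp ℂ 2 (volume : Measure ℝ)

/-- Bounded operators on `L²(ℝ)`. -/
abbrev Op : Type := L2 →L[ℂ] L2

/-- The Hilbert space `L²(ℝ) ⊕ L²(ℝ)`. -/
abbrev L2Sum : Type := WithLp 2 (L2 × L2)

/-- Bounded operators on `L²(ℝ) ⊕ L²(ℝ)`. -/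
abbrev SumOp : Type := L2Sum →L[ℂ] L2Sum

/-- First inclusion `f ↦ (f, 0)`. -/
def inl : L2 →L[ℂ] L2Sum :=
  (WithLp.prodContinuousLinearEquiv 2 ℂ L2 L2).symm.toContinuousLinearMap ∘L
    ContinuousLinearMap.inl ℂ L2 L2

/-- Second inclusion `g ↦ (0, g)`. -/
def inr : L2 →L[ℂ] L2Sum :=
  (WithLp.prodContinuousLinearEquiv 2 ℂ L2 L2).symm.toContinuousLinearMap ∘L
    ContinuousLinearMap.inr ℂ L2 L2

/-- First coordinate. -/
def fst : L2Sum →L[ℂ] L2 := WithLp.fstL 2 ℂ L2 L2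

/-- Second coordinate. -/
def snd : L2Sum →L[ℂ] L2 := WithLp.sndL 2 ℂ L2 L2

/-- The entry `[Γ]₁₁` of an operator-valued `2 × 2` matrix. -/
def entry11 (Γ : SumOp) : Op := fst ∘L Γ ∘L inl

/-- The entry `[Γ]₁₂`. -/
def entry12 (Γ : SumOp) : Op := fst ∘L Γ ∘L inr

/-- The entry `[Γ]₂₁`. -/
def entry21 (Γ : SumOp) : Op := snd ∘L Γ ∘L inl

/-- The entry `[Γ]₂₂`. -/
def entry22 (Γ : SumOp) : Op := snd ∘L Γ ∘L inr

/-- The operator with the given four entries. -/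
def ofEntries (A B C D : Op) : SumOp :=
  inl ∘L (A ∘L fst + B ∘L snd) + inr ∘L (C ∘L fst + D ∘L snd)

/-- Pointwise complex conjugation on `L²(ℝ)`, a conjugate-linear isometry. -/
def conjL2 : L2 →L⋆[ℂ] L2 :=
  LinearMap.mkContinuous
    { toFun := fun f => star f
      map_add' := fun f g => by
        apply Lp.ext
        filter_upwards [Lp.coeFn_star (f + g), Lp.coeFn_add f g,
          Lp.coeFn_add (star f) (star g), Lp.coeFn_star f, Lp.coeFn_star g] with x h1 h2 h3 h4 h5
        rw [h1, Pi.star_apply, h2, h3, Pi.add_apply, Pi.add_apply, h4, h5, Pi.star_apply,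
          Pi.star_apply, star_add]
      map_smul' := fun c f => by
        apply Lp.ext
        filter_upwards [Lp.coeFn_star (c • f), Lp.coeFn_smul c f,
          Lp.coeFn_smul ((starRingEnd ℂ) c) (star f), Lp.coeFn_star f] with x h1 h2 h3 h4
        simp [h1, h2, h3, h4] }
    1 (fun f => by
      rw [one_mul]
      apply Lp.norm_le_norm_of_ae_le
      filter_upwards [Lp.coeFn_star f] with x h1
      simp [h1])

/-- The complex conjugate `Ā` of an operator: `Ā f = conj (A (conj f))`. If `A` has the integral
kernel `k (x, y)`, then `Ā` has the integral kernel `conj (k (x, y))`. -/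
def conjOp (A : Op) : Op := conjL2.comp (A.comp conjL2)

/-- The function `f(A)` of a bounded self-adjoint operator `A` on a complex Hilbert space
(continuous functional calculus). -/
def opFun {H : Type*} [NormedAddCommGroup H] [InnerProductSpace ℂ H] [CompleteSpace H]
    (f : ℝ → ℝ) (A : H →L[ℂ] H) : H →L[ℂ] H := cfc f A

/-- Multiplication by a bounded measurable function (and `0` for all other functions). -/
def mulOp (m : ℝ → ℂ) : Op :=
  open Classical in
  if hm : MemLp m ∞ (volume : Measure ℝ) then
    ContinuousLinearMap.holderL volume ∞ 2 2 (ContinuousLinearMap.mul ℂ ℂ) (hm.toLp m)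
  else 0

/-- The Fourier multiplier `m(-i∇)` with a bounded symbol `m`. In Mathlib's normalization the
Fourier variable `ξ` corresponds to the momentum `p = 2πξ`. -/
def fourierMul (m : ℝ → ℂ) : Op :=
  (Lp.fourierTransformₗᵢ ℝ ℂ).symm.toLinearIsometry.toContinuousLinearMap ∘L
    mulOp (fun ξ => m (2 * Real.pi * ξ)) ∘L
      (Lp.fourierTransformₗᵢ ℝ ℂ).toLinearIsometry.toContinuousLinearMap

/-- Translation by the period: `f ↦ f (· + 1)`. -/
def translation : Op :=
  (Lp.compMeasurePreservingₗᵢ ℂ (fun x : ℝ => x + 1)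
    (measurePreserving_add_right volume (1 : ℝ))).toContinuousLinearMap

/-- An operator is periodic if it commutes with translation by `1`. -/
def IsPeriodicOp (A : Op) : Prop := A ∘L translation = translation ∘L A

/-- `A` is an integral operator with kernel `k`. -/
def IsKernel (A : Op) (k : ℝ → ℝ → ℂ) : Prop :=
  AEStronglyMeasurable (Function.uncurry k) (volume.prod volume) ∧
    ∀ f : L2, ∀ᵐ x : ℝ,
      Integrable (fun y => k x y * f y) ∧ A f x = ∫ y, k x y * f y

/-! ### Traces per unit volume -/

/-- The function `e^{2πinx}` on the unit interval, extended by zero. -/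
def cellFun (n : ℤ) : ℝ → ℂ :=
  (Set.Ico (0 : ℝ) 1).indicator (fun x => Complex.exp (2 * Real.pi * n * x * Complex.I))

theorem memLp_cellFun (n : ℤ) : MemLp (cellFun n) 2 (volume : Measure ℝ) := by
  rw [cellFun, memLp_indicator_iff_restrict measurableSet_Ico]
  have : IsFiniteMeasure ((volume : Measure ℝ).restrict (Set.Ico (0 : ℝ) 1)) :=
    ⟨by simp⟩
  refine MemLp.of_bound (Continuous.aestronglyMeasurable (by fun_prop)) 1 ?_
  filter_upwards with x
  have : (2 * Real.pi * n * x * Complex.I : ℂ) = ((2 * Real.pi * n * x : ℝ) : ℂ) * Complex.I := by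
    push_cast; ring
  rw [this, Complex.norm_exp_ofReal_mul_I]

/-- The standard orthonormal basis of `L²([0,1])`, regarded as a family in `L²(ℝ)`. -/
def cellBasis (n : ℤ) : L2 := (memLp_cellFun n).toLp (cellFun n)

/-- The trace per unit volume of a periodic operator `B`: the trace of `χ B`, with `χ` the
characteristic function of the unit interval. -/
def trPV (B : Op) : ℂ := ∑' n : ℤ, inner ℂ (cellBasis n) (B (cellBasis n))

/-- For a symbol `m ≥ 0`, the trace per unit volume `Tr [A* m(-i∇) A] ∈ [0, ∞]`, where
`⟨f, m(-i∇) f⟩ = ∫ m(2πξ) |𝓕f(ξ)|² dξ`. -/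
def trForm (m : ℝ → ℝ) (A : Op) : ℝ≥0∞ :=
  ∑' n : ℤ, ∫⁻ ξ : ℝ, ENNReal.ofReal (m (2 * Real.pi * ξ)) *
    ‖(Lp.fourierTransformₗᵢ ℝ ℂ (A (cellBasis n)) : L2) ξ‖ₑ ^ 2

/-- The squared `H¹` norm of a periodic operator, `‖η‖² = Tr [η* (1 - h²∇²) η]`. -/
def h1NormSq (h : ℝ) (η : Op) : ℝ≥0∞ := trForm (fun p => 1 + h ^ 2 * p ^ 2) η

/-! ### The BCS functional -/

/-- Admissible states: periodic `Γ = (γ, α; ᾱ, 1 - γ̄)` with `0 ≤ Γ ≤ 1` and with finite kinetic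
energy and particle number per unit volume, `Tr (1 - ∇²) γ = Tr [γ^{1/2} (1 - ∇²) γ^{1/2}] < ∞`. -/
structure Admissible (Γ : SumOp) : Prop where
  entry21_eq : entry21 Γ = conjOp (entry12 Γ)
  entry22_eq : entry22 Γ = 1 - conjOp (entry11 Γ)
  nonneg : Γ.IsPositive
  le_one : (1 - Γ).IsPositive
  periodic11 : IsPeriodicOp (entry11 Γ)
  periodic12 : IsPeriodicOp (entry12 Γ)
  finite_kinetic : trForm (fun p => 1 + p ^ 2) (opFun Real.sqrt (entry11 Γ)) < ∞

/-- The entropy per unit volume `S(Γ) = - Tr Γ ln Γ`; the trace per unit volume on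
`L²(ℝ) ⊕ L²(ℝ)` is the sum over the two diagonal entries. -/
def entropy (Γ : SumOp) : ℝ :=
  (trPV (entry11 (opFun Real.negMulLog Γ)) + trPV (entry22 (opFun Real.negMulLog Γ))).re

/-- A kernel `k` of `A` that is continuous in the first variable for almost every value of the
second. On the diagonal, `k (y, y)` is then determined for almost every `y` by `A`. -/
def IsDiagKernel (A : Op) (k : ℝ → ℝ → ℂ) : Prop :=
  IsKernel A k ∧ ∀ᵐ y : ℝ, Continuous (fun x => k x y)

/-- `∫₀¹ |α(x,x)|² dx`, where `α(x,y)` is the integral kernel of `A`. -/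
def diagSq (A : Op) : ℝ :=
  open Classical in
  if H : ∃ k, IsDiagKernel A k then ∫ x in (0 : ℝ)..1, ‖H.choose x x‖ ^ 2 else 0

/-- The BCS functional (per unit volume, in macroscopic variables)
`Tr (-h²∇² - μ + h² W) γ - T S(Γ) - a h ∫₀¹ |α(x,x)|² dx`, where `γ = [Γ]₁₁`, `α = [Γ]₁₂` and
`Tr (-h²∇²) γ = Tr [γ^{1/2} (-h²∇²) γ^{1/2}]`. -/
def energy (μ a T h : ℝ) (W : ℝ → ℝ) (Γ : SumOp) : ℝ :=
  (trForm (fun p => h ^ 2 * p ^ 2) (opFun Real.sqrt (entry11 Γ))).toReal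
    + (trPV (mulOp (fun x => ((-μ + h ^ 2 * W x : ℝ) : ℂ)) ∘L entry11 Γ)).re
    - T * entropy Γ - a * h * diagSq (entry12 Γ)

/-! ### The translation-invariant case -/

/-- `Tc` is the critical temperature:
`1/a = ∫ tanh ((p² - μ) / (2 Tc)) / (p² - μ) dp / (2π)`. -/
def IsCriticalTemperature (μ a Tc : ℝ) : Prop :=
  0 < Tc ∧ 1 / a = ∫ p : ℝ, Real.tanh ((p ^ 2 - μ) / (2 * Tc)) / (p ^ 2 - μ) / (2 * Real.pi)

/-- `√((p² - μ)² + Δ₀²)`. -/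
def dispersion (μ Δ₀ p : ℝ) : ℝ := Real.sqrt ((p ^ 2 - μ) ^ 2 + Δ₀ ^ 2)

/-- The function `K_T⁰(p)`. -/
def KT (μ T Δ₀ p : ℝ) : ℝ :=
  dispersion μ Δ₀ p / Real.tanh (dispersion μ Δ₀ p / (2 * T))

/-- `Δ₀ > 0` solves the gap equation `1/a = ∫ 1 / K_T⁰(p) dp / (2π)`. -/
def IsGap (μ a T Δ₀ : ℝ) : Prop :=
  0 < Δ₀ ∧ 1 / a = ∫ p : ℝ, 1 / KT μ T Δ₀ p / (2 * Real.pi)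

/-- The matrix `H⁰(p)`. -/
def H0 (μ Δ₀ p : ℝ) : Matrix (Fin 2) (Fin 2) ℝ :=
  !![p ^ 2 - μ, -Δ₀; -Δ₀, -p ^ 2 + μ]

/-- The matrix `Γ̃⁰(p) = (1 + exp (H⁰(p) / T))⁻¹`. -/
def Gamma0Symbol (μ T Δ₀ p : ℝ) : Matrix (Fin 2) (Fin 2) ℝ :=
  (1 + NormedSpace.exp (T⁻¹ • H0 μ Δ₀ p))⁻¹

/-- The entries of `Γ̃⁰(p)` in closed form. -/
theorem Gamma0Symbol_eq (μ T Δ₀ p : ℝ) (hT : 0 < T) (hΔ : 0 < Δ₀) :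
    Gamma0Symbol μ T Δ₀ p =
      !![(1 - (p ^ 2 - μ) / KT μ T Δ₀ p) / 2, Δ₀ / (2 * KT μ T Δ₀ p);
         Δ₀ / (2 * KT μ T Δ₀ p), (1 + (p ^ 2 - μ) / KT μ T Δ₀ p) / 2] := by
  set k := p ^ 2 - μ with hk
  set E := dispersion μ Δ₀ p with hE
  have hE2 : E ^ 2 = k ^ 2 + Δ₀ ^ 2 := Real.sq_sqrt (by positivity)
  have hΔ2 : Δ₀ ^ 2 = E ^ 2 - k ^ 2 := by linarith
  have hEpos : 0 < E := Real.sqrt_pos.2 (by positivity)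
  set P : Matrix (Fin 2) (Fin 2) ℝ := !![k + E, Δ₀; -Δ₀, k + E] with hP
  have hdet : P.det = (k + E) ^ 2 + Δ₀ ^ 2 := by
    rw [hP, Matrix.det_fin_two_of]; ring
  have hdet0 : 0 < (k + E) ^ 2 + Δ₀ ^ 2 := by positivity
  have hPu : IsUnit P := by
    rw [Matrix.isUnit_iff_isUnit_det, hdet]; exact hdet0.ne'.isUnit
  have hPi : P⁻¹ * P = 1 := Matrix.nonsing_inv_mul P ((Matrix.isUnit_iff_isUnit_det P).1 hPu)
  have hPi' : P * P⁻¹ = 1 := Matrix.mul_nonsing_inv P ((Matrix.isUnit_iff_isUnit_det P).1 hPu)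
  have hHP : (T⁻¹ • H0 μ Δ₀ p) * P = P * Matrix.diagonal ![E / T, -(E / T)] := by
    ext i j
    fin_cases i <;> fin_cases j <;>
      simp [H0, hP, Matrix.mul_apply, Fin.sum_univ_two, Matrix.diagonal] <;> field_simp <;>
      nlinarith [hE2, hk]
  have hH : T⁻¹ • H0 μ Δ₀ p = P * Matrix.diagonal ![E / T, -(E / T)] * P⁻¹ := by
    rw [← hHP, Matrix.mul_assoc, hPi', Matrix.mul_one]
  have hexp : NormedSpace.exp (T⁻¹ • H0 μ Δ₀ p) =
      P * Matrix.diagonal ![Real.exp (E / T), Real.exp (-(E / T))] * P⁻¹ := by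
    rw [hH, Matrix.exp_conj _ _ hPu, Matrix.exp_diagonal]
    congr 3
    ext i
    rw [Pi.coe_exp, ← Real.exp_eq_exp_ℝ]
    fin_cases i <;> simp
  set u := Real.exp (E / (2 * T)) with hu
  have hupos : 0 < u := Real.exp_pos _
  have hu1 : Real.exp (E / T) = u ^ 2 := by
    rw [hu, ← Real.exp_nat_mul]; congr 1; field_simp; norm_num
  have hu2 : Real.exp (-(E / T)) = (u ^ 2)⁻¹ := by rw [Real.exp_neg, hu1]
  have hugt : 1 < u := Real.one_lt_exp_iff.2 (by positivity)
  have htanh : Real.tanh (E / (2 * T)) = (u ^ 2 - 1) / (u ^ 2 + 1) := by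
    rw [Real.tanh_eq_sinh_div_cosh, Real.sinh_eq, Real.cosh_eq, Real.exp_neg, ← hu]
    field_simp
  have hu21 : 0 < u ^ 2 - 1 := by nlinarith
  have hK : KT μ T Δ₀ p = E * (u ^ 2 + 1) / (u ^ 2 - 1) := by
    rw [KT, ← hE, htanh]; field_simp
  set M := !![(1 - k / KT μ T Δ₀ p) / 2, Δ₀ / (2 * KT μ T Δ₀ p);
         Δ₀ / (2 * KT μ T Δ₀ p), (1 + k / KT μ T Δ₀ p) / 2] with hM
  have hMP : M * P = P * Matrix.diagonal ![1 / (1 + u ^ 2), u ^ 2 / (1 + u ^ 2)] := by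
    ext i j
    fin_cases i <;> fin_cases j <;>
      simp [hM, hP, hK, Matrix.mul_apply, Fin.sum_univ_two, Matrix.diagonal] <;>
      field_simp <;>
      first
        | ring1
        | linear_combination (-(u ^ 2 - 1) * (1 + u ^ 2)) * hΔ2
        | linear_combination ((u ^ 2 - 1) * (1 + u ^ 2)) * hΔ2
        | nlinarith [hE2]
  rw [Gamma0Symbol, hexp, hu1, hu2]
  apply Matrix.inv_eq_left_inv
  have hD : Matrix.diagonal ![1 / (1 + u ^ 2), u ^ 2 / (1 + u ^ 2)] *
      (1 + Matrix.diagonal ![u ^ 2, (u ^ 2)⁻¹]) = (1 : Matrix (Fin 2) (Fin 2) ℝ) := by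
    ext i j
    fin_cases i <;> fin_cases j <;>
      simp [Matrix.mul_apply, Fin.sum_univ_two, Matrix.diagonal]
    all_goals field_simp
    all_goals ring
  calc M * (1 + P * Matrix.diagonal ![u ^ 2, (u ^ 2)⁻¹] * P⁻¹)
      = (M * P) * (1 + Matrix.diagonal ![u ^ 2, (u ^ 2)⁻¹]) * P⁻¹ := by
        rw [mul_add, mul_add, add_mul, mul_one, mul_one, Matrix.mul_assoc M P P⁻¹, hPi', mul_one]
        simp only [Matrix.mul_assoc]
    _ = P * (Matrix.diagonal ![1 / (1 + u ^ 2), u ^ 2 / (1 + u ^ 2)] *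
          (1 + Matrix.diagonal ![u ^ 2, (u ^ 2)⁻¹])) * P⁻¹ := by
        rw [hMP]; simp only [Matrix.mul_assoc]
    _ = 1 := by rw [hD, mul_one, hPi']

/-- The translation-invariant minimizer `Γ⁰`, with entries `γ⁰ = γ̃⁰(-ih∇)`, `α⁰ = α̃⁰(-ih∇)`,
`ᾱ⁰` and `1 - γ̄⁰`. -/
def Gamma0 (μ T Δ₀ h : ℝ) : SumOp :=
  let γ₀ : Op := fourierMul (fun p => (Gamma0Symbol μ T Δ₀ (h * p) 0 0 : ℂ))
  let α₀ : Op := fourierMul (fun p => (Gamma0Symbol μ T Δ₀ (h * p) 0 1 : ℂ))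
  ofEntries γ₀ α₀ (conjOp α₀) (1 - conjOp γ₀)

/-- The function `α⁰`: `α⁰(x / h) = (Δ₀ / 2) ∫ e^{ipx} / K_T⁰(hp) dp / (2π)`. -/
def alpha0 (μ T Δ₀ h : ℝ) (z : ℝ) : ℂ :=
  (Δ₀ / 2 : ℝ) * ∫ p : ℝ,
    ((1 / KT μ T Δ₀ (h * p) : ℝ) : ℂ) * Complex.exp (p * (h * z) * Complex.I) / (2 * Real.pi)

/-- The kernel `½ (ψ(x) + ψ(y)) α⁰((x - y) / h)`. -/
def pairKernel (μ T Δ₀ h : ℝ) (ψ : ℝ → ℂ) (x y : ℝ) : ℂ :=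
  (1 / 2) * (ψ x + ψ y) * alpha0 μ T Δ₀ h ((x - y) / h)

/-- The projection of a kernel `k` onto `α⁰`:
`ψ₀(y) = (h ∫ |α⁰|²)⁻¹ ∫ α⁰((x - y) / h) k(x, y) dx`. -/
def psi0 (μ T Δ₀ h : ℝ) (k : ℝ → ℝ → ℂ) (y : ℝ) : ℂ :=
  ((h * ∫ x : ℝ, ‖alpha0 μ T Δ₀ h x‖ ^ 2 : ℝ) : ℂ)⁻¹ *
    ∫ x : ℝ, alpha0 μ T Δ₀ h ((x - y) / h) * k x y

/-! ### Periodic Sobolev functions -/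

/-- The Fourier coefficient at momentum `p = 2πn` of a function with period `1`. -/
def fourierCoef (ψ : ℝ → ℂ) (n : ℤ) : ℂ :=
  ∫ x in (0 : ℝ)..1, Complex.exp (-(2 * Real.pi * n * x * Complex.I)) * ψ x

/-- Membership in the periodic Sobolev space `H^s`. -/
def MemPerSobolev (s : ℕ) (ψ : ℝ → ℂ) : Prop :=
  Function.Periodic ψ 1 ∧ MemLp ψ 2 (volume.restrict (Set.Ioc (0 : ℝ) 1)) ∧
    Summable (fun n : ℤ => (1 + (2 * Real.pi * n) ^ 2) ^ s * ‖fourierCoef ψ n‖ ^ 2)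

/-- The norm of the periodic Sobolev space `H^s`,
`‖ψ‖² = ∑ (1 + p²)^s |ψ̂(p)|²` with `p ∈ 2πℤ`. -/
def perSobolevNorm (s : ℕ) (ψ : ℝ → ℂ) : ℝ :=
  Real.sqrt (∑' n : ℤ, (1 + (2 * Real.pi * n) ^ 2) ^ s * ‖fourierCoef ψ n‖ ^ 2)

end BCS

end

/-!
Everything takes place in Fourier space. A periodic operator couples the momentum `ξ` only to
`ξ + ℤ` (`IsPeriodicOp.comm_fmul`), so it has a diagonal `diagSym`, and traces and Hilbert–Schmidt
norms per unit volume are integrals of diagonals (`hasSum_trPV`, `tsum_enorm_FT_cell`).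

*Entropy.* At each momentum, `(1 - 2Γ⁰)²` is a scalar `w²`, and the entropy of `x` is strongly
concave in `(1 - 2x)²` (`binEnt_le`). So the functional calculus of `Γ` alone gives an entropy
inequality (`entSym_le`) that involves only the diagonal of `(1 - 2Γ)²`, which is quadratic in `γ`
and `α`. The terms linear in `γ` cancel the kinetic energy, and the quadratic terms come with the
coefficient `K = K_T⁰`. Particle-hole symmetry turns `Tr Γ ln Γ` into the integral of this density
(`entropy_eq_integral`). The result (`energy_gap_le`) bounds the sum of `∫ K |γ - γ⁰|²`, of the pair
form `∫ K |α|² - ah ∫ |α(x, x)|²`, and of the squared deviation of `(1 - 2Γ)²` from `w²` by the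
potential term, which costs `O(h³)` after absorption (`energy_bounds`).

*Pair form.* In the Fourier series of `α` in the centre-of-mass variable, with coefficients `c m ξ`
(`HasCoef`), the pair form is the sum over `m` of `∫ K |c m|² - ah |∫ c m|²`. By the gap equation,
`a₀ = Δ₀ / (2K)` spans the kernel of this form, and the form is coercive on the complement
(`form_coercive`). Hence `c m` is `z m • a₀` up to a remainder, of total size `O(h³)`. The numbers
`z m` are the Fourier coefficients of `ψ₀` (`IsSymbol.ae_psi0_eq`).

*Sobolev bounds.* Since `α` is symmetric, `c m` has the same inner product with `a₀` and with
`a₀(· - m)` (`HasCoef.integral_shift_mul`); this bounds `m * z m` by the remainder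
(`coef_deriv_le`). The deviation of `(1 - 2Γ)²` bounds `α α*` and so the size of `z m`
(`integral_inv_weight_sqSym_le`). Together they bound `ψ₀` in `H¹` (`sum_projCoef_le`). The constants
are uniform because the gap equation and the equation for `T_c` force `Δ₀ ∼ h`
(`exists_gap_bounds`, `exists_pairBounds`).

*Decomposition.* The functions `ψ` and `ψ'` collect the frequencies of `ψ₀` below and above `ε / h`.
Symmetrizing the product replaces `z m • a₀` by the mean of `z m • a₀` and `z m • a₀(· - m)`, at a
cost `O(h³) |m * z m|²` (`remainder_le`, `exists_decomposition`).
-/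

noncomputable section

namespace BCS

open ContinuousLinearMap (adjoint comp_apply)
open Real (cosh sinh tanh sqrt log negMulLog)
open Set (Ico Icc Ioo Ioc indicator_apply indicator_of_mem indicator_of_notMem)
open scoped Real ComplexConjugate

/-! ### Plane waves and the basis adapted to the unit cells -/

/-- The phase `e^{2πit}`. -/
def phase (t : ℝ) : ℂ := Complex.exp ((2 * π * t : ℝ) * Complex.I)

theorem norm_phase (t : ℝ) : ‖phase t‖ = 1 := Complex.norm_exp_ofReal_mul_I _

theorem phase_add (s t : ℝ) : phase (s + t) = phase s * phase t := by
  rw [phase, phase, phase, ← Complex.exp_add]; congr 1; push_cast; ring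

theorem phase_zero : phase 0 = 1 := by simp [phase]

theorem conj_phase (t : ℝ) : conj (phase t) = phase (-t) := by
  rw [phase, phase, ← Complex.exp_conj, map_mul, Complex.conj_ofReal, Complex.conj_I]
  congr 1; push_cast; ring

theorem phase_neg_mul (t : ℝ) : phase (-t) * phase t = 1 := by
  rw [← phase_add]; simp [phase_zero]

theorem phase_int (n : ℤ) : phase n = 1 := by
  rw [phase, Complex.exp_eq_one_iff]
  exact ⟨n, by push_cast; ring⟩

theorem phase_add_int (t : ℝ) (n : ℤ) : phase (t + n) = phase t := by
  rw [phase_add, phase_int, mul_one]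

theorem phase_mul_add_int (t : ℝ) (m n : ℤ) : phase (m * (t + n)) = phase (m * t) := by
  rw [mul_add, ← Int.cast_mul, phase_add_int]

@[fun_prop]
theorem continuous_phase : Continuous phase := by unfold phase; fun_prop

@[fun_prop]
theorem measurable_phase : Measurable phase := continuous_phase.measurable

/-- The function `e^{2πilx}` on the cell `[j, j+1)`, extended by zero. -/
def boxFun (j l : ℤ) : ℝ → ℂ := (Ico (j : ℝ) (j + 1)).indicator (fun x => phase (l * x))

theorem measurable_boxFun (j l : ℤ) : Measurable (boxFun j l) :=
  Measurable.indicator (by fun_prop) measurableSet_Ico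

theorem memLp_boxFun (p : ℝ≥0∞) (j l : ℤ) : MemLp (boxFun j l) p (volume : Measure ℝ) := by
  rw [boxFun, memLp_indicator_iff_restrict measurableSet_Ico]
  have : IsFiniteMeasure ((volume : Measure ℝ).restrict (Ico (j : ℝ) (j + 1))) :=
    ⟨by simp⟩
  refine MemLp.of_bound (Continuous.aestronglyMeasurable (by fun_prop)) 1 ?_
  filter_upwards with x
  rw [norm_phase]

/-- The functions `e^{2πilx}` on the cells `[j, j+1)` as elements of `L²(ℝ)`. -/
def box (j l : ℤ) : L2 := (memLp_boxFun 2 j l).toLp _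

theorem coeFn_box (j l : ℤ) : box j l =ᵐ[volume] boxFun j l := MemLp.coeFn_toLp _

theorem boxFun_zero (n : ℤ) : boxFun 0 n = cellFun n := by
  funext x
  simp only [boxFun, cellFun, Int.cast_zero, zero_add]
  congr 1
  funext y
  rw [phase]; congr 1; push_cast; ring

theorem box_zero (n : ℤ) : box 0 n = cellBasis n := by
  simp only [box, cellBasis, boxFun_zero]

theorem inner_box_left (j l : ℤ) (f : L2) :
    inner ℂ (box j l) f = ∫ x in Ico (j : ℝ) (j + 1), phase (-(l * x)) * f x := by
  rw [L2.inner_def, ← integral_indicator measurableSet_Ico]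
  apply integral_congr_ae
  filter_upwards [coeFn_box j l] with x hx
  rw [hx, boxFun, indicator_apply, indicator_apply]
  split_ifs <;> simp [conj_phase, mul_comm]

theorem fourier_neg_coe_eq_phase {T : ℝ} (hT : T = 1) (l : ℤ) (x : ℝ) :
    (fourier (-l) : AddCircle T → ℂ) (x : AddCircle T) = phase (-(l * x)) := by
  subst hT
  rw [fourier_coe_apply, phase]; congr 1; push_cast; ring

theorem orthonormal_box : Orthonormal ℂ (fun p : ℤ × ℤ => box p.1 p.2) := by
  rw [orthonormal_iff_ite]
  rintro ⟨j, l⟩ ⟨i, n⟩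
  simp only
  rw [inner_box_left]
  rcases eq_or_ne j i with rfl | hji
  · have h1 : ∫ x in Ico (j : ℝ) (j + 1), phase (-(l * x)) * box j n x =
        ∫ x in (j : ℝ)..(j + 1), phase (((n - l : ℤ) : ℝ) * x) := by
      rw [intervalIntegral.integral_of_le (by linarith), ← integral_Ico_eq_integral_Ioc]
      apply setIntegral_congr_ae measurableSet_Ico
      filter_upwards [coeFn_box j n] with x hx hxm
      rw [hx, boxFun, indicator_of_mem hxm, ← phase_add]
      congr 1; push_cast; ring
    rw [h1]
    rcases eq_or_ne l n with rfl | hln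
    · simp [phase_zero]
    · have hne : (((n - l : ℤ) : ℝ) : ℂ) ≠ 0 := by
        norm_cast; exact sub_ne_zero.2 hln.symm
      have hc : (2 * π * ((n - l : ℤ) : ℝ) * Complex.I : ℂ) ≠ 0 := by
        simp only [ne_eq, mul_eq_zero, not_or]
        refine ⟨⟨⟨two_ne_zero, ?_⟩, hne⟩, Complex.I_ne_zero⟩
        exact_mod_cast Real.pi_ne_zero
      have h2 : ∀ x : ℝ, phase (((n - l : ℤ) : ℝ) * x) =
          Complex.exp ((2 * π * ((n - l : ℤ) : ℝ) * Complex.I) * x) := by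
        intro x; rw [phase]; congr 1; push_cast; ring
      simp_rw [h2]
      rw [integral_exp_mul_complex hc, ← h2, ← h2]
      have h3 : phase (((n - l : ℤ) : ℝ) * ((j : ℝ) + 1)) = phase (((n - l : ℤ) : ℝ) * (j : ℝ)) := by
        have := phase_mul_add_int (j : ℝ) (n - l) 1
        simpa using this
      rw [h3, sub_self, zero_div, if_neg]
      simp [hln]
  · rw [if_neg (by simp [hji])]
    rw [← integral_zero ℝ ℂ, ← integral_indicator measurableSet_Ico]
    apply integral_congr_ae
    filter_upwards [coeFn_box i n] with x hx
    rw [indicator_apply]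
    split_ifs with h
    · rw [hx, boxFun, indicator_of_notMem, mul_zero]
      rintro h'
      apply hji
      have e1 := (Int.floor_eq_iff.2 ⟨h.1, h.2⟩ : ⌊x⌋ = j)
      have e2 := (Int.floor_eq_iff.2 ⟨h'.1, h'.2⟩ : ⌊x⌋ = i)
      exact e1.symm.trans e2
    · rfl

theorem memLp_restrict_coeFn (f : L2) (s : Set ℝ) : MemLp f 2 (volume.restrict s) :=
  (Lp.memLp f).mono_measure Measure.restrict_le_self

theorem eq_zero_of_inner_box_eq_zero (f : L2) (h : ∀ j l, inner ℂ (box j l) f = 0) : f = 0 := by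
  have key : ∀ j : ℤ, ∀ᵐ x ∂(volume.restrict (Ico (j : ℝ) (j + 1))), f x = 0 := by
    intro j
    have hab : (j : ℝ) < j + 1 := by linarith
    have hp := hasSum_sq_fourierCoeffOn hab (memLp_restrict_coeFn f (Ioc (j : ℝ) (j + 1)))
    have hz : ∀ l : ℤ, fourierCoeffOn hab f l = 0 := by
      intro l
      rw [fourierCoeffOn_eq_integral]
      have := h j l
      rw [inner_box_left, integral_Ico_eq_integral_Ioc,
        ← intervalIntegral.integral_of_le hab.le] at this
      simp_rw [fourier_neg_coe_eq_phase (add_sub_cancel_left (j : ℝ) 1), smul_eq_mul]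
      rw [this, smul_zero]
    simp only [hz, norm_zero, ne_eq, OfNat.ofNat_ne_zero, not_false_eq_true, zero_pow] at hp
    have h0 := hp.unique hasSum_zero
    rw [add_sub_cancel_left, inv_one, one_smul, intervalIntegral.integral_of_le hab.le,
      integral_eq_zero_iff_of_nonneg (fun x => by positivity)
        (memLp_restrict_coeFn f _).norm.integrable_sq] at h0
    rw [restrict_Ico_eq_restrict_Ioc]
    filter_upwards [h0] with x hx
    simpa using hx
  apply Lp.ext
  have h2 : ∀ᵐ x : ℝ, ∀ j : ℤ, x ∈ Ico (j : ℝ) (j + 1) → f x = 0 := by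
    rw [ae_all_iff]
    intro j
    exact (ae_restrict_iff' measurableSet_Ico).1 (key j)
  filter_upwards [h2, Lp.coeFn_zero ℂ 2 (volume : Measure ℝ)] with x hx h0
  rw [h0]
  exact hx ⌊x⌋ ⟨Int.floor_le x, Int.lt_floor_add_one x⟩

/-- The Hilbert basis of `L²(ℝ)` formed by the functions `e^{2πilx}` on the cells `[j, j+1)`. -/
def boxBasis : HilbertBasis (ℤ × ℤ) ℂ L2 :=
  HilbertBasis.mkOfOrthogonalEqBot orthonormal_box (by
    rw [Submodule.eq_bot_iff]
    intro f hf
    apply eq_zero_of_inner_box_eq_zero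
    intro j l
    exact (Submodule.mem_orthogonal _ _).1 hf _ (Submodule.subset_span ⟨(j, l), rfl⟩))

theorem boxBasis_apply (p : ℤ × ℤ) : boxBasis p = box p.1 p.2 := by
  simp [boxBasis]

/-- Bounded operators that agree on the box functions are equal. -/
theorem op_ext_box {A B : Op} (h : ∀ j l, A (box j l) = B (box j l)) : A = B := by
  apply ContinuousLinearMap.ext_on (s := Set.range boxBasis)
  · rw [dense_iff_closure_eq, ← Submodule.topologicalClosure_coe, boxBasis.dense_span]; rfl
  · rintro _ ⟨p, rfl⟩
    rw [boxBasis_apply]; exact h _ _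

/-! ### Multiplication operators -/

/-- Bounded measurable functions. -/
def BddMeas (m : ℝ → ℂ) : Prop := Measurable m ∧ ∃ C : ℝ, ∀ x, ‖m x‖ ≤ C

theorem BddMeas.memLp {m : ℝ → ℂ} (hm : BddMeas m) : MemLp m ∞ (volume : Measure ℝ) := by
  obtain ⟨C, hC⟩ := hm.2
  exact memLp_top_of_bound hm.1.aestronglyMeasurable C (.of_forall hC)

theorem BddMeas.mul {m n : ℝ → ℂ} (hm : BddMeas m) (hn : BddMeas n) :
    BddMeas (fun x => m x * n x) := by
  obtain ⟨C, hC⟩ := hm.2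
  obtain ⟨D, hD⟩ := hn.2
  refine ⟨hm.1.mul hn.1, C * D, fun x => ?_⟩
  rw [norm_mul]
  exact mul_le_mul (hC x) (hD x) (norm_nonneg _) ((norm_nonneg _).trans (hC x))

theorem BddMeas.conj {m : ℝ → ℂ} (hm : BddMeas m) :
    BddMeas (fun x => conj (m x)) := by
  obtain ⟨C, hC⟩ := hm.2
  exact ⟨(Complex.continuous_conj.measurable).comp hm.1, C, fun x => by simpa using hC x⟩

theorem BddMeas.comp {m : ℝ → ℂ} (hm : BddMeas m) {g : ℝ → ℝ} (hg : Measurable g) :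
    BddMeas (fun x => m (g x)) := by
  obtain ⟨C, hC⟩ := hm.2
  exact ⟨hm.1.comp hg, C, fun x => hC _⟩

theorem bddMeas_phase (n : ℤ) : BddMeas (fun x => phase (n * x)) :=
  ⟨by fun_prop, 1, fun x => (norm_phase _).le⟩

theorem bddMeas_indicator {s : Set ℝ} (hs : MeasurableSet s) :
    BddMeas (s.indicator (fun _ => (1 : ℂ))) := by
  refine ⟨measurable_const.indicator hs, 1, fun x => ?_⟩
  by_cases h : x ∈ s <;> simp [h]

theorem mulOp_coeFn {m : ℝ → ℂ} (hm : BddMeas m) (f : L2) :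
    mulOp m f =ᵐ[volume] fun x => m x * f x := by
  have h := hm.memLp
  rw [mulOp, dif_pos h, ContinuousLinearMap.holderL_apply_apply]
  filter_upwards [ContinuousLinearMap.coeFn_holder (r := 2) (ContinuousLinearMap.mul ℂ ℂ)
    (h.toLp m) f, h.coeFn_toLp] with x h1 h2
  rw [h1, h2]; rfl

theorem mulOp_mul {m n : ℝ → ℂ} (hm : BddMeas m) (hn : BddMeas n) :
    mulOp (fun x => m x * n x) = mulOp m ∘L mulOp n := by
  ext1 f
  apply Lp.ext
  filter_upwards [mulOp_coeFn (hm.mul hn) f, mulOp_coeFn hm (mulOp n f), mulOp_coeFn hn f]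
    with x h1 h2 h3
  rw [h1, comp_apply, h2, h3, mul_assoc]

theorem inner_mulOp_right {m : ℝ → ℂ} (hm : BddMeas m) (f g : L2) :
    inner ℂ f (mulOp m g) = inner ℂ (mulOp (fun x => conj (m x)) f) g := by
  rw [L2.inner_def, L2.inner_def]
  apply integral_congr_ae
  filter_upwards [mulOp_coeFn hm g, mulOp_coeFn hm.conj f] with x h1 h2
  rw [h1, h2]
  simp; ring

theorem adjoint_mulOp {m : ℝ → ℂ} (hm : BddMeas m) :
    adjoint (mulOp m) = mulOp (fun x => conj (m x)) := by
  symm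
  rw [ContinuousLinearMap.eq_adjoint_iff]
  intro f g
  rw [inner_mulOp_right hm]

theorem mulOp_box (n j l : ℤ) : mulOp (fun x => phase (n * x)) (box j l) = box j (l + n) := by
  apply Lp.ext
  filter_upwards [mulOp_coeFn (bddMeas_phase n) (box j l), coeFn_box j l, coeFn_box j (l + n)]
    with x h1 h2 h3
  rw [h1, h2, h3, boxFun, boxFun, indicator_apply, indicator_apply]
  split_ifs
  · rw [← phase_add]; congr 1; push_cast; ring
  · simp

theorem translation_coeFn (f : L2) : translation f =ᵐ[volume] fun x => f (x + 1) :=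
  Lp.coeFn_compMeasurePreserving f (measurePreserving_add_right volume (1 : ℝ))

theorem translation_box (j l : ℤ) : translation (box j l) = box (j - 1) l := by
  apply Lp.ext
  have h := (measurePreserving_add_right volume (1 : ℝ)).quasiMeasurePreserving.ae_eq_comp
    (coeFn_box j l)
  filter_upwards [translation_coeFn (box j l), h, coeFn_box (j - 1) l] with x h1 h2 h3
  rw [h1, h3]
  simp only [Function.comp_apply] at h2
  rw [h2, boxFun, boxFun, indicator_apply, indicator_apply]
  have e : (x + 1 ∈ Ico (j : ℝ) (j + 1)) ↔ x ∈ Ico ((j - 1 : ℤ) : ℝ) ((j - 1 : ℤ) + 1) := by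
    simp only [Set.mem_Ico]; push_cast; constructor <;> rintro ⟨a, b⟩ <;> constructor <;> linarith
  simp only [e]
  split_ifs
  · have := phase_mul_add_int x l 1
    simpa using this
  · rfl

/-! ### The Fourier transform on `L²(ℝ)` -/

/-- The Fourier transform as a unitary operator on `L²(ℝ)`. -/
abbrev FT : L2 ≃ₗᵢ[ℂ] L2 := Lp.fourierTransformₗᵢ ℝ ℂ

/-- On `L¹ ∩ L²` the unitary Fourier transform is given by the Fourier integral. -/
theorem FT_ae_eq_fourier (f : L2) (hf : Integrable f) : FT f =ᵐ[volume] 𝓕 (f : ℝ → ℂ) := by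
  have hcont : Continuous (𝓕 (f : ℝ → ℂ)) :=
    VectorFourier.fourierIntegral_continuous Real.continuous_fourierChar
      (by exact continuous_inner) hf
  apply ae_eq_of_integral_contDiff_smul_eq
  · exact (Lp.memLp (FT f)).locallyIntegrable (by norm_num)
  · exact hcont.locallyIntegrable
  intro g hg hgc
  have hg' : ContDiff ℝ (⊤ : ℕ∞) (fun x => (g x : ℂ)) := Complex.ofRealCLM.contDiff.comp hg
  have hgc' : HasCompactSupport (fun x => (g x : ℂ)) := hgc.comp_left (g := fun r : ℝ => (r : ℂ)) (by simp)
  set φ : SchwartzMap ℝ ℂ := hgc'.toSchwartzMap hg' with hφ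
  have hφx : ∀ x, φ x = (g x : ℂ) := fun x => rfl
  have h1 := congrArg (fun T => T φ) (Lp.fourier_toTemperedDistribution_eq f)
  simp only [TemperedDistribution.fourier_apply, Lp.toTemperedDistribution_apply] at h1
  have h2 : ∫ x, g x • (FT f) x = ∫ x, φ x • ((𝓕 f : L2) x) := by
    apply integral_congr_ae; filter_upwards with x; rw [hφx, Complex.coe_smul]; rfl
  have h3 : ∫ x, g x • 𝓕 (f : ℝ → ℂ) x = ∫ x, φ x • 𝓕 (f : ℝ → ℂ) x := by
    apply integral_congr_ae; filter_upwards with x; rw [hφx, Complex.coe_smul]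
  rw [h2, h3, ← h1]
  have h4 := VectorFourier.integral_fourierIntegral_smul_eq_flip (e := Real.fourierChar) (μ := volume) (ν := volume) (L := innerₗ ℝ)
    Real.continuous_fourierChar (by exact continuous_inner) φ.integrable hf
  rw [flip_innerₗ] at h4
  exact h4

theorem coeFn_FT_toLp {f : ℝ → ℂ} (h2 : MemLp f 2) (h1 : Integrable f) :
    FT (h2.toLp f) =ᵐ[volume] fun ξ => ∫ x, phase (-(ξ * x)) * f x := by
  have hi : Integrable (h2.toLp f : ℝ → ℂ) := h1.congr h2.coeFn_toLp.symm
  filter_upwards [FT_ae_eq_fourier _ hi] with ξ hξ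
  rw [hξ, Real.fourier_congr_ae h2.coeFn_toLp, Real.fourier_real_eq_integral_exp_smul]
  congr 1; funext x
  rw [smul_eq_mul, phase]; congr 3; push_cast; ring

theorem coeFn_FT_box (j l : ℤ) :
    FT (box j l) =ᵐ[volume] fun ξ => ∫ x, phase (-(ξ * x)) * boxFun j l x :=
  coeFn_FT_toLp (memLp_boxFun 2 j l) (memLp_one_iff_integrable.1 (memLp_boxFun 1 j l))

/-- Composition with a measure preserving map, as a bounded operator. -/
def compOp (g : ℝ → ℝ) (hg : MeasurePreserving g volume volume) : Op :=
  (Lp.compMeasurePreservingₗᵢ ℂ g hg).toContinuousLinearMap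

theorem compOp_coeFn {g : ℝ → ℝ} (hg : MeasurePreserving g volume volume) (f : L2) :
    compOp g hg f =ᵐ[volume] fun x => f (g x) :=
  Lp.coeFn_compMeasurePreserving f hg

/-- Translation by an integer: `f ↦ f (· + k)`. -/
def transl (k : ℤ) : Op := compOp (fun x => x + k) (measurePreserving_add_right volume (k : ℝ))

theorem transl_coeFn (k : ℤ) (f : L2) : transl k f =ᵐ[volume] fun x => f (x + k) :=
  compOp_coeFn _ f

theorem transl_box (k j l : ℤ) : transl k (box j l) = box (j - k) l := by
  apply Lp.ext
  have h := (measurePreserving_add_right volume (k : ℝ)).quasiMeasurePreserving.ae_eq_comp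
    (coeFn_box j l)
  filter_upwards [transl_coeFn k (box j l), h, coeFn_box (j - k) l] with x h1 h2 h3
  rw [h1, h3]
  simp only [Function.comp_apply] at h2
  rw [h2, boxFun, boxFun, indicator_apply, indicator_apply]
  have e : (x + k ∈ Ico (j : ℝ) (j + 1)) ↔ x ∈ Ico ((j - k : ℤ) : ℝ) ((j - k : ℤ) + 1) := by
    simp only [Set.mem_Ico]; push_cast; constructor <;> rintro ⟨a, b⟩ <;> constructor <;> linarith
  simp only [e]
  split_ifs
  · exact phase_mul_add_int x l k
  · rfl

theorem transl_one : transl 1 = translation := by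
  apply op_ext_box; intro j l; rw [transl_box, translation_box]

theorem transl_add (k l : ℤ) : transl (k + l) = transl k ∘L transl l := by
  apply op_ext_box; intro j n
  rw [comp_apply, transl_box, transl_box, transl_box]; congr 1; ring

theorem transl_zero : transl 0 = 1 := by
  apply op_ext_box; intro j n; rw [transl_box]; simp

theorem inner_transl_left (k : ℤ) (f g : L2) :
    inner ℂ (transl k f) g = inner ℂ f (transl (-k) g) := by
  have h1 : transl k (transl (-k) g) = g := by
    rw [← comp_apply, ← transl_add, add_neg_cancel, transl_zero]; rfl
  conv_lhs => rw [← h1]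
  exact (Lp.compMeasurePreservingₗᵢ ℂ (fun x : ℝ => x + k)
    (measurePreserving_add_right volume (k : ℝ))).inner_map_map f (transl (-k) g)

theorem FT_transl (k : ℤ) (f : L2) :
    FT (transl k f) = mulOp (fun ξ => phase (k * ξ)) (FT f) := by
  have h : FT.toLinearIsometry.toContinuousLinearMap ∘L transl k =
      mulOp (fun ξ => phase (k * ξ)) ∘L FT.toLinearIsometry.toContinuousLinearMap := by
    apply op_ext_box
    intro j l
    rw [comp_apply, comp_apply, transl_box]
    apply Lp.ext
    filter_upwards [coeFn_FT_box (j - k) l, coeFn_FT_box j l,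
      mulOp_coeFn (bddMeas_phase k) (FT (box j l))] with ξ h1 h2 h3
    refine h1.trans ?_
    refine Eq.trans ?_ h3.symm
    rw [h2, ← integral_const_mul,
      ← integral_add_right_eq_self (fun x => phase (k * ξ) * (phase (-(ξ * x)) * boxFun j l x)) (k : ℝ)]
    congr 1; funext x
    have e : boxFun j l (x + k) = boxFun (j - k) l x := by
      rw [boxFun, boxFun, indicator_apply, indicator_apply]
      have e : (x + k ∈ Ico (j : ℝ) (j + 1)) ↔
          x ∈ Ico ((j - k : ℤ) : ℝ) ((j - k : ℤ) + 1) := by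
        simp only [Set.mem_Ico]; push_cast
        constructor <;> rintro ⟨a, b⟩ <;> constructor <;> linarith
      simp only [e]
      split_ifs
      · exact phase_mul_add_int x l k
      · rfl
    rw [e, ← mul_assoc, ← phase_add]; congr 2; ring
  exact congrArg (fun A : Op => A f) h

theorem FT_mulOp_phase (m : ℤ) (f : L2) :
    FT (mulOp (fun x => phase (m * x)) f) = transl (-m) (FT f) := by
  have h : FT.toLinearIsometry.toContinuousLinearMap ∘L mulOp (fun x => phase (m * x)) =
      transl (-m) ∘L FT.toLinearIsometry.toContinuousLinearMap := by
    apply op_ext_box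
    intro j l
    rw [comp_apply, comp_apply, mulOp_box]
    apply Lp.ext
    have hq := (measurePreserving_add_right volume ((-m : ℤ) : ℝ)).quasiMeasurePreserving.ae_eq_comp
      (coeFn_FT_box j l)
    filter_upwards [coeFn_FT_box j (l + m), hq, transl_coeFn (-m) (FT (box j l))] with ξ h1 h2 h3
    refine h1.trans ?_
    refine Eq.trans ?_ h3.symm
    simp only [Function.comp_apply] at h2
    rw [h2]
    congr 1; funext x
    rw [boxFun, boxFun, indicator_apply, indicator_apply]
    split_ifs
    · rw [← phase_add, ← phase_add]; congr 1; push_cast; ring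
    · simp
  exact congrArg (fun A : Op => A f) h

theorem conjL2_coeFn (f : L2) : conjL2 f =ᵐ[volume] fun x => conj (f x) :=
  Lp.coeFn_star f

theorem conjL2_conjL2 (f : L2) : conjL2 (conjL2 f) = f := star_star f

theorem conjL2_box (j l : ℤ) : conjL2 (box j l) = box j (-l) := by
  apply Lp.ext
  filter_upwards [conjL2_coeFn (box j l), coeFn_box j l, coeFn_box j (-l)] with x h1 h2 h3
  rw [h1, h2, h3, boxFun, boxFun, indicator_apply, indicator_apply]
  split_ifs
  · rw [conj_phase]; congr 1; push_cast; ring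
  · simp

/-- Reflection `f ↦ f (-·)`. -/
def reflect : Op := compOp (fun x => -x) (Measure.measurePreserving_neg volume)

theorem FT_conjL2 (f : L2) : FT (conjL2 f) = conjL2 (reflect (FT f)) := by
  have h : conjL2.comp ((FT.toLinearIsometry.toContinuousLinearMap : Op).comp conjL2) =
      reflect ∘L FT.toLinearIsometry.toContinuousLinearMap := by
    apply op_ext_box
    intro j l
    change conjL2 (FT (conjL2 (box j l))) = reflect (FT (box j l))
    rw [conjL2_box]
    apply Lp.ext
    have hq := (Measure.measurePreserving_neg (volume : Measure ℝ)).quasiMeasurePreserving.ae_eq_comp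
      (coeFn_FT_box j l)
    filter_upwards [coeFn_FT_box j (-l), hq, compOp_coeFn (Measure.measurePreserving_neg volume)
      (FT (box j l)), conjL2_coeFn (FT (box j (-l)))] with ξ h1 h2 h3 h4
    rw [h4, h1]
    refine Eq.trans ?_ h3.symm
    simp only [Function.comp_apply] at h2
    rw [h2, ← integral_conj]
    congr 1; funext x
    rw [map_mul, conj_phase, boxFun, boxFun, indicator_apply, indicator_apply]
    split_ifs
    · rw [conj_phase]; congr 2 <;> push_cast <;> ring
    · simp
  have h2 := congrArg (fun A : Op => conjL2 (A f)) h
  rw [← conjL2_conjL2 (FT (conjL2 f))]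
  exact h2

theorem coeFn_FT_conjL2 (f : L2) :
    FT (conjL2 f) =ᵐ[volume] fun ξ => conj (FT f (-ξ)) := by
  rw [FT_conjL2]
  filter_upwards [conjL2_coeFn (reflect (FT f)),
    compOp_coeFn (Measure.measurePreserving_neg volume) (FT f)] with ξ h1 h2
  rw [h1]; congr 1

/-! ### Periodic operators -/

theorem IsPeriodicOp.transl {A : Op} (hA : IsPeriodicOp A) (k : ℤ) (f : L2) :
    A (BCS.transl k f) = BCS.transl k (A f) := by
  have h1 : ∀ f, A (BCS.transl 1 f) = BCS.transl 1 (A f) := by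
    intro f
    rw [transl_one]; exact congrArg (fun B : Op => B f) hA
  have hm : ∀ f, A (BCS.transl (-1) f) = BCS.transl (-1) (A f) := by
    intro f
    have e : ∀ g, BCS.transl (-1) (BCS.transl 1 g) = g := fun g => by
      rw [← comp_apply, ← transl_add, neg_add_cancel, transl_zero]; rfl
    have e' : ∀ g, BCS.transl 1 (BCS.transl (-1) g) = g := fun g => by
      rw [← comp_apply, ← transl_add, add_neg_cancel, transl_zero]; rfl
    rw [← e (A _), ← h1, e']
  induction k using Int.induction_on generalizing f with
  | zero => rw [transl_zero]; rfl
  | succ n ih =>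
    rw [transl_add, comp_apply, ih, h1]; rfl
  | pred n ih =>
    rw [sub_eq_add_neg, transl_add, comp_apply, ih, hm]; rfl

theorem isPeriodicOp_of_transl {A : Op} (h : ∀ f, A (transl 1 f) = transl 1 (A f)) :
    IsPeriodicOp A := by
  rw [transl_one] at h
  exact ContinuousLinearMap.ext h

theorem IsPeriodicOp.adjoint {A : Op} (hA : IsPeriodicOp A) :
    IsPeriodicOp (adjoint A) := by
  apply isPeriodicOp_of_transl
  intro f
  apply ext_inner_right ℂ
  intro g
  rw [ContinuousLinearMap.adjoint_inner_left, inner_transl_left, inner_transl_left,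
    ContinuousLinearMap.adjoint_inner_left, hA.transl]

theorem IsPeriodicOp.comp {A B : Op} (hA : IsPeriodicOp A) (hB : IsPeriodicOp B) :
    IsPeriodicOp (A ∘L B) := by
  apply isPeriodicOp_of_transl
  intro f
  rw [comp_apply, hB.transl, hA.transl]; rfl

theorem IsPeriodicOp.add {A B : Op} (hA : IsPeriodicOp A) (hB : IsPeriodicOp B) :
    IsPeriodicOp (A + B) := by
  apply isPeriodicOp_of_transl
  intro f
  simp only [add_apply, hA.transl, hB.transl, map_add]

theorem IsPeriodicOp.smul {A : Op} (hA : IsPeriodicOp A) (c : ℂ) : IsPeriodicOp (c • A) := by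
  apply isPeriodicOp_of_transl
  intro f
  simp only [smul_apply, hA.transl, map_smul]

theorem IsPeriodicOp.sub {A B : Op} (hA : IsPeriodicOp A) (hB : IsPeriodicOp B) :
    IsPeriodicOp (A - B) := by
  apply isPeriodicOp_of_transl
  intro f
  simp only [sub_apply, hA.transl, hB.transl, map_sub]

theorem isPeriodicOp_one : IsPeriodicOp 1 := isPeriodicOp_of_transl fun _ => rfl

theorem conjL2_transl (k : ℤ) (f : L2) : conjL2 (transl k f) = transl k (conjL2 f) := by
  apply Lp.ext
  have hq := (measurePreserving_add_right volume (k : ℝ)).quasiMeasurePreserving.ae_eq_comp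
    (conjL2_coeFn f)
  filter_upwards [conjL2_coeFn (transl k f), transl_coeFn k f, transl_coeFn k (conjL2 f), hq]
    with x h1 h2 h3 h4
  rw [h1, h2, h3]; exact h4.symm

theorem IsPeriodicOp.conjOp {A : Op} (hA : IsPeriodicOp A) : IsPeriodicOp (conjOp A) := by
  apply isPeriodicOp_of_transl
  intro f
  change conjL2 (A (conjL2 _)) = BCS.transl 1 (conjL2 (A (conjL2 f)))
  rw [conjL2_transl, hA.transl, conjL2_transl]

theorem isPeriodicOp_mulOp {m : ℝ → ℂ} (hm : BddMeas m) (hp : Function.Periodic m 1) :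
    IsPeriodicOp (mulOp m) := by
  apply isPeriodicOp_of_transl
  intro f
  apply Lp.ext
  have hq := (measurePreserving_add_right volume ((1 : ℤ) : ℝ)).quasiMeasurePreserving.ae_eq_comp
    (mulOp_coeFn hm f)
  filter_upwards [mulOp_coeFn hm (transl 1 f), transl_coeFn 1 f, transl_coeFn 1 (mulOp m f), hq]
    with x h1 h2 h3 h4
  rw [h1, h2, h3]
  refine Eq.trans ?_ h4.symm
  simp only [Function.comp_apply]
  have : m (x + (1 : ℤ)) = m x := by simpa using hp x
  rw [this]

theorem FT_fourierMul (m : ℝ → ℂ) (f : L2) :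
    FT (fourierMul m f) = mulOp (fun ξ => m (2 * π * ξ)) (FT f) := by
  rw [fourierMul]
  exact FT.apply_symm_apply _

theorem isPeriodicOp_fourierMul {m : ℝ → ℂ} (hm : BddMeas m) : IsPeriodicOp (fourierMul m) := by
  apply isPeriodicOp_of_transl
  intro f
  apply FT.injective
  have h1 : BddMeas (fun ξ : ℝ => m (2 * π * ξ)) := hm.comp (by fun_prop)
  rw [FT_fourierMul, FT_transl, FT_transl, FT_fourierMul, ← comp_apply,
    ← comp_apply, ← mulOp_mul h1 (bddMeas_phase 1),
    ← mulOp_mul (bddMeas_phase 1) h1]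
  congr 2; funext x; ring

/-! ### Fundamental domains for the translations -/

/-- The translates of the family `w` by integers satisfy Parseval's identity. -/
def IsTranslBasis (w : ℤ → L2) : Prop :=
  ∀ f : L2, ∑' (j : ℤ) (l : ℤ), ‖(inner ℂ (transl l (w j)) f : ℂ)‖ₑ ^ 2 = ‖f‖ₑ ^ 2

/-- Fourier multiplication by `m(ξ)`, where the momentum is `p = 2πξ`. -/
def fmul (m : ℝ → ℂ) : Op :=
  FT.symm.toLinearIsometry.toContinuousLinearMap ∘L mulOp m ∘L
    FT.toLinearIsometry.toContinuousLinearMap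

theorem fourierMul_eq_fmul (m : ℝ → ℂ) :
    fourierMul m = fmul (fun ξ => m (2 * π * ξ)) := rfl

theorem FT_fmul (m : ℝ → ℂ) (f : L2) : FT (fmul m f) = mulOp m (FT f) :=
  FT.apply_symm_apply _

theorem fmul_apply (m : ℝ → ℂ) (f : L2) : fmul m f = FT.symm (mulOp m (FT f)) := rfl

/-- The function whose Fourier transform is the characteristic function of `[j, j+1)`. -/
def wave (j : ℤ) : L2 := FT.symm (box j 0)

theorem FT_wave (j : ℤ) : FT (wave j) = box j 0 := FT.apply_symm_apply _

theorem FT_transl_wave (j l : ℤ) : FT (transl l (wave j)) = box j l := by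
  rw [FT_transl, FT_wave, mulOp_box, zero_add]

theorem tsum_enorm_inner_sq {ι : Type*} (b : HilbertBasis ι ℂ L2) (f : L2) :
    ∑' i, ‖(inner ℂ (b i) f : ℂ)‖ₑ ^ 2 = ‖f‖ₑ ^ 2 := by
  have h := b.hasSum_inner_mul_inner f f
  have h2 : HasSum (fun i => ‖(inner ℂ (b i) f : ℂ)‖ ^ 2) (‖f‖ ^ 2) := by
    have h3 := Complex.hasSum_re h
    convert h3 using 1
    · funext i
      rw [← inner_conj_symm f (b i), ← Complex.normSq_eq_conj_mul_self, Complex.ofReal_re,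
        Complex.normSq_eq_norm_sq]
    · exact norm_sq_eq_re_inner (𝕜 := ℂ) f
  have h4 := h2.tsum_eq
  have h5 : ∀ i, ‖(inner ℂ (b i) f : ℂ)‖ₑ ^ 2 = ENNReal.ofReal (‖(inner ℂ (b i) f : ℂ)‖ ^ 2) := by
    intro i; rw [ENNReal.ofReal_pow (norm_nonneg _), ofReal_norm]
  simp_rw [h5]
  rw [← ENNReal.ofReal_tsum_of_nonneg (fun i => by positivity) h2.summable, h4,
    ENNReal.ofReal_pow (norm_nonneg _), ofReal_norm]

theorem isTranslBasis_cellBasis : IsTranslBasis cellBasis := by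
  intro f
  rw [← tsum_enorm_inner_sq boxBasis f, ENNReal.tsum_prod', ENNReal.tsum_comm,
    ← (Equiv.neg ℤ).tsum_eq]
  congr 1; funext l; congr 1; funext n
  rw [← box_zero, transl_box, boxBasis_apply]; simp

theorem isTranslBasis_wave : IsTranslBasis wave := by
  intro f
  rw [← LinearIsometryEquiv.enorm_map FT f, ← tsum_enorm_inner_sq boxBasis (FT f),
    ENNReal.tsum_prod']
  congr 1; funext j; congr 1; funext l
  rw [boxBasis_apply, ← FT_transl_wave, LinearIsometryEquiv.inner_map_map]

/-- The Hilbert–Schmidt norm per unit volume of a periodic operator may be computed with any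
fundamental domain for the translations, and agrees with that of the adjoint. -/
theorem tsum_enorm_sq_eq_adjoint {w v : ℤ → L2} (hw : IsTranslBasis w) (hv : IsTranslBasis v)
    {A : Op} (hA : IsPeriodicOp A) :
    ∑' n, ‖A (w n)‖ₑ ^ 2 = ∑' j, ‖adjoint A (v j)‖ₑ ^ 2 := by
  have h1 : ∀ n, ‖A (w n)‖ₑ ^ 2 =
      ∑' (j : ℤ) (l : ℤ), ‖(inner ℂ (transl l (v j)) (A (w n)) : ℂ)‖ₑ ^ 2 := fun n => (hv _).symm
  have h2 : ∀ j, ‖adjoint A (v j)‖ₑ ^ 2 = ∑' (n : ℤ) (l : ℤ),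
      ‖(inner ℂ (transl l (w n)) (adjoint A (v j)) : ℂ)‖ₑ ^ 2 :=
    fun j => (hw _).symm
  simp_rw [h1, h2]
  rw [ENNReal.tsum_comm]
  congr 1; funext j; congr 1; funext n
  rw [← (Equiv.neg ℤ).tsum_eq]
  congr 1; funext l
  simp only [Equiv.neg_apply]
  rw [inner_transl_left, neg_neg, ContinuousLinearMap.adjoint_inner_right, hA.transl,
    ← ofReal_norm, norm_inner_symm, ofReal_norm]

theorem tsum_enorm_sq_adjoint_cell {A : Op} (hA : IsPeriodicOp A) :
    ∑' n, ‖adjoint A (cellBasis n)‖ₑ ^ 2 = ∑' n, ‖A (cellBasis n)‖ₑ ^ 2 :=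
  (tsum_enorm_sq_eq_adjoint isTranslBasis_cellBasis isTranslBasis_cellBasis hA).symm

/-! ### Fibre structure of periodic operators in Fourier space -/

theorem inner_box_mulOp_box {g : ℝ → ℂ} (hg : BddMeas g) (hp : Function.Periodic g 1)
    (i n j l : ℤ) : inner ℂ (box i n) (mulOp g (box j l)) =
      if i = j then ∫ x in Ico (0 : ℝ) 1, phase ((l - n : ℤ) * x) * g x else 0 := by
  rw [inner_box_left]
  have h0 : ∀ᵐ x : ℝ, mulOp g (box j l) x = g x * boxFun j l x := by
    filter_upwards [mulOp_coeFn hg (box j l), coeFn_box j l] with x h1 h2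
    rw [h1, h2]
  split_ifs with hij
  · subst hij
    have h1 : ∫ x in Ico (i : ℝ) (i + 1), phase (-(n * x)) * mulOp g (box i l) x =
        ∫ x in (i : ℝ)..(i + 1), phase ((l - n : ℤ) * x) * g x := by
      rw [intervalIntegral.integral_of_le (by linarith), ← integral_Ico_eq_integral_Ioc]
      apply setIntegral_congr_ae measurableSet_Ico
      filter_upwards [h0] with x hx hxm
      rw [hx, boxFun, indicator_of_mem hxm]
      have : phase ((l - n : ℤ) * x) = phase (-(n * x)) * phase (l * x) := by
        rw [← phase_add]; congr 1; push_cast; ring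
      rw [this]; ring
    have hper : Function.Periodic (fun x => phase ((l - n : ℤ) * x) * g x) 1 := by
      intro x
      have := phase_mul_add_int x (l - n) 1
      simp only [Int.cast_one] at this
      simp only [this, hp x]
    rw [h1, hper.intervalIntegral_add_eq (i : ℝ) 0, zero_add,
      intervalIntegral.integral_of_le zero_le_one, ← integral_Ico_eq_integral_Ioc]
  · rw [← integral_zero ℝ ℂ, ← integral_indicator measurableSet_Ico]
    apply integral_congr_ae
    filter_upwards [h0] with x hx
    rw [indicator_apply]
    split_ifs with h
    · rw [hx, boxFun, indicator_of_notMem, mul_zero, mul_zero]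
      intro h'
      apply hij
      have e1 := (Int.floor_eq_iff.2 ⟨h.1, h.2⟩ : ⌊x⌋ = i)
      have e2 := (Int.floor_eq_iff.2 ⟨h'.1, h'.2⟩ : ⌊x⌋ = j)
      exact e1.symm.trans e2
    · rfl

theorem tsum_prod_ite (j : ℤ) (φ : ℤ → ℂ) :
    ∑' p : ℤ × ℤ, (if p.1 = j then φ p.2 else 0) = ∑' s, φ s := by
  have hinj : Function.Injective (fun s : ℤ => (j, s)) := fun a b h => (Prod.ext_iff.1 h).2
  rw [← hinj.tsum_eq]
  · simp
  · intro p hp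
    rw [Function.mem_support] at hp
    by_cases h : p.1 = j
    · exact ⟨p.2, by rw [← h]⟩
    · simp [h] at hp

/-- The Fourier conjugate of a periodic operator commutes with multiplication by bounded
periodic functions: the matrix elements of both operators in the adapted basis are convolution
kernels in the translation index. -/
theorem IsPeriodicOp.comm_fmul {A : Op} (hA : IsPeriodicOp A) {g : ℝ → ℂ} (hg : BddMeas g)
    (hp : Function.Periodic g 1) (f : L2) : A (fmul g f) = fmul g (A f) := by
  set B : Op := FT.toLinearIsometry.toContinuousLinearMap ∘L A ∘L
    FT.symm.toLinearIsometry.toContinuousLinearMap with hB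
  have hBa : ∀ f, B f = FT (A (FT.symm f)) := fun f => rfl
  have hmat : ∀ i n j l r : ℤ, (inner ℂ (box i (n + r)) (B (box j (l + r))) : ℂ) =
      inner ℂ (box i n) (B (box j l)) := by
    intro i n j l r
    have e : ∀ i n, FT.symm (box i n) = BCS.transl n (wave i) := by
      intro i n; rw [← FT_transl_wave, FT.symm_apply_apply]
    have e2 : ∀ i n j l, (inner ℂ (box i n) (B (box j l)) : ℂ) =
        inner ℂ (BCS.transl (n - l) (wave i)) (A (wave j)) := by
      intro i n j l
      rw [hBa, e, ← FT_transl_wave i n, LinearIsometryEquiv.inner_map_map, hA.transl]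
      have : BCS.transl n (wave i) = BCS.transl l (BCS.transl (n - l) (wave i)) := by
        rw [← comp_apply, ← transl_add]; congr 2; ring
      rw [this, inner_transl_left, ← comp_apply (BCS.transl (-l)), ← transl_add,
        neg_add_cancel, transl_zero]; rfl
    rw [e2, e2]; congr 3; ring
  have hcomm : B ∘L mulOp g = mulOp g ∘L B := by
    apply op_ext_box
    intro j l
    simp only [comp_apply]
    rw [← sub_eq_zero]
    apply eq_zero_of_inner_box_eq_zero
    intro i n
    rw [inner_sub_right, sub_eq_zero, ← ContinuousLinearMap.adjoint_inner_left B (mulOp g (box j l)),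
      ← ContinuousLinearMap.adjoint_inner_left (mulOp g) (B (box j l)),
      ← boxBasis.tsum_inner_mul_inner (ContinuousLinearMap.adjoint B (box i n)) (mulOp g (box j l)),
      ← boxBasis.tsum_inner_mul_inner (ContinuousLinearMap.adjoint (mulOp g) (box i n))
        (B (box j l))]
    set G : ℤ → ℂ := fun r => ∫ x in Ico (0 : ℝ) 1, phase (r * x) * g x with hG
    have t1 : ∀ p : ℤ × ℤ, (inner ℂ (ContinuousLinearMap.adjoint B (box i n)) (boxBasis p) : ℂ) *
        inner ℂ (boxBasis p) (mulOp g (box j l)) =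
        if p.1 = j then inner ℂ (box i n) (B (box j p.2)) * G (l - p.2) else 0 := by
      intro p
      rw [boxBasis_apply, inner_box_mulOp_box hg hp, ContinuousLinearMap.adjoint_inner_left]
      split_ifs with h
      · rw [h]
      · simp
    have t2 : ∀ p : ℤ × ℤ, (inner ℂ (ContinuousLinearMap.adjoint (mulOp g) (box i n))
        (boxBasis p) : ℂ) * inner ℂ (boxBasis p) (B (box j l)) =
        if p.1 = i then G (p.2 - n) * inner ℂ (box i p.2) (B (box j l)) else 0 := by
      intro p
      rw [boxBasis_apply, ContinuousLinearMap.adjoint_inner_left, inner_box_mulOp_box hg hp]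
      by_cases h : p.1 = i
      · rw [if_pos h.symm, if_pos h, h]
      · rw [if_neg (Ne.symm h), if_neg h, zero_mul]
    simp_rw [t1, t2]
    rw [tsum_prod_ite j (fun s => inner ℂ (box i n) (B (box j s)) * G (l - s)),
      tsum_prod_ite i (fun s => G (s - n) * inner ℂ (box i s) (B (box j l))),
      ← (Equiv.subLeft (n + l)).tsum_eq]
    congr 1; funext s
    simp only [Equiv.subLeft_apply]
    have e := hmat i s j l (n - s)
    rw [show s + (n - s) = n by ring, show l + (n - s) = n + l - s by ring] at e
    rw [e, mul_comm]; congr 2; ring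
  apply FT.injective
  have h1 := congrArg (fun C : Op => C (FT f)) hcomm
  simp only [comp_apply, hBa, FT.symm_apply_apply] at h1
  rw [FT_fmul, fmul_apply]
  exact h1

theorem BddMeas.periodize {m : ℝ → ℂ} (hm : BddMeas m) (j : ℤ) :
    BddMeas (fun ξ => m (Int.fract ξ + j)) := hm.comp (by fun_prop)

theorem FT_apply_fmul_wave {A : Op} (hA : IsPeriodicOp A) {m : ℝ → ℂ} (hm : BddMeas m) (j : ℤ) :
    FT (A (fmul m (wave j))) =ᵐ[volume] fun ξ => m (Int.fract ξ + j) * FT (A (wave j)) ξ := by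
  have hg := hm.periodize j
  have hp : Function.Periodic (fun ξ : ℝ => m (Int.fract ξ + j)) 1 := by
    intro x; simp
  have h1 : fmul m (wave j) = fmul (fun ξ => m (Int.fract ξ + j)) (wave j) := by
    apply FT.injective
    rw [FT_fmul, FT_fmul, FT_wave]
    apply Lp.ext
    filter_upwards [mulOp_coeFn hm (box j 0), mulOp_coeFn hg (box j 0), coeFn_box j 0]
      with x h1 h2 h3
    rw [h1, h2, h3, boxFun, indicator_apply]
    split_ifs with h
    · have := (Int.floor_eq_iff.2 ⟨h.1, h.2⟩ : ⌊x⌋ = j)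
      rw [← this, Int.fract_add_floor]
    · simp
  rw [h1, hA.comm_fmul hg hp, FT_fmul]
  exact mulOp_coeFn hg _

/-- The diagonal symbol of a periodic operator: the real part of its diagonal entry at the momentum
`ξ` with respect to plane waves. The Fourier transform of `wave ⌊ξ⌋` is `1` on the cell of `ξ`, and
no other point of `ξ + ℤ` lies in this cell, so that only the entry at `(ξ, ξ)` contributes. -/
def diagSym (B : Op) (ξ : ℝ) : ℝ := (FT (B (wave ⌊ξ⌋)) ξ).re

theorem ae_floor {P : ℤ → ℝ → Prop} (h : ∀ j, ∀ᵐ ξ : ℝ, P j ξ) : ∀ᵐ ξ : ℝ, P ⌊ξ⌋ ξ := by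
  filter_upwards [ae_all_iff.2 h] with ξ hξ using hξ _

theorem measurable_diagSym (B : Op) : Measurable (diagSym B) := by
  have h1 : ∀ j, Measurable (FT (B (wave j)) : ℝ → ℂ) := fun j =>
    (Lp.stronglyMeasurable _).measurable
  generalize hF : (fun j => (FT (B (wave j)) : ℝ → ℂ)) = F at *
  have h2 : ∀ j, Measurable (F j) := by
    intro j; rw [← hF]; exact h1 j
  have h3 : diagSym B = fun ξ => (F ⌊ξ⌋ ξ).re := by rw [← hF]; rfl
  rw [h3]
  have h : Measurable (fun p : ℤ × ℝ => F p.1 p.2) := measurable_from_prod_countable_right h2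
  exact Complex.measurable_re.comp (h.comp (Int.measurable_floor.prodMk measurable_id))

theorem diagSym_add (A B : Op) : ∀ᵐ ξ : ℝ, diagSym (A + B) ξ = diagSym A ξ + diagSym B ξ := by
  apply ae_floor (P := fun j ξ => (FT ((A + B) (wave j)) ξ).re =
    (FT (A (wave j)) ξ).re + (FT (B (wave j)) ξ).re)
  intro j
  rw [add_apply, map_add]
  filter_upwards [Lp.coeFn_add (FT (A (wave j))) (FT (B (wave j)))] with ξ h
  rw [h]; simp

theorem diagSym_sub (A B : Op) : ∀ᵐ ξ : ℝ, diagSym (A - B) ξ = diagSym A ξ - diagSym B ξ := by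
  apply ae_floor (P := fun j ξ => (FT ((A - B) (wave j)) ξ).re =
    (FT (A (wave j)) ξ).re - (FT (B (wave j)) ξ).re)
  intro j
  rw [sub_apply, map_sub]
  filter_upwards [Lp.coeFn_sub (FT (A (wave j))) (FT (B (wave j)))] with ξ h
  rw [h]; simp

theorem diagSym_smul (c : ℝ) (A : Op) :
    ∀ᵐ ξ : ℝ, diagSym ((c : ℂ) • A) ξ = c * diagSym A ξ := by
  apply ae_floor (P := fun j ξ => (FT (((c : ℂ) • A) (wave j)) ξ).re =
    c * (FT (A (wave j)) ξ).re)
  intro j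
  rw [smul_apply, map_smul]
  filter_upwards [Lp.coeFn_smul (c : ℂ) (FT (A (wave j)))] with ξ h
  rw [h]; simp

theorem diagSym_fmul_comp {m : ℝ → ℝ} (hm : BddMeas (fun ξ => (m ξ : ℂ))) (B : Op) :
    ∀ᵐ ξ : ℝ, diagSym (fmul (fun ξ => (m ξ : ℂ)) ∘L B) ξ = m ξ * diagSym B ξ := by
  apply ae_floor (P := fun j ξ => (FT ((fmul (fun ξ => (m ξ : ℂ)) ∘L B) (wave j)) ξ).re =
    m ξ * (FT (B (wave j)) ξ).re)
  intro j
  rw [comp_apply, FT_fmul]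
  filter_upwards [mulOp_coeFn hm (FT (B (wave j)))] with ξ h
  rw [h]; simp

theorem diagSym_comp_fmul {m : ℝ → ℝ} (hm : BddMeas (fun ξ => (m ξ : ℂ))) {B : Op}
    (hB : IsPeriodicOp B) :
    ∀ᵐ ξ : ℝ, diagSym (B ∘L fmul (fun ξ => (m ξ : ℂ))) ξ = m ξ * diagSym B ξ := by
  have := ae_floor (P := fun j ξ => (FT ((B ∘L fmul (fun ξ => (m ξ : ℂ))) (wave j)) ξ) =
    (m (Int.fract ξ + j) : ℂ) * (FT (B (wave j)) ξ)) (fun j => FT_apply_fmul_wave hB hm j)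
  filter_upwards [this] with ξ h
  rw [diagSym, h, Int.fract_add_floor, Complex.re_ofReal_mul]; rfl

theorem diagSym_one : ∀ᵐ ξ : ℝ, diagSym 1 ξ = 1 := by
  have := ae_floor (P := fun j ξ => FT (wave j) ξ = boxFun j 0 ξ)
    (fun j => by rw [FT_wave]; exact coeFn_box j 0)
  filter_upwards [this] with ξ h
  change (FT (wave ⌊ξ⌋) ξ).re = 1
  have hm : ξ ∈ Ico (⌊ξ⌋ : ℝ) (⌊ξ⌋ + 1) := ⟨Int.floor_le ξ, Int.lt_floor_add_one ξ⟩
  rw [h, boxFun, indicator_of_mem hm]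
  simp [phase_zero]

/-- The integral of the diagonal symbol over a set is the expectation in the corresponding
wave packet. -/
theorem inner_fmul_indicator_wave {B : Op} (hB : IsPeriodicOp B) {s : Set ℝ}
    (hs : MeasurableSet s) (j : ℤ) :
    inner ℂ (fmul (s.indicator fun _ => 1) (wave j)) (B (fmul (s.indicator fun _ => 1) (wave j))) =
      ∫ ξ in s ∩ Ico (j : ℝ) (j + 1), FT (B (wave j)) ξ := by
  rw [← FT.inner_map_map, L2.inner_def, ← integral_indicator (hs.inter measurableSet_Ico), FT_fmul,
    FT_wave]
  apply integral_congr_ae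
  filter_upwards [mulOp_coeFn (bddMeas_indicator hs) (box j 0), coeFn_box j 0,
    FT_apply_fmul_wave hB (bddMeas_indicator hs) j] with ξ h1 h2 h3
  rw [h1, h2, h3, boxFun]
  by_cases hξ : ξ ∈ Ico (j : ℝ) (j + 1)
  · have := (Int.floor_eq_iff.2 ⟨hξ.1, hξ.2⟩ : ⌊ξ⌋ = j)
    rw [← this, Int.fract_add_floor, this]
    by_cases hξs : ξ ∈ s <;> simp [hξ, hξs, phase_zero, -Set.mem_Ico]
  · simp [hξ, -Set.mem_Ico]

theorem integrableOn_FT (f : L2) (j : ℤ) :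
    IntegrableOn (FT f) (Ico (j : ℝ) (j + 1)) := by
  have : IsFiniteMeasure ((volume : Measure ℝ).restrict (Ico (j : ℝ) (j + 1))) := ⟨by simp⟩
  exact (memLp_restrict_coeFn (FT f) _).integrable (by norm_num)

theorem ae_of_forall_box {P : ℝ → Prop}
    (h : ∀ j : ℤ, ∀ᵐ ξ ∂(volume.restrict (Ico (j : ℝ) (j + 1))), P ξ) : ∀ᵐ ξ : ℝ, P ξ := by
  have h2 : ∀ᵐ x : ℝ, ∀ j : ℤ, x ∈ Ico (j : ℝ) (j + 1) → P x := by
    rw [ae_all_iff]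
    intro j
    exact (ae_restrict_iff' measurableSet_Ico).1 (h j)
  filter_upwards [h2] with x hx
  exact hx ⌊x⌋ ⟨Int.floor_le x, Int.lt_floor_add_one x⟩

theorem diagSym_nonneg {B : Op} (hB : IsPeriodicOp B) (hpos : B.IsPositive) :
    ∀ᵐ ξ : ℝ, 0 ≤ diagSym B ξ := by
  apply ae_of_forall_box
  intro j
  have hi : IntegrableOn (fun ξ => (FT (B (wave j)) ξ).re) (Ico (j : ℝ) (j + 1)) :=
    (integrableOn_FT _ j).re
  have h : 0 ≤ᵐ[volume.restrict (Ico (j : ℝ) (j + 1))] fun ξ => (FT (B (wave j)) ξ).re := by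
    apply ae_nonneg_of_forall_setIntegral_nonneg hi
    intro s hs _
    have h1 := inner_fmul_indicator_wave hB hs j
    have h2 := hpos.re_inner_nonneg_right (fmul (s.indicator fun _ => 1) (wave j))
    rw [h1] at h2
    rw [Measure.restrict_restrict hs]
    have h3 := integral_re ((integrableOn_FT (B (wave j)) j).mono_set (Set.inter_subset_right (s := s)))
    simp only [RCLike.re_to_complex] at h3 h2
    rw [h3]
    exact h2
  filter_upwards [h, ae_restrict_mem measurableSet_Ico] with ξ h1 h2
  have := (Int.floor_eq_iff.2 ⟨h2.1, h2.2⟩ : ⌊ξ⌋ = j)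
  rw [diagSym, this]; exact h1

/-! ### Traces per unit volume through the diagonal symbol -/

theorem enorm_sq_eq_lintegral (f : L2) : ‖f‖ₑ ^ 2 = ∫⁻ x, ‖f x‖ₑ ^ 2 := by
  rw [Lp.enorm_def, eLpNorm_eq_lintegral_rpow_enorm_toReal (by norm_num) (by norm_num),
    ← ENNReal.rpow_natCast, ← ENNReal.rpow_mul]
  norm_num

theorem measurable_coeFn (f : L2) : Measurable (f : ℝ → ℂ) := (Lp.stronglyMeasurable f).measurable

theorem isPositive_comp_adjoint (A : Op) : (A ∘L adjoint A).IsPositive := by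
  have h := (ContinuousLinearMap.isPositive_one (𝕜 := ℂ) (E := L2)).conj_adjoint A
  rwa [show (1 : Op) ∘L adjoint A = adjoint A from
    ContinuousLinearMap.id_comp _] at h

theorem isPeriodicOp_fmul {m : ℝ → ℂ} (hm : BddMeas m) : IsPeriodicOp (fmul m) := by
  have h := isPeriodicOp_fourierMul (m := fun p => m (p / (2 * π)))
    (hm.comp (g := fun p => p / (2 * π)) (by fun_prop))
  rw [fourierMul_eq_fmul] at h
  convert h using 2
  funext ξ
  congr 1
  have := Real.pi_pos
  field_simp

theorem adjoint_fmul {m : ℝ → ℂ} (hm : BddMeas m) :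
    adjoint (fmul m) = fmul (fun x => conj (m x)) := by
  symm
  rw [ContinuousLinearMap.eq_adjoint_iff]
  intro f g
  rw [← FT.inner_map_map, FT_fmul, ← FT.inner_map_map f, FT_fmul, inner_mulOp_right hm]

theorem fmul_mul {m n : ℝ → ℂ} (hm : BddMeas m) (hn : BddMeas n) :
    fmul (fun x => m x * n x) = fmul m ∘L fmul n := by
  ext1 f
  apply FT.injective
  rw [FT_fmul, comp_apply, FT_fmul, FT_fmul, mulOp_mul hm hn]; rfl

/-- The density, in Fourier space, of the Hilbert–Schmidt norm per unit volume of `A` is the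
diagonal symbol of `A A*`. -/
theorem tsum_enorm_FT_cell {A : Op} (hA : IsPeriodicOp A) :
    (fun ξ => ∑' n, ‖FT (A (cellBasis n)) ξ‖ₑ ^ 2) =ᵐ[volume]
      fun ξ => ENNReal.ofReal (diagSym (A ∘L adjoint A) ξ) := by
  set B : Op := A ∘L adjoint A with hB
  have hBp : IsPeriodicOp B := hA.comp hA.adjoint
  have hBpos : B.IsPositive := isPositive_comp_adjoint A
  have hdiag := diagSym_nonneg hBp hBpos
  apply ae_eq_of_forall_setLIntegral_eq_of_sigmaFinite
  · exact Measurable.tsum fun n => ((measurable_coeFn _).enorm.pow_const 2)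
  · exact (measurable_diagSym B).ennreal_ofReal
  intro s hs _
  have hm := bddMeas_indicator hs
  rw [lintegral_tsum fun n => ((measurable_coeFn _).enorm.pow_const 2).aemeasurable]
  have h1 : ∀ n, ∫⁻ ξ in s, ‖FT (A (cellBasis n)) ξ‖ₑ ^ 2 =
      ‖(fmul (s.indicator fun _ => 1) ∘L A) (cellBasis n)‖ₑ ^ 2 := by
    intro n
    rw [← LinearIsometryEquiv.enorm_map FT, comp_apply, FT_fmul,
      enorm_sq_eq_lintegral, ← lintegral_indicator hs]
    apply lintegral_congr_ae
    filter_upwards [mulOp_coeFn hm (FT (A (cellBasis n)))] with ξ h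
    rw [h]
    by_cases hξ : ξ ∈ s <;> simp [hξ]
  simp_rw [h1]
  rw [tsum_enorm_sq_eq_adjoint isTranslBasis_cellBasis isTranslBasis_wave
    ((isPeriodicOp_fmul hm).comp hA)]
  have hU : s = ⋃ j : ℤ, s ∩ Ico (j : ℝ) (j + 1) := by
    rw [← Set.inter_iUnion, iUnion_Ico_intCast, Set.inter_univ]
  have hdisj : Pairwise (Function.onFun Disjoint fun j : ℤ => s ∩ Ico (j : ℝ) (j + 1)) := by
    intro i j hij
    exact (Set.pairwise_disjoint_Ico_intCast ℝ hij).mono Set.inter_subset_right Set.inter_subset_right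
  conv_rhs => rw [hU, lintegral_iUnion (fun j => hs.inter measurableSet_Ico) hdisj]
  congr 1; funext j
  have hadj : adjoint (fmul (s.indicator fun _ => (1 : ℂ)) ∘L A) =
      adjoint A ∘L fmul (s.indicator fun _ => 1) := by
    rw [ContinuousLinearMap.adjoint_comp, adjoint_fmul hm]
    congr 2; funext ξ
    by_cases hξ : ξ ∈ s <;> simp [hξ]
  set u := fmul (s.indicator fun _ => (1 : ℂ)) (wave j) with hu
  have h3 : ‖adjoint (fmul (s.indicator fun _ => (1 : ℂ)) ∘L A) (wave j)‖ ^ 2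
      = ∫ ξ in s ∩ Ico (j : ℝ) (j + 1), diagSym B ξ := by
    rw [hadj, comp_apply, ← hu, norm_sq_eq_re_inner (𝕜 := ℂ),
      ContinuousLinearMap.adjoint_inner_left]
    have h4 := inner_fmul_indicator_wave hBp hs j
    rw [← hu, hB, comp_apply] at h4
    rw [h4, ← hB, ← integral_re ((integrableOn_FT (B (wave j)) j).mono_set Set.inter_subset_right)]
    apply setIntegral_congr_fun (hs.inter measurableSet_Ico)
    intro ξ hξ
    have := (Int.floor_eq_iff.2 ⟨hξ.2.1, hξ.2.2⟩ : ⌊ξ⌋ = j)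
    rw [diagSym, this]; rfl
  rw [← ofReal_norm, ← ENNReal.ofReal_pow (norm_nonneg _), h3,
    ofReal_integral_eq_lintegral_ofReal _ (ae_restrict_of_ae hdiag)]
  have h5 : IntegrableOn (fun ξ => (FT (B (wave j)) ξ).re) (s ∩ Ico (j : ℝ) (j + 1)) :=
    ((integrableOn_FT (B (wave j)) j).mono_set Set.inter_subset_right).re
  refine h5.congr_fun ?_ (hs.inter measurableSet_Ico)
  intro ξ hξ
  have := (Int.floor_eq_iff.2 ⟨hξ.2.1, hξ.2.2⟩ : ⌊ξ⌋ = j)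
  simp only [diagSym, this]

theorem trForm_eq_lintegral {A : Op} (hA : IsPeriodicOp A) {m : ℝ → ℝ} (hm : Measurable m) :
    trForm m A = ∫⁻ ξ, ENNReal.ofReal (m (2 * π * ξ)) *
      ENNReal.ofReal (diagSym (A ∘L adjoint A) ξ) := by
  have hm' : Measurable fun ξ : ℝ => ENNReal.ofReal (m (2 * π * ξ)) :=
    (hm.comp (by fun_prop)).ennreal_ofReal
  have h1 := lintegral_tsum (μ := volume) (f := fun (n : ℤ) ξ =>
    ENNReal.ofReal (m (2 * π * ξ)) * ‖FT (A (cellBasis n)) ξ‖ₑ ^ 2)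
    fun n => (hm'.mul ((measurable_coeFn _).enorm.pow_const 2)).aemeasurable
  rw [trForm, ← h1]
  apply lintegral_congr_ae
  filter_upwards [tsum_enorm_FT_cell hA] with ξ h
  rw [ENNReal.tsum_mul_left, ← h]

theorem tsum_enorm_cell_eq_lintegral {A : Op} (hA : IsPeriodicOp A) :
    ∑' n, ‖A (cellBasis n)‖ₑ ^ 2 =
      ∫⁻ ξ, ENNReal.ofReal (diagSym (A ∘L adjoint A) ξ) := by
  have h1 : ∀ n, ‖A (cellBasis n)‖ₑ ^ 2 = ∫⁻ ξ, ‖FT (A (cellBasis n)) ξ‖ₑ ^ 2 := fun n => by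
    rw [← LinearIsometryEquiv.enorm_map FT, enorm_sq_eq_lintegral]
  simp_rw [h1]
  rw [← lintegral_tsum fun n => ((measurable_coeFn _).enorm.pow_const 2).aemeasurable]
  exact lintegral_congr_ae (tsum_enorm_FT_cell hA)

section SquareRoot

variable {H : Type*} [NormedAddCommGroup H] [InnerProductSpace ℂ H] [CompleteSpace H]

theorem opFun_sqrt_mul_self {B : H →L[ℂ] H} (hB : B.IsPositive) :
    opFun sqrt B ∘L opFun sqrt B = B := by
  have h0 : 0 ≤ B := (ContinuousLinearMap.nonneg_iff_isPositive B).2 hB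
  have hsa : IsSelfAdjoint B := hB.isSelfAdjoint
  change cfc sqrt B * cfc sqrt B = B
  rw [← cfc_mul sqrt sqrt B]
  conv_rhs => rw [← cfc_id' ℝ B]
  apply cfc_congr
  intro x hx
  exact Real.mul_self_sqrt (spectrum_nonneg_of_nonneg h0 hx)

theorem adjoint_opFun (f : ℝ → ℝ) (B : H →L[ℂ] H) :
    adjoint (opFun f B) = opFun f B := by
  have h : IsSelfAdjoint (cfc f B) := cfc_predicate f B
  exact h

theorem commute_opFun {B C : H →L[ℂ] H} (h : Commute B C) (f : ℝ → ℝ) :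
    Commute (opFun f B) C := h.cfc_real f

end SquareRoot

theorem isPeriodicOp_opFun {B : Op} (hB : IsPeriodicOp B) (f : ℝ → ℝ) :
    IsPeriodicOp (opFun f B) := by
  have h : Commute B translation := hB
  exact commute_opFun h f

theorem trForm_sqrt {B : Op} (hB : IsPeriodicOp B) (hpos : B.IsPositive) {m : ℝ → ℝ}
    (hm : Measurable m) : trForm m (opFun sqrt B) =
      ∫⁻ ξ, ENNReal.ofReal (m (2 * π * ξ)) * ENNReal.ofReal (diagSym B ξ) := by
  rw [trForm_eq_lintegral (isPeriodicOp_opFun hB _) hm, adjoint_opFun, opFun_sqrt_mul_self hpos]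

theorem summable_norm_sq_of_tsum_ne_top {f : ℤ → L2} (h : ∑' n, ‖f n‖ₑ ^ 2 ≠ ∞) :
    Summable fun n => ‖f n‖ ^ 2 := by
  have h2 : ∀ n, ‖f n‖ₑ ^ 2 = ((‖f n‖₊ ^ 2 : NNReal) : ℝ≥0∞) := fun n => by
    rw [ENNReal.coe_pow]; rfl
  simp_rw [h2] at h
  have h3 := NNReal.summable_coe.2 (ENNReal.tsum_coe_ne_top_iff_summable.1 h)
  simpa using h3

theorem lintegral_ofReal_ne_top {f : ℝ → ℝ} (hf : Integrable f) :
    ∫⁻ ξ, ENNReal.ofReal (f ξ) ≠ ∞ := by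
  refine ne_top_of_le_ne_top hf.2.ne (lintegral_mono fun ξ => ?_)
  exact Real.ofReal_le_enorm _

/-- The trace per unit volume of a positive periodic operator is the integral of its diagonal
symbol. -/
theorem hasSum_trPV {B : Op} (hB : IsPeriodicOp B) (hpos : B.IsPositive)
    (hi : Integrable (diagSym B)) :
    HasSum (fun n => inner ℂ (cellBasis n) (B (cellBasis n))) ((∫ ξ, diagSym B ξ : ℝ) : ℂ) := by
  set S : Op := opFun sqrt B with hS
  have hSS : S ∘L S = B := opFun_sqrt_mul_self hpos
  have hSa : adjoint S = S := adjoint_opFun _ _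
  have hSp : IsPeriodicOp S := isPeriodicOp_opFun hB _
  have h1 := tsum_enorm_cell_eq_lintegral hSp
  rw [hSa, hSS] at h1
  have hsum : Summable fun n => ‖S (cellBasis n)‖ ^ 2 :=
    summable_norm_sq_of_tsum_ne_top (by rw [h1]; exact lintegral_ofReal_ne_top hi)
  have h2 : ∑' n, ‖S (cellBasis n)‖ ^ 2 = ∫ ξ, diagSym B ξ := by
    have h3 : ENNReal.ofReal (∑' n, ‖S (cellBasis n)‖ ^ 2) =
        ENNReal.ofReal (∫ ξ, diagSym B ξ) := by
      rw [ofReal_integral_eq_lintegral_ofReal hi (diagSym_nonneg hB hpos), ← h1,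
        ENNReal.ofReal_tsum_of_nonneg (fun n => by positivity) hsum]
      congr 1; funext n
      rw [ENNReal.ofReal_pow (norm_nonneg _), ofReal_norm]
    refine (ENNReal.ofReal_eq_ofReal_iff (tsum_nonneg fun n => by positivity)
      (integral_nonneg_of_ae (diagSym_nonneg hB hpos))).1 h3
  rw [← h2]
  have h4 : ∀ n, inner ℂ (cellBasis n) (B (cellBasis n)) = ((‖S (cellBasis n)‖ ^ 2 : ℝ) : ℂ) := by
    intro n
    rw [← hSS, comp_apply, ← ContinuousLinearMap.adjoint_inner_left, hSa,
      inner_self_eq_norm_sq_to_K]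
    push_cast; rfl
  simp_rw [h4]
  exact_mod_cast hsum.hasSum

theorem trPV_eq_integral {B : Op} (hB : IsPeriodicOp B) (hpos : B.IsPositive)
    (hi : Integrable (diagSym B)) : trPV B = ((∫ ξ, diagSym B ξ : ℝ) : ℂ) :=
  (hasSum_trPV hB hpos hi).tsum_eq

theorem norm_mulOp_apply_le {m : ℝ → ℂ} (hm : BddMeas m) {M : ℝ} (hM : ∀ x, ‖m x‖ ≤ M) (f : L2) :
    ‖mulOp m f‖ ≤ M * ‖f‖ := by
  apply Lp.norm_le_mul_norm_of_ae_le_mul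
  filter_upwards [mulOp_coeFn hm f] with x h
  rw [h, norm_mul]
  exact mul_le_mul_of_nonneg_right (hM x) (norm_nonneg _)

theorem summable_trPV_mulOp {B : Op} (hB : IsPeriodicOp B) (hpos : B.IsPositive)
    (hi : Integrable (diagSym B)) {m : ℝ → ℂ} (hm : BddMeas m) (hp : Function.Periodic m 1) :
    Summable fun n => (inner ℂ (cellBasis n) ((mulOp m ∘L B) (cellBasis n)) : ℂ) := by
  set S : Op := opFun sqrt B with hS
  have hSS : S ∘L S = B := opFun_sqrt_mul_self hpos
  have hSa : adjoint S = S := adjoint_opFun _ _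
  have hSp : IsPeriodicOp S := isPeriodicOp_opFun hB _
  have h1 := tsum_enorm_cell_eq_lintegral hSp
  rw [hSa, hSS] at h1
  have hsum : Summable fun n => ‖S (cellBasis n)‖ ^ 2 :=
    summable_norm_sq_of_tsum_ne_top (by rw [h1]; exact lintegral_ofReal_ne_top hi)
  obtain ⟨M, hM⟩ := hm.2
  have hsum2 : Summable fun n => ‖S (mulOp (fun x => conj (m x)) (cellBasis n))‖ ^ 2 := by
    apply summable_norm_sq_of_tsum_ne_top
    have h2 := tsum_enorm_sq_adjoint_cell ((isPeriodicOp_mulOp hm hp).comp hSp)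
    rw [ContinuousLinearMap.adjoint_comp, hSa, adjoint_mulOp hm] at h2
    simp only [comp_apply] at h2
    rw [h2]
    have hsum3 : Summable fun n => ‖mulOp m (S (cellBasis n))‖ ^ 2 := by
      refine Summable.of_nonneg_of_le (fun n => by positivity) (fun n => ?_) (hsum.mul_left (M ^ 2))
      rw [← mul_pow]
      exact pow_le_pow_left₀ (norm_nonneg _) (norm_mulOp_apply_le hm hM _) 2
    have : ∀ n, ‖mulOp m (S (cellBasis n))‖ₑ ^ 2 =
        ENNReal.ofReal (‖mulOp m (S (cellBasis n))‖ ^ 2) := fun n => by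
      rw [ENNReal.ofReal_pow (norm_nonneg _), ofReal_norm]
    simp_rw [this]
    rw [← ENNReal.ofReal_tsum_of_nonneg (fun n => by positivity) hsum3]
    exact ENNReal.ofReal_ne_top
  refine Summable.of_norm_bounded (hsum.add hsum2) fun n => ?_
  rw [comp_apply, inner_mulOp_right hm, ← hSS, comp_apply,
    ← ContinuousLinearMap.adjoint_inner_left, hSa]
  refine (norm_inner_le_norm _ _).trans ?_
  nlinarith [sq_nonneg (‖S (mulOp (fun x => conj (m x)) (cellBasis n))‖ -
    ‖S (cellBasis n)‖), sq_nonneg (‖S (mulOp (fun x => conj (m x)) (cellBasis n))‖ +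
    ‖S (cellBasis n)‖)]

theorem integral_weight {h : ℝ} (hh : 0 < h) :
    Integrable (fun ξ : ℝ => (1 + h ^ 2 * (2 * π * ξ) ^ 2)⁻¹) ∧
      ∫ ξ : ℝ, (1 + h ^ 2 * (2 * π * ξ) ^ 2)⁻¹ = (2 * h)⁻¹ := by
  have hc : (2 * π * h) ≠ 0 := by positivity
  have e : (fun ξ : ℝ => (1 + h ^ 2 * (2 * π * ξ) ^ 2)⁻¹) =
      fun ξ => (fun x : ℝ => (1 + x ^ 2)⁻¹) (2 * π * h * ξ) := by
    funext ξ; congr 1; ring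
  rw [e]
  refine ⟨integrable_inv_one_add_sq.comp_mul_left' hc, ?_⟩
  rw [Measure.integral_comp_mul_left (fun x : ℝ => (1 + x ^ 2)⁻¹), integral_univ_inv_one_add_sq,
    smul_eq_mul, abs_of_pos (by positivity)]
  have := Real.pi_pos
  field_simp

/-- A bounded periodic potential is controlled, in the trace per unit volume, by the weighted
Hilbert–Schmidt norm: the weight `(1 + h²p²)⁻¹` has integral `1 / (2h)`. -/
theorem norm_trPV_mulOp_le {g : Op} (hg : IsPeriodicOp g) {h : ℝ} (hh : 0 < h) {m : ℝ → ℂ}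
    (hm : BddMeas m) (hp : Function.Periodic m 1) {M : ℝ} (hM : ∀ x, ‖m x‖ ≤ M)
    (hi : Integrable fun ξ => (1 + h ^ 2 * (2 * π * ξ) ^ 2) *
      diagSym (g ∘L adjoint g) ξ) {t : ℝ} (ht : 0 < t) :
    ‖trPV (mulOp m ∘L g)‖ ≤ t * (M ^ 2 * (2 * h)⁻¹) +
      t⁻¹ * ∫ ξ, (1 + h ^ 2 * (2 * π * ξ) ^ 2) *
        diagSym (g ∘L adjoint g) ξ := by
  set q : ℝ → ℝ := fun ξ => 1 + h ^ 2 * (2 * π * ξ) ^ 2 with hq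
  have hq0 : ∀ ξ, 0 < q ξ := fun ξ => by positivity
  have hqm : Measurable q := by fun_prop
  set mc : ℝ → ℂ := fun x => conj (m x) with hmc
  have hmcb : BddMeas mc := hm.conj
  have hmcp : Function.Periodic mc 1 := fun x => by simp only [hmc, hp x]
  have hMc : ∀ x, ‖mc x‖ ≤ M := fun x => by simpa [hmc] using hM x
  have hN := isPeriodicOp_mulOp hmcb hmcp
  have hdg := diagSym_nonneg (hg.comp hg.adjoint) (isPositive_comp_adjoint g)
  -- The diagonal symbol of `|m|²` is bounded by `M²`.
  have hdm : ∀ᵐ ξ : ℝ, diagSym (mulOp mc ∘L adjoint (mulOp mc)) ξ ≤ M ^ 2 := by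
    have hpos : (((M ^ 2 : ℝ) : ℂ) • (1 : Op) -
        mulOp mc ∘L adjoint (mulOp mc)).IsPositive := by
      rw [ContinuousLinearMap.isPositive_iff_complex]
      intro f
      have h1 : (inner ℂ ((((M ^ 2 : ℝ) : ℂ) • (1 : Op) -
          mulOp mc ∘L adjoint (mulOp mc)) f) f : ℂ) =
          ((M ^ 2 * ‖f‖ ^ 2 - ‖mulOp m f‖ ^ 2 : ℝ) : ℂ) := by
        rw [sub_apply, inner_sub_left, smul_apply, show (1 : Op) f = f from rfl, inner_smul_left,
          Complex.conj_ofReal, comp_apply, ← ContinuousLinearMap.adjoint_inner_right,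
          adjoint_mulOp hmcb]
        simp only [hmc, Complex.conj_conj]
        rw [inner_self_eq_norm_sq_to_K, inner_self_eq_norm_sq_to_K]
        push_cast; rfl
      rw [h1]
      refine ⟨by rw [RCLike.re_to_complex, Complex.ofReal_re], ?_⟩
      simp only [RCLike.re_to_complex, Complex.ofReal_re]
      have := pow_le_pow_left₀ (norm_nonneg _) (norm_mulOp_apply_le hm hM f) 2
      rw [mul_pow] at this
      linarith
    filter_upwards [diagSym_nonneg ((isPeriodicOp_one.smul _).sub (hN.comp hN.adjoint)) hpos,
      diagSym_sub (((M ^ 2 : ℝ) : ℂ) • (1 : Op)) (mulOp mc ∘L adjoint (mulOp mc)),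
      diagSym_smul (M ^ 2) 1, diagSym_one] with ξ h1 h2 h3 h4
    rw [h2, h3, h4] at h1
    linarith
  have key : ∑' n, ‖(inner ℂ (cellBasis n) ((mulOp m ∘L g) (cellBasis n)) : ℂ)‖ₑ ≤
      ENNReal.ofReal (t * (M ^ 2 * (2 * h)⁻¹) + t⁻¹ * ∫ ξ, q ξ *
        diagSym (g ∘L adjoint g) ξ) := by
    have hterm : ∀ n, ‖(inner ℂ (cellBasis n) ((mulOp m ∘L g) (cellBasis n)) : ℂ)‖ₑ ≤
        ENNReal.ofReal t * (∫⁻ ξ, ENNReal.ofReal (q ξ)⁻¹ * ‖FT (mulOp mc (cellBasis n)) ξ‖ₑ ^ 2) +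
        ENNReal.ofReal t⁻¹ * ∫⁻ ξ, ENNReal.ofReal (q ξ) * ‖FT (g (cellBasis n)) ξ‖ₑ ^ 2 := by
      intro n
      rw [comp_apply, inner_mulOp_right hm, ← FT.inner_map_map, L2.inner_def]
      refine (enorm_integral_le_lintegral_enorm _).trans ?_
      rw [← lintegral_const_mul' _ _ ENNReal.ofReal_ne_top,
        ← lintegral_const_mul' _ _ ENNReal.ofReal_ne_top, ← lintegral_add_left]
      · apply lintegral_mono
        intro ξ
        simp only
        rw [← ofReal_norm, ← ofReal_norm, ← ofReal_norm, ← ENNReal.ofReal_pow (norm_nonneg _),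
          ← ENNReal.ofReal_pow (norm_nonneg _), ← ENNReal.ofReal_mul (inv_nonneg.2 (hq0 ξ).le),
          ← ENNReal.ofReal_mul ht.le, ← ENNReal.ofReal_mul (hq0 ξ).le,
          ← ENNReal.ofReal_mul (inv_nonneg.2 ht.le), ← ENNReal.ofReal_add
            (mul_nonneg ht.le (mul_nonneg (inv_nonneg.2 (hq0 ξ).le) (by positivity)))
            (mul_nonneg (inv_nonneg.2 ht.le) (mul_nonneg (hq0 ξ).le (by positivity)))]
        apply ENNReal.ofReal_le_ofReal
        refine (norm_inner_le_norm _ _).trans ?_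
        set a := ‖FT (mulOp mc (cellBasis n)) ξ‖
        set b := ‖FT (g (cellBasis n)) ξ‖
        have hq1 := hq0 ξ
        have e : t * ((q ξ)⁻¹ * a ^ 2) + t⁻¹ * (q ξ * b ^ 2) - 2 * (a * b) =
            (t * (q ξ)⁻¹) * (a - t⁻¹ * q ξ * b) ^ 2 := by
          field_simp; ring
        have h1 : 0 ≤ (t * (q ξ)⁻¹) * (a - t⁻¹ * q ξ * b) ^ 2 := by positivity
        have h2 : 0 ≤ a * b := by positivity
        linarith
      · exact ((hqm.inv.ennreal_ofReal).mul
          ((measurable_coeFn _).enorm.pow_const 2)).const_mul _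
    refine (ENNReal.tsum_le_tsum hterm).trans ?_
    rw [ENNReal.tsum_add, ENNReal.tsum_mul_left, ENNReal.tsum_mul_left]
    have h1 : ∑' n, ∫⁻ ξ, ENNReal.ofReal (q ξ)⁻¹ * ‖FT (mulOp mc (cellBasis n)) ξ‖ₑ ^ 2 ≤
        ENNReal.ofReal (M ^ 2 * (2 * h)⁻¹) := by
      have h2 := trForm_eq_lintegral hN (m := fun p => (1 + h ^ 2 * p ^ 2)⁻¹) (by fun_prop)
      rw [trForm] at h2
      refine h2.le.trans ?_
      rw [← (integral_weight hh).2, ← integral_const_mul, ofReal_integral_eq_lintegral_ofReal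
        ((integral_weight hh).1.const_mul _) (.of_forall fun ξ => by positivity)]
      apply lintegral_mono_ae
      filter_upwards [hdm] with ξ hξ
      rw [mul_comm (M ^ 2), ENNReal.ofReal_mul (by positivity)]
      exact mul_le_mul_right (ENNReal.ofReal_le_ofReal hξ) _
    have h2 : ∑' n, ∫⁻ ξ, ENNReal.ofReal (q ξ) * ‖FT (g (cellBasis n)) ξ‖ₑ ^ 2 =
        ENNReal.ofReal (∫ ξ, q ξ * diagSym (g ∘L adjoint g) ξ) := by
      have h2 := trForm_eq_lintegral hg (m := fun p => (1 + h ^ 2 * p ^ 2)) (by fun_prop)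
      rw [trForm] at h2
      refine h2.trans ?_
      rw [ofReal_integral_eq_lintegral_ofReal hi]
      · apply lintegral_congr
        intro ξ
        rw [ENNReal.ofReal_mul (hq0 ξ).le]
      · filter_upwards [hdg] with ξ hξ
        exact mul_nonneg (hq0 ξ).le hξ
    rw [h2, ENNReal.ofReal_add, ENNReal.ofReal_mul ht.le, ENNReal.ofReal_mul (inv_nonneg.2 ht.le)]
    · gcongr
    · positivity
    · refine mul_nonneg (by positivity) (integral_nonneg_of_ae ?_)
      filter_upwards [hdg] with ξ hξ
      exact mul_nonneg (hq0 ξ).le hξ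
  have hnn : 0 ≤ t * (M ^ 2 * (2 * h)⁻¹) + t⁻¹ * ∫ ξ, q ξ *
        diagSym (g ∘L adjoint g) ξ := by
    refine add_nonneg (by positivity) (mul_nonneg (by positivity) (integral_nonneg_of_ae ?_))
    filter_upwards [hdg] with ξ hξ
    exact mul_nonneg (hq0 ξ).le hξ
  rw [← ENNReal.ofReal_le_ofReal_iff hnn, ofReal_norm]
  refine le_trans ?_ key
  rw [trPV]
  exact enorm_tsum_le_tsum_enorm

/-! ### Entries of operators on `L²(ℝ) ⊕ L²(ℝ)` -/

@[simp] theorem fst_inl (f : L2) : fst (inl f) = f := rfl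
@[simp] theorem snd_inl (f : L2) : snd (inl f) = 0 := rfl
@[simp] theorem fst_inr (f : L2) : fst (inr f) = 0 := rfl
@[simp] theorem snd_inr (f : L2) : snd (inr f) = f := rfl

theorem inl_fst_add_inr_snd (u : L2Sum) : inl (fst u) + inr (snd u) = u := by
  apply (WithLp.prodContinuousLinearEquiv 2 ℂ L2 L2).injective
  ext1
  · change fst u + 0 = fst u; simp
  · change 0 + snd u = snd u; simp

theorem sum_ext {u v : L2Sum} (h1 : fst u = fst v) (h2 : snd u = snd v) : u = v := by
  rw [← inl_fst_add_inr_snd u, ← inl_fst_add_inr_snd v, h1, h2]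

theorem inner_sum (u v : L2Sum) :
    (inner ℂ u v : ℂ) = inner ℂ (fst u) (fst v) + inner ℂ (snd u) (snd v) :=
  WithLp.prod_inner_apply u v

theorem inner_inl_left (f : L2) (v : L2Sum) : (inner ℂ (inl f) v : ℂ) = inner ℂ f (fst v) := by
  rw [inner_sum]; simp

theorem inner_inr_left (f : L2) (v : L2Sum) : (inner ℂ (inr f) v : ℂ) = inner ℂ f (snd v) := by
  rw [inner_sum]; simp

theorem entry11_apply (A : SumOp) (f : L2) : entry11 A f = fst (A (inl f)) := rfl
theorem entry12_apply (A : SumOp) (f : L2) : entry12 A f = fst (A (inr f)) := rfl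
theorem entry21_apply (A : SumOp) (f : L2) : entry21 A f = snd (A (inl f)) := rfl
theorem entry22_apply (A : SumOp) (f : L2) : entry22 A f = snd (A (inr f)) := rfl

theorem entry11_mul (A B : SumOp) :
    entry11 (A * B) = entry11 A ∘L entry11 B + entry12 A ∘L entry21 B := by
  ext1 f
  change fst (A (B (inl f))) = fst (A (inl (fst (B (inl f))))) + fst (A (inr (snd (B (inl f)))))
  rw [← map_add, ← map_add, inl_fst_add_inr_snd]

section OfEntries
variable (A B C D : Op)

theorem ofEntries_apply (u : L2Sum) : ofEntries A B C D u =
    inl (A (fst u) + B (snd u)) + inr (C (fst u) + D (snd u)) := rfl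

@[simp] theorem entry11_ofEntries : entry11 (ofEntries A B C D) = A := by
  ext1 f; simp [entry11_apply, ofEntries_apply]
@[simp] theorem entry12_ofEntries : entry12 (ofEntries A B C D) = B := by
  ext1 f; simp [entry12_apply, ofEntries_apply]
@[simp] theorem entry21_ofEntries : entry21 (ofEntries A B C D) = C := by
  ext1 f; simp [entry21_apply, ofEntries_apply]
@[simp] theorem entry22_ofEntries : entry22 (ofEntries A B C D) = D := by
  ext1 f; simp [entry22_apply, ofEntries_apply]

end OfEntries

theorem isPositive_entry11 {A : SumOp} (hA : A.IsPositive) : (entry11 A).IsPositive := by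
  rw [ContinuousLinearMap.isPositive_iff_complex]
  intro f
  have h := (ContinuousLinearMap.isPositive_iff_complex A).1 hA (inl f)
  have e : (inner ℂ (entry11 A f) f : ℂ) = inner ℂ (A (inl f)) (inl f) := by
    rw [inner_sum (A (inl f))]; simp [entry11_apply]
  rw [e]; exact h

theorem adjoint_entry12 {A : SumOp} (hA : adjoint A = A) :
    adjoint (entry12 A) = entry21 A := by
  symm
  rw [ContinuousLinearMap.eq_adjoint_iff]
  intro f g
  have h := ContinuousLinearMap.adjoint_inner_left A (inr g) (inl f)
  rw [hA, inner_inl_left] at h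
  rw [entry12_apply, ← h, ← inner_conj_symm, ← inner_conj_symm (A (inl f)), inner_inr_left]
  rfl

theorem adjoint_entry11 {A : SumOp} (hA : adjoint A = A) :
    adjoint (entry11 A) = entry11 A := by
  symm
  rw [ContinuousLinearMap.eq_adjoint_iff]
  intro f g
  have h := ContinuousLinearMap.adjoint_inner_left A (inl g) (inl f)
  rw [hA, inner_inl_left] at h
  rw [entry11_apply A g, ← h, ← inner_conj_symm, ← inner_conj_symm (A (inl f)), inner_inl_left]
  rfl

/-- Operators on `L²(ℝ) ⊕ L²(ℝ)` all of whose entries are periodic. -/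
def IsPeriodicSum (A : SumOp) : Prop := Commute A (ofEntries translation 0 0 translation)

theorem isPeriodicSum_iff (A : SumOp) : IsPeriodicSum A ↔
    IsPeriodicOp (entry11 A) ∧ IsPeriodicOp (entry12 A) ∧ IsPeriodicOp (entry21 A) ∧
      IsPeriodicOp (entry22 A) := by
  set T2 := ofEntries translation 0 0 translation with hT2
  have hl : ∀ f, T2 (inl f) = inl (translation f) := fun f => by
    rw [hT2, ofEntries_apply]; simp
  have hr : ∀ f, T2 (inr f) = inr (translation f) := fun f => by
    rw [hT2, ofEntries_apply]; simp
  have hf : ∀ u, fst (T2 u) = translation (fst u) := fun u => by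
    rw [hT2, ofEntries_apply]; simp
  have hs : ∀ u, snd (T2 u) = translation (snd u) := fun u => by
    rw [hT2, ofEntries_apply]; simp
  constructor
  · intro h
    have h' : ∀ u, A (T2 u) = T2 (A u) := fun u => congrArg (fun B : SumOp => B u) h
    refine ⟨?_, ?_, ?_, ?_⟩ <;> refine ContinuousLinearMap.ext fun f => ?_
    · change fst (A (inl (translation f))) = translation (fst (A (inl f)))
      rw [← hl, h', hf]
    · change fst (A (inr (translation f))) = translation (fst (A (inr f)))
      rw [← hr, h', hf]
    · change snd (A (inl (translation f))) = translation (snd (A (inl f)))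
      rw [← hl, h', hs]
    · change snd (A (inr (translation f))) = translation (snd (A (inr f)))
      rw [← hr, h', hs]
  · rintro ⟨h1, h2, h3, h4⟩
    have h1' : ∀ f, fst (A (inl (translation f))) = translation (fst (A (inl f))) :=
      fun f => congrArg (fun B : Op => B f) h1
    have h2' : ∀ f, fst (A (inr (translation f))) = translation (fst (A (inr f))) :=
      fun f => congrArg (fun B : Op => B f) h2
    have h3' : ∀ f, snd (A (inl (translation f))) = translation (snd (A (inl f))) :=
      fun f => congrArg (fun B : Op => B f) h3
    have h4' : ∀ f, snd (A (inr (translation f))) = translation (snd (A (inr f))) :=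
      fun f => congrArg (fun B : Op => B f) h4
    refine ContinuousLinearMap.ext fun u => ?_
    change A (T2 u) = T2 (A u)
    rw [← inl_fst_add_inr_snd u, map_add, map_add, map_add, map_add, hl, hr]
    apply sum_ext
    · rw [map_add, map_add, h1', h2', hf, hf]
    · rw [map_add, map_add, h3', h4', hs, hs]

theorem IsPeriodicSum.opFun {A : SumOp} (hA : IsPeriodicSum A) (f : ℝ → ℝ) :
    IsPeriodicSum (opFun f A) := commute_opFun hA f

theorem IsPeriodicSum.mul {A B : SumOp} (hA : IsPeriodicSum A) (hB : IsPeriodicSum B) :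
    IsPeriodicSum (A * B) := Commute.mul_left hA hB

theorem isPeriodicSum_one : IsPeriodicSum 1 := Commute.one_left _

theorem IsPeriodicSum.sub {A B : SumOp} (hA : IsPeriodicSum A) (hB : IsPeriodicSum B) :
    IsPeriodicSum (A - B) := Commute.sub_left hA hB

/-! ### Particle-hole symmetry -/

/-- The antiunitary map `(f, g) ↦ (conj g, -conj f)`. -/
def holeMap : L2Sum →L⋆[ℂ] L2Sum :=
  inl.comp (conjL2.comp snd) - inr.comp (conjL2.comp fst)

/-- The inverse `(f, g) ↦ (-conj g, conj f)` of `holeMap`. -/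
def holeMapInv : L2Sum →L⋆[ℂ] L2Sum :=
  inr.comp (conjL2.comp fst) - inl.comp (conjL2.comp snd)

theorem holeMap_apply (u : L2Sum) :
    holeMap u = inl (conjL2 (snd u)) - inr (conjL2 (fst u)) := rfl

theorem holeMapInv_apply (u : L2Sum) :
    holeMapInv u = inr (conjL2 (fst u)) - inl (conjL2 (snd u)) := rfl

theorem holeMapInv_holeMap (u : L2Sum) : holeMapInv (holeMap u) = u := by
  rw [holeMapInv_apply, holeMap_apply]
  apply sum_ext <;> simp [conjL2_conjL2]

theorem holeMap_holeMapInv (u : L2Sum) : holeMap (holeMapInv u) = u := by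
  rw [holeMapInv_apply, holeMap_apply]
  apply sum_ext <;> simp [conjL2_conjL2]

theorem inner_conjL2 (f g : L2) : (inner ℂ (conjL2 f) (conjL2 g) : ℂ) = inner ℂ g f := by
  rw [L2.inner_def, L2.inner_def]
  apply integral_congr_ae
  filter_upwards [conjL2_coeFn f, conjL2_coeFn g] with x h1 h2
  rw [h1, h2]; simp; ring

theorem inner_holeMap (u v : L2Sum) : (inner ℂ (holeMap u) (holeMap v) : ℂ) = inner ℂ v u := by
  rw [holeMap_apply, holeMap_apply, inner_sum, inner_sum]
  simp [inner_conjL2]; ring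

/-- Conjugation by the particle-hole map, as a real star algebra homomorphism. -/
def holeConj : SumOp →⋆ₐ[ℝ] SumOp where
  toFun A := holeMap.comp (A.comp holeMapInv)
  map_one' := ContinuousLinearMap.ext fun u => holeMap_holeMapInv u
  map_mul' A B := ContinuousLinearMap.ext fun u => by
    change holeMap (A (B (holeMapInv u))) = holeMap (A (holeMapInv (holeMap (B (holeMapInv u)))))
    rw [holeMapInv_holeMap]
  map_zero' := ContinuousLinearMap.ext fun u => by
    change holeMap 0 = 0; simp
  map_add' A B := ContinuousLinearMap.ext fun u => by
    change holeMap (A (holeMapInv u) + B (holeMapInv u)) = _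
    rw [map_add]; rfl
  commutes' r := ContinuousLinearMap.ext fun u => by
    rw [Algebra.algebraMap_eq_smul_one]
    change holeMap ((r : ℂ) • holeMapInv u) = (r : ℂ) • u
    rw [map_smulₛₗ, holeMap_holeMapInv, Complex.conj_ofReal]
  map_star' A := by
    change _ = adjoint (holeMap.comp (A.comp holeMapInv))
    rw [ContinuousLinearMap.eq_adjoint_iff]
    intro u v
    change inner ℂ (holeMap ((adjoint A) (holeMapInv u))) v =
      inner ℂ u (holeMap (A (holeMapInv v)))
    conv_lhs => rw [← holeMap_holeMapInv v]
    conv_rhs => rw [← holeMap_holeMapInv u]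
    rw [inner_holeMap, inner_holeMap, ContinuousLinearMap.adjoint_inner_right]

theorem holeConj_apply (A : SumOp) (u : L2Sum) : holeConj A u = holeMap (A (holeMapInv u)) := rfl

theorem continuous_holeConj : Continuous holeConj := by
  refine AddMonoidHomClass.continuous_of_bound holeConj 1 fun A => ?_
  rw [one_mul]
  refine ContinuousLinearMap.opNorm_le_bound _ (norm_nonneg _) fun u => ?_
  have h1 : ∀ u, ‖holeMap u‖ = ‖u‖ := fun u => by
    rw [@norm_eq_sqrt_re_inner ℂ, @norm_eq_sqrt_re_inner ℂ, inner_holeMap]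
  rw [holeConj_apply, h1]
  refine (A.le_opNorm _).trans_eq ?_
  rw [← h1 (holeMapInv u), holeMap_holeMapInv]

theorem entry11_holeConj (A : SumOp) : entry11 (holeConj A) = conjOp (entry22 A) := by
  ext1 f
  change fst (holeMap (A (holeMapInv (inl f)))) = conjL2 (snd (A (inr (conjL2 f))))
  rw [holeMapInv_apply, holeMap_apply]; simp

/-! ### Scalar entropy inequalities -/

/-- The fermionic entropy `-x ln x - (1 - x) ln (1 - x)`. -/
def binEnt (x : ℝ) : ℝ := negMulLog x + negMulLog (1 - x)

/-- `2 artanh w / w`. -/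
def artanhRatio (w : ℝ) : ℝ := (log (1 + w) - log (1 - w)) / w

theorem continuous_binEnt : Continuous binEnt := by unfold binEnt; fun_prop

theorem binEnt_half_sub (s : ℝ) :
    binEnt ((1 - s) / 2) = negMulLog ((1 - s) / 2) + negMulLog ((1 + s) / 2) := by
  rw [binEnt]; congr 2; ring

theorem binEnt_even (s : ℝ) : binEnt ((1 - -s) / 2) = binEnt ((1 - s) / 2) := by
  rw [binEnt_half_sub, binEnt_half_sub, add_comm, sub_neg_eq_add, ← sub_eq_add_neg]

theorem hasDerivAt_binEnt {s : ℝ} (h0 : -1 < s) (h1 : s < 1) :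
    HasDerivAt (fun s => binEnt ((1 - s) / 2))
      (-(log (1 + s) - log (1 - s)) / 2) s := by
  have d1 : HasDerivAt (fun s : ℝ => (1 - s) / 2) (-1 / 2) s := by
    simpa using ((hasDerivAt_id s).const_sub 1).div_const 2
  have d2 : HasDerivAt (fun s : ℝ => (1 + s) / 2) (1 / 2) s := by
    simpa using ((hasDerivAt_id s).const_add 1).div_const 2
  have e1 := (Real.hasDerivAt_negMulLog (x := (1 - s) / 2) (by linarith)).comp s d1
  have e2 := (Real.hasDerivAt_negMulLog (x := (1 + s) / 2) (by linarith)).comp s d2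
  have e3 := e1.add e2
  have l1 : log ((1 - s) / 2) = log (1 - s) - log 2 :=
    Real.log_div (by linarith) two_ne_zero
  have l2 : log ((1 + s) / 2) = log (1 + s) - log 2 :=
    Real.log_div (by linarith) two_ne_zero
  have h3 : (fun s : ℝ => binEnt ((1 - s) / 2)) =
      (negMulLog ∘ fun s : ℝ => (1 - s) / 2) + (negMulLog ∘ fun s : ℝ => (1 + s) / 2) := by
    funext s; rw [binEnt_half_sub]; rfl
  rw [h3]
  refine e3.congr_deriv ?_
  rw [l1, l2]; ring

/-- `artanhRatio w - (2/3) w²` is increasing, since all coefficients of its power series are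
nonnegative. -/
theorem artanhRatio_sub_le {s w : ℝ} (hs : 0 < s) (hsw : s ≤ w) (hw : w < 1) :
    artanhRatio s - 2 / 3 * s ^ 2 ≤ artanhRatio w - 2 / 3 * w ^ 2 := by
  have hser : ∀ x : ℝ, 0 < x → x < 1 →
      HasSum (fun k : ℕ => 2 * (1 / (2 * k + 1 : ℝ)) * x ^ (2 * k)) (artanhRatio x) := by
    intro x hx hx1
    have h := (Real.hasSum_log_sub_log_of_abs_lt_one
      (by rw [abs_of_pos hx]; exact hx1)).div_const x
    have e : (fun k : ℕ => 2 * (1 / (2 * k + 1 : ℝ)) * x ^ (2 * k)) =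
        fun k : ℕ => 2 * (1 / (2 * k + 1 : ℝ)) * x ^ (2 * k + 1) / x := by
      funext k
      rw [pow_succ]; field_simp
    rw [e]
    exact h
  have h := (hser w (hs.trans_le hsw) hw).sub (hser s hs (hsw.trans_lt hw))
  have h2 := le_hasSum h 1 (fun k _ => by
    rw [← mul_sub]
    refine mul_nonneg (by positivity) (sub_nonneg.2 (pow_le_pow_left₀ hs.le hsw _)))
  norm_num at h2
  linarith

/-- The inequality `binEnt_le` in the variable `s = |1 - 2x|`. The derivative in `s` of the difference
has the sign of `s - w`, by the monotonicity of `artanhRatio x - (2/3) x²`. -/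
theorem binEnt_le_aux {w : ℝ} (hw0 : 0 < w) (hw1 : w < 1) {s : ℝ} (hs0 : 0 ≤ s) (hs1 : s ≤ 1) :
    artanhRatio w / 4 * (s ^ 2 - w ^ 2) + (s ^ 2 - w ^ 2) ^ 2 / 12 ≤
      binEnt ((1 - w) / 2) - binEnt ((1 - s) / 2) := by
  set D : ℝ → ℝ := fun s => -binEnt ((1 - s) / 2) -
    (artanhRatio w / 4 * (s ^ 2 - w ^ 2) + (s ^ 2 - w ^ 2) ^ 2 / 12) with hD
  have hcont : Continuous D := by
    have := continuous_binEnt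
    fun_prop
  have hder : ∀ x, 0 < x → x < 1 → HasDerivAt D
      (x / 2 * ((artanhRatio x - 2 / 3 * x ^ 2) - (artanhRatio w - 2 / 3 * w ^ 2))) x := by
    intro x hx0 hx1
    have e1 := (hasDerivAt_binEnt (by linarith) hx1).neg
    have e2 : HasDerivAt (fun s : ℝ => artanhRatio w / 4 * (s ^ 2 - w ^ 2) +
        (s ^ 2 - w ^ 2) ^ 2 / 12) (artanhRatio w / 4 * (2 * x) +
        2 * (x ^ 2 - w ^ 2) * (2 * x) / 12) x := by
      have e3 : HasDerivAt (fun s : ℝ => s ^ 2 - w ^ 2) (2 * x) x := by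
        simpa using (hasDerivAt_pow 2 x).sub_const (w ^ 2)
      have e4 := (e3.const_mul (artanhRatio w / 4)).add ((e3.pow 2).div_const 12)
      refine e4.congr_deriv ?_
      norm_num
    refine (e1.sub e2).congr_deriv ?_
    have : artanhRatio x = (log (1 + x) - log (1 - x)) / x := rfl
    rw [this]; field_simp; ring
  have key : D w ≤ D s := by
    rcases le_total s w with hsw | hsw
    · have := antitoneOn_of_deriv_nonpos (convex_Icc 0 w) hcont.continuousOn
        (fun x hx => by
          rw [interior_Icc] at hx
          exact (hder x hx.1 (hx.2.trans hw1)).differentiableAt.differentiableWithinAt)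
        (fun x hx => by
          rw [interior_Icc] at hx
          rw [(hder x hx.1 (hx.2.trans hw1)).deriv]
          exact mul_nonpos_of_nonneg_of_nonpos (by linarith [hx.1])
            (sub_nonpos.2 (artanhRatio_sub_le hx.1 hx.2.le hw1)))
      exact this ⟨hs0, hsw⟩ ⟨hw0.le, le_rfl⟩ hsw
    · have := monotoneOn_of_deriv_nonneg (convex_Icc w 1) hcont.continuousOn
        (fun x hx => by
          rw [interior_Icc] at hx
          exact (hder x (hw0.trans hx.1) hx.2).differentiableAt.differentiableWithinAt)
        (fun x hx => by
          rw [interior_Icc] at hx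
          rw [(hder x (hw0.trans hx.1) hx.2).deriv]
          exact mul_nonneg (by linarith [hx.1])
            (sub_nonneg.2 (artanhRatio_sub_le hw0 hx.1.le hx.2)))
      exact this ⟨le_rfl, hw1.le⟩ ⟨hsw, hs1⟩ hsw
  simp only [hD, sub_self] at key
  nlinarith [key]

theorem negMulLog_ge_tangent {x y : ℝ} (hx : 0 ≤ x) (hy : 0 < y) :
    negMulLog y + (-log y - 1) * (x - y) - (x - y) ^ 2 / y ≤ negMulLog x := by
  rcases hx.eq_or_lt with rfl | hx
  · simp only [negMulLog, Real.log_zero]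
    have : (0 - y) ^ 2 / y = y := by field_simp; ring
    rw [this]; linarith
  · have h := Real.log_le_sub_one_of_pos (div_pos hx hy)
    rw [Real.log_div hx.ne' hy.ne'] at h
    have h2 := mul_le_mul_of_nonneg_left h hx.le
    have e : (x - y) ^ 2 / y = x * (x / y - 1) - x + y := by field_simp; ring
    simp only [negMulLog]
    rw [e]; nlinarith

theorem binEnt_ge_aux {w : ℝ} (hw0 : 0 < w) (hw1 : w < 1) {s : ℝ} (hs0 : 0 ≤ s) (hs1 : s ≤ 1) :
    binEnt ((1 - w) / 2) - binEnt ((1 - s) / 2) ≤ artanhRatio w / 4 * (s ^ 2 - w ^ 2) +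
      (s ^ 2 - w ^ 2) ^ 2 / (w ^ 2 * (1 - w ^ 2)) := by
  have h1 := negMulLog_ge_tangent (x := (1 - s) / 2) (y := (1 - w) / 2) (by linarith) (by linarith)
  have h2 := negMulLog_ge_tangent (x := (1 + s) / 2) (y := (1 + w) / 2) (by linarith) (by linarith)
  have l1 : log ((1 - w) / 2) = log (1 - w) - log 2 :=
    Real.log_div (by linarith) two_ne_zero
  have l2 : log ((1 + w) / 2) = log (1 + w) - log 2 :=
    Real.log_div (by linarith) two_ne_zero
  have hL : log (1 + w) - log (1 - w) = artanhRatio w * w := by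
    rw [artanhRatio]; field_simp
  have hLpos : 0 ≤ artanhRatio w := by
    have := Real.log_le_log (by linarith : 0 < 1 - w) (by linarith : 1 - w ≤ 1 + w)
    exact div_nonneg (by linarith) hw0.le
  rw [binEnt_half_sub, binEnt_half_sub]
  rw [l1] at h1
  rw [l2] at h2
  have hw2 : 0 < 1 - w ^ 2 := by nlinarith
  have e1 : ((1 - s) / 2 - (1 - w) / 2) ^ 2 / ((1 - w) / 2) +
      ((1 + s) / 2 - (1 + w) / 2) ^ 2 / ((1 + w) / 2) = (s - w) ^ 2 / (1 - w ^ 2) := by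
    have a1 : (1 - w) ≠ 0 := by linarith
    have a2 : (1 + w) ≠ 0 := by linarith
    have a3 : 1 - w ^ 2 = (1 - w) * (1 + w) := by ring
    rw [a3]; field_simp; ring
  have e2 : (s - w) ^ 2 / (1 - w ^ 2) ≤ (s ^ 2 - w ^ 2) ^ 2 / (w ^ 2 * (1 - w ^ 2)) := by
    rw [div_le_div_iff₀ hw2 (by positivity)]
    have : (s ^ 2 - w ^ 2) ^ 2 = (s - w) ^ 2 * (s + w) ^ 2 := by ring
    rw [this]
    have h3 : w ^ 2 ≤ (s + w) ^ 2 := by nlinarith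
    calc (s - w) ^ 2 * (w ^ 2 * (1 - w ^ 2)) = ((s - w) ^ 2 * (1 - w ^ 2)) * w ^ 2 := by ring
      _ ≤ ((s - w) ^ 2 * (1 - w ^ 2)) * (s + w) ^ 2 := by gcongr
      _ = _ := by ring
  have e3 : artanhRatio w / 4 * (s ^ 2 - w ^ 2) = artanhRatio w * w / 2 * (s - w) +
      artanhRatio w / 4 * (s - w) ^ 2 := by ring
  have e4 : 0 ≤ artanhRatio w / 4 * (s - w) ^ 2 := by positivity
  rw [e3, ← hL]
  linarith

/-- Strong concavity of the entropy in the variable `(1 - 2x)²`. -/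
theorem binEnt_le {w : ℝ} (hw0 : 0 < w) (hw1 : w < 1) {x : ℝ} (hx0 : 0 ≤ x) (hx1 : x ≤ 1) :
    artanhRatio w / 4 * ((1 - 2 * x) ^ 2 - w ^ 2) + ((1 - 2 * x) ^ 2 - w ^ 2) ^ 2 / 12 ≤
      binEnt ((1 - w) / 2) - binEnt x := by
  rcases le_total 0 (1 - 2 * x) with h | h
  · have := binEnt_le_aux hw0 hw1 h (by linarith)
    rwa [show (1 - (1 - 2 * x)) / 2 = x by ring] at this
  · have := binEnt_le_aux hw0 hw1 (neg_nonneg.2 h) (by linarith)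
    rwa [binEnt_even, show (1 - (1 - 2 * x)) / 2 = x by ring, neg_sq] at this

/-- A bound complementary to `binEnt_le`, with the same linear term. -/
theorem binEnt_ge {w : ℝ} (hw0 : 0 < w) (hw1 : w < 1) {x : ℝ} (hx0 : 0 ≤ x) (hx1 : x ≤ 1) :
    binEnt ((1 - w) / 2) - binEnt x ≤ artanhRatio w / 4 * ((1 - 2 * x) ^ 2 - w ^ 2) +
      ((1 - 2 * x) ^ 2 - w ^ 2) ^ 2 / (w ^ 2 * (1 - w ^ 2)) := by
  rcases le_total 0 (1 - 2 * x) with h | h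
  · have := binEnt_ge_aux hw0 hw1 h (by linarith)
    rwa [show (1 - (1 - 2 * x)) / 2 = x by ring] at this
  · have := binEnt_ge_aux hw0 hw1 (neg_nonneg.2 h) (by linarith)
    rwa [binEnt_even, show (1 - (1 - 2 * x)) / 2 = x by ring, neg_sq] at this

theorem binEnt_nonneg {x : ℝ} (hx0 : 0 ≤ x) (hx1 : x ≤ 1) : 0 ≤ binEnt x :=
  add_nonneg (Real.negMulLog_nonneg hx0 hx1) (Real.negMulLog_nonneg (by linarith) (by linarith))

theorem continuousOn_artanhRatio : ContinuousOn artanhRatio (Ioo 0 1) := by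
  unfold artanhRatio
  refine ContinuousOn.div (ContinuousOn.sub ?_ ?_) continuousOn_id (fun x hx => hx.1.ne')
  · exact ContinuousOn.log (by fun_prop) (fun x hx => by linarith [hx.1])
  · exact ContinuousOn.log (by fun_prop) (fun x hx => by linarith [hx.2])

/-! ### Functional calculus of a state -/

section Klein

variable {H : Type*} [NormedAddCommGroup H] [InnerProductSpace ℂ H] [CompleteSpace H]
  {Γ : H →L[ℂ] H}

/-- The operator `(1 - 2Γ)²`. -/
def sqDev (Γ : H →L[ℂ] H) : H →L[ℂ] H := (1 - (2 : ℂ) • Γ) * (1 - (2 : ℂ) • Γ)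

theorem spectrum_subset_of_le_one (h0 : Γ.IsPositive) (h1 : (1 - Γ).IsPositive) {x : ℝ}
    (hx : x ∈ spectrum ℝ Γ) : 0 ≤ x ∧ x ≤ 1 := by
  refine ⟨spectrum_nonneg_of_nonneg ((ContinuousLinearMap.nonneg_iff_isPositive Γ).2 h0) hx, ?_⟩
  have h2 : (1 - x) ∈ spectrum ℝ (1 - Γ) := by
    rw [spectrum.mem_iff] at hx ⊢
    rwa [map_sub, map_one, sub_sub_sub_cancel_left, ← IsUnit.neg_iff, neg_sub]
  have := spectrum_nonneg_of_nonneg ((ContinuousLinearMap.nonneg_iff_isPositive (1 - Γ)).2 h1) h2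
  linarith

/-- Inequalities between the functions of `x` on `[0, 1]` pass to the operators. -/
theorem isPositive_poly (h0 : Γ.IsPositive) (h1 : (1 - Γ).IsPositive) {a b c d : ℝ}
    (h : ∀ x : ℝ, 0 ≤ x → x ≤ 1 →
      0 ≤ a + b * (1 - 2 * x) ^ 2 + c * ((1 - 2 * x) ^ 2) ^ 2 + d * binEnt x) :
    ((a : ℂ) • (1 : H →L[ℂ] H) + (b : ℂ) • sqDev Γ + (c : ℂ) • (sqDev Γ * sqDev Γ) +
      (d : ℂ) • opFun binEnt Γ).IsPositive := by
  have hsa : IsSelfAdjoint Γ := h0.isSelfAdjoint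
  have hc := continuous_binEnt.continuousOn (s := spectrum ℝ Γ)
  have e0 : cfc (fun x : ℝ => 1 - 2 * x) Γ = 1 - (2 : ℂ) • Γ := by
    rw [cfc_sub (fun _ => (1 : ℝ)) (fun x => 2 * x) Γ, cfc_const_one ℝ Γ, cfc_const_mul_id 2 Γ]
    rfl
  have e1 : cfc (fun x : ℝ => (1 - 2 * x) ^ 2) Γ = sqDev Γ := by
    simp_rw [sq]
    rw [cfc_mul (fun x : ℝ => 1 - 2 * x) (fun x => 1 - 2 * x) Γ, e0]; rfl
  have e2 : cfc (fun x : ℝ => ((1 - 2 * x) ^ 2) ^ 2) Γ = sqDev Γ * sqDev Γ := by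
    have : (fun x : ℝ => ((1 - 2 * x) ^ 2) ^ 2) = fun x => (1 - 2 * x) ^ 2 * (1 - 2 * x) ^ 2 := by
      funext x; rw [sq ((1 - 2 * x) ^ 2)]
    rw [this, cfc_mul (fun x : ℝ => (1 - 2 * x) ^ 2) (fun x => (1 - 2 * x) ^ 2) Γ, e1]
  have e3 : cfc (fun x : ℝ => a + b * (1 - 2 * x) ^ 2 + c * ((1 - 2 * x) ^ 2) ^ 2 + d * binEnt x) Γ
      = (a : ℂ) • (1 : H →L[ℂ] H) + (b : ℂ) • sqDev Γ + (c : ℂ) • (sqDev Γ * sqDev Γ) +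
      (d : ℂ) • opFun binEnt Γ := by
    rw [cfc_add Γ (fun x : ℝ => a + b * (1 - 2 * x) ^ 2 + c * ((1 - 2 * x) ^ 2) ^ 2)
        (fun x => d * binEnt x),
      cfc_add Γ (fun x : ℝ => a + b * (1 - 2 * x) ^ 2) (fun x => c * ((1 - 2 * x) ^ 2) ^ 2),
      cfc_add Γ (fun _ : ℝ => a) (fun x => b * (1 - 2 * x) ^ 2), cfc_const a Γ,
      cfc_const_mul b (fun x : ℝ => (1 - 2 * x) ^ 2) Γ,
      cfc_const_mul c (fun x : ℝ => ((1 - 2 * x) ^ 2) ^ 2) Γ, cfc_const_mul d binEnt Γ, e1, e2,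
      Algebra.algebraMap_eq_smul_one]
    rfl
  rw [← e3, ← ContinuousLinearMap.nonneg_iff_isPositive]
  apply cfc_nonneg
  intro x hx
  obtain ⟨hx0, hx1⟩ := spectrum_subset_of_le_one h0 h1 hx
  exact h x hx0 hx1

theorem map_opFun {K : Type*} [NormedAddCommGroup K] [InnerProductSpace ℂ K] [CompleteSpace K]
    (φ : (H →L[ℂ] H) →⋆ₐ[ℝ] (K →L[ℂ] K)) (hφ : Continuous φ) {f : ℝ → ℝ} (hf : Continuous f)
    (hΓ : IsSelfAdjoint Γ) : φ (opFun f Γ) = opFun f (φ Γ) :=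
  StarAlgHom.map_cfc φ f Γ hf.continuousOn hφ hΓ (hΓ.map φ)

theorem opFun_binEnt (hΓ : IsSelfAdjoint Γ) :
    opFun binEnt Γ = opFun negMulLog Γ + opFun negMulLog (1 - Γ) := by
  have e0 : cfc (fun x : ℝ => 1 - x) Γ = 1 - Γ := by
    rw [cfc_sub (fun _ => (1 : ℝ)) (fun x => x) Γ, cfc_const_one ℝ Γ, cfc_id' ℝ Γ]
  have e1 := cfc_comp negMulLog (fun x : ℝ => 1 - x) Γ hΓ
    Real.continuous_negMulLog.continuousOn (by fun_prop)
  rw [e0] at e1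
  have e2 := cfc_add Γ negMulLog (fun x => negMulLog (1 - x))
    Real.continuous_negMulLog.continuousOn
    (Real.continuous_negMulLog.comp (by fun_prop)).continuousOn
  change cfc (fun x => negMulLog x + negMulLog (1 - x)) Γ = _
  rw [e2]
  exact congrArg _ e1

theorem isPositive_opFun {f : ℝ → ℝ} (h0 : Γ.IsPositive) (h1 : (1 - Γ).IsPositive)
    (hf : ∀ x, 0 ≤ x → x ≤ 1 → 0 ≤ f x) : (opFun f Γ).IsPositive := by
  rw [← ContinuousLinearMap.nonneg_iff_isPositive]
  apply cfc_nonneg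
  intro x hx
  obtain ⟨hx0, hx1⟩ := spectrum_subset_of_le_one h0 h1 hx
  exact hf x hx0 hx1

end Klein

/-! ### The Klein inequality for the diagonal symbol -/

/-- The diagonal symbol of the upper left entry of `(1 - 2Γ)²`. -/
def devSym (Γ : SumOp) : ℝ → ℝ := diagSym (entry11 (sqDev Γ))

/-- The diagonal symbol of the upper left entry of `(1 - 2Γ)⁴`. -/
def devSqSym (Γ : SumOp) : ℝ → ℝ := diagSym (entry11 (sqDev Γ * sqDev Γ))

/-- The diagonal symbol of the upper left entry of the operator `-Γ ln Γ - (1 - Γ) ln (1 - Γ)`. -/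
def entSym (Γ : SumOp) : ℝ → ℝ := diagSym (entry11 (opFun binEnt Γ))

theorem IsPeriodicSum.smul {A : SumOp} (hA : IsPeriodicSum A) (c : ℂ) : IsPeriodicSum (c • A) :=
  Commute.smul_left hA c

theorem IsPeriodicSum.sqDev {A : SumOp} (hA : IsPeriodicSum A) : IsPeriodicSum (sqDev A) :=
  (isPeriodicSum_one.sub (hA.smul 2)).mul (isPeriodicSum_one.sub (hA.smul 2))

theorem IsPeriodicSum.entry11 {A : SumOp} (hA : IsPeriodicSum A) : IsPeriodicOp (entry11 A) :=
  ((isPeriodicSum_iff A).1 hA).1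

theorem IsPeriodicSum.add {A B : SumOp} (hA : IsPeriodicSum A) (hB : IsPeriodicSum B) :
    IsPeriodicSum (A + B) := Commute.add_left hA hB

variable {Γ : SumOp}

/-- Inequalities between the functions of `x` on `[0, 1]` pass to the diagonal symbols. -/
theorem diag_poly_nonneg (h0 : Γ.IsPositive) (h1 : (1 - Γ).IsPositive) (hp : IsPeriodicSum Γ)
    {a b c d : ℝ} (h : ∀ x : ℝ, 0 ≤ x → x ≤ 1 →
      0 ≤ a + b * (1 - 2 * x) ^ 2 + c * ((1 - 2 * x) ^ 2) ^ 2 + d * binEnt x) :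
    ∀ᵐ ξ : ℝ, 0 ≤ a + b * devSym Γ ξ + c * devSqSym Γ ξ + d * entSym Γ ξ := by
  have hpos := isPositive_poly h0 h1 h
  have hper : IsPeriodicSum ((a : ℂ) • (1 : SumOp) + (b : ℂ) • sqDev Γ +
      (c : ℂ) • (sqDev Γ * sqDev Γ) + (d : ℂ) • opFun binEnt Γ) :=
    (((isPeriodicSum_one.smul _).add (hp.sqDev.smul _)).add ((hp.sqDev.mul hp.sqDev).smul _)).add
      ((hp.opFun _).smul _)
  have hn := diagSym_nonneg hper.entry11 (isPositive_entry11 hpos)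
  have e : entry11 ((a : ℂ) • (1 : SumOp) + (b : ℂ) • sqDev Γ +
      (c : ℂ) • (sqDev Γ * sqDev Γ) + (d : ℂ) • opFun binEnt Γ) =
      (a : ℂ) • (1 : Op) + (b : ℂ) • entry11 (sqDev Γ) +
      (c : ℂ) • entry11 (sqDev Γ * sqDev Γ) + (d : ℂ) • entry11 (opFun binEnt Γ) := by
    ext1 f
    simp only [entry11_apply, add_apply, smul_apply, map_add, map_smul,
      one_apply_eq_self, fst_inl]
  rw [e] at hn
  filter_upwards [hn, diagSym_add ((a : ℂ) • (1 : Op) + (b : ℂ) • entry11 (sqDev Γ) +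
      (c : ℂ) • entry11 (sqDev Γ * sqDev Γ)) ((d : ℂ) • entry11 (opFun binEnt Γ)),
    diagSym_add ((a : ℂ) • (1 : Op) + (b : ℂ) • entry11 (sqDev Γ))
      ((c : ℂ) • entry11 (sqDev Γ * sqDev Γ)),
    diagSym_add ((a : ℂ) • (1 : Op)) ((b : ℂ) • entry11 (sqDev Γ)), diagSym_smul a 1,
    diagSym_smul b (entry11 (sqDev Γ)), diagSym_smul c (entry11 (sqDev Γ * sqDev Γ)),
    diagSym_smul d (entry11 (opFun binEnt Γ)), diagSym_one] with ξ g1 g2 g3 g4 g5 g6 g7 g8 g9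
  rw [g2, g3, g4, g5, g6, g7, g8, g9, mul_one] at g1
  exact g1

/-- A continuous function that is nonnegative at the rational points of `(0, 1)` is nonnegative. -/
theorem nonneg_of_rat {f : ℝ → ℝ} (hf : ContinuousOn f (Ioo 0 1))
    (h : ∀ q : ℚ, (q : ℝ) ∈ Ioo (0 : ℝ) 1 → 0 ≤ f q) {w : ℝ} (hw : w ∈ Ioo (0 : ℝ) 1) :
    0 ≤ f w := by
  by_contra hneg
  push Not at hneg
  have hev := (hf.continuousAt (isOpen_Ioo.mem_nhds hw)).eventually (gt_mem_nhds hneg)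
  obtain ⟨U, hU, hUo, hwU⟩ := mem_nhds_iff.1 (hev.and (isOpen_Ioo.mem_nhds hw))
  obtain ⟨q, hq⟩ := Rat.denseRange_cast.exists_mem_open hUo ⟨w, hwU⟩
  exact absurd (h q (hU hq).2) (not_le.2 (hU hq).1)

/-- The square of the diagonal symbol is at most the diagonal symbol of the square. -/
theorem devSym_sq_le (h0 : Γ.IsPositive) (h1 : (1 - Γ).IsPositive) (hp : IsPeriodicSum Γ) :
    ∀ᵐ ξ : ℝ, devSym Γ ξ ^ 2 ≤ devSqSym Γ ξ := by
  have h2 : ∀ᵐ ξ : ℝ, ∀ t : ℚ, 0 ≤ (t : ℝ) ^ 2 + (-2 * t) * devSym Γ ξ + 1 * devSqSym Γ ξ +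
      0 * entSym Γ ξ := by
    refine ae_all_iff.2 fun t => diag_poly_nonneg h0 h1 hp fun x _ _ => ?_
    nlinarith [sq_nonneg ((1 - 2 * x) ^ 2 - t)]
  filter_upwards [h2] with ξ hξ
  have h3 : ∀ t : ℝ, 0 ≤ t ^ 2 + (-2 * t) * devSym Γ ξ + 1 * devSqSym Γ ξ + 0 * entSym Γ ξ := by
    intro t
    have hcl : IsClosed {t : ℝ | 0 ≤ t ^ 2 + (-2 * t) * devSym Γ ξ + 1 * devSqSym Γ ξ +
        0 * entSym Γ ξ} := isClosed_le continuous_const (by fun_prop)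
    exact Rat.denseRange_cast.induction_on (p := fun t : ℝ => 0 ≤ t ^ 2 + (-2 * t) * devSym Γ ξ +
      1 * devSqSym Γ ξ + 0 * entSym Γ ξ) t hcl hξ
  nlinarith [h3 (devSym Γ ξ)]

theorem devSym_nonneg (h0 : Γ.IsPositive) (h1 : (1 - Γ).IsPositive) (hp : IsPeriodicSum Γ) :
    ∀ᵐ ξ : ℝ, 0 ≤ devSym Γ ξ := by
  filter_upwards [diag_poly_nonneg h0 h1 hp (a := 0) (b := 1) (c := 0) (d := 0)
    fun x _ _ => by nlinarith [sq_nonneg (1 - 2 * x)]] with ξ h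
  linarith

theorem devSym_le_one (h0 : Γ.IsPositive) (h1 : (1 - Γ).IsPositive) (hp : IsPeriodicSum Γ) :
    ∀ᵐ ξ : ℝ, devSym Γ ξ ≤ 1 := by
  filter_upwards [diag_poly_nonneg h0 h1 hp (a := 1) (b := -1) (c := 0) (d := 0)
    fun x hx0 hx1 => by nlinarith] with ξ h
  linarith

theorem entSym_nonneg (h0 : Γ.IsPositive) (h1 : (1 - Γ).IsPositive) (hp : IsPeriodicSum Γ) :
    ∀ᵐ ξ : ℝ, 0 ≤ entSym Γ ξ := by
  filter_upwards [diag_poly_nonneg h0 h1 hp (a := 0) (b := 0) (c := 0) (d := 1)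
    fun x hx0 hx1 => by linarith [binEnt_nonneg hx0 hx1]] with ξ h
  linarith

/-- Upper bound on the entropy of `Γ`, with a quadratic remainder, in terms of the comparison
value `(1 - 2x)² = w²`. Since the comparison state is scalar at each momentum, no spectral
decomposition of `Γ` is needed. The exceptional null set does not depend on `w`: rational `w`
suffice, by continuity. -/
theorem entSym_le (h0 : Γ.IsPositive) (h1 : (1 - Γ).IsPositive) (hp : IsPeriodicSum Γ) :
    ∀ᵐ ξ : ℝ, ∀ w ∈ Ioo (0 : ℝ) 1, artanhRatio w / 4 * (devSym Γ ξ - w ^ 2) +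
      (devSym Γ ξ - w ^ 2) ^ 2 / 12 ≤ binEnt ((1 - w) / 2) - entSym Γ ξ := by
  have h2 : ∀ᵐ ξ : ℝ, ∀ q : ℚ, (q : ℝ) ∈ Ioo (0 : ℝ) 1 →
      0 ≤ (binEnt ((1 - (q : ℝ)) / 2) + artanhRatio q / 4 * (q : ℝ) ^ 2 - (q : ℝ) ^ 4 / 12) +
        (-(artanhRatio q / 4) + (q : ℝ) ^ 2 / 6) * devSym Γ ξ + (-1 / 12) * devSqSym Γ ξ +
        (-1) * entSym Γ ξ := by
    refine ae_all_iff.2 fun q => ?_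
    by_cases hq : (q : ℝ) ∈ Ioo (0 : ℝ) 1
    · filter_upwards [diag_poly_nonneg h0 h1 hp (a := binEnt ((1 - (q : ℝ)) / 2) +
          artanhRatio q / 4 * (q : ℝ) ^ 2 - (q : ℝ) ^ 4 / 12)
          (b := -(artanhRatio q / 4) + (q : ℝ) ^ 2 / 6) (c := -1 / 12) (d := -1)
          fun x hx0 hx1 => by nlinarith [binEnt_le hq.1 hq.2 hx0 hx1]] with ξ h _
      exact h
    · exact .of_forall fun ξ h => absurd h hq
  filter_upwards [h2, devSym_sq_le h0 h1 hp] with ξ hξ hsq w hw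
  -- `binEnt_le` is an upper bound in terms of `(1 - 2Γ)⁴`, which dominates the squared diagonal.
  have h3 := nonneg_of_rat (f := fun w => (binEnt ((1 - w) / 2) + artanhRatio w / 4 * w ^ 2 -
      w ^ 4 / 12) + (-(artanhRatio w / 4) + w ^ 2 / 6) * devSym Γ ξ + (-1 / 12) * devSqSym Γ ξ +
      (-1) * entSym Γ ξ) (by
    have := continuousOn_artanhRatio
    have := (continuous_binEnt.comp (f := fun w : ℝ => (1 - w) / 2) (by fun_prop)).continuousOn
      (s := Ioo (0 : ℝ) 1)
    have e : ContinuousOn (fun w : ℝ => binEnt ((1 - w) / 2)) (Ioo 0 1) := this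
    fun_prop) hξ hw
  nlinarith

/-- Lower bound on the entropy of a state for which `(1 - 2Γ)²` and its square have the diagonal
symbols `w²` and `w⁴`. -/
theorem entSym_ge (h0 : Γ.IsPositive) (h1 : (1 - Γ).IsPositive) (hp : IsPeriodicSum Γ)
    {w : ℝ → ℝ} (hw : ∀ ξ, w ξ ∈ Ioo (0 : ℝ) 1) (hd1 : ∀ᵐ ξ : ℝ, devSym Γ ξ = w ξ ^ 2)
    (hd2 : ∀ᵐ ξ : ℝ, devSqSym Γ ξ = (w ξ ^ 2) ^ 2) :
    ∀ᵐ ξ : ℝ, binEnt ((1 - w ξ) / 2) ≤ entSym Γ ξ := by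
  have h2 : ∀ᵐ ξ : ℝ, ∀ q : ℚ, (q : ℝ) ∈ Ioo (0 : ℝ) 1 →
      0 ≤ (artanhRatio q / 4 * (-(q : ℝ) ^ 2) + (q : ℝ) ^ 4 / ((q : ℝ) ^ 2 * (1 - (q : ℝ) ^ 2)) -
          binEnt ((1 - (q : ℝ)) / 2)) +
        (artanhRatio q / 4 - 2 * (q : ℝ) ^ 2 / ((q : ℝ) ^ 2 * (1 - (q : ℝ) ^ 2))) * devSym Γ ξ +
        (1 / ((q : ℝ) ^ 2 * (1 - (q : ℝ) ^ 2))) * devSqSym Γ ξ + 1 * entSym Γ ξ := by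
    refine ae_all_iff.2 fun q => ?_
    by_cases hq : (q : ℝ) ∈ Ioo (0 : ℝ) 1
    · filter_upwards [diag_poly_nonneg h0 h1 hp (a := artanhRatio q / 4 * (-(q : ℝ) ^ 2) +
          (q : ℝ) ^ 4 / ((q : ℝ) ^ 2 * (1 - (q : ℝ) ^ 2)) - binEnt ((1 - (q : ℝ)) / 2))
          (b := artanhRatio q / 4 - 2 * (q : ℝ) ^ 2 / ((q : ℝ) ^ 2 * (1 - (q : ℝ) ^ 2)))
          (c := 1 / ((q : ℝ) ^ 2 * (1 - (q : ℝ) ^ 2))) (d := 1)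
          fun x hx0 hx1 => by
            have := binEnt_ge hq.1 hq.2 hx0 hx1
            have e : ((1 - 2 * x) ^ 2 - (q : ℝ) ^ 2) ^ 2 / ((q : ℝ) ^ 2 * (1 - (q : ℝ) ^ 2)) =
              (q : ℝ) ^ 4 / ((q : ℝ) ^ 2 * (1 - (q : ℝ) ^ 2)) -
              2 * (q : ℝ) ^ 2 / ((q : ℝ) ^ 2 * (1 - (q : ℝ) ^ 2)) * (1 - 2 * x) ^ 2 +
              1 / ((q : ℝ) ^ 2 * (1 - (q : ℝ) ^ 2)) * ((1 - 2 * x) ^ 2) ^ 2 := by ring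
            rw [e] at this
            linarith] with ξ h _
      exact h
    · exact .of_forall fun ξ h => absurd h hq
  filter_upwards [h2, hd1, hd2] with ξ hξ e1 e2
  have h3 := nonneg_of_rat (f := fun w => (artanhRatio w / 4 * (-w ^ 2) +
      w ^ 4 / (w ^ 2 * (1 - w ^ 2)) - binEnt ((1 - w) / 2)) +
      (artanhRatio w / 4 - 2 * w ^ 2 / (w ^ 2 * (1 - w ^ 2))) * devSym Γ ξ +
      (1 / (w ^ 2 * (1 - w ^ 2))) * devSqSym Γ ξ + 1 * entSym Γ ξ) (by
    have := continuousOn_artanhRatio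
    have := (continuous_binEnt.comp (f := fun w : ℝ => (1 - w) / 2) (by fun_prop)).continuousOn
      (s := Ioo (0 : ℝ) 1)
    have e : ContinuousOn (fun w : ℝ => binEnt ((1 - w) / 2)) (Ioo 0 1) := this
    have hne : ∀ w ∈ Ioo (0 : ℝ) 1, w ^ 2 * (1 - w ^ 2) ≠ 0 := fun w hw => by
      have h4 : 0 < 1 - w ^ 2 := by nlinarith [hw.1, hw.2]
      have h5 : 0 < w ^ 2 := by have := hw.1; positivity
      positivity
    fun_prop (disch := exact hne)) hξ (hw ξ)
  rw [e1, e2] at h3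
  have e3 : (w ξ) ^ 4 / ((w ξ) ^ 2 * (1 - (w ξ) ^ 2)) -
      2 * (w ξ) ^ 2 / ((w ξ) ^ 2 * (1 - (w ξ) ^ 2)) * (w ξ) ^ 2 +
      1 / ((w ξ) ^ 2 * (1 - (w ξ) ^ 2)) * ((w ξ) ^ 2) ^ 2 = 0 := by ring
  nlinarith

/-! ### The entropy per unit volume -/

theorem Admissible.isPeriodicSum (hΓ : Admissible Γ) : IsPeriodicSum Γ := by
  rw [isPeriodicSum_iff, hΓ.entry21_eq, hΓ.entry22_eq]
  exact ⟨hΓ.periodic11, hΓ.periodic12, hΓ.periodic12.conjOp,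
    isPeriodicOp_one.sub hΓ.periodic11.conjOp⟩

theorem conjOp_conjOp (A : Op) : conjOp (conjOp A) = A := by
  ext1 f
  change conjL2 (conjL2 (A (conjL2 (conjL2 f)))) = A f
  rw [conjL2_conjL2, conjL2_conjL2]

theorem holeConj_eq (h21 : entry21 Γ = conjOp (entry12 Γ))
    (h22 : entry22 Γ = 1 - conjOp (entry11 Γ)) : holeConj Γ = 1 - Γ := by
  have h22' : ∀ f, snd (Γ (inr f)) = f - conjL2 (fst (Γ (inl (conjL2 f)))) :=
    fun f => congrArg (fun B : Op => B f) h22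
  have h21' : ∀ f, snd (Γ (inl f)) = conjL2 (fst (Γ (inr (conjL2 f)))) :=
    fun f => congrArg (fun B : Op => B f) h21
  refine ContinuousLinearMap.ext fun u => ?_
  rw [holeConj_apply, holeMapInv_apply, holeMap_apply, sub_apply,
    one_apply_eq_self, map_sub]
  have hu : Γ u = Γ (inl (fst u)) + Γ (inr (snd u)) := by
    rw [← map_add, inl_fst_add_inr_snd]
  rw [hu]
  apply sum_ext <;> simp [h21', h22', conjL2_conjL2] <;> abel

theorem trPV_conjOp (B : Op) : trPV (conjOp B) = conj (trPV B) := by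
  rw [trPV, trPV, Complex.conj_tsum, ← (Equiv.neg ℤ).tsum_eq]
  congr 1
  funext n
  have e : ∀ n, conjL2 (cellBasis n) = cellBasis (-n) := fun n => by
    rw [← box_zero, conjL2_box, box_zero]
  rw [Equiv.neg_apply, inner_conj_symm]
  change inner ℂ (cellBasis (-n)) (conjL2 (B (conjL2 (cellBasis (-n))))) = _
  rw [e, neg_neg, ← e n, inner_conjL2]

/-- The entropy of a state with particle-hole symmetry is an integral over its momentum-space
density. -/
theorem entropy_eq_integral (h0 : Γ.IsPositive) (h1 : (1 - Γ).IsPositive) (hp : IsPeriodicSum Γ)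
    (hh : holeConj Γ = 1 - Γ) (hi : Integrable (entSym Γ)) : entropy Γ = ∫ ξ, entSym Γ ξ := by
  have hsa : IsSelfAdjoint Γ := h0.isSelfAdjoint
  set A : Op := entry11 (opFun negMulLog Γ) with hA
  set B : Op := entry11 (opFun negMulLog (1 - Γ)) with hB
  have hη : ∀ x : ℝ, 0 ≤ x → x ≤ 1 → 0 ≤ negMulLog x := fun x => Real.negMulLog_nonneg
  have hApos : A.IsPositive := isPositive_entry11 (isPositive_opFun h0 h1 hη)
  have hBpos : B.IsPositive :=
    isPositive_entry11 (isPositive_opFun h1 (by rwa [sub_sub_cancel]) hη)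
  have hAp : IsPeriodicOp A := (hp.opFun _).entry11
  have hBp : IsPeriodicOp B := ((isPeriodicSum_one.sub hp).opFun _).entry11
  have hsum : ∀ᵐ ξ, entSym Γ ξ = diagSym A ξ + diagSym B ξ := by
    have e : entry11 (opFun binEnt Γ) = A + B := by
      rw [opFun_binEnt hsa, hA, hB]
      ext1 f; simp only [entry11_apply, add_apply, map_add]
    rw [entSym, e]
    exact diagSym_add A B
  have hA0 := diagSym_nonneg hAp hApos
  have hB0 := diagSym_nonneg hBp hBpos
  have hAi : Integrable (diagSym A) := hi.mono' (measurable_diagSym A).aestronglyMeasurable (by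
    filter_upwards [hsum, hA0, hB0] with ξ e a b
    rw [Real.norm_eq_abs, abs_of_nonneg a]; linarith)
  have hBi : Integrable (diagSym B) := hi.mono' (measurable_diagSym B).aestronglyMeasurable (by
    filter_upwards [hsum, hA0, hB0] with ξ e a b
    rw [Real.norm_eq_abs, abs_of_nonneg b]; linarith)
  have e22 : conjOp (entry22 (opFun negMulLog Γ)) = B := by
    rw [← entry11_holeConj]
    have e := map_opFun holeConj continuous_holeConj Real.continuous_negMulLog hsa
    exact congrArg entry11 (e.trans (congrArg (opFun negMulLog) hh))
  have e22' : entry22 (opFun negMulLog Γ) = conjOp B := by rw [← e22, conjOp_conjOp]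
  rw [entropy, e22', trPV_conjOp, ← hA, trPV_eq_integral hAp hApos hAi,
    trPV_eq_integral hBp hBpos hBi, integral_congr_ae hsum, integral_add hAi hBi]
  simp

/-! ### The function `tanh x / x` -/

theorem tanh_pos_of_pos {x : ℝ} (hx : 0 < x) : 0 < tanh x := by
  rw [Real.tanh_eq_sinh_div_cosh]
  exact div_pos (Real.sinh_pos_iff.2 hx) (Real.cosh_pos x)

theorem hasDerivAt_tanh (x : ℝ) : HasDerivAt tanh (1 / cosh x ^ 2) x := by
  have h := (Real.hasDerivAt_sinh x).div (Real.hasDerivAt_cosh x) (Real.cosh_pos x).ne'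
  have e : tanh = fun x => sinh x / cosh x := by
    funext x; exact Real.tanh_eq_sinh_div_cosh x
  rw [e]
  refine h.congr_deriv ?_
  congr 1
  nlinarith [Real.cosh_sq x]

theorem continuous_tanh : Continuous tanh :=
  continuous_iff_continuousAt.2 fun x => (hasDerivAt_tanh x).continuousAt

theorem mul_le_sinh_mul_cosh {x : ℝ} (hx : 0 ≤ x) :
    x + 2 / 3 * x ^ 3 ≤ sinh x * cosh x := by
  have hd : ∀ y : ℝ, HasDerivAt (fun y => sinh y * cosh y - (y + 2 / 3 * y ^ 3))
      (2 * (sinh y ^ 2 - y ^ 2)) y := by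
    intro y
    refine (((Real.hasDerivAt_sinh y).mul (Real.hasDerivAt_cosh y)).sub
      ((hasDerivAt_id y).add ((hasDerivAt_pow 3 y).const_mul (2 / 3)))).congr_deriv ?_
    have := Real.cosh_sq y
    push_cast
    ring_nf; ring_nf at this; linarith
  have hm := monotoneOn_of_deriv_nonneg (convex_Ici 0)
    (fun y _ => (hd y).continuousAt.continuousWithinAt)
    (fun y _ => (hd y).differentiableAt.differentiableWithinAt) (fun y hy => by
      rw [interior_Ici] at hy
      rw [(hd y).deriv]
      have h1 := Real.self_le_sinh_iff.2 (le_of_lt hy)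
      have h2 := pow_le_pow_left₀ (le_of_lt hy) h1 2
      linarith)
  have := hm Set.self_mem_Ici hx hx
  simp at this
  linarith

theorem tanh_le_self {x : ℝ} (hx : 0 ≤ x) : tanh x ≤ x := by
  have hd : ∀ y : ℝ, HasDerivAt (fun y => y - tanh y) (1 - 1 / cosh y ^ 2) y :=
    fun y => (hasDerivAt_id y).sub (hasDerivAt_tanh y)
  have hm := monotoneOn_of_deriv_nonneg (convex_Ici 0)
    (fun y _ => (hd y).continuousAt.continuousWithinAt)
    (fun y _ => (hd y).differentiableAt.differentiableWithinAt) (fun y hy => by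
      rw [(hd y).deriv, sub_nonneg, div_le_one (by positivity)]
      nlinarith [Real.one_le_cosh y])
  have := hm Set.self_mem_Ici hx hx
  simp at this
  linarith

/-- The function `tanh x / x` (for `x ≠ 0`). -/
def tanhRatio (x : ℝ) : ℝ := tanh x / x

theorem hasDerivAt_tanhRatio {x : ℝ} (hx : x ≠ 0) :
    HasDerivAt tanhRatio ((1 / cosh x ^ 2 * x - tanh x * 1) / x ^ 2) x :=
  (hasDerivAt_tanh x).div (hasDerivAt_id x) hx

theorem tanhRatio_pos {x : ℝ} (hx : 0 < x) : 0 < tanhRatio x := div_pos (tanh_pos_of_pos hx) hx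

theorem le_tanhRatio {x : ℝ} (hx : 0 < x) : 1 / (1 + x) ≤ tanhRatio x := by
  rw [tanhRatio, div_le_div_iff₀ (by linarith) hx, Real.tanh_eq_sinh_div_cosh, div_mul_eq_mul_div,
    le_div_iff₀ (Real.cosh_pos x)]
  have h1 := Real.self_le_sinh_iff.2 hx.le
  have h2 := Real.exp_le_one_iff.2 (neg_nonpos.2 hx.le)
  have h3 := Real.cosh_sub_sinh x
  nlinarith [Real.exp_pos (-x)]

theorem sub_le_tanhRatio_sub {x y M : ℝ} (hx : 0 < x) (hxy : x ≤ y) (hy : y ≤ M) :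
    (y ^ 2 - x ^ 2) / (3 * cosh M ^ 2) ≤ tanhRatio x - tanhRatio y := by
  have hc := Real.cosh_pos M
  have hd : ∀ t ∈ Icc x y, HasDerivAt (fun t => tanhRatio t + t ^ 2 / (3 * cosh M ^ 2))
      ((1 / cosh t ^ 2 * t - tanh t * 1) / t ^ 2 + 2 * t / (3 * cosh M ^ 2)) t := by
    intro t ht
    refine (hasDerivAt_tanhRatio (hx.trans_le ht.1).ne').add ?_
    exact ((hasDerivAt_pow 2 t).div_const _).congr_deriv (by norm_num)
  have hm := antitoneOn_of_deriv_nonpos (convex_Icc x y)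
    (fun t ht => (hd t ht).continuousAt.continuousWithinAt)
    (fun t ht => (hd t (interior_subset ht)).differentiableAt.differentiableWithinAt)
    (fun t ht => by
      have ht := interior_subset ht
      have ht0 : 0 < t := hx.trans_le ht.1
      have hct := Real.cosh_pos t
      rw [(hd t ht).deriv]
      have h1 := mul_le_sinh_mul_cosh ht0.le
      have h2 : cosh t ^ 2 ≤ cosh M ^ 2 := by
        refine pow_le_pow_left₀ hct.le (Real.cosh_le_cosh.2 ?_) 2
        rw [abs_of_pos ht0, abs_of_pos (by linarith [ht.2])]
        linarith [ht.2]
      have h3 : (1 / cosh t ^ 2 * t - tanh t * 1) / t ^ 2 ≤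
          -(2 * t / (3 * cosh t ^ 2)) := by
        rw [Real.tanh_eq_sinh_div_cosh, div_le_iff₀ (by positivity)]
        have e : -(2 * t / (3 * cosh t ^ 2)) * t ^ 2 -
            (1 / cosh t ^ 2 * t - sinh t / cosh t * 1) =
            (sinh t * cosh t - (t + 2 / 3 * t ^ 3)) / cosh t ^ 2 := by
          field_simp; ring
        have := div_nonneg (sub_nonneg.2 h1) (sq_nonneg (cosh t))
        linarith
      have h4 : 2 * t / (3 * cosh M ^ 2) ≤ 2 * t / (3 * cosh t ^ 2) := by gcongr
      linarith)
  have := hm ⟨le_rfl, hxy⟩ ⟨hxy, le_rfl⟩ hxy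
  rw [sub_div]
  simp only at this
  linarith

theorem tanhRatio_antitone {x y : ℝ} (hx : 0 < x) (hxy : x ≤ y) : tanhRatio y ≤ tanhRatio x := by
  have := sub_le_tanhRatio_sub hx hxy le_rfl
  have h2 : 0 ≤ (y ^ 2 - x ^ 2) / (3 * cosh y ^ 2) :=
    div_nonneg (by nlinarith) (by positivity)
  linarith

/-- The comparison function is `4 (t / (1 + t))²`, whose sum with `tanhRatio` is increasing. -/
theorem tanhRatio_sub_le {x y : ℝ} (hx : 0 < x) (hxy : x ≤ y) :
    tanhRatio x - tanhRatio y ≤ 8 * (y ^ 2 - x ^ 2) / ((1 + x) * (1 + y) * (1 + x + y)) := by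
  have hd : ∀ t ∈ Icc x y, HasDerivAt (fun t => tanhRatio t + 4 * (t / (1 + t)) ^ 2)
      ((1 / cosh t ^ 2 * t - tanh t * 1) / t ^ 2 + 8 * t / (1 + t) ^ 3) t := by
    intro t ht
    have ht0 : 0 < t := hx.trans_le ht.1
    refine (hasDerivAt_tanhRatio ht0.ne').add ?_
    have h1 : HasDerivAt (fun t : ℝ => 1 + t) 1 t := (hasDerivAt_id t).const_add 1
    have h2 := (((hasDerivAt_id t).div h1 (by positivity)).pow 2).const_mul 4
    refine h2.congr_deriv ?_
    have h3 : 1 + t ≠ 0 := by positivity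
    simp only [id, Pi.div_apply]
    rw [show (2 - 1 : ℕ) = 1 from rfl, pow_one, show 1 * (1 + t) - t * 1 = 1 by ring]
    push_cast
    field_simp
    ring
  have hm := monotoneOn_of_deriv_nonneg (convex_Icc x y)
    (fun t ht => (hd t ht).continuousAt.continuousWithinAt)
    (fun t ht => (hd t (interior_subset ht)).differentiableAt.differentiableWithinAt)
    (fun t ht => by
      have ht := interior_subset ht
      have ht0 : 0 < t := hx.trans_le ht.1
      have hct := Real.cosh_pos t
      have htt := tanh_pos_of_pos ht0
      have htl := tanh_le_self ht0.le
      have ht1 := Real.tanh_lt_one t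
      rw [(hd t ht).deriv]
      have e1 : 1 / cosh t ^ 2 = 1 - tanh t ^ 2 := by
        rw [Real.tanh_eq_sinh_div_cosh]
        field_simp
        linarith [Real.cosh_sq t]
      rw [e1]
      have h3 : -(8 * t / (1 + t) ^ 3) ≤
          ((1 - tanh t ^ 2) * t - tanh t * 1) / t ^ 2 := by
        rw [le_div_iff₀ (by positivity)]
        rcases le_total t 1 with h | h
        · have h5 : t ≤ 8 * t / (1 + t) ^ 3 := by
            rw [le_div_iff₀ (by positivity)]
            have : (1 + t) ^ 3 ≤ 2 ^ 3 := pow_le_pow_left₀ (by positivity) (by linarith) 3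
            nlinarith
          have h6 : tanh t ^ 2 ≤ t ^ 2 := pow_le_pow_left₀ htt.le htl 2
          nlinarith [mul_le_mul_of_nonneg_right h5 (sq_nonneg t)]
        · have h5 : 1 ≤ 8 * t / (1 + t) ^ 3 * t ^ 2 := by
            rw [div_mul_eq_mul_div, le_div_iff₀ (by positivity)]
            have : (1 + t) ^ 3 ≤ (2 * t) ^ 3 := pow_le_pow_left₀ (by positivity) (by linarith) 3
            nlinarith
          have h6 : tanh t ^ 2 ≤ 1 := by nlinarith
          nlinarith
      linarith)
  have := hm ⟨le_rfl, hxy⟩ ⟨hxy, le_rfl⟩ hxy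
  simp only at this
  have hy : 0 < y := hx.trans_le hxy
  have e : 8 * (y ^ 2 - x ^ 2) / ((1 + x) * (1 + y) * (1 + x + y)) -
      (4 * (y / (1 + y)) ^ 2 - 4 * (x / (1 + x)) ^ 2) =
      4 * (y - x) * ((x + y) + (x + y) ^ 2 - 2 * x * y) /
        ((1 + x) ^ 2 * (1 + y) ^ 2 * (1 + x + y)) := by
    field_simp; ring
  have h4 : 0 ≤ 4 * (y - x) * ((x + y) + (x + y) ^ 2 - 2 * x * y) /
        ((1 + x) ^ 2 * (1 + y) ^ 2 * (1 + x + y)) := by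
    refine div_nonneg (mul_nonneg (by linarith) ?_) (by positivity)
    nlinarith
  linarith

theorem artanhRatio_tanh {x : ℝ} (hx : 0 < x) :
    artanhRatio (tanh x) = 2 * x / tanh x := by
  have h1 := Real.tanh_lt_one x
  have h2 := tanh_pos_of_pos hx
  have h3 := Real.artanh_eq_half_log (x := tanh x) ⟨by linarith, h1.le⟩
  rw [Real.artanh_tanh, Real.log_div (by linarith) (by linarith)] at h3
  rw [artanhRatio]
  congr 1
  linarith

/-! ### The function `K_T⁰` -/

section Symbols

variable {μ T Δ₀ : ℝ}

theorem dispersion_sq (μ Δ₀ p : ℝ) : dispersion μ Δ₀ p ^ 2 = (p ^ 2 - μ) ^ 2 + Δ₀ ^ 2 :=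
  Real.sq_sqrt (by positivity)

theorem dispersion_pos (hΔ : 0 < Δ₀) (p : ℝ) : 0 < dispersion μ Δ₀ p :=
  Real.sqrt_pos.2 (by positivity)

theorem continuous_dispersion (μ Δ₀ : ℝ) : Continuous (dispersion μ Δ₀) := by
  unfold dispersion; fun_prop

theorem KT_pos (hT : 0 < T) (hΔ : 0 < Δ₀) (p : ℝ) : 0 < KT μ T Δ₀ p :=
  div_pos (dispersion_pos hΔ p) (tanh_pos_of_pos (div_pos (dispersion_pos hΔ p) (by linarith)))

theorem continuous_KT (hT : 0 < T) (hΔ : 0 < Δ₀) : Continuous (KT μ T Δ₀) := by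
  have := continuous_dispersion μ Δ₀
  have := continuous_tanh
  unfold KT
  refine Continuous.div (by fun_prop) (by fun_prop) fun p =>
    (tanh_pos_of_pos (div_pos (dispersion_pos hΔ p) (by linarith))).ne'

theorem KT_neg (p : ℝ) : KT μ T Δ₀ (-p) = KT μ T Δ₀ p := by simp [KT, dispersion]

theorem inv_KT (hT : 0 < T) (p : ℝ) :
    (KT μ T Δ₀ p)⁻¹ = tanhRatio (dispersion μ Δ₀ p / (2 * T)) / (2 * T) := by
  rw [KT, tanhRatio, inv_div]
  field_simp

theorem two_mul_le_KT (hT : 0 < T) (hΔ : 0 < Δ₀) (p : ℝ) : 2 * T ≤ KT μ T Δ₀ p := by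
  have hx : 0 < dispersion μ Δ₀ p / (2 * T) := div_pos (dispersion_pos hΔ p) (by linarith)
  have h := tanh_le_self hx.le
  rw [KT, le_div_iff₀ (tanh_pos_of_pos hx)]
  calc 2 * T * tanh (dispersion μ Δ₀ p / (2 * T))
      ≤ 2 * T * (dispersion μ Δ₀ p / (2 * T)) := by gcongr
    _ = _ := by field_simp

theorem dispersion_le_KT (hT : 0 < T) (hΔ : 0 < Δ₀) (p : ℝ) :
    dispersion μ Δ₀ p ≤ KT μ T Δ₀ p := by
  have hE := dispersion_pos (μ := μ) hΔ p
  have hx : 0 < dispersion μ Δ₀ p / (2 * T) := div_pos hE (by linarith)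
  rw [KT, le_div_iff₀ (tanh_pos_of_pos hx)]
  nlinarith [Real.tanh_lt_one (dispersion μ Δ₀ p / (2 * T))]

theorem abs_le_dispersion (μ Δ₀ p : ℝ) : |p ^ 2 - μ| ≤ dispersion μ Δ₀ p :=
  Real.abs_le_sqrt (by nlinarith)

theorem dispersion_le (hΔ : 0 < Δ₀) (p : ℝ) : dispersion μ Δ₀ p ≤ |p ^ 2 - μ| + Δ₀ := by
  rw [dispersion, Real.sqrt_le_left (by positivity)]
  nlinarith [sq_abs (p ^ 2 - μ), abs_nonneg (p ^ 2 - μ), mul_nonneg (abs_nonneg (p ^ 2 - μ)) hΔ.le]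

theorem KT_le (hT : 0 < T) (hΔ : 0 < Δ₀) (p : ℝ) :
    KT μ T Δ₀ p ≤ |p ^ 2 - μ| + Δ₀ + 2 * T := by
  have hE := dispersion_pos (μ := μ) hΔ p
  have hx : 0 < dispersion μ Δ₀ p / (2 * T) := div_pos hE (by linarith)
  have h := le_tanhRatio hx
  rw [← inv_le_inv₀ (by positivity) (KT_pos hT hΔ p), inv_KT hT]
  have h2 : (|p ^ 2 - μ| + Δ₀ + 2 * T)⁻¹ ≤ (dispersion μ Δ₀ p + 2 * T)⁻¹ := by
    have := dispersion_le (μ := μ) hΔ p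
    gcongr
  refine h2.trans ?_
  rw [le_div_iff₀ (by linarith)]
  refine le_trans (le_of_eq ?_) h
  field_simp; ring

end Symbols

/-! ### Matrices of real Fourier multipliers -/

/-- The Fourier multiplier with the real symbol `m`. -/
abbrev rmul (m : ℝ → ℝ) : Op := fmul (fun ξ => (m ξ : ℂ))

/-- A bounded measurable real symbol. -/
abbrev RBdd (m : ℝ → ℝ) : Prop := BddMeas (fun ξ => (m ξ : ℂ))

theorem rBdd_of_le {m : ℝ → ℝ} (hm : Measurable m) {C : ℝ} (h : ∀ ξ, |m ξ| ≤ C) : RBdd m :=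
  ⟨Complex.measurable_ofReal.comp hm, C, fun ξ => by rw [Complex.norm_real]; exact h ξ⟩

theorem coeFn_FT_rmul {m : ℝ → ℝ} (hm : RBdd m) (f : L2) :
    FT (rmul m f) =ᵐ[volume] fun ξ => (m ξ : ℂ) * FT f ξ := by
  rw [rmul, FT_fmul]; exact mulOp_coeFn hm _

theorem op_ext_FT {A B : Op} (h : ∀ f, FT (A f) =ᵐ[volume] FT (B f)) : A = B := by
  ext1 f
  exact FT.injective (Lp.ext (h f))

theorem rmul_one_sub {m : ℝ → ℝ} (hm : RBdd m) (h : RBdd fun ξ => 1 - m ξ) :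
    rmul (fun ξ => 1 - m ξ) = 1 - rmul m := by
  apply op_ext_FT
  intro f
  rw [sub_apply, one_apply_eq_self, map_sub]
  filter_upwards [Lp.coeFn_sub (FT f) (FT (rmul m f)), coeFn_FT_rmul h f, coeFn_FT_rmul hm f]
    with ξ e1 e2 e3
  rw [e1, e2, Pi.sub_apply, e3]; push_cast; ring

theorem conjOp_rmul {m : ℝ → ℝ} (hm : RBdd m) (he : ∀ ξ, m (-ξ) = m ξ) :
    conjOp (rmul m) = rmul m := by
  apply op_ext_FT
  intro f
  change FT (conjL2 (rmul m (conjL2 f))) =ᵐ[volume] _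
  have hneg := (Measure.measurePreserving_neg (volume : Measure ℝ)).quasiMeasurePreserving
  filter_upwards [coeFn_FT_conjL2 (rmul m (conjL2 f)),
    hneg.ae (coeFn_FT_rmul hm (conjL2 f)), hneg.ae (coeFn_FT_conjL2 f), coeFn_FT_rmul hm f]
    with ξ e1 e2 e3 e4
  rw [e1, e2, e3, e4, he, neg_neg, map_mul, Complex.conj_ofReal, Complex.conj_conj]

theorem diagSym_rmul {m : ℝ → ℝ} (hm : RBdd m) : ∀ᵐ ξ : ℝ, diagSym (rmul m) ξ = m ξ := by
  filter_upwards [diagSym_fmul_comp hm 1, diagSym_one] with ξ e1 e2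
  rw [e2, mul_one] at e1
  exact e1

theorem isPeriodicOp_rmul {m : ℝ → ℝ} (hm : RBdd m) : IsPeriodicOp (rmul m) := isPeriodicOp_fmul hm

/-- A matrix of multipliers is positive if the matrix of symbols is positive semidefinite. -/
theorem isPositive_ofEntries_rmul {p q r : ℝ → ℝ} (hp : RBdd p) (hq : RBdd q) (hr : RBdd r)
    (hp0 : ∀ ξ, 0 ≤ p ξ) (hr0 : ∀ ξ, 0 ≤ r ξ) (hd : ∀ ξ, q ξ ^ 2 ≤ p ξ * r ξ) :
    (ofEntries (rmul p) (rmul q) (rmul q) (rmul r)).IsPositive := by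
  rw [ContinuousLinearMap.isPositive_iff_complex]
  intro u
  set f := fst u with hf
  set g := snd u with hg
  have e : (inner ℂ (ofEntries (rmul p) (rmul q) (rmul q) (rmul r) u) u : ℂ) =
      ((∫ ξ, (p ξ * ‖FT f ξ‖ ^ 2 + 2 * q ξ * (conj (FT f ξ) * FT g ξ).re +
        r ξ * ‖FT g ξ‖ ^ 2) : ℝ) : ℂ) := by
    have e1 : fst (ofEntries (rmul p) (rmul q) (rmul q) (rmul r) u) = rmul p f + rmul q g := by
      rw [ofEntries_apply, map_add, fst_inl, fst_inr, add_zero]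
    have e2 : snd (ofEntries (rmul p) (rmul q) (rmul q) (rmul r) u) = rmul q f + rmul r g := by
      rw [ofEntries_apply, map_add, snd_inl, snd_inr, zero_add]
    rw [inner_sum, e1, e2, ← FT.inner_map_map, ← FT.inner_map_map (rmul q f + rmul r g), L2.inner_def,
      L2.inner_def, ← integral_add (L2.integrable_inner _ _) (L2.integrable_inner _ _),
      ← integral_complex_ofReal]
    apply integral_congr_ae
    rw [map_add, map_add]
    filter_upwards [coeFn_FT_rmul hp f, coeFn_FT_rmul hq g, coeFn_FT_rmul hq f, coeFn_FT_rmul hr g,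
      Lp.coeFn_add (FT (rmul p f)) (FT (rmul q g)), Lp.coeFn_add (FT (rmul q f)) (FT (rmul r g))]
      with ξ e1 e2 e3 e4 e5 e6
    rw [e5, e6, Pi.add_apply, Pi.add_apply, e1, e2, e3, e4, ← hf, ← hg]
    simp only [RCLike.inner_apply]
    have h1 : ∀ z : ℂ, ((‖z‖ ^ 2 : ℝ) : ℂ) = z * conj z := fun z => by
      rw [Complex.mul_conj, Complex.normSq_eq_norm_sq]
    have h2 : ∀ z : ℂ, (2 * z.re : ℂ) = z + conj z := fun z => by
      rw [Complex.add_conj]; push_cast; rfl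
    have h3 : ((2 * q ξ * (conj (FT f ξ) * FT g ξ).re : ℝ) : ℂ) = q ξ *
        (conj (FT f ξ) * FT g ξ + FT f ξ * conj (FT g ξ)) := by
      have := h2 (conj (FT f ξ) * FT g ξ)
      rw [map_mul, Complex.conj_conj] at this
      rw [← this]; push_cast; ring
    rw [Complex.ofReal_add, Complex.ofReal_add, h3, Complex.ofReal_mul, Complex.ofReal_mul, h1, h1]
    simp only [map_add, map_mul, Complex.conj_ofReal]
    ring
  rw [e]
  refine ⟨by simp, ?_⟩
  simp only [RCLike.re_to_complex, Complex.ofReal_re]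
  refine integral_nonneg fun ξ => ?_
  set z := FT f ξ
  set v := FT g ξ
  have h1 : |(conj z * v).re| ≤ ‖z‖ * ‖v‖ := by
    refine (Complex.abs_re_le_norm _).trans ?_
    rw [norm_mul, RCLike.norm_conj]
  have h2 : |q ξ| ≤ sqrt (p ξ) * sqrt (r ξ) := by
    rw [← Real.sqrt_mul (hp0 ξ)]
    exact Real.abs_le_sqrt (hd ξ)
  have h3 : |q ξ * (conj z * v).re| ≤
      (sqrt (p ξ) * sqrt (r ξ)) * (‖z‖ * ‖v‖) := by
    rw [abs_mul]; gcongr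
  have h4 := neg_abs_le (q ξ * (conj z * v).re)
  have h5 := Real.sq_sqrt (hp0 ξ)
  have h6 := Real.sq_sqrt (hr0 ξ)
  change 0 ≤ p ξ * ‖z‖ ^ 2 + 2 * q ξ * (conj z * v).re + r ξ * ‖v‖ ^ 2
  nlinarith [sq_nonneg (sqrt (p ξ) * ‖z‖ - sqrt (r ξ) * ‖v‖)]

/-! ### The translation-invariant state -/

section State

/-- The momentum distribution `γ̃⁰(hp)` with `p = 2πξ`. -/
def densSym (μ T Δ₀ h ξ : ℝ) : ℝ :=
  (1 - ((h * (2 * π * ξ)) ^ 2 - μ) / KT μ T Δ₀ (h * (2 * π * ξ))) / 2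

/-- The pair wave function `α̃⁰(hp)` with `p = 2πξ`. -/
def pairSym (μ T Δ₀ h ξ : ℝ) : ℝ := Δ₀ / (2 * KT μ T Δ₀ (h * (2 * π * ξ)))

/-- The number `tanh (E(hp) / (2T))` with `p = 2πξ`; the eigenvalues of `1 - 2Γ̃⁰(hp)` are plus
and minus this number. -/
def gapTanh (μ T Δ₀ h ξ : ℝ) : ℝ :=
  tanh (dispersion μ Δ₀ (h * (2 * π * ξ)) / (2 * T))

variable {μ T Δ₀ h : ℝ}

theorem one_sub_two_densSym (ξ : ℝ) : 1 - 2 * densSym μ T Δ₀ h ξ =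
    ((h * (2 * π * ξ)) ^ 2 - μ) / KT μ T Δ₀ (h * (2 * π * ξ)) := by
  rw [densSym]; ring

theorem continuous_gapTanh : Continuous (gapTanh μ T Δ₀ h) := by
  have := continuous_dispersion μ Δ₀
  have := continuous_tanh
  unfold gapTanh
  fun_prop

theorem holeConj_Gamma0 : holeConj (Gamma0 μ T Δ₀ h) = 1 - Gamma0 μ T Δ₀ h := by
  apply holeConj_eq
  · simp only [Gamma0, entry21_ofEntries, entry12_ofEntries]
  · simp only [Gamma0, entry22_ofEntries, entry11_ofEntries]

variable (hT : 0 < T) (hΔ : 0 < Δ₀)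
include hT hΔ

theorem gapTanh_mem (ξ : ℝ) : gapTanh μ T Δ₀ h ξ ∈ Ioo (0 : ℝ) 1 :=
  ⟨tanh_pos_of_pos (div_pos (dispersion_pos hΔ _) (by linarith)), Real.tanh_lt_one _⟩

theorem dispersion_div_KT (p : ℝ) :
    dispersion μ Δ₀ p / KT μ T Δ₀ p = tanh (dispersion μ Δ₀ p / (2 * T)) := by
  have h1 := dispersion_pos (μ := μ) hΔ p
  have h2 := tanh_pos_of_pos (div_pos h1 (by linarith : (0 : ℝ) < 2 * T))
  rw [KT]; field_simp

theorem gapTanh_sq (ξ : ℝ) : (1 - 2 * densSym μ T Δ₀ h ξ) ^ 2 + 4 * pairSym μ T Δ₀ h ξ ^ 2 =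
    gapTanh μ T Δ₀ h ξ ^ 2 := by
  rw [one_sub_two_densSym, pairSym, gapTanh, ← dispersion_div_KT hT hΔ, div_pow, div_pow,
    div_pow, dispersion_sq]
  have := KT_pos (μ := μ) hT hΔ (h * (2 * π * ξ))
  field_simp
  ring

theorem KT_mul_one_sub (ξ : ℝ) :
    KT μ T Δ₀ (h * (2 * π * ξ)) * (1 - 2 * densSym μ T Δ₀ h ξ) =
    (h * (2 * π * ξ)) ^ 2 - μ := by
  rw [one_sub_two_densSym, mul_div_cancel₀ _ (KT_pos hT hΔ _).ne']

theorem T_mul_artanhRatio (ξ : ℝ) :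
    T * artanhRatio (gapTanh μ T Δ₀ h ξ) = KT μ T Δ₀ (h * (2 * π * ξ)) := by
  have h1 : 0 < dispersion μ Δ₀ (h * (2 * π * ξ)) / (2 * T) :=
    div_pos (dispersion_pos hΔ _) (by linarith)
  rw [gapTanh, artanhRatio_tanh h1, KT]
  field_simp

theorem densSym_sq_add : ∀ ξ, densSym μ T Δ₀ h ξ ^ 2 + pairSym μ T Δ₀ h ξ ^ 2 ≤
    densSym μ T Δ₀ h ξ := by
  intro ξ
  have h1 := gapTanh_sq (μ := μ) (h := h) hT hΔ ξ
  have h2 := gapTanh_mem (μ := μ) (h := h) hT hΔ ξ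
  nlinarith [h2.1, h2.2]

theorem densSym_mem (ξ : ℝ) : densSym μ T Δ₀ h ξ ∈ Icc (0 : ℝ) 1 := by
  have := densSym_sq_add (μ := μ) (h := h) hT hΔ ξ
  constructor <;> nlinarith [sq_nonneg (pairSym μ T Δ₀ h ξ), sq_nonneg (densSym μ T Δ₀ h ξ),
    sq_nonneg (densSym μ T Δ₀ h ξ - 1)]

theorem pairSym_pos (ξ : ℝ) : 0 < pairSym μ T Δ₀ h ξ := by
  have := KT_pos (μ := μ) hT hΔ (h * (2 * π * ξ))
  rw [pairSym]; positivity

theorem continuous_densSym : Continuous (densSym μ T Δ₀ h) := by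
  have := continuous_KT (μ := μ) hT hΔ
  unfold densSym
  have hne : ∀ ξ : ℝ, KT μ T Δ₀ (h * (2 * π * ξ)) ≠ 0 := fun ξ => (KT_pos hT hΔ _).ne'
  fun_prop (disch := exact hne)

theorem continuous_pairSym : Continuous (pairSym μ T Δ₀ h) := by
  have := continuous_KT (μ := μ) hT hΔ
  unfold pairSym
  have hne : ∀ ξ : ℝ, 2 * KT μ T Δ₀ (h * (2 * π * ξ)) ≠ 0 := fun ξ =>
    (mul_pos two_pos (KT_pos hT hΔ _)).ne'
  fun_prop (disch := exact hne)

theorem pairSym_le (ξ : ℝ) : pairSym μ T Δ₀ h ξ ≤ 1 / 2 := by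
  have h1 := dispersion_le_KT (μ := μ) hT hΔ (h * (2 * π * ξ))
  have h2 : Δ₀ ≤ dispersion μ Δ₀ (h * (2 * π * ξ)) :=
    Real.le_sqrt_of_sq_le (by nlinarith [sq_nonneg ((h * (2 * π * ξ)) ^ 2 - μ)])
  rw [pairSym, div_le_div_iff₀ (by have := KT_pos (μ := μ) hT hΔ (h * (2 * π * ξ)); linarith)
    two_pos]
  linarith

theorem rBdd_densSym : RBdd (densSym μ T Δ₀ h) :=
  rBdd_of_le (continuous_densSym hT hΔ).measurable (C := 1) fun ξ => by
    have := densSym_mem (μ := μ) (h := h) hT hΔ ξ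
    rw [abs_of_nonneg this.1]; exact this.2

theorem rBdd_pairSym : RBdd (pairSym μ T Δ₀ h) :=
  rBdd_of_le (continuous_pairSym hT hΔ).measurable (C := 1 / 2) fun ξ => by
    rw [abs_of_pos (pairSym_pos hT hΔ ξ)]; exact pairSym_le hT hΔ ξ

theorem Gamma0_eq : Gamma0 μ T Δ₀ h = ofEntries (rmul (densSym μ T Δ₀ h))
    (rmul (pairSym μ T Δ₀ h)) (rmul (pairSym μ T Δ₀ h)) (1 - rmul (densSym μ T Δ₀ h)) := by
  have h1 : fourierMul (fun p => (Gamma0Symbol μ T Δ₀ (h * p) 0 0 : ℂ)) =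
      rmul (densSym μ T Δ₀ h) := by
    rw [fourierMul_eq_fmul, rmul]
    congr 1
    funext ξ
    rw [Gamma0Symbol_eq _ _ _ _ hT hΔ]
    simp [densSym]
  have h2 : fourierMul (fun p => (Gamma0Symbol μ T Δ₀ (h * p) 0 1 : ℂ)) =
      rmul (pairSym μ T Δ₀ h) := by
    rw [fourierMul_eq_fmul, rmul]
    congr 1
    funext ξ
    rw [Gamma0Symbol_eq _ _ _ _ hT hΔ]
    simp [pairSym]
  have e1 : conjOp (rmul (densSym μ T Δ₀ h)) = rmul (densSym μ T Δ₀ h) :=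
    conjOp_rmul (rBdd_densSym hT hΔ) fun ξ => by
      simp only [densSym, mul_neg, KT_neg, even_two.neg_pow]
  have e2 : conjOp (rmul (pairSym μ T Δ₀ h)) = rmul (pairSym μ T Δ₀ h) :=
    conjOp_rmul (rBdd_pairSym hT hΔ) fun ξ => by simp only [pairSym, mul_neg, KT_neg]
  simp only [Gamma0]
  rw [h1, h2, e1, e2]

theorem rBdd_one_sub_densSym : RBdd fun ξ => 1 - densSym μ T Δ₀ h ξ :=
  rBdd_of_le (measurable_const.sub (continuous_densSym hT hΔ).measurable) (C := 1) fun ξ => by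
    have := densSym_mem (μ := μ) (h := h) hT hΔ ξ
    rw [abs_of_nonneg (by linarith [this.2])]; linarith [this.1]

theorem isPositive_Gamma0 : (Gamma0 μ T Δ₀ h).IsPositive := by
  rw [Gamma0_eq hT hΔ, ← rmul_one_sub (rBdd_densSym hT hΔ) (rBdd_one_sub_densSym hT hΔ)]
  refine isPositive_ofEntries_rmul (rBdd_densSym hT hΔ) (rBdd_pairSym hT hΔ)
    (rBdd_one_sub_densSym hT hΔ) (fun ξ => (densSym_mem hT hΔ ξ).1)
    (fun ξ => sub_nonneg.2 (densSym_mem hT hΔ ξ).2) fun ξ => ?_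
  have := densSym_sq_add (μ := μ) (h := h) hT hΔ ξ
  nlinarith

theorem isPeriodicSum_Gamma0 : IsPeriodicSum (Gamma0 μ T Δ₀ h) := by
  rw [isPeriodicSum_iff, Gamma0_eq hT hΔ]
  simp only [entry11_ofEntries, entry12_ofEntries, entry21_ofEntries, entry22_ofEntries]
  exact ⟨isPeriodicOp_rmul (rBdd_densSym hT hΔ), isPeriodicOp_rmul (rBdd_pairSym hT hΔ),
    isPeriodicOp_rmul (rBdd_pairSym hT hΔ),
    isPeriodicOp_one.sub (isPeriodicOp_rmul (rBdd_densSym hT hΔ))⟩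

theorem isPositive_one_sub_Gamma0 : (1 - Gamma0 μ T Δ₀ h).IsPositive := by
  rw [← holeConj_Gamma0, ContinuousLinearMap.isPositive_iff_complex]
  intro u
  have h1 := (ContinuousLinearMap.isPositive_iff_complex _).1
    (isPositive_Gamma0 (μ := μ) (h := h) hT hΔ) (holeMapInv u)
  have h2 : (inner ℂ (holeConj (Gamma0 μ T Δ₀ h) u) u : ℂ) =
      inner ℂ (holeMapInv u) (Gamma0 μ T Δ₀ h (holeMapInv u)) := by
    rw [holeConj_apply]
    conv_lhs => rw [← holeMap_holeMapInv u]
    rw [inner_holeMap, holeMapInv_holeMap]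
  have h3 : (inner ℂ (holeMapInv u) (Gamma0 μ T Δ₀ h (holeMapInv u)) : ℂ) =
      inner ℂ (Gamma0 μ T Δ₀ h (holeMapInv u)) (holeMapInv u) := by
    rw [← inner_conj_symm, ← h1.1]; exact Complex.conj_ofReal _
  rw [h2, h3]
  exact h1

end State

/-! ### Diagonal symbols of the entries of a state -/

theorem sqDev_eq (Γ : SumOp) : sqDev Γ = 1 - (4 : ℂ) • Γ + (4 : ℂ) • (Γ * Γ) := by
  ext1 u
  change (u - (2 : ℂ) • Γ u) - (2 : ℂ) • Γ (u - (2 : ℂ) • Γ u) =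
    u - (4 : ℂ) • Γ u + (4 : ℂ) • Γ (Γ u)
  rw [map_sub, map_smul]
  module

theorem entry12_mul (A B : SumOp) :
    entry12 (A * B) = entry11 A ∘L entry12 B + entry12 A ∘L entry22 B := by
  ext1 f
  change fst (A (B (inr f))) = fst (A (inl (fst (B (inr f))))) + fst (A (inr (snd (B (inr f)))))
  rw [← map_add, ← map_add, inl_fst_add_inr_snd]

theorem entry11_sqDev (Γ : SumOp) : entry11 (sqDev Γ) = 1 - (4 : ℂ) • entry11 Γ +
    (4 : ℂ) • (entry11 Γ ∘L entry11 Γ + entry12 Γ ∘L entry21 Γ) := by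
  rw [← entry11_mul, sqDev_eq]
  ext1 f
  simp only [entry11_apply, add_apply, sub_apply, smul_apply, map_add, map_sub, map_smul,
    one_apply_eq_self, fst_inl]

theorem entry12_sqDev (Γ : SumOp) : entry12 (sqDev Γ) = (-4 : ℂ) • entry12 Γ +
    (4 : ℂ) • (entry11 Γ ∘L entry12 Γ + entry12 Γ ∘L entry22 Γ) := by
  rw [← entry12_mul, sqDev_eq]
  ext1 f
  simp only [entry12_apply, add_apply, sub_apply, smul_apply, map_add, map_sub, map_smul,
    one_apply_eq_self, fst_inr, zero_sub, neg_smul, neg_apply]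

/-- The diagonal symbol of `(1 - 2Γ)² = 1 - 4Γ + 4Γ²`, where the upper left entry of `Γ²` is
`γ γ* + α α*`. -/
theorem devSym_eq {Γ : SumOp} (h0 : Γ.IsPositive) : ∀ᵐ ξ : ℝ, devSym Γ ξ =
    1 - 4 * diagSym (entry11 Γ) ξ +
    4 * (diagSym (entry11 Γ ∘L adjoint (entry11 Γ)) ξ +
      diagSym (entry12 Γ ∘L adjoint (entry12 Γ)) ξ) := by
  have hsa : adjoint Γ = Γ := h0.isSelfAdjoint
  rw [adjoint_entry11 hsa, adjoint_entry12 hsa, devSym, entry11_sqDev]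
  set A := entry11 Γ
  set B := entry12 Γ ∘L entry21 Γ
  have h4 := diagSym_smul 4 A
  have h5 := diagSym_smul 4 (A ∘L A + B)
  push_cast at h4 h5
  filter_upwards [diagSym_add (1 - (4 : ℂ) • A) ((4 : ℂ) • (A ∘L A + B)),
    diagSym_sub 1 ((4 : ℂ) • A), h4, h5, diagSym_add (A ∘L A) B, diagSym_one]
    with ξ e1 e2 e3 e4 e5 e6
  rw [e1, e2, e3, e4, e5, e6]

/-! ### Decay of the translation-invariant state -/

theorem one_sub_tanh_le {x : ℝ} (hx : 0 < x) : 1 - tanh x ≤ 1 / x ^ 2 := by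
  rw [Real.tanh_eq_sinh_div_cosh, Real.sinh_eq, Real.cosh_eq, one_sub_div (by positivity),
    div_le_div_iff₀ (by positivity) (by positivity)]
  have h1 := Real.quadratic_le_exp_of_nonneg hx.le
  have h2 := Real.exp_pos (-x)
  have h3 : Real.exp (-x) * Real.exp x = 1 := by rw [← Real.exp_add]; simp
  have h4 : Real.exp (-x) ≤ 1 := Real.exp_le_one_iff.2 (by linarith)
  have h5 : 1 * x ^ 2 ≤ Real.exp x * 2 := by nlinarith
  have h6 : Real.exp (-x) * x ^ 2 ≤ 2 := by
    calc Real.exp (-x) * x ^ 2 ≤ Real.exp (-x) * (Real.exp x * 2) := by gcongr; linarith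
      _ = 2 := by rw [← mul_assoc, h3, one_mul]
  nlinarith

section State

variable {μ T Δ₀ h : ℝ} (hT : 0 < T) (hΔ : 0 < Δ₀)
include hT hΔ

theorem entry11_sqDev_Gamma0 : entry11 (sqDev (Gamma0 μ T Δ₀ h)) =
    rmul fun ξ => gapTanh μ T Δ₀ h ξ ^ 2 := by
  have hg := rBdd_densSym (μ := μ) (h := h) hT hΔ
  have ha := rBdd_pairSym (μ := μ) (h := h) hT hΔ
  have hw : RBdd fun ξ => gapTanh μ T Δ₀ h ξ ^ 2 :=
    rBdd_of_le (continuous_gapTanh.pow 2).measurable (C := 1) fun ξ => by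
      have := gapTanh_mem (μ := μ) (h := h) hT hΔ ξ
      rw [abs_of_nonneg (sq_nonneg _)]
      nlinarith [this.1, this.2]
  rw [entry11_sqDev, Gamma0_eq hT hΔ, entry11_ofEntries, entry12_ofEntries, entry21_ofEntries]
  apply op_ext_FT
  intro f
  set G := rmul (densSym μ T Δ₀ h)
  set A := rmul (pairSym μ T Δ₀ h)
  have e : (1 - (4 : ℂ) • G + (4 : ℂ) • (G ∘L G + A ∘L A)) f =
      f - (4 : ℂ) • G f + (4 : ℂ) • (G (G f) + A (A f)) := rfl
  rw [e, map_add, map_sub, map_smul, map_smul, map_add]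
  filter_upwards [Lp.coeFn_add (FT f - (4 : ℂ) • FT (G f))
      ((4 : ℂ) • (FT (G (G f)) + FT (A (A f)))),
    Lp.coeFn_sub (FT f) ((4 : ℂ) • FT (G f)), Lp.coeFn_smul (4 : ℂ) (FT (G f)),
    Lp.coeFn_smul (4 : ℂ) (FT (G (G f)) + FT (A (A f))), Lp.coeFn_add (FT (G (G f))) (FT (A (A f))),
    coeFn_FT_rmul hg f, coeFn_FT_rmul hg (G f), coeFn_FT_rmul ha f, coeFn_FT_rmul ha (A f),
    coeFn_FT_rmul hw f] with ξ e1 e2 e3 e4 e5 e6 e7 e8 e9 e10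
  rw [e1, e10, Pi.add_apply, e2, e4, Pi.sub_apply, Pi.smul_apply, e3, e5, Pi.add_apply,
    Pi.smul_apply, e7, e9, e6, e8, ← gapTanh_sq hT hΔ ξ]
  simp only [smul_eq_mul]
  push_cast; ring

theorem entry12_sqDev_Gamma0 : entry12 (sqDev (Gamma0 μ T Δ₀ h)) = 0 := by
  have hg := rBdd_densSym (μ := μ) (h := h) hT hΔ
  have ha := rBdd_pairSym (μ := μ) (h := h) hT hΔ
  have hc : rmul (densSym μ T Δ₀ h) ∘L rmul (pairSym μ T Δ₀ h) =
      rmul (pairSym μ T Δ₀ h) ∘L rmul (densSym μ T Δ₀ h) := by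
    rw [rmul, rmul, ← fmul_mul hg ha, ← fmul_mul ha hg]
    congr 1; funext ξ; ring
  rw [entry12_sqDev, Gamma0_eq hT hΔ, entry11_ofEntries, entry12_ofEntries, entry22_ofEntries,
    ContinuousLinearMap.comp_sub, hc, show (1 : Op) = ContinuousLinearMap.id ℂ L2 from rfl,
    ContinuousLinearMap.comp_id, add_sub_cancel, neg_smul, neg_add_cancel]

theorem devSym_Gamma0 : ∀ᵐ ξ : ℝ, devSym (Gamma0 μ T Δ₀ h) ξ = gapTanh μ T Δ₀ h ξ ^ 2 := by
  rw [devSym, entry11_sqDev_Gamma0 hT hΔ]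
  refine diagSym_rmul (rBdd_of_le (continuous_gapTanh.pow 2).measurable (C := 1) fun ξ => ?_)
  have := gapTanh_mem (μ := μ) (h := h) hT hΔ ξ
  rw [abs_of_nonneg (sq_nonneg _)]
  nlinarith [this.1, this.2]

theorem devSqSym_Gamma0 :
    ∀ᵐ ξ : ℝ, devSqSym (Gamma0 μ T Δ₀ h) ξ = (gapTanh μ T Δ₀ h ξ ^ 2) ^ 2 := by
  have hw : RBdd fun ξ => gapTanh μ T Δ₀ h ξ ^ 2 :=
    rBdd_of_le (continuous_gapTanh.pow 2).measurable (C := 1) fun ξ => by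
      have := gapTanh_mem (μ := μ) (h := h) hT hΔ ξ
      rw [abs_of_nonneg (sq_nonneg _)]
      nlinarith [this.1, this.2]
  rw [devSqSym, entry11_mul, entry11_sqDev_Gamma0 hT hΔ, entry12_sqDev_Gamma0 hT hΔ,
    ContinuousLinearMap.zero_comp, add_zero]
  filter_upwards [diagSym_fmul_comp hw (rmul fun ξ => gapTanh μ T Δ₀ h ξ ^ 2), diagSym_rmul hw]
    with ξ e1 e2
  rw [e1, e2, ← sq]

theorem entSym_Gamma0 :
    ∀ᵐ ξ : ℝ, entSym (Gamma0 μ T Δ₀ h) ξ = binEnt ((1 - gapTanh μ T Δ₀ h ξ) / 2) := by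
  have h0 := isPositive_Gamma0 (μ := μ) (h := h) hT hΔ
  have h1 := isPositive_one_sub_Gamma0 (μ := μ) (h := h) hT hΔ
  have hp := isPeriodicSum_Gamma0 (μ := μ) (h := h) hT hΔ
  filter_upwards [entSym_le h0 h1 hp, entSym_ge h0 h1 hp (gapTanh_mem hT hΔ) (devSym_Gamma0 hT hΔ)
    (devSqSym_Gamma0 hT hΔ), devSym_Gamma0 (μ := μ) (h := h) hT hΔ] with ξ e1 e2 e3
  have := e1 _ (gapTanh_mem (μ := μ) (h := h) hT hΔ ξ)
  rw [e3, sub_self] at this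
  norm_num at this
  linarith

omit hT in
theorem one_add_sq_le_dispersion (p : ℝ) :
    1 + p ^ 2 ≤ (1 + (1 + |μ|) / Δ₀) * dispersion μ Δ₀ p := by
  have h1 := abs_le_dispersion μ Δ₀ p
  have h2 : Δ₀ ≤ dispersion μ Δ₀ p := Real.le_sqrt_of_sq_le (by nlinarith [sq_nonneg (p ^ 2 - μ)])
  have h3 : 1 + |μ| ≤ (1 + |μ|) / Δ₀ * dispersion μ Δ₀ p := by
    rw [div_mul_eq_mul_div, le_div_iff₀ hΔ]
    have := abs_nonneg μ
    gcongr
  have h4 := le_abs_self (p ^ 2 - μ)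
  have h5 := le_abs_self μ
  nlinarith

end State

/-! ### States of finite kinetic energy -/

/-- The weight `1 + h²p²` with `p = 2πξ`. -/
def weight (h ξ : ℝ) : ℝ := 1 + h ^ 2 * (2 * π * ξ) ^ 2

theorem one_le_weight (h ξ : ℝ) : 1 ≤ weight h ξ := by
  have : 0 ≤ h ^ 2 * (2 * π * ξ) ^ 2 := by positivity
  rw [weight]; linarith

theorem weight_pos (h ξ : ℝ) : 0 < weight h ξ := one_pos.trans_le (one_le_weight h ξ)

theorem weight_eq (h ξ : ℝ) : weight h ξ = 1 + (h * (2 * π * ξ)) ^ 2 := by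
  rw [weight]; ring

theorem continuous_weight (h : ℝ) : Continuous (weight h) := by unfold weight; fun_prop

/-- Periodic states with particle-hole symmetry. -/
structure IsState (Γ : SumOp) : Prop where
  nonneg : Γ.IsPositive
  le_one : (1 - Γ).IsPositive
  periodic : IsPeriodicSum Γ
  hole : holeConj Γ = 1 - Γ

theorem Admissible.isState {Γ : SumOp} (hΓ : Admissible Γ) : IsState Γ :=
  ⟨hΓ.nonneg, hΓ.le_one, hΓ.isPeriodicSum, holeConj_eq hΓ.entry21_eq hΓ.entry22_eq⟩

theorem isState_Gamma0 {μ T Δ₀ h : ℝ} (hT : 0 < T) (hΔ : 0 < Δ₀) : IsState (Gamma0 μ T Δ₀ h) :=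
  ⟨isPositive_Gamma0 hT hΔ, isPositive_one_sub_Gamma0 hT hΔ, isPeriodicSum_Gamma0 hT hΔ,
    holeConj_Gamma0⟩

/-- The momentum distribution of a state. -/
def dens (Γ : SumOp) : ℝ → ℝ := diagSym (entry11 Γ)

/-- The momentum density of the Hilbert–Schmidt norm per unit volume of an operator. -/
def sqSym (A : Op) : ℝ → ℝ := diagSym (A ∘L adjoint A)

theorem sqSym_nonneg {A : Op} (hA : IsPeriodicOp A) : ∀ᵐ ξ : ℝ, 0 ≤ sqSym A ξ :=
  diagSym_nonneg (hA.comp hA.adjoint) (isPositive_comp_adjoint A)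

theorem measurable_sqSym (A : Op) : Measurable (sqSym A) := measurable_diagSym _

section IsState

variable {Γ : SumOp} (hs : IsState Γ)
include hs

theorem IsState.periodic11 : IsPeriodicOp (entry11 Γ) := hs.periodic.entry11

theorem IsState.periodic12 : IsPeriodicOp (entry12 Γ) := ((isPeriodicSum_iff Γ).1 hs.periodic).2.1

theorem IsState.dens_nonneg : ∀ᵐ ξ : ℝ, 0 ≤ dens Γ ξ :=
  diagSym_nonneg hs.periodic11 (isPositive_entry11 hs.nonneg)

theorem IsState.devSym_eq : ∀ᵐ ξ : ℝ, devSym Γ ξ =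
    1 - 4 * dens Γ ξ + 4 * (sqSym (entry11 Γ) ξ + sqSym (entry12 Γ) ξ) := BCS.devSym_eq hs.nonneg

theorem IsState.sq_add_le :
    ∀ᵐ ξ : ℝ, sqSym (entry11 Γ) ξ + sqSym (entry12 Γ) ξ ≤ dens Γ ξ := by
  filter_upwards [hs.devSym_eq, devSym_le_one hs.nonneg hs.le_one hs.periodic] with ξ e1 e2
  rw [e1] at e2
  linarith

end IsState

theorem integrable_inv_weight {h : ℝ} (hh : 0 < h) : Integrable fun ξ => (weight h ξ)⁻¹ :=
  (integral_weight hh).1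

section Decay

variable {μ T Δ₀ h : ℝ}

theorem KT_le_weight (hT : 0 < T) (hΔ : 0 < Δ₀) (ξ : ℝ) :
    KT μ T Δ₀ (h * (2 * π * ξ)) ≤ (1 + |μ| + Δ₀ + 2 * T) * weight h ξ := by
  have h1 := KT_le (μ := μ) hT hΔ (h * (2 * π * ξ))
  have h2 := one_le_weight h ξ
  have h3 := weight_eq h ξ
  have h4 := abs_sub ((h * (2 * π * ξ)) ^ 2) μ
  rw [abs_of_nonneg (sq_nonneg (h * (2 * π * ξ)))] at h4
  have h5 := abs_nonneg μ
  nlinarith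

theorem exists_decay (hT : 0 < T) (hΔ : 0 < Δ₀) (μ : ℝ) (h : ℝ) : ∃ C : ℝ, 0 < C ∧ ∀ ξ,
    weight h ξ * densSym μ T Δ₀ h ξ ≤ C * (weight h ξ)⁻¹ ∧
    weight h ξ * (1 - gapTanh μ T Δ₀ h ξ ^ 2) ≤ C * (weight h ξ)⁻¹ ∧
    (gapTanh μ T Δ₀ h ξ ^ 2)⁻¹ ≤ C := by
  set c := 1 + (1 + |μ|) / Δ₀ with hc
  have hc0 : 0 < c := by positivity
  set d := 1 + |μ| + Δ₀ + 2 * T with hd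
  have hd0 : 0 < d := by positivity
  refine ⟨(μ ^ 2 + Δ₀ ^ 2 + 8 * T ^ 2) * c ^ 2 + (d * c) ^ 2, by positivity, fun ξ => ?_⟩
  set p := h * (2 * π * ξ) with hp
  set E := dispersion μ Δ₀ p with hE
  have hE0 : 0 < E := dispersion_pos hΔ p
  have hE2 : E ^ 2 = (p ^ 2 - μ) ^ 2 + Δ₀ ^ 2 := dispersion_sq μ Δ₀ p
  set q := weight h ξ with hq
  have hq0 : 0 < q := weight_pos h ξ
  have hqE : q ≤ c * E := by rw [hq, weight_eq]; exact one_add_sq_le_dispersion hΔ p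
  have hK := KT_le_weight (μ := μ) (h := h) hT hΔ ξ
  rw [← hp, ← hq, ← hd] at hK
  have hK0 := KT_pos (μ := μ) hT hΔ p
  set w := gapTanh μ T Δ₀ h ξ with hw
  have hwm : w ∈ Ioo (0 : ℝ) 1 := gapTanh_mem hT hΔ ξ
  have hw1 : 1 - w ≤ 4 * T ^ 2 / E ^ 2 := by
    have := one_sub_tanh_le (x := E / (2 * T)) (by positivity)
    refine this.trans_eq ?_
    field_simp; ring
  have hEK : E / KT μ T Δ₀ p = w := dispersion_div_KT hT hΔ p
  have hg : densSym μ T Δ₀ h ξ ≤ (μ ^ 2 + Δ₀ ^ 2 + 2 * T ^ 2) / E ^ 2 := by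
    have e : densSym μ T Δ₀ h ξ = (1 - w * ((p ^ 2 - μ) / E)) / 2 := by
      rw [densSym, ← hp, ← hEK]; field_simp
    have h1 : (p ^ 2 - μ) / E ≤ 1 :=
      (div_le_one hE0).2 ((le_abs_self _).trans (abs_le_dispersion μ Δ₀ p))
    have h1' : -1 ≤ (p ^ 2 - μ) / E := by
      rw [le_div_iff₀ hE0]
      have := (neg_abs_le (p ^ 2 - μ))
      have := abs_le_dispersion μ Δ₀ p
      linarith
    have h2 : 1 - (p ^ 2 - μ) / E ≤ (2 * μ ^ 2 + 2 * Δ₀ ^ 2) / E ^ 2 := by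
      rw [le_div_iff₀ (by positivity)]
      rcases le_total 0 (p ^ 2 - μ) with hk | hk
      · have h3 : (1 - (p ^ 2 - μ) / E) * E ^ 2 = E * (E - (p ^ 2 - μ)) := by field_simp
        have h4 : (p ^ 2 - μ) ≤ E := (le_abs_self _).trans (abs_le_dispersion μ Δ₀ p)
        rw [h3]
        nlinarith [sq_nonneg μ]
      · have h3 : (p ^ 2 - μ) ^ 2 ≤ μ ^ 2 := by nlinarith [sq_nonneg p]
        have h4 : E ^ 2 ≤ μ ^ 2 + Δ₀ ^ 2 := by linarith
        nlinarith
    have h3 : (μ ^ 2 + Δ₀ ^ 2 + 2 * T ^ 2) / E ^ 2 =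
        ((2 * μ ^ 2 + 2 * Δ₀ ^ 2) / E ^ 2 + 4 * T ^ 2 / E ^ 2) / 2 := by ring
    rw [e, h3]
    nlinarith [hwm.1, hwm.2]
  have hEq : 1 / E ^ 2 ≤ c ^ 2 * (q⁻¹ * q⁻¹) := by
    rw [← mul_inv, ← div_eq_mul_inv, div_le_div_iff₀ (by positivity) (by positivity)]
    nlinarith
  have hfin : ∀ A x : ℝ, 0 ≤ A → A ≤ μ ^ 2 + Δ₀ ^ 2 + 8 * T ^ 2 → x ≤ A / E ^ 2 →
      q * x ≤ ((μ ^ 2 + Δ₀ ^ 2 + 8 * T ^ 2) * c ^ 2 + (d * c) ^ 2) * q⁻¹ := by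
    intro A x hA hA2 hx
    have h1 : x ≤ A * (c ^ 2 * (q⁻¹ * q⁻¹)) := by
      refine hx.trans ?_
      rw [div_eq_mul_one_div]; gcongr
    calc q * x ≤ q * (A * (c ^ 2 * (q⁻¹ * q⁻¹))) := by gcongr
      _ = A * c ^ 2 * q⁻¹ := by field_simp
      _ ≤ _ := by
        gcongr
        linarith [mul_le_mul_of_nonneg_right hA2 (sq_nonneg c), sq_nonneg (d * c)]
  refine ⟨hfin _ _ (by positivity) ?_ hg, hfin (8 * T ^ 2) _ (by positivity) ?_ ?_, ?_⟩
  · linarith [sq_nonneg T]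
  · linarith [sq_nonneg μ, sq_nonneg Δ₀]
  · have : 8 * T ^ 2 / E ^ 2 = 2 * (4 * T ^ 2 / E ^ 2) := by ring
    rw [this]; linarith [sq_nonneg (1 - w), sub_sq 1 w]
  · have h1 : w⁻¹ ≤ d * c := by
      rw [← hEK, inv_div, div_le_iff₀ hE0]
      calc _ ≤ d * q := hK
        _ ≤ d * (c * E) := by gcongr
        _ = _ := by ring
    rw [← inv_pow]
    have h2 : w⁻¹ ^ 2 ≤ (d * c) ^ 2 := pow_le_pow_left₀ (inv_nonneg.2 hwm.1.le) h1 2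
    linarith [mul_nonneg (by positivity : 0 ≤ μ ^ 2 + Δ₀ ^ 2 + 8 * T ^ 2) (sq_nonneg c)]

variable (hT : 0 < T) (hΔ : 0 < Δ₀) (hh : 0 < h)
include hT hΔ hh

theorem integrable_weight_densSym :
    Integrable fun ξ => weight h ξ * densSym μ T Δ₀ h ξ := by
  obtain ⟨C, hC0, hC⟩ := exists_decay hT hΔ μ h
  refine ((integrable_inv_weight hh).const_mul C).mono'
    ((continuous_weight h).mul (continuous_densSym hT hΔ)).aestronglyMeasurable
    (.of_forall fun ξ => ?_)
  rw [Real.norm_eq_abs, abs_of_nonneg (mul_nonneg (weight_pos h ξ).le (densSym_mem hT hΔ ξ).1)]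
  exact (hC ξ).1

theorem integrable_weight_gapTanh :
    Integrable fun ξ => weight h ξ * (1 - gapTanh μ T Δ₀ h ξ ^ 2) := by
  obtain ⟨C, hC0, hC⟩ := exists_decay hT hΔ μ h
  refine ((integrable_inv_weight hh).const_mul C).mono'
    ((continuous_weight h).mul (continuous_const.sub
      (continuous_gapTanh.pow 2))).aestronglyMeasurable
    (.of_forall fun ξ => ?_)
  have := gapTanh_mem (μ := μ) (h := h) hT hΔ ξ
  rw [Real.norm_eq_abs, abs_of_nonneg (mul_nonneg (weight_pos h ξ).le
    (by nlinarith [this.1, this.2]))]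
  exact (hC ξ).2.1

theorem integrable_binEnt_gapTanh :
    Integrable fun ξ => binEnt ((1 - gapTanh μ T Δ₀ h ξ) / 2) := by
  obtain ⟨C, hC0, hC⟩ := exists_decay hT hΔ μ h
  set d := 1 + |μ| + Δ₀ + 2 * T with hd
  have hd0 : 0 < d := by positivity
  refine ((integrable_weight_gapTanh hT hΔ hh (μ := μ)).const_mul (d / T / 4 + C)).mono'
    (continuous_binEnt.comp ((continuous_const.sub
      continuous_gapTanh).div_const 2)).aestronglyMeasurable
    (.of_forall fun ξ => ?_)
  have hw := gapTanh_mem (μ := μ) (h := h) hT hΔ ξ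
  rw [Real.norm_eq_abs, abs_of_nonneg
    (binEnt_nonneg (by linarith [hw.2]) (by linarith [hw.1]))]
  have h1 := binEnt_ge_aux hw.1 hw.2 zero_le_one le_rfl
  have h2 : binEnt ((1 - 1) / 2) = 0 := by simp [binEnt]
  have h3 := T_mul_artanhRatio (μ := μ) (h := h) hT hΔ ξ
  have h4 := KT_le_weight (μ := μ) (h := h) hT hΔ ξ
  have h5 := (hC ξ).2.2
  set w := gapTanh μ T Δ₀ h ξ
  have hw0 := hw.1
  have hw2 : 0 < 1 - w ^ 2 := by nlinarith [hw.1, hw.2]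
  have e : (1 ^ 2 - w ^ 2) ^ 2 / (w ^ 2 * (1 - w ^ 2)) = (w ^ 2)⁻¹ * (1 - w ^ 2) := by
    field_simp
  rw [h2, sub_zero, e] at h1
  have h6 : artanhRatio w ≤ d / T * weight h ξ := by
    rw [div_mul_eq_mul_div, le_div_iff₀ hT, mul_comm, h3]; exact h4
  refine h1.trans ?_
  have h7 := one_le_weight h ξ
  calc artanhRatio w / 4 * (1 ^ 2 - w ^ 2) + (w ^ 2)⁻¹ * (1 - w ^ 2)
      = (artanhRatio w / 4 + (w ^ 2)⁻¹) * (1 - w ^ 2) := by ring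
    _ ≤ ((d / T * weight h ξ) / 4 + C * weight h ξ) * (1 - w ^ 2) := by
      gcongr; nlinarith
    _ = _ := by ring

theorem IsState.integrable_entSym (μ : ℝ) {Γ : SumOp} (hs : IsState Γ)
    (hq : Integrable fun ξ => weight h ξ * dens Γ ξ) : Integrable (entSym Γ) := by
  set d := 1 + |μ| + Δ₀ + 2 * T with hd
  have hd0 : 0 < d := by positivity
  refine ((integrable_binEnt_gapTanh hT hΔ hh (μ := μ)).add (hq.const_mul (d / T))).mono'
    (measurable_diagSym _).aestronglyMeasurable ?_
  filter_upwards [entSym_nonneg hs.nonneg hs.le_one hs.periodic,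
    entSym_le hs.nonneg hs.le_one hs.periodic, hs.devSym_eq, hs.dens_nonneg,
    sqSym_nonneg hs.periodic11, sqSym_nonneg hs.periodic12] with ξ e1 e2 e3 e4 e5 e6
  rw [Real.norm_eq_abs, abs_of_nonneg e1]
  have hw := gapTanh_mem (μ := μ) (h := h) hT hΔ ξ
  have h1 := e2 _ hw
  have h3 := T_mul_artanhRatio (μ := μ) (h := h) hT hΔ ξ
  have h4 := KT_le_weight (μ := μ) (h := h) hT hΔ ξ
  have hK0 := KT_pos (μ := μ) hT hΔ (h * (2 * π * ξ))
  simp only [Pi.add_apply]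
  set w := gapTanh μ T Δ₀ h ξ
  have h6 : artanhRatio w ≤ d / T * weight h ξ := by
    rw [div_mul_eq_mul_div, le_div_iff₀ hT, mul_comm, h3]; exact h4
  have h7 : 0 ≤ artanhRatio w := by
    by_contra hneg
    push Not at hneg
    nlinarith
  have h8 : -(devSym Γ ξ - w ^ 2) ≤ 4 * dens Γ ξ := by
    rw [e3]; nlinarith [hw.1, hw.2]
  have h9 := mul_le_mul_of_nonneg_left h8 h7
  have h10 := mul_le_mul_of_nonneg_right h6 e4
  nlinarith [sq_nonneg (devSym Γ ξ - w ^ 2)]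

end Decay

/-! ### The energy as an integral in momentum space -/

theorem integrable_of_weight {h : ℝ} {f : ℝ → ℝ} (hf : Measurable f)
    (hi : Integrable fun ξ => weight h ξ * f ξ) : Integrable f := by
  refine hi.mono hf.aestronglyMeasurable (.of_forall fun ξ => ?_)
  rw [norm_mul, Real.norm_eq_abs (weight h ξ), abs_of_pos (weight_pos h ξ)]
  exact le_mul_of_one_le_left (norm_nonneg _) (one_le_weight h ξ)

theorem Admissible.integrable_weight_dens {Γ : SumOp} (hΓ : Admissible Γ) (h : ℝ) :
    Integrable fun ξ => weight h ξ * dens Γ ξ := by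
  have hs := hΓ.isState
  have hm : Measurable (dens Γ) := measurable_diagSym _
  have hfin := hΓ.finite_kinetic
  rw [trForm_sqrt hs.periodic11 (isPositive_entry11 hs.nonneg) (by fun_prop)] at hfin
  have hi : Integrable fun ξ : ℝ => (1 + (2 * π * ξ) ^ 2) * dens Γ ξ := by
    refine ⟨((by fun_prop : Measurable fun ξ : ℝ => 1 + (2 * π * ξ) ^ 2).mul
      hm).aestronglyMeasurable, ?_⟩
    rw [hasFiniteIntegral_iff_ofReal]
    · refine lt_of_eq_of_lt (lintegral_congr fun ξ => ?_) hfin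
      rw [ENNReal.ofReal_mul (by positivity)]; rfl
    · filter_upwards [hs.dens_nonneg] with ξ e
      exact mul_nonneg (by positivity) e
  refine (hi.const_mul (1 + h ^ 2)).mono
    ((continuous_weight h).measurable.mul hm).aestronglyMeasurable
    (.of_forall fun ξ => ?_)
  rw [← mul_assoc, norm_mul, norm_mul]
  refine mul_le_mul_of_nonneg_right ?_ (norm_nonneg _)
  have h1 : 0 ≤ (2 * π * ξ) ^ 2 := sq_nonneg _
  rw [Real.norm_eq_abs, Real.norm_eq_abs, abs_of_pos (weight_pos h ξ), abs_of_pos (by positivity),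
    weight]
  nlinarith [sq_nonneg h]

section Energy

variable {h : ℝ} (hh : 0 < h) {Γ : SumOp} (hs : IsState Γ)
  (hq : Integrable fun ξ => weight h ξ * dens Γ ξ)
include hh hs hq

theorem IsState.energy_eq {μ a T : ℝ} {W : ℝ → ℝ} (hW : RBdd W) (hWp : Function.Periodic W 1)
    (he : Integrable (entSym Γ)) : energy μ a T h W Γ =
    (∫ ξ, ((h * (2 * π * ξ)) ^ 2 - μ) * dens Γ ξ) +
      h ^ 2 * (trPV (mulOp (fun x => (W x : ℂ)) ∘L entry11 Γ)).re -
      T * (∫ ξ, entSym Γ ξ) - a * h * diagSq (entry12 Γ) := by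
  have hm : Measurable (dens Γ) := measurable_diagSym _
  have hpos := isPositive_entry11 hs.nonneg
  have hdi : Integrable (dens Γ) := integrable_of_weight hm hq
  have hki : Integrable fun ξ => h ^ 2 * (2 * π * ξ) ^ 2 * dens Γ ξ := by
    refine (hq.sub hdi).congr (.of_forall fun ξ => ?_)
    simp only [Pi.sub_apply, weight]; ring
  have hkin : (trForm (fun p => h ^ 2 * p ^ 2) (opFun sqrt (entry11 Γ))).toReal =
      ∫ ξ, h ^ 2 * (2 * π * ξ) ^ 2 * dens Γ ξ := by
    rw [trForm_sqrt hs.periodic11 hpos (by fun_prop), integral_eq_lintegral_of_nonneg_ae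
      (by filter_upwards [hs.dens_nonneg] with ξ e using mul_nonneg (by positivity) e)
      hki.aestronglyMeasurable]
    congr 1
    refine lintegral_congr fun ξ => ?_
    rw [ENNReal.ofReal_mul (p := h ^ 2 * (2 * π * ξ) ^ 2) (by positivity)]; rfl
  have hop : mulOp (fun x => ((-μ + h ^ 2 * W x : ℝ) : ℂ)) ∘L entry11 Γ =
      (-μ : ℂ) • entry11 Γ + (h ^ 2 : ℂ) • (mulOp (fun x => (W x : ℂ)) ∘L entry11 Γ) := by
    have hb : RBdd fun x => -μ + h ^ 2 * W x := by
      obtain ⟨C, hC⟩ := hW.2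
      refine ⟨?_, |μ| + h ^ 2 * C, fun x => ?_⟩
      · have := hW.1
        push_cast
        fun_prop
      · have := hC x
        push_cast
        refine (norm_add_le _ _).trans ?_
        rw [norm_neg, Complex.norm_real, norm_mul, norm_pow, Complex.norm_real, Real.norm_eq_abs,
          Real.norm_eq_abs, sq_abs]
        gcongr
    ext1 f
    apply Lp.ext
    rw [comp_apply, add_apply, smul_apply, smul_apply,
      comp_apply]
    filter_upwards [mulOp_coeFn hb (entry11 Γ f), mulOp_coeFn hW (entry11 Γ f),
      Lp.coeFn_add ((-μ : ℂ) • entry11 Γ f)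
        ((h ^ 2 : ℂ) • mulOp (fun x => (W x : ℂ)) (entry11 Γ f)),
      Lp.coeFn_smul (-μ : ℂ) (entry11 Γ f),
      Lp.coeFn_smul (h ^ 2 : ℂ) (mulOp (fun x => (W x : ℂ)) (entry11 Γ f))] with x e1 e2 e3 e4 e5
    rw [e1, e3, Pi.add_apply, e4, e5, Pi.smul_apply, Pi.smul_apply, e2]
    simp only [smul_eq_mul]; push_cast; ring
  have hWp' : Function.Periodic (fun x => (W x : ℂ)) 1 := fun x => by simp only [hWp x]
  have htr : trPV (mulOp (fun x => ((-μ + h ^ 2 * W x : ℝ) : ℂ)) ∘L entry11 Γ) =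
      (-μ : ℂ) * ((∫ ξ, dens Γ ξ : ℝ) : ℂ) +
        (h ^ 2 : ℂ) * trPV (mulOp (fun x => (W x : ℂ)) ∘L entry11 Γ) := by
    have h1 := (hasSum_trPV hs.periodic11 hpos hdi).mul_left (-μ : ℂ)
    have h2 := (summable_trPV_mulOp hs.periodic11 hpos hdi hW hWp').hasSum.mul_left (h ^ 2 : ℂ)
    rw [hop]
    refine (tsum_congr fun n => ?_).trans (h1.add h2).tsum_eq
    rw [add_apply, smul_apply, smul_apply, inner_add_right, inner_smul_right, inner_smul_right]
  have hre : (trPV (mulOp (fun x => ((-μ + h ^ 2 * W x : ℝ) : ℂ)) ∘L entry11 Γ)).re =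
      -μ * (∫ ξ, dens Γ ξ) + h ^ 2 * (trPV (mulOp (fun x => (W x : ℂ)) ∘L entry11 Γ)).re := by
    rw [htr, Complex.add_re, ← Complex.ofReal_neg, ← Complex.ofReal_pow, Complex.re_ofReal_mul,
      Complex.re_ofReal_mul, Complex.ofReal_re]
  have hint : (∫ ξ, ((h * (2 * π * ξ)) ^ 2 - μ) * dens Γ ξ) =
      (∫ ξ, h ^ 2 * (2 * π * ξ) ^ 2 * dens Γ ξ) - μ * ∫ ξ, dens Γ ξ := by
    rw [← integral_const_mul, ← integral_sub hki (hdi.const_mul μ)]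
    congr 1; funext ξ; ring
  rw [energy, hkin, hre, entropy_eq_integral hs.nonneg hs.le_one hs.periodic hs.hole he, hint]
  ring

end Energy

theorem sqSym_sub_rmul {A : Op} (hA : IsPeriodicOp A) (hsa : adjoint A = A)
    {r : ℝ → ℝ} (hr : RBdd r) : ∀ᵐ ξ : ℝ,
    sqSym (A - rmul r) ξ = sqSym A ξ - 2 * r ξ * diagSym A ξ + r ξ ^ 2 := by
  have hrsa : adjoint (rmul r) = rmul r := by
    rw [adjoint_fmul hr]; simp only [Complex.conj_ofReal]
  have e : (A - rmul r) ∘L adjoint (A - rmul r) =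
      A ∘L adjoint A - A ∘L rmul r - rmul r ∘L (A - rmul r) := by
    rw [map_sub, hsa, hrsa]
    ext1 f
    simp only [comp_apply, sub_apply, map_sub]
    abel
  rw [sqSym, e]
  filter_upwards [diagSym_sub (A ∘L adjoint A - A ∘L rmul r)
      (rmul r ∘L (A - rmul r)), diagSym_sub (A ∘L adjoint A) (A ∘L rmul r),
    diagSym_comp_fmul hr hA, diagSym_fmul_comp hr (A - rmul r), diagSym_sub A (rmul r),
    diagSym_rmul hr] with ξ f1 f2 f3 f4 f5 f6
  rw [f1, f2, f3, f4, f5, f6]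
  simp only [sqSym]; ring

/-- The energy of a state relative to that of the translation-invariant state controls the
deviation from the translation-invariant state. -/
theorem energy_gap_le {μ a T Δ₀ h : ℝ} (hT : 0 < T) (hΔ : 0 < Δ₀) (hh : 0 < h) {W : ℝ → ℝ}
    (hW : RBdd W) (hWp : Function.Periodic W 1) {Γ : SumOp} (hΓ : Admissible Γ)
    (hE : energy μ a T h W Γ ≤ energy μ a T h W (Gamma0 μ T Δ₀ h)) :
    Integrable (fun ξ => weight h ξ * sqSym (entry11 Γ - rmul (densSym μ T Δ₀ h)) ξ) ∧
    Integrable (fun ξ => weight h ξ * sqSym (entry12 Γ) ξ) ∧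
    Integrable (fun ξ => (devSym Γ ξ - gapTanh μ T Δ₀ h ξ ^ 2) ^ 2) ∧
    (∫ ξ, KT μ T Δ₀ (h * (2 * π * ξ)) *
        sqSym (entry11 Γ - rmul (densSym μ T Δ₀ h)) ξ) +
      ((∫ ξ, KT μ T Δ₀ (h * (2 * π * ξ)) * sqSym (entry12 Γ) ξ) -
        a * h * diagSq (entry12 Γ)) +
      T / 12 * (∫ ξ, (devSym Γ ξ - gapTanh μ T Δ₀ h ξ ^ 2) ^ 2) ≤
    ((∫ ξ, KT μ T Δ₀ (h * (2 * π * ξ)) * pairSym μ T Δ₀ h ξ ^ 2) -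
        a * h * diagSq (rmul (pairSym μ T Δ₀ h))) +
      h ^ 2 * ‖trPV (mulOp (fun x => (W x : ℂ)) ∘L
        (entry11 Γ - rmul (densSym μ T Δ₀ h)))‖ := by
  have hs := hΓ.isState
  have hs0 := isState_Gamma0 (μ := μ) (h := h) hT hΔ
  set Γ₀ := Gamma0 μ T Δ₀ h with hΓ₀
  set γ := entry11 Γ with hγ
  set γ₀ := rmul (densSym μ T Δ₀ h) with hγ₀
  set K : ℝ → ℝ := fun ξ => KT μ T Δ₀ (h * (2 * π * ξ)) with hK
  set w := gapTanh μ T Δ₀ h with hw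
  set g₀ := densSym μ T Δ₀ h with hg₀
  set a₀ := pairSym μ T Δ₀ h with ha₀
  have hgb := rBdd_densSym (μ := μ) (h := h) hT hΔ
  have e11 : entry11 Γ₀ = γ₀ := by rw [hΓ₀, Gamma0_eq hT hΔ, entry11_ofEntries]
  have e12 : entry12 Γ₀ = rmul a₀ := by rw [hΓ₀, Gamma0_eq hT hΔ, entry12_ofEntries]
  have hd0 : ∀ᵐ ξ : ℝ, dens Γ₀ ξ = g₀ ξ := by rw [dens, e11]; exact diagSym_rmul hgb
  have hm : Measurable (dens Γ) := measurable_diagSym _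
  have hq := hΓ.integrable_weight_dens h
  have hq0 := integrable_weight_densSym (μ := μ) hT hΔ hh
  have hq0' : Integrable fun ξ => weight h ξ * dens Γ₀ ξ := hq0.congr (by
    filter_upwards [hd0] with ξ e; rw [e])
  have hK0 : ∀ ξ, 0 < K ξ := fun ξ => KT_pos hT hΔ _
  have hKm : Measurable K := by
    have := continuous_KT (μ := μ) hT hΔ
    exact (by fun_prop : Continuous K).measurable
  have hKw : ∀ ξ, K ξ ≤ (1 + |μ| + Δ₀ + 2 * T) * weight h ξ := KT_le_weight hT hΔ
  have hγsa : adjoint γ = γ := adjoint_entry11 hs.nonneg.isSelfAdjoint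
  have hγ₀sa : adjoint γ₀ = γ₀ := by
    rw [hγ₀, rmul, adjoint_fmul hgb]
    simp only [Complex.conj_ofReal, hg₀]
  have hsq : ∀ᵐ ξ : ℝ, sqSym (γ - γ₀) ξ = sqSym γ ξ - 2 * g₀ ξ * dens Γ ξ + g₀ ξ ^ 2 :=
    sqSym_sub_rmul hs.periodic11 hγsa hgb
  have hper : IsPeriodicOp (γ - γ₀) := hs.periodic11.sub (isPeriodicOp_rmul hgb)
  have hle := hs.sq_add_le
  have hn0 := sqSym_nonneg hs.periodic11
  have hn1 := sqSym_nonneg hs.periodic12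
  have hn2 := sqSym_nonneg hper
  have hdn := hs.dens_nonneg
  have hwm := (continuous_weight h).measurable
  have hg0 : ∀ ξ, g₀ ξ ∈ Icc (0 : ℝ) 1 := fun ξ => densSym_mem hT hΔ ξ
  have hA : Integrable fun ξ => weight h ξ * sqSym (entry12 Γ) ξ := by
    refine hq.mono' (hwm.mul (measurable_sqSym _)).aestronglyMeasurable ?_
    filter_upwards [hle, hn0, hn1] with ξ f1 f2 f3
    rw [Real.norm_eq_abs, abs_of_nonneg (mul_nonneg (weight_pos h ξ).le f3)]
    exact mul_le_mul_of_nonneg_left (by linarith) (weight_pos h ξ).le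
  have hG : Integrable fun ξ => weight h ξ * sqSym (γ - γ₀) ξ := by
    refine (hq.add hq0).mono' (hwm.mul (measurable_sqSym _)).aestronglyMeasurable ?_
    filter_upwards [hle, hn0, hn1, hn2, hsq, hdn] with ξ f1 f2 f3 f4 f5 f6
    rw [Real.norm_eq_abs, abs_of_nonneg (mul_nonneg (weight_pos h ξ).le f4), Pi.add_apply,
      ← mul_add]
    refine mul_le_mul_of_nonneg_left ?_ (weight_pos h ξ).le
    have := hg0 ξ
    rw [f5]
    nlinarith [this.1, this.2, mul_nonneg this.1 f6]
  have hR : Integrable fun ξ => (devSym Γ ξ - w ξ ^ 2) ^ 2 := by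
    have hi1 : Integrable (dens Γ) := integrable_of_weight hm hq
    have hi2 : Integrable fun ξ => 1 - w ξ ^ 2 := integrable_of_weight
      (measurable_const.sub (continuous_gapTanh.pow 2).measurable)
      (integrable_weight_gapTanh (μ := μ) hT hΔ hh)
    refine ((hi1.const_mul 4).add hi2).mono' (((measurable_diagSym _).sub
      (continuous_gapTanh.pow 2).measurable).pow_const 2).aestronglyMeasurable ?_
    filter_upwards [hs.devSym_eq, hn0, hn1, devSym_le_one hs.nonneg hs.le_one hs.periodic,
      devSym_nonneg hs.nonneg hs.le_one hs.periodic, hdn] with ξ f1 f2 f3 f4 f5 f6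
    have hwξ := gapTanh_mem (μ := μ) (h := h) hT hΔ ξ
    rw [← hw] at hwξ
    have hw2 : w ξ ^ 2 ≤ 1 := by nlinarith [hwξ.1, hwξ.2]
    have hw3 : 0 ≤ w ξ ^ 2 := sq_nonneg _
    rw [Real.norm_eq_abs, abs_of_nonneg (sq_nonneg _), Pi.add_apply]
    have hb : |devSym Γ ξ - w ξ ^ 2| ≤ 1 := abs_le.2 ⟨by linarith, by linarith⟩
    have hb2 : |devSym Γ ξ - w ξ ^ 2| ≤ 4 * dens Γ ξ + (1 - w ξ ^ 2) :=
      abs_le.2 ⟨by linarith, by linarith⟩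
    rw [← sq_abs]
    nlinarith [abs_nonneg (devSym Γ ξ - w ξ ^ 2)]
  refine ⟨hG, hA, hR, ?_⟩
  have hKi : ∀ f : ℝ → ℝ, Measurable f → Integrable (fun ξ => weight h ξ * f ξ) →
      Integrable fun ξ => K ξ * f ξ := by
    intro f hf hi
    refine (hi.const_mul (1 + |μ| + Δ₀ + 2 * T)).mono (hKm.mul hf).aestronglyMeasurable
      (.of_forall fun ξ => ?_)
    rw [← mul_assoc, norm_mul, norm_mul]
    refine mul_le_mul_of_nonneg_right ?_ (norm_nonneg _)
    rw [Real.norm_eq_abs, Real.norm_eq_abs, abs_of_pos (hK0 ξ)]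
    exact (hKw ξ).trans (le_abs_self _)
  have hi1 := hKi _ (measurable_sqSym _) hG
  have hi2 := hKi _ (measurable_sqSym _) hA
  have hi3 : Integrable fun ξ => K ξ * a₀ ξ ^ 2 := by
    refine hKi _ ((continuous_pairSym hT hΔ).pow 2).measurable (hq0.mono'
      (hwm.mul ((continuous_pairSym hT hΔ).pow 2).measurable).aestronglyMeasurable
      (.of_forall fun ξ => ?_))
    rw [Real.norm_eq_abs, abs_of_nonneg (mul_nonneg (weight_pos h ξ).le (sq_nonneg _))]
    refine mul_le_mul_of_nonneg_left ?_ (weight_pos h ξ).le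
    have := densSym_sq_add (μ := μ) (h := h) hT hΔ ξ
    linarith [sq_nonneg (g₀ ξ)]
  have hΦ := hs.integrable_entSym hT hΔ hh μ hq
  have hΦ0 := hs0.integrable_entSym hT hΔ hh μ hq0'
  have hkx : ∀ f : ℝ → ℝ, Measurable f → Integrable (fun ξ => weight h ξ * f ξ) →
      Integrable fun ξ => ((h * (2 * π * ξ)) ^ 2 - μ) * f ξ := by
    intro f hf hi
    refine (hi.sub ((integrable_of_weight hf hi).const_mul (1 + μ))).congr
      (.of_forall fun ξ => ?_)
    simp only [Pi.sub_apply, weight_eq]; ring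
  have hk1 := hkx _ hm hq
  have hk0 := hkx (dens Γ₀) (measurable_diagSym _) hq0'
  rw [hs.energy_eq hh hq hW hWp hΦ, hs0.energy_eq hh hq0' hW hWp hΦ0, e11, e12] at hE
  have hWp' : Function.Periodic (fun x => (W x : ℂ)) 1 := fun x => by simp only [hWp x]
  have htr : trPV (mulOp (fun x => (W x : ℂ)) ∘L (γ - γ₀)) =
      trPV (mulOp (fun x => (W x : ℂ)) ∘L γ) - trPV (mulOp (fun x => (W x : ℂ)) ∘L γ₀) := by
    have h1 := summable_trPV_mulOp hs.periodic11 (isPositive_entry11 hs.nonneg)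
      (integrable_of_weight hm hq) hW hWp'
    have h2 := summable_trPV_mulOp hs0.periodic11 (isPositive_entry11 hs0.nonneg)
      (integrable_of_weight (measurable_diagSym _) hq0') hW hWp'
    rw [e11] at h2
    rw [trPV, trPV, trPV, ← h1.tsum_sub h2]
    congr 1; funext n
    rw [ContinuousLinearMap.comp_sub, sub_apply, inner_sub_right]
  have hre : -‖trPV (mulOp (fun x => (W x : ℂ)) ∘L (γ - γ₀))‖ ≤
      (trPV (mulOp (fun x => (W x : ℂ)) ∘L γ)).re -
        (trPV (mulOp (fun x => (W x : ℂ)) ∘L γ₀)).re := by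
    rw [← Complex.sub_re, ← htr]
    have := Complex.abs_re_le_norm (trPV (mulOp (fun x => (W x : ℂ)) ∘L (γ - γ₀)))
    linarith [neg_abs_le (trPV (mulOp (fun x => (W x : ℂ)) ∘L (γ - γ₀))).re]
  -- The entropy bound, in which the kinetic energy cancels the linear term.
  have hpt : ∀ᵐ ξ : ℝ, K ξ * sqSym (γ - γ₀) ξ + K ξ * sqSym (entry12 Γ) ξ - K ξ * a₀ ξ ^ 2 +
      T / 12 * (devSym Γ ξ - w ξ ^ 2) ^ 2 ≤
      ((h * (2 * π * ξ)) ^ 2 - μ) * dens Γ ξ - ((h * (2 * π * ξ)) ^ 2 - μ) * dens Γ₀ ξ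
        - T * entSym Γ ξ + T * entSym Γ₀ ξ := by
    filter_upwards [entSym_le hs.nonneg hs.le_one hs.periodic,
      entSym_Gamma0 (μ := μ) (h := h) hT hΔ, hs.devSym_eq, hsq, hd0] with ξ f1 f2 f3 f4 f5
    have h1 := f1 _ (gapTanh_mem (μ := μ) (h := h) hT hΔ ξ)
    have h2 := T_mul_artanhRatio (μ := μ) (h := h) hT hΔ ξ
    have h3 := KT_mul_one_sub (μ := μ) (h := h) hT hΔ ξ
    have h4 := gapTanh_sq (μ := μ) (h := h) hT hΔ ξ
    rw [← hw] at h1 h2 h4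
    have h2' : T * artanhRatio (w ξ) = K ξ := h2
    have h3' : K ξ * (1 - 2 * g₀ ξ) = (h * (2 * π * ξ)) ^ 2 - μ := h3
    have h4' : (1 - 2 * g₀ ξ) ^ 2 + 4 * a₀ ξ ^ 2 = w ξ ^ 2 := h4
    rw [f5, f2, ← h3']
    have h5 := mul_le_mul_of_nonneg_left h1 hT.le
    have h6 : devSym Γ ξ - w ξ ^ 2 = 4 * (sqSym (γ - γ₀) ξ - (1 - 2 * g₀ ξ) * (dens Γ ξ - g₀ ξ) +
        sqSym (entry12 Γ) ξ - a₀ ξ ^ 2) := by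
      rw [f3, f4, ← h4']; ring
    have h7 : T * (artanhRatio (w ξ) / 4 * (devSym Γ ξ - w ξ ^ 2)) = K ξ *
        (sqSym (γ - γ₀) ξ - (1 - 2 * g₀ ξ) * (dens Γ ξ - g₀ ξ) +
        sqSym (entry12 Γ) ξ - a₀ ξ ^ 2) := by
      rw [← h2', h6]; ring
    rw [mul_add, h7] at h5
    linarith
  have hI := integral_mono_ae (((hi1.add hi2).sub hi3).add (hR.const_mul (T / 12)))
    (((hk1.sub hk0).sub (hΦ.const_mul T)).add (hΦ0.const_mul T)) hpt
  rw [integral_add' ((hi1.add hi2).sub hi3) (hR.const_mul (T / 12)),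
    integral_sub' (hi1.add hi2) hi3, integral_add' hi1 hi2,
    integral_add' ((hk1.sub hk0).sub (hΦ.const_mul T)) (hΦ0.const_mul T),
    integral_sub' (hk1.sub hk0) (hΦ.const_mul T), integral_sub' hk1 hk0, integral_const_mul,
    integral_const_mul, integral_const_mul] at hI
  simp only [hK] at hI
  have hh2 := mul_le_mul_of_nonneg_left hre (sq_nonneg h)
  linarith

/-! ### Symbols of Hilbert–Schmidt operators -/

/-- Lebesgue measure on the unit cell `[0, 1)`. -/
abbrev cellVol : Measure ℝ := volume.restrict (Ico (0 : ℝ) 1)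

instance : IsProbabilityMeasure cellVol := ⟨by simp⟩

theorem integral_cell_phase (k : ℤ) : ∫ y, phase (k * y) ∂cellVol = if k = 0 then 1 else 0 := by
  split_ifs with hk
  · simp [hk, phase_zero]
  · have h := orthonormal_box.2 (i := ((0 : ℤ), (0 : ℤ))) (j := ((0 : ℤ), k))
      (fun e => hk (by simpa using (congrArg Prod.snd e).symm))
    simp only at h
    rw [inner_box_left] at h
    simp only [Int.cast_zero, zero_add, zero_mul, neg_zero, phase_zero, one_mul] at h
    rw [← h]
    apply setIntegral_congr_ae measurableSet_Ico
    filter_upwards [coeFn_box 0 k] with y e hy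
    rw [e, boxFun, indicator_of_mem]
    simpa using hy

/-- Parseval's identity on the unit cell. -/
theorem hasSum_norm_sq_cell {f : ℝ → ℂ} (hf : MemLp f 2 cellVol) :
    HasSum (fun n : ℤ => ‖∫ y, phase (-(n * y)) * f y ∂cellVol‖ ^ 2) (∫ y, ‖f y‖ ^ 2 ∂cellVol) := by
  have h := hasSum_sq_fourierCoeffOn (zero_lt_one (α := ℝ)) (f := f)
    (by rwa [← restrict_Ico_eq_restrict_Ioc])
  rw [intervalIntegral.integral_of_le zero_le_one, ← restrict_Ico_eq_restrict_Ioc, sub_zero,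
    inv_one, one_smul] at h
  have e : ∀ n : ℤ, fourierCoeffOn (zero_lt_one (α := ℝ)) f n =
      ∫ y, phase (-(n * y)) * f y ∂cellVol := by
    intro n
    rw [fourierCoeffOn_eq_integral, sub_zero, div_one, one_smul,
      intervalIntegral.integral_of_le zero_le_one, ← restrict_Ico_eq_restrict_Ioc]
    congr 1
    funext y
    rw [smul_eq_mul]
    congr 1
    exact fourier_neg_coe_eq_phase rfl n y
  simp_rw [e] at h
  exact h

theorem memLp_cellTensor (n : ℤ) (u : L2) :
    MemLp (fun z : ℝ × ℝ => u z.1 * phase (-(n * z.2))) 2 (volume.prod cellVol) := by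
  have h := (Lp.memLp u).comp_fst cellVol
  refine h.congr_norm (Measurable.aestronglyMeasurable ?_) (.of_forall fun z => ?_)
  · have := measurable_coeFn u
    fun_prop
  · rw [norm_mul, norm_phase, mul_one]

theorem inner_cellTensor (m n : ℤ) (u v : L2) :
    (inner ℂ ((memLp_cellTensor m u).toLp _) ((memLp_cellTensor n v).toLp _) : ℂ) =
      if m = n then inner ℂ u v else 0 := by
  rw [L2.inner_def, L2.inner_def]
  have e : ∀ᵐ z ∂(volume.prod cellVol), (inner ℂ ((memLp_cellTensor m u).toLp _ z)
      ((memLp_cellTensor n v).toLp _ z) : ℂ) =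
      (inner ℂ (u z.1) (v z.1) : ℂ) * phase ((m - n : ℤ) * z.2) := by
    filter_upwards [(memLp_cellTensor m u).coeFn_toLp, (memLp_cellTensor n v).coeFn_toLp]
      with z h1 h2
    rw [h1, h2]
    simp only [RCLike.inner_apply, map_mul, conj_phase]
    rw [show ((m - n : ℤ) : ℝ) * z.2 = -(n * z.2) + -(-(m * z.2)) by push_cast; ring, phase_add]
    ring
  rw [integral_congr_ae e, integral_prod_mul (fun x => (inner ℂ (u x) (v x) : ℂ))
    (fun y => phase ((m - n : ℤ) * y)), integral_cell_phase]
  split_ifs with h1 h2 h2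
  · rw [mul_one]
  · omega
  · omega
  · rw [mul_zero]

/-- The isometric embedding `u ↦ u(ξ) e^{-2πiny}` of `L²(ℝ)` into `L²(ℝ × [0, 1))`. -/
def cellTensor (n : ℤ) : L2 →ₗᵢ[ℂ] Lp ℂ 2 ((volume : Measure ℝ).prod cellVol) :=
  LinearMap.isometryOfInner
    { toFun := fun u => (memLp_cellTensor n u).toLp _
      map_add' := fun u v => by
        rw [← MemLp.toLp_add]
        apply MemLp.toLp_congr
        filter_upwards [measurePreserving_fst.quasiMeasurePreserving.ae (Lp.coeFn_add u v)] with z h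
        rw [h, Pi.add_apply, Pi.add_apply, add_mul]
      map_smul' := fun c u => by
        rw [RingHom.id_apply, ← MemLp.toLp_const_smul]
        apply MemLp.toLp_congr
        filter_upwards [measurePreserving_fst.quasiMeasurePreserving.ae (Lp.coeFn_smul c u)]
          with z h
        rw [h, Pi.smul_apply, Pi.smul_apply, smul_mul_assoc] }
    (fun u v => (inner_cellTensor n n u v).trans (if_pos rfl))

theorem orthogonalFamily_cellTensor : OrthogonalFamily ℂ (fun _ : ℤ => L2) cellTensor :=
  fun m n hmn u v => (inner_cellTensor m n u v).trans (if_neg hmn)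

/-- `B(ξ, y)` is the symbol of the operator `A`: for `y ∈ [0, 1)` it is the partial Fourier
transform, in the first variable, of the integral kernel of `A`. For periodic `A`, the action on the
functions supported in the cell determines `A`. -/
structure IsSymbol (A : Op) (B : ℝ → ℝ → ℂ) : Prop where
  measurable : Measurable (Function.uncurry B)
  memLp : ∀ᵐ ξ : ℝ, MemLp (B ξ) 2 cellVol
  coeff : ∀ n : ℤ, ∀ᵐ ξ : ℝ, FT (A (cellBasis n)) ξ = ∫ y, phase (n * y) * B ξ y ∂cellVol

theorem IsSymbol.hasSum_cell {A : Op} {B : ℝ → ℝ → ℂ} (hB : IsSymbol A B) :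
    ∀ᵐ ξ : ℝ, HasSum (fun n => ‖FT (A (cellBasis n)) ξ‖ ^ 2) (∫ y, ‖B ξ y‖ ^ 2 ∂cellVol) := by
  filter_upwards [hB.memLp, ae_all_iff.2 hB.coeff] with ξ h1 h2
  have h3 := hasSum_norm_sq_cell h1
  rw [← (Equiv.neg ℤ).hasSum_iff] at h3
  have e : (fun n => ‖FT (A (cellBasis n)) ξ‖ ^ 2) =
      (fun n : ℤ => ‖∫ y, phase (-(n * y)) * B ξ y ∂cellVol‖ ^ 2) ∘ Equiv.neg ℤ := by
    funext n
    simp only [Function.comp_apply, Equiv.neg_apply, h2, Int.cast_neg, neg_mul, neg_neg]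
  rw [e]
  exact h3

theorem IsSymbol.integral_norm_sq {A : Op} (hA : IsPeriodicOp A) {B : ℝ → ℝ → ℂ}
    (hB : IsSymbol A B) : ∀ᵐ ξ : ℝ, ∫ y, ‖B ξ y‖ ^ 2 ∂cellVol = sqSym A ξ := by
  filter_upwards [hB.hasSum_cell, tsum_enorm_FT_cell hA, sqSym_nonneg hA] with ξ h1 h2 h3
  have h4 : ∑' n, ‖FT (A (cellBasis n)) ξ‖ₑ ^ 2 =
      ENNReal.ofReal (∑' n, ‖FT (A (cellBasis n)) ξ‖ ^ 2) := by
    rw [ENNReal.ofReal_tsum_of_nonneg (fun n => by positivity) h1.summable]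
    congr 1; funext n
    rw [ENNReal.ofReal_pow (norm_nonneg _), ofReal_norm]
  rw [h4, h1.tsum_eq] at h2
  exact (ENNReal.ofReal_eq_ofReal_iff (integral_nonneg fun y => by positivity) h3).1 h2

/-- The Fourier coefficients, in the centre-of-mass variable, of a symbol. -/
def symCoef (B : ℝ → ℝ → ℂ) (m : ℤ) (ξ : ℝ) : ℂ := ∫ y, phase ((ξ - m) * y) * B ξ y ∂cellVol

theorem measurable_symCoef {B : ℝ → ℝ → ℂ} (hB : Measurable (Function.uncurry B)) (m : ℤ) :
    Measurable (symCoef B m) := by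
  have h : StronglyMeasurable (Function.uncurry fun ξ y => phase ((ξ - m) * y) * B ξ y) := by
    refine Measurable.stronglyMeasurable (Measurable.mul (f := fun z : ℝ × ℝ =>
      phase ((z.1 - m) * z.2)) (by fun_prop) hB)
  exact h.integral_prod_right.measurable

theorem IsSymbol.hasSum_symCoef {A : Op} (hA : IsPeriodicOp A) {B : ℝ → ℝ → ℂ}
    (hB : IsSymbol A B) : ∀ᵐ ξ : ℝ, HasSum (fun m => ‖symCoef B m ξ‖ ^ 2) (sqSym A ξ) := by
  filter_upwards [hB.memLp, hB.integral_norm_sq hA] with ξ h1 h2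
  have h3 : MemLp (fun y => phase (ξ * y) * B ξ y) 2 cellVol := by
    refine h1.congr_norm ((by fun_prop : Measurable fun y => phase (ξ * y)).aestronglyMeasurable.mul
      h1.1) (.of_forall fun y => ?_)
    rw [norm_mul, norm_phase, one_mul]
  have h4 := hasSum_norm_sq_cell h3
  have e1 : ∀ m : ℤ, ∫ y, phase (-(m * y)) * (phase (ξ * y) * B ξ y) ∂cellVol = symCoef B m ξ := by
    intro m
    rw [symCoef]
    congr 1; funext y
    rw [← mul_assoc, ← phase_add]
    congr 2; ring
  simp_rw [e1, norm_mul, norm_phase, one_mul, h2] at h4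
  exact h4

/-- Every periodic operator of finite Hilbert–Schmidt norm per unit volume has a symbol. -/
theorem exists_isSymbol {A : Op} (hA : IsPeriodicOp A) (hi : Integrable (sqSym A)) :
    ∃ B, IsSymbol A B := by
  have hsum : Summable fun n => ‖FT (A (cellBasis n))‖ ^ 2 := by
    simp_rw [LinearIsometryEquiv.norm_map]
    apply summable_norm_sq_of_tsum_ne_top
    rw [tsum_enorm_cell_eq_lintegral hA]
    exact lintegral_ofReal_ne_top hi
  set F := ∑' n, cellTensor n (FT (A (cellBasis n))) with hF
  have hFs : HasSum (fun n => cellTensor n (FT (A (cellBasis n)))) F :=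
    ((orthogonalFamily_cellTensor.summable_iff_norm_sq_summable _).2 hsum).hasSum
  have hm : Measurable (F : ℝ × ℝ → ℂ) := (Lp.stronglyMeasurable F).measurable
  have hsq : Integrable (fun z => ‖F z‖ ^ 2) ((volume : Measure ℝ).prod cellVol) :=
    (memLp_two_iff_integrable_sq_norm hm.aestronglyMeasurable).1 (Lp.memLp F)
  refine ⟨fun ξ y => F (ξ, y), hm, ?_, fun n => ?_⟩
  · filter_upwards [hsq.prod_right_ae] with ξ h
    exact (memLp_two_iff_integrable_sq_norm (hm.comp (by fun_prop)).aestronglyMeasurable).2 h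
  have hloc : ∀ s : Set ℝ, MeasurableSet s → volume s < ∞ →
      Integrable (fun z : ℝ × ℝ => phase (n * z.2) * F z) ((volume.restrict s).prod cellVol) := by
    intro s hs hfin
    have : IsFiniteMeasure ((volume : Measure ℝ).restrict s) := ⟨by simpa using hfin⟩
    have h1 : MemLp (F : ℝ × ℝ → ℂ) 2 ((volume.restrict s).prod cellVol) := by
      refine (Lp.memLp F).mono_measure ?_
      exact Measure.prod_mono Measure.restrict_le_self le_rfl
    refine (h1.integrable one_le_two).norm.mono' ?_ (.of_forall fun z => ?_)
    · exact ((by fun_prop : Measurable fun z : ℝ × ℝ => phase (n * z.2)).mul hm).aestronglyMeasurable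
    · rw [norm_mul, norm_phase, one_mul]
  apply ae_eq_of_forall_setIntegral_eq_of_sigmaFinite
  · intro s hs hfin
    have : IsFiniteMeasure ((volume : Measure ℝ).restrict s) := ⟨by simpa using hfin⟩
    exact ((Lp.memLp (FT (A (cellBasis n)))).restrict s).integrable one_le_two
  · intro s hs hfin
    exact (hloc s hs hfin).integral_prod_left
  · intro s hs hfin
    set g : L2 := indicatorConstLp 2 hs hfin.ne (1 : ℂ) with hg
    have h1 : (inner ℂ (cellTensor n g) F : ℂ) = inner ℂ g (FT (A (cellBasis n))) := by
      have h2 := hFs.mapL (innerSL ℂ (cellTensor n g))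
      have h3 : ∀ k, innerSL ℂ (cellTensor n g) (cellTensor k (FT (A (cellBasis k)))) =
          if k = n then inner ℂ g (FT (A (cellBasis n))) else 0 := by
        intro k
        rw [innerSL_apply_apply]
        refine (inner_cellTensor n k g _).trans ?_
        by_cases h : k = n
        · subst h; simp
        · rw [if_neg h, if_neg (Ne.symm h)]
      simp_rw [h3] at h2
      exact h2.unique (hasSum_ite_eq n _)
    rw [L2.inner_indicatorConstLp_one hs hfin.ne] at h1
    have h4 : ∫ ξ in s, ∫ y, phase (n * y) * F (ξ, y) ∂cellVol =
        ∫ z, phase (n * z.2) * F z ∂((volume.restrict s).prod cellVol) :=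
      (integral_prod _ (hloc s hs hfin)).symm
    have h5 : ((volume : Measure ℝ).restrict s).prod cellVol =
        ((volume : Measure ℝ).prod cellVol).restrict (s ×ˢ Set.univ) := by
      rw [← Measure.prod_restrict, Measure.restrict_univ]
    rw [← h1, h4, h5, L2.inner_def, ← integral_indicator (hs.prod MeasurableSet.univ)]
    apply integral_congr_ae
    have h6 : (cellTensor n g : ℝ × ℝ → ℂ) =ᵐ[(volume : Measure ℝ).prod cellVol]
        fun z => g z.1 * phase (-(n * z.2)) := (memLp_cellTensor n g).coeFn_toLp
    have h7 : (g : ℝ → ℂ) =ᵐ[volume] s.indicator fun _ => (1 : ℂ) := indicatorConstLp_coeFn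
    filter_upwards [h6, measurePreserving_fst.quasiMeasurePreserving.ae h7] with z e1 e2
    rw [e1, e2]
    simp only [RCLike.inner_apply, map_mul, conj_phase, neg_neg]
    by_cases hz : z.1 ∈ s
    · rw [indicator_of_mem hz, indicator_of_mem (by simpa using hz), map_one]; ring
    · rw [indicator_of_notMem hz, indicator_of_notMem (by simpa using hz), map_zero]; ring

/-! ### Integral kernels -/

/-- On `L¹ ∩ L²` the inverse Fourier transform is given by the inverse Fourier integral. -/
theorem coeFn_FT_symm_toLp {f : ℝ → ℂ} (h2 : MemLp f 2) (h1 : Integrable f) :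
    FT.symm (h2.toLp f) =ᵐ[volume] fun x => ∫ ξ, phase (ξ * x) * f ξ := by
  have hf : Integrable (h2.toLp f : ℝ → ℂ) := h1.congr h2.coeFn_toLp.symm
  set F : L2 := h2.toLp f with hF
  have hcont : Continuous (𝓕⁻ (F : ℝ → ℂ)) :=
    VectorFourier.fourierIntegral_continuous Real.continuous_fourierChar
      (L := -innerₗ ℝ) (by exact continuous_inner.neg) hf
  have key : FT.symm F =ᵐ[volume] 𝓕⁻ (F : ℝ → ℂ) := by
    apply ae_eq_of_integral_contDiff_smul_eq
    · exact (Lp.memLp (FT.symm F)).locallyIntegrable (by norm_num)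
    · exact hcont.locallyIntegrable
    intro g hg hgc
    have hg' : ContDiff ℝ (⊤ : ℕ∞) (fun x => (g x : ℂ)) := Complex.ofRealCLM.contDiff.comp hg
    have hgc' : HasCompactSupport (fun x => (g x : ℂ)) :=
      hgc.comp_left (g := fun r : ℝ => (r : ℂ)) (by simp)
    set φ : SchwartzMap ℝ ℂ := hgc'.toSchwartzMap hg' with hφ
    have hφx : ∀ x, φ x = (g x : ℂ) := fun x => rfl
    have h1 := congrArg (fun T => T φ) (Lp.fourierInv_toTemperedDistribution_eq F)
    simp only [TemperedDistribution.fourierInv_apply, Lp.toTemperedDistribution_apply] at h1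
    have h2 : ∫ x, g x • (FT.symm F) x = ∫ x, φ x • ((𝓕⁻ F : L2) x) := by
      apply integral_congr_ae; filter_upwards with x; rw [hφx, Complex.coe_smul]; rfl
    have h3 : ∫ x, g x • 𝓕⁻ (F : ℝ → ℂ) x = ∫ x, φ x • 𝓕⁻ (F : ℝ → ℂ) x := by
      apply integral_congr_ae; filter_upwards with x; rw [hφx, Complex.coe_smul]
    rw [h2, h3, ← h1]
    have h4 := VectorFourier.integral_fourierIntegral_smul_eq_flip (e := Real.fourierChar)
      (μ := volume) (ν := volume) (L := -innerₗ ℝ)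
      Real.continuous_fourierChar (by exact continuous_inner.neg) φ.integrable hf
    have h5 : (-innerₗ ℝ : ℝ →ₗ[ℝ] ℝ →ₗ[ℝ] ℝ).flip = -innerₗ ℝ := by
      ext; simp
    rw [h5] at h4
    simp only [SchwartzMap.fourierInv_coe]
    exact h4
  filter_upwards [key] with x hx
  rw [hx, Real.fourierInv_congr_ae h2.coeFn_toLp, Real.fourierInv_eq]
  congr 1; funext ξ
  rw [Circle.smul_def, smul_eq_mul, Real.fourierChar_apply, phase]
  congr 3
  simp [mul_comm]

theorem lintegral_eq_tsum_cell (f : ℝ → ℝ≥0∞) :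
    ∫⁻ x, f x = ∑' j : ℤ, ∫⁻ u, f (u + j) ∂cellVol := by
  have h1 : ∀ j : ℤ, ∫⁻ u, f (u + j) ∂cellVol = ∫⁻ x in Ico (j : ℝ) (j + 1), f x := by
    intro j
    have hm := measurePreserving_add_right (volume : Measure ℝ) (j : ℝ)
    have he : MeasurableEmbedding fun x : ℝ => x + j := measurableEmbedding_addRight (j : ℝ)
    rw [← hm.setLIntegral_comp_preimage_emb he f (Ico (j : ℝ) (j + 1))]
    simp
  simp_rw [h1]
  rw [← lintegral_iUnion (fun j : ℤ => measurableSet_Ico) (Set.pairwise_disjoint_Ico_intCast ℝ),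
    iUnion_Ico_intCast, Measure.restrict_univ]

theorem ae_fract {P : ℝ → Prop} (h : ∀ᵐ y ∂cellVol, P y) : ∀ᵐ y : ℝ, P (Int.fract y) := by
  have h1 : ∀ j : ℤ, ∀ᵐ y : ℝ, y - j ∈ Ico (0 : ℝ) 1 → P (y - j) := fun j =>
    (measurePreserving_sub_right volume (j : ℝ)).quasiMeasurePreserving.ae
      ((ae_restrict_iff' measurableSet_Ico).1 h)
  filter_upwards [ae_floor h1] with y hy
  exact hy ⟨Int.fract_nonneg y, Int.fract_lt_one y⟩

/-- A kernel with square integrable rows that acts correctly on the basis is an integral kernel. -/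
theorem isKernel_of_box {A : Op} {k : ℝ → ℝ → ℂ} (hk : Measurable (Function.uncurry k))
    (h2 : ∀ᵐ x : ℝ, MemLp (k x) 2)
    (hbox : ∀ j l, ∀ᵐ x : ℝ, A (box j l) x = ∫ y, k x y * box j l y) : IsKernel A k := by
  have hint : ∀ {x : ℝ}, MemLp (k x) 2 → ∀ f : L2, Integrable fun y => k x y * f y :=
    fun hx f => hx.integrable_mul (Lp.memLp f)
  refine ⟨hk.aestronglyMeasurable, ?_⟩
  suffices H : ∀ f : L2, ∀ᵐ x : ℝ, A f x = ∫ y, k x y * f y by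
    intro f
    filter_upwards [h2, H f] with x h3 h4 using ⟨hint h3 f, h4⟩
  set S : Submodule ℂ L2 :=
    { carrier := {f | ∀ᵐ x : ℝ, A f x = ∫ y, k x y * f y}
      add_mem' := fun {f g} hf hg => by
        simp only [Set.mem_ofPred_eq] at hf hg ⊢
        filter_upwards [h2, hf, hg, Lp.coeFn_add (A f) (A g)] with x h3 h4 h5 h6
        rw [map_add, h6, Pi.add_apply, h4, h5, ← integral_add (hint h3 f) (hint h3 g)]
        apply integral_congr_ae
        filter_upwards [Lp.coeFn_add f g] with y h7
        rw [h7, Pi.add_apply, mul_add]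
      zero_mem' := by
        simp only [Set.mem_ofPred_eq, map_zero]
        filter_upwards [Lp.coeFn_zero ℂ 2 (volume : Measure ℝ)] with x h
        rw [h, Pi.zero_apply, eq_comm]
        apply integral_eq_zero_of_ae
        filter_upwards [] with y
        simp
      smul_mem' := fun c f hf => by
        simp only [Set.mem_ofPred_eq] at hf ⊢
        filter_upwards [hf, Lp.coeFn_smul c (A f)] with x h4 h6
        rw [map_smul, h6, Pi.smul_apply, h4, smul_eq_mul, ← integral_const_mul]
        apply integral_congr_ae
        filter_upwards [Lp.coeFn_smul c f] with y h7
        rw [h7, Pi.smul_apply, smul_eq_mul]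
        ring } with hS
  have hspan : Submodule.span ℂ (Set.range boxBasis) ≤ S := by
    rw [Submodule.span_le]
    rintro _ ⟨p, rfl⟩
    rw [boxBasis_apply]
    exact hbox p.1 p.2
  intro f
  have hf : f ∈ closure (Submodule.span ℂ (Set.range boxBasis) : Set L2) := by
    rw [← Submodule.topologicalClosure_coe, boxBasis.dense_span]; trivial
  obtain ⟨u, hu, hlim⟩ := mem_closure_iff_seq_limit.1 hf
  have hA : Filter.Tendsto (fun n => A (u n)) Filter.atTop (nhds (A f)) :=
    (A.continuous.tendsto f).comp hlim
  obtain ⟨ns, hns, hae⟩ := (tendstoInMeasure_of_tendsto_Lp hA).exists_seq_tendsto_ae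
  have hall : ∀ᵐ x : ℝ, ∀ n, A (u n) x = ∫ y, k x y * u n y := ae_all_iff.2 fun n => hspan (hu n)
  filter_upwards [hae, hall, h2] with x h3 h4 h5
  have hstar : MemLp (fun y => conj (k x y)) 2 := h5.star
  set g : L2 := hstar.toLp _ with hg
  have hin : ∀ v : L2, (inner ℂ g v : ℂ) = ∫ y, k x y * v y := by
    intro v
    rw [L2.inner_def]
    apply integral_congr_ae
    filter_upwards [hstar.coeFn_toLp] with y hy
    rw [RCLike.inner_apply, hg, hy, Complex.conj_conj, mul_comm]
  have hlim2 : Filter.Tendsto (fun n => (inner ℂ g (u (ns n)) : ℂ)) Filter.atTop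
      (nhds (inner ℂ g f)) :=
    ((continuous_const.inner continuous_id).tendsto f).comp (hlim.comp hns.tendsto_atTop)
  rw [← hin f]
  refine tendsto_nhds_unique ?_ hlim2
  simpa only [hin, ← h4] using h3

theorem ae_eq_zero_of_integral_rat {g : ℝ → ℂ} (hg : LocallyIntegrable g)
    (h : ∀ q : ℚ, ∫ y in (0 : ℝ)..q, g y = 0) : ∀ᵐ y : ℝ, g y = 0 := by
  have hcont : Continuous fun x => ∫ y in (0 : ℝ)..x, g y :=
    intervalIntegral.continuous_primitive (fun a b =>
      (hg.integrableOn_isCompact isCompact_uIcc).intervalIntegrable) 0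
  have hz : (fun x => ∫ y in (0 : ℝ)..x, g y) = fun _ => 0 := by
    refine Rat.isDenseEmbedding_coe_real.dense.equalizer hcont continuous_const ?_
    funext q
    exact h q
  filter_upwards [_root_.LocallyIntegrable.ae_hasDerivAt_integral hg] with y hy
  have h1 := hy 0
  rw [hz] at h1
  exact h1.unique (hasDerivAt_const y 0)

/-- An operator has at most one integral kernel. -/
theorem IsKernel.ae_eq {A : Op} {k k' : ℝ → ℝ → ℂ} (hk : IsKernel A k) (hk' : IsKernel A k') :
    ∀ᵐ y : ℝ, ∀ᵐ x : ℝ, k x y = k' x y := by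
  set S : ℚ → L2 := fun q => indicatorConstLp 2 (measurableSet_uIoc (a := (0 : ℝ)) (b := q))
    (by simp [Set.uIoc]) (1 : ℂ) with hS
  have h1 : ∀ᵐ x : ℝ, ∀ q, (Integrable fun y => k x y * S q y) ∧ A (S q) x = ∫ y, k x y * S q y :=
    ae_all_iff.2 fun q => hk.2 (S q)
  have h2 : ∀ᵐ x : ℝ, ∀ q,
      (Integrable fun y => k' x y * S q y) ∧ A (S q) x = ∫ y, k' x y * S q y :=
    ae_all_iff.2 fun q => hk'.2 (S q)
  have hSq : ∀ (q : ℚ) (g : ℝ → ℂ), (fun y => g y * S q y) =ᵐ[volume]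
      (Set.uIoc (0 : ℝ) q).indicator g := by
    intro q g
    filter_upwards [indicatorConstLp_coeFn (p := 2) (hs := measurableSet_uIoc (a := (0 : ℝ))
      (b := q)) (hμs := by simp [Set.uIoc]) (c := (1 : ℂ))] with y hy
    rw [hS]
    simp only [hy]
    by_cases hm : y ∈ Set.uIoc (0 : ℝ) q
    · rw [indicator_of_mem hm, indicator_of_mem hm, mul_one]
    · rw [indicator_of_notMem hm, indicator_of_notMem hm, mul_zero]
  have h3 : ∀ᵐ x : ℝ, ∀ᵐ y : ℝ, k x y - k' x y = 0 := by
    filter_upwards [h1, h2] with x hx hx'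
    have hi : ∀ q, Integrable ((Set.uIoc (0 : ℝ) (q : ℚ)).indicator fun y => k x y - k' x y) := by
      intro q
      refine Integrable.congr ((hx q).1.sub (hx' q).1) ?_
      filter_upwards [hSq q (fun y => k x y - k' x y)] with y hy
      rw [← hy, Pi.sub_apply, sub_mul]
    apply ae_eq_zero_of_integral_rat
    · rw [locallyIntegrable_iff]
      intro K hK
      obtain ⟨R, hR⟩ := hK.isBounded.subset_closedBall 0
      obtain ⟨N, hN⟩ := exists_nat_gt R
      have h4 := (integrable_indicator_iff measurableSet_uIoc).1 (hi N)
      have h5 := (integrable_indicator_iff measurableSet_uIoc).1 (hi (-N - 1))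
      refine (h4.union h5).mono_set fun y hy => ?_
      have := hR hy
      rw [Metric.mem_closedBall, dist_zero_right, Real.norm_eq_abs, abs_le] at this
      rcases lt_or_ge 0 y with h0 | h0
      · left
        rw [Set.mem_uIoc]; left; constructor
        · exact h0
        · push_cast; linarith
      · right
        rw [Set.mem_uIoc]; right; constructor
        · push_cast; linarith
        · exact h0
    · intro q
      have h6 : ∫ y, (Set.uIoc (0 : ℝ) q).indicator (fun y => k x y - k' x y) y = 0 := by
        rw [← integral_congr_ae (hSq q _)]
        simp_rw [sub_mul]
        rw [integral_sub (hx q).1 (hx' q).1, ← (hx q).2, ← (hx' q).2, sub_self]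
      rw [integral_indicator measurableSet_uIoc] at h6
      rw [intervalIntegral.intervalIntegral_eq_integral_uIoc, h6, smul_zero]
  have hm : AEStronglyMeasurable (fun z : ℝ × ℝ => k z.1 z.2 - k' z.1 z.2)
      ((volume : Measure ℝ).prod volume) := hk.1.sub hk'.1
  have h4 : ∀ᵐ z ∂((volume : Measure ℝ).prod volume), k z.1 z.2 - k' z.1 z.2 = 0 := by
    have h5 : ∀ᵐ z ∂((volume : Measure ℝ).prod volume), hm.mk _ z = 0 := by
      refine (Measure.ae_prod_iff_ae_ae (hm.stronglyMeasurable_mk.measurable (measurableSet_singleton 0))).2 ?_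
      filter_upwards [h3, Measure.ae_ae_of_ae_prod hm.ae_eq_mk] with x e1 e2
      filter_upwards [e1, e2] with y e3 e4
      exact e4.symm.trans e3
    filter_upwards [h5, hm.ae_eq_mk] with z e1 e2
    rw [e2, e1]
  have h5 := (Measure.measurePreserving_swap (μ := (volume : Measure ℝ))
    (ν := (volume : Measure ℝ))).quasiMeasurePreserving.ae h4
  filter_upwards [Measure.ae_ae_of_ae_prod h5] with y hy
  filter_upwards [hy] with x hx
  exact sub_eq_zero.1 hx

/-- For a function invariant under joint integer translations, integrating the second variable
over the line and the first over the cell is the same as doing so the other way round. -/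
theorem lintegral_cell_swap {φ : ℝ → ℝ → ℝ≥0∞} (hφ : Measurable fun z : ℝ × ℝ => φ z.1 z.2)
    (hp : ∀ (x y : ℝ) (j : ℤ), φ (x + j) (y + j) = φ x y) :
    ∫⁻ x, (∫⁻ y, φ x y) ∂cellVol = ∫⁻ u, (∫⁻ x, φ x u) ∂cellVol := by
  have h1 : ∀ x, ∫⁻ y, φ x y = ∑' j : ℤ, ∫⁻ u, φ x (u + j) ∂cellVol := fun x =>
    lintegral_eq_tsum_cell (φ x)
  have h2 : ∀ u, ∫⁻ x, φ x u = ∑' j : ℤ, ∫⁻ x, φ (x + j) u ∂cellVol := fun u =>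
    lintegral_eq_tsum_cell fun x => φ x u
  simp_rw [h1, h2]
  rw [lintegral_tsum, lintegral_tsum, ← (Equiv.neg ℤ).tsum_eq]
  · congr 1; funext j
    rw [lintegral_lintegral_swap]
    · congr 1; funext u
      congr 1; funext x
      rw [← hp x _ j]
      simp
    · exact (hφ.comp (by fun_prop : Measurable fun z : ℝ × ℝ =>
        (z.1, z.2 + ((Equiv.neg ℤ j : ℤ) : ℝ)))).aemeasurable
  · intro j
    exact (Measurable.lintegral_prod_right' (f := fun z : ℝ × ℝ => φ (z.2 + j) z.1)
      (hφ.comp (by fun_prop : Measurable fun z : ℝ × ℝ => (z.2 + j, z.1)))).aemeasurable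
  · intro j
    exact (Measurable.lintegral_prod_right' (f := fun z : ℝ × ℝ => φ z.1 (z.2 + j))
      (hφ.comp (by fun_prop : Measurable fun z : ℝ × ℝ => (z.1, z.2 + j)))).aemeasurable

/-! ### The kernel of an operator with a symbol -/

section Kernel

variable {A : Op} {B : ℝ → ℝ → ℂ} {h : ℝ}

theorem IsSymbol.integrable_weight_sq (hA : IsPeriodicOp A) (hB : IsSymbol A B)
    (hi : Integrable fun ξ => weight h ξ * sqSym A ξ) :
    Integrable (fun z : ℝ × ℝ => weight h z.1 * ‖B z.1 z.2‖ ^ 2) (volume.prod cellVol) := by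
  have hm : Measurable (fun z : ℝ × ℝ => B z.1 z.2) := hB.measurable
  have hm2 : Measurable (fun z : ℝ × ℝ => weight h z.1 * ‖B z.1 z.2‖ ^ 2) :=
    ((continuous_weight h).measurable.comp measurable_fst).mul (hm.norm.pow_const 2)
  rw [integrable_prod_iff hm2.aestronglyMeasurable]
  constructor
  · filter_upwards [hB.memLp] with ξ h1
    exact ((memLp_two_iff_integrable_sq_norm h1.1).1 h1).const_mul _
  · refine hi.congr ?_
    filter_upwards [hB.integral_norm_sq hA] with ξ h1
    rw [← h1, ← integral_const_mul]
    congr 1; funext y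
    rw [Real.norm_of_nonneg (mul_nonneg (weight_pos h ξ).le (by positivity))]

theorem IsSymbol.integrable_sq (hA : IsPeriodicOp A) (hB : IsSymbol A B)
    (hi : Integrable fun ξ => weight h ξ * sqSym A ξ) :
    Integrable (fun z : ℝ × ℝ => ‖B z.1 z.2‖ ^ 2) (volume.prod cellVol) := by
  have hm : Measurable (fun z : ℝ × ℝ => B z.1 z.2) := hB.measurable
  refine (hB.integrable_weight_sq hA hi).mono' (hm.norm.pow_const 2).aestronglyMeasurable
    (.of_forall fun z => ?_)
  rw [Real.norm_of_nonneg (by positivity)]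
  exact le_mul_of_one_le_left (by positivity) (one_le_weight h z.1)

theorem IsSymbol.integrable (hh : 0 < h) (hA : IsPeriodicOp A) (hB : IsSymbol A B)
    (hi : Integrable fun ξ => weight h ξ * sqSym A ξ) :
    Integrable (fun z : ℝ × ℝ => B z.1 z.2) (volume.prod cellVol) := by
  have hm : Measurable (fun z : ℝ × ℝ => B z.1 z.2) := hB.measurable
  refine (((integrable_inv_weight hh).comp_fst cellVol).add
    (hB.integrable_weight_sq hA hi)).mono' hm.aestronglyMeasurable
    (.of_forall fun z => ?_)
  simp only [Pi.add_apply]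
  have hw := weight_pos h z.1
  have h1 : ‖B z.1 z.2‖ = (weight h z.1)⁻¹ * (weight h z.1 * ‖B z.1 z.2‖) := by
    rw [inv_mul_cancel_left₀ hw.ne']
  have h2 : weight h z.1 * ‖B z.1 z.2‖ ^ 2 =
      (weight h z.1)⁻¹ * (weight h z.1 * ‖B z.1 z.2‖) ^ 2 := by
    field_simp
  have h3 : 0 ≤ (weight h z.1)⁻¹ * (1 + (weight h z.1 * ‖B z.1 z.2‖) ^ 2 -
      weight h z.1 * ‖B z.1 z.2‖) :=
    mul_nonneg (inv_pos.2 hw).le (by nlinarith [sq_nonneg (weight h z.1 * ‖B z.1 z.2‖ - 1)])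
  rw [mul_sub, mul_add, mul_one, ← h2, ← h1] at h3
  linarith

theorem IsSymbol.ae_memLp (hh : 0 < h) (hA : IsPeriodicOp A) (hB : IsSymbol A B)
    (hi : Integrable fun ξ => weight h ξ * sqSym A ξ) :
    ∀ᵐ y ∂cellVol, Integrable (fun ξ => B ξ y) ∧ MemLp (fun ξ => B ξ y) 2 := by
  filter_upwards [(hB.integrable hh hA hi).prod_left_ae, (hB.integrable_sq hA hi).prod_left_ae]
    with y h1 h2
  exact ⟨h1, (memLp_two_iff_integrable_sq_norm h1.1).2 h2⟩

/-- The integral kernel of the operator with symbol `B`. -/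
def cellKernel (B : ℝ → ℝ → ℂ) (x y : ℝ) : ℂ :=
  ∫ ξ, phase (ξ * (x - ⌊y⌋)) * B ξ (Int.fract y)

theorem cellKernel_add_int (B : ℝ → ℝ → ℂ) (x y : ℝ) (j : ℤ) :
    cellKernel B (x + j) (y + j) = cellKernel B x y := by
  simp only [cellKernel, Int.floor_add_intCast, Int.fract_add_intCast]
  congr 1; funext ξ; congr 3; push_cast; ring

theorem measurable_cellKernel (hB : Measurable (Function.uncurry B)) :
    Measurable (Function.uncurry (cellKernel B)) := by
  have h1 : Measurable fun w : (ℝ × ℝ) × ℝ =>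
      phase (w.2 * (w.1.1 - ⌊w.1.2⌋)) * B w.2 (Int.fract w.1.2) := by
    refine Measurable.mul (by fun_prop) (hB.comp (f := fun w : (ℝ × ℝ) × ℝ =>
      (w.2, Int.fract w.1.2)) (by fun_prop))
  exact h1.stronglyMeasurable.integral_prod_right'.measurable

theorem cellKernel_eq {y : ℝ} (hy : y ∈ Ico (0 : ℝ) 1) (x : ℝ) :
    cellKernel B x y = ∫ ξ, phase (ξ * x) * B ξ y := by
  have h1 : ⌊y⌋ = 0 := Int.floor_eq_zero_iff.2 hy
  simp only [cellKernel, Int.fract_eq_self.2 hy, h1, Int.cast_zero, sub_zero]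

theorem IsSymbol.continuous_cellKernel (hh : 0 < h) (hA : IsPeriodicOp A) (hB : IsSymbol A B)
    (hi : Integrable fun ξ => weight h ξ * sqSym A ξ) :
    ∀ᵐ y : ℝ, Continuous fun x => cellKernel B x y := by
  filter_upwards [ae_fract (hB.ae_memLp hh hA hi)] with y hy
  refine continuous_of_dominated (bound := fun ξ => ‖B ξ (Int.fract y)‖) (fun x => ?_) (fun x => ?_)
    hy.1.norm (.of_forall fun ξ => ?_)
  · exact ((by fun_prop : Measurable fun ξ : ℝ => phase (ξ * (x - ⌊y⌋))).aestronglyMeasurable).mul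
      hy.1.1
  · refine .of_forall fun ξ => ?_
    rw [norm_mul, norm_phase, one_mul]
  · have := continuous_phase
    fun_prop

/-- Plancherel's identity for the columns of the kernel. -/
theorem IsSymbol.lintegral_cellKernel (hh : 0 < h) (hA : IsPeriodicOp A) (hB : IsSymbol A B)
    (hi : Integrable fun ξ => weight h ξ * sqSym A ξ) :
    ∀ᵐ y ∂cellVol, ∫⁻ x, ‖cellKernel B x y‖ₑ ^ 2 = ∫⁻ ξ, ‖B ξ y‖ₑ ^ 2 := by
  filter_upwards [hB.ae_memLp hh hA hi, ae_restrict_mem measurableSet_Ico] with y hy hm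
  have h1 : ∫⁻ x, ‖cellKernel B x y‖ₑ ^ 2 = ∫⁻ x, ‖FT.symm (hy.2.toLp _) x‖ₑ ^ 2 := by
    apply lintegral_congr_ae
    filter_upwards [coeFn_FT_symm_toLp hy.2 hy.1] with x hx
    rw [hx, cellKernel_eq hm]
  rw [h1, ← enorm_sq_eq_lintegral]
  have h2 : ‖FT.symm (hy.2.toLp _)‖ₑ = ‖(hy.2.toLp _ : L2)‖ₑ := by
    rw [← ofReal_norm, ← ofReal_norm, LinearIsometryEquiv.norm_map]
  rw [h2, enorm_sq_eq_lintegral]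
  apply lintegral_congr_ae
  filter_upwards [hy.2.coeFn_toLp] with ξ hξ
  rw [hξ]

theorem IsSymbol.memLp_cellKernel (hh : 0 < h) (hA : IsPeriodicOp A) (hB : IsSymbol A B)
    (hi : Integrable fun ξ => weight h ξ * sqSym A ξ) :
    ∀ᵐ x : ℝ, MemLp (cellKernel B x) 2 := by
  have hm := measurable_cellKernel hB.measurable
  have hmx : ∀ x, Measurable (cellKernel B x) := fun x => hm.of_uncurry_left
  have hm2 : Measurable fun z : ℝ × ℝ => ‖cellKernel B z.1 z.2‖ₑ ^ 2 :=
    (show Measurable fun z : ℝ × ℝ => cellKernel B z.1 z.2 from hm).enorm.pow_const 2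
  have hGm : Measurable fun x => ∫⁻ y, ‖cellKernel B x y‖ₑ ^ 2 :=
    Measurable.lintegral_prod_right' (f := fun z : ℝ × ℝ => ‖cellKernel B z.1 z.2‖ₑ ^ 2) hm2
  have hGp : ∀ (x : ℝ) (j : ℤ), ∫⁻ y, ‖cellKernel B (x + j) y‖ₑ ^ 2 =
      ∫⁻ y, ‖cellKernel B x y‖ₑ ^ 2 := by
    intro x j
    rw [← lintegral_add_right_eq_self (fun y => ‖cellKernel B (x + j) y‖ₑ ^ 2) (j : ℝ)]
    simp_rw [cellKernel_add_int]
  have hGfin : ∫⁻ x, (∫⁻ y, ‖cellKernel B x y‖ₑ ^ 2) ∂cellVol ≠ ∞ := by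
    rw [lintegral_cell_swap (φ := fun x y => ‖cellKernel B x y‖ₑ ^ 2) hm2 fun x y j => by
        rw [cellKernel_add_int],
      lintegral_congr_ae (hB.lintegral_cellKernel hh hA hi)]
    have e2 := (hB.integrable_sq hA hi).2
    have hBm : Measurable (fun z : ℝ × ℝ => B z.1 z.2) := hB.measurable
    rw [hasFiniteIntegral_iff_enorm, lintegral_prod_symm _
      (hBm.norm.pow_const 2).enorm.aemeasurable] at e2
    refine ne_of_lt (lt_of_le_of_lt (le_of_eq ?_) e2)
    congr 1; funext y; congr 1; funext ξ
    rw [enorm_pow, enorm_norm]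
  filter_upwards [ae_fract (P := fun x => ∫⁻ y, ‖cellKernel B x y‖ₑ ^ 2 < ∞) (ae_lt_top hGm hGfin)] with x hx
  have h1 : ∫⁻ y, ‖cellKernel B x y‖ₑ ^ 2 < ∞ := by
    rw [← Int.fract_add_floor x, hGp]; exact hx
  rw [memLp_two_iff_integrable_sq_norm (hmx x).aestronglyMeasurable]
  refine ⟨((hmx x).norm.pow_const 2).aestronglyMeasurable, ?_⟩
  rw [hasFiniteIntegral_iff_enorm]
  refine lt_of_le_of_lt (le_of_eq ?_) h1
  congr 1; funext y
  rw [enorm_pow, enorm_norm]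

theorem IsSymbol.isKernel (hh : 0 < h) (hA : IsPeriodicOp A) (hB : IsSymbol A B)
    (hi : Integrable fun ξ => weight h ξ * sqSym A ξ) : IsKernel A (cellKernel B) := by
  have hm := measurable_cellKernel hB.measurable
  refine isKernel_of_box hm (hB.memLp_cellKernel hh hA hi) fun j l => ?_
  have hint := hB.integrable hh hA hi
  have h0 : ∀ᵐ x : ℝ, A (box 0 l) x = ∫ y, cellKernel B x y * box 0 l y := by
    set f : ℝ → ℂ := fun ξ => ∫ y, phase (l * y) * B ξ y ∂cellVol with hf
    have hprod : Integrable (fun z : ℝ × ℝ => phase (l * z.2) * B z.1 z.2)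
        (volume.prod cellVol) := by
      refine hint.norm.mono' (((by fun_prop : Measurable fun z : ℝ × ℝ =>
        phase (l * z.2)).aestronglyMeasurable).mul hint.1) (.of_forall fun z => ?_)
      rw [norm_mul, norm_phase, one_mul]
    have hf1 : Integrable f := hprod.integral_prod_left
    have hf3 : FT (A (box 0 l)) =ᵐ[volume] f := by
      rw [box_zero]; exact hB.coeff l
    have hf2 : MemLp f 2 := (memLp_congr_ae hf3).1 (Lp.memLp _)
    have hf4 : hf2.toLp f = FT (A (box 0 l)) := by
      apply Lp.ext
      filter_upwards [hf2.coeFn_toLp, hf3] with ξ h1 h2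
      rw [h1, h2]
    have h5 := coeFn_FT_symm_toLp hf2 hf1
    rw [hf4, LinearIsometryEquiv.symm_apply_apply] at h5
    filter_upwards [h5] with x hx
    rw [hx]
    have e1 : ∫ y, cellKernel B x y * box 0 l y = ∫ y, cellKernel B x y * phase (l * y) ∂cellVol := by
      rw [← integral_indicator measurableSet_Ico]
      apply integral_congr_ae
      filter_upwards [coeFn_box 0 l] with y hy
      rw [hy, boxFun]
      simp only [Int.cast_zero, zero_add]
      by_cases h : y ∈ Ico (0 : ℝ) 1
      · rw [indicator_of_mem h, indicator_of_mem h]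
      · rw [indicator_of_notMem h, indicator_of_notMem h, mul_zero]
    rw [e1]
    have hprod2 : Integrable (fun z : ℝ × ℝ => phase (z.1 * x) * (phase (l * z.2) * B z.1 z.2))
        (volume.prod cellVol) := by
      refine hprod.norm.mono' (((by fun_prop : Measurable fun z : ℝ × ℝ =>
        phase (z.1 * x)).aestronglyMeasurable).mul hprod.1) (.of_forall fun z => ?_)
      rw [norm_mul, norm_phase, one_mul]
    simp only [hf]
    simp_rw [← integral_const_mul]
    rw [integral_integral_swap hprod2]
    apply setIntegral_congr_fun measurableSet_Ico
    intro y hy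
    simp only
    rw [cellKernel_eq hy, ← integral_mul_const]
    congr 1; funext ξ; ring
  have h1 : box j l = transl (-j) (box 0 l) := by rw [transl_box]; simp
  have hmp := measurePreserving_add_right (volume : Measure ℝ) (((-j : ℤ) : ℝ))
  rw [h1, hA.transl]
  filter_upwards [transl_coeFn (-j) (A (box 0 l)), hmp.quasiMeasurePreserving.ae h0] with x h2 h3
  rw [h2, h3, ← integral_add_right_eq_self _ (((-j : ℤ) : ℝ))]
  apply integral_congr_ae
  filter_upwards [transl_coeFn (-j) (box 0 l)] with y hy
  rw [hy, cellKernel_add_int]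

theorem IsSymbol.isDiagKernel (hh : 0 < h) (hA : IsPeriodicOp A) (hB : IsSymbol A B)
    (hi : Integrable fun ξ => weight h ξ * sqSym A ξ) : IsDiagKernel A (cellKernel B) :=
  ⟨hB.isKernel hh hA hi, hB.continuous_cellKernel hh hA hi⟩

end Kernel

/-! ### Cauchy–Schwarz inequalities -/

section CauchySchwarz

variable {X : Type*} [MeasurableSpace X] {ν : Measure X}

theorem sq_integral_mul_le {f g : X → ℝ} (hf : MemLp f 2 ν) (hg : MemLp g 2 ν) :
    (∫ x, f x * g x ∂ν) ^ 2 ≤ (∫ x, f x ^ 2 ∂ν) * ∫ x, g x ^ 2 ∂ν := by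
  have hfg : Integrable (fun x => f x * g x) ν := hf.integrable_mul hg
  have h : ∀ t : ℝ, 0 ≤ (∫ x, f x ^ 2 ∂ν) * (t * t) + (-2 * ∫ x, f x * g x ∂ν) * t +
      ∫ x, g x ^ 2 ∂ν := by
    intro t
    have h1 : 0 ≤ ∫ x, (f x * t - g x) ^ 2 ∂ν := integral_nonneg fun x => sq_nonneg _
    have h2 : ∫ x, (f x * t - g x) ^ 2 ∂ν = ∫ x, (t * t) * f x ^ 2 + (-2 * t) * (f x * g x) +
        g x ^ 2 ∂ν := by
      congr 1; funext x; ring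
    rw [h2, integral_add _ hg.integrable_sq, integral_add (hf.integrable_sq.const_mul _)
      (hfg.const_mul _), integral_const_mul, integral_const_mul] at h1
    · linarith
    · exact (hf.integrable_sq.const_mul _).add (hfg.const_mul _)
  have := discrim_le_zero h
  rw [discrim] at this
  nlinarith

theorem norm_sq_integral_mul_le {f g : X → ℂ} (hf : MemLp f 2 ν) (hg : MemLp g 2 ν) :
    ‖∫ x, f x * g x ∂ν‖ ^ 2 ≤ (∫ x, ‖f x‖ ^ 2 ∂ν) * ∫ x, ‖g x‖ ^ 2 ∂ν := by
  refine le_trans ?_ (sq_integral_mul_le hf.norm hg.norm)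
  gcongr
  refine (norm_integral_le_integral_norm _).trans (le_of_eq ?_)
  simp_rw [norm_mul]

end CauchySchwarz

/-- The weighted Cauchy–Schwarz inequality `|∫ f|² ≤ ∫ w⁻¹ ∫ w |f|²`, with the value of `∫ w⁻¹`. -/
theorem norm_sq_integral_le_weight {h : ℝ} (hh : 0 < h) {f : ℝ → ℂ} (hm : AEStronglyMeasurable f)
    (hf : Integrable fun ξ => weight h ξ * ‖f ξ‖ ^ 2) :
    ‖∫ ξ, f ξ‖ ^ 2 ≤ (2 * h)⁻¹ * ∫ ξ, weight h ξ * ‖f ξ‖ ^ 2 := by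
  have hw : Measurable (weight h) := (continuous_weight h).measurable
  have e1 : ∀ ξ, sqrt (weight h ξ)⁻¹ ^ 2 = (weight h ξ)⁻¹ := fun ξ =>
    Real.sq_sqrt (inv_nonneg.2 (weight_pos h ξ).le)
  have e2 : ∀ ξ, (sqrt (weight h ξ) * ‖f ξ‖) ^ 2 = weight h ξ * ‖f ξ‖ ^ 2 := fun ξ => by
    rw [mul_pow, Real.sq_sqrt (weight_pos h ξ).le]
  have h1 : MemLp (fun ξ => sqrt (weight h ξ)⁻¹) 2 := by
    rw [memLp_two_iff_integrable_sq (by fun_prop)]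
    simp_rw [e1]
    exact integrable_inv_weight hh
  have h2 : MemLp (fun ξ => sqrt (weight h ξ) * ‖f ξ‖) 2 := by
    have hm2 : AEStronglyMeasurable (fun ξ => sqrt (weight h ξ) * ‖f ξ‖) :=
      (by fun_prop : Measurable fun ξ => sqrt (weight h ξ)).aestronglyMeasurable.mul hm.norm
    rw [memLp_two_iff_integrable_sq hm2]
    simp_rw [e2]
    exact hf
  have h3 := sq_integral_mul_le h1 h2
  simp_rw [e1, e2] at h3
  have h4 : ∫ ξ, (weight h ξ)⁻¹ = (2 * h)⁻¹ := (integral_weight hh).2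
  rw [h4] at h3
  refine le_trans ?_ h3
  gcongr
  refine (norm_integral_le_integral_norm _).trans (le_of_eq ?_)
  congr 1; funext ξ
  rw [Real.sqrt_inv, inv_mul_cancel_left₀ (Real.sqrt_pos.2 (weight_pos h ξ)).ne']

/-! ### The diagonal of the kernel -/

section Diagonal

variable {A : Op} {B : ℝ → ℝ → ℂ} {h : ℝ}

theorem IsSymbol.integral_symCoef (hh : 0 < h) (hA : IsPeriodicOp A) (hB : IsSymbol A B)
    (hi : Integrable fun ξ => weight h ξ * sqSym A ξ) {m : ℤ} {b : ℝ → ℂ} (hb : BddMeas b) :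
    ∫ y, phase (-(m * y)) * (∫ ξ, b ξ * (phase (ξ * y) * B ξ y)) ∂cellVol =
      ∫ ξ, b ξ * symCoef B m ξ := by
  obtain ⟨hbm, C, hC⟩ := hb
  have hint : Integrable (fun z : ℝ × ℝ => b z.1 * (phase ((z.1 - m) * z.2) * B z.1 z.2))
      (volume.prod cellVol) := by
    refine ((hB.integrable hh hA hi).norm.const_mul C).mono' ?_
      (.of_forall fun z => ?_)
    · refine ((hbm.comp measurable_fst).aestronglyMeasurable).mul
        (((by fun_prop : Measurable fun z : ℝ × ℝ =>
        phase ((z.1 - m) * z.2)).aestronglyMeasurable).mul (hB.integrable hh hA hi).1)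
    · rw [norm_mul, norm_mul, norm_phase, one_mul]
      gcongr
      exact hC _
  have e : ∀ ξ y, phase (-(m * y)) * (b ξ * (phase (ξ * y) * B ξ y)) =
      b ξ * (phase ((ξ - m) * y) * B ξ y) := by
    intro ξ y
    rw [show (ξ - m) * y = -(m * y) + ξ * y by ring, phase_add]
    ring
  simp_rw [symCoef, ← integral_const_mul, e]
  exact (integral_integral_swap (f := fun ξ y => b ξ * (phase ((ξ - m) * y) * B ξ y)) hint).symm

theorem IsSymbol.memLp_projection (hh : 0 < h) (hA : IsPeriodicOp A) (hB : IsSymbol A B)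
    (hi : Integrable fun ξ => weight h ξ * sqSym A ξ) {b : ℝ → ℂ} (hb : BddMeas b) :
    MemLp (fun y => ∫ ξ, b ξ * (phase (ξ * y) * B ξ y)) 2 cellVol := by
  obtain ⟨hbm, C, hC⟩ := hb
  have hm : Measurable (fun z : ℝ × ℝ => b z.1 * (phase (z.1 * z.2) * B z.1 z.2)) :=
    (hbm.comp measurable_fst).mul ((by fun_prop : Measurable fun z : ℝ × ℝ =>
      phase (z.1 * z.2)).mul hB.measurable)
  have hm2 : AEStronglyMeasurable (fun y => ∫ ξ, b ξ * (phase (ξ * y) * B ξ y)) cellVol :=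
    (StronglyMeasurable.integral_prod_left' (f := fun z : ℝ × ℝ =>
      b z.1 * (phase (z.1 * z.2) * B z.1 z.2)) hm.stronglyMeasurable).aestronglyMeasurable
  rw [memLp_two_iff_integrable_sq_norm hm2]
  refine ((hB.integrable_weight_sq hA hi).integral_prod_right.const_mul
    ((2 * h)⁻¹ * C ^ 2)).mono' (hm2.norm.pow 2) ?_
  filter_upwards [(hB.integrable_weight_sq hA hi).prod_left_ae] with y hy
  rw [Real.norm_of_nonneg (by positivity)]
  have hmy : Measurable fun ξ => b ξ * (phase (ξ * y) * B ξ y) :=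
    hm.comp (by fun_prop : Measurable fun ξ : ℝ => (ξ, y))
  have hle : ∀ ξ, weight h ξ * ‖b ξ * (phase (ξ * y) * B ξ y)‖ ^ 2 ≤
      C ^ 2 * (weight h ξ * ‖B ξ y‖ ^ 2) := by
    intro ξ
    rw [norm_mul, norm_mul, norm_phase, one_mul, mul_pow]
    have h1 : ‖b ξ‖ ^ 2 ≤ C ^ 2 := by have := hC ξ; gcongr
    nlinarith [mul_nonneg (weight_pos h ξ).le (sq_nonneg ‖B ξ y‖),
      mul_le_mul_of_nonneg_right h1 (mul_nonneg (weight_pos h ξ).le (sq_nonneg ‖B ξ y‖))]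
  have hi2 : Integrable fun ξ => weight h ξ * ‖b ξ * (phase (ξ * y) * B ξ y)‖ ^ 2 := by
    refine (hy.const_mul (C ^ 2)).mono' ?_ (.of_forall fun ξ => ?_)
    · exact ((continuous_weight h).measurable.mul (hmy.norm.pow_const 2)).aestronglyMeasurable
    · rw [Real.norm_of_nonneg (mul_nonneg (weight_pos h ξ).le (by positivity))]
      exact hle ξ
  refine (norm_sq_integral_le_weight hh hmy.aestronglyMeasurable hi2).trans ?_
  rw [mul_assoc]
  gcongr
  rw [← integral_const_mul]
  exact integral_mono hi2 (hy.const_mul _) hle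

theorem bddMeas_one : BddMeas fun _ => (1 : ℂ) := ⟨measurable_const, 1, fun _ => by simp⟩

/-- The diagonal of the kernel has the integrals of the functions `symCoef B m` as its Fourier
coefficients. -/
theorem IsSymbol.hasSum_diagSq (hh : 0 < h) (hA : IsPeriodicOp A) (hB : IsSymbol A B)
    (hi : Integrable fun ξ => weight h ξ * sqSym A ξ) :
    HasSum (fun m => ‖∫ ξ, symCoef B m ξ‖ ^ 2) (diagSq A) := by
  have h1 := hasSum_norm_sq_cell (hB.memLp_projection hh hA hi bddMeas_one)
  have h2 := fun m => hB.integral_symCoef hh hA hi (m := m) bddMeas_one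
  simp_rw [h2] at h1
  simp_rw [one_mul] at h1
  have H : ∃ k, IsDiagKernel A k := ⟨_, hB.isDiagKernel hh hA hi⟩
  have h3 : diagSq A = ∫ y, ‖∫ ξ, phase (ξ * y) * B ξ y‖ ^ 2 ∂cellVol := by
    rw [diagSq, dif_pos H, intervalIntegral.integral_of_le zero_le_one,
      ← restrict_Ico_eq_restrict_Ioc]
    apply setIntegral_congr_ae measurableSet_Ico
    filter_upwards [H.choose_spec.1.ae_eq (hB.isKernel hh hA hi), H.choose_spec.2,
      hB.continuous_cellKernel hh hA hi] with y e1 e2 e3 hy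
    have e4 := Continuous.ae_eq_iff_eq (volume : Measure ℝ) e2 e3 |>.1 e1
    rw [← cellKernel_eq hy, ← congrFun e4 y]
  rw [h3]
  exact h1

end Diagonal

/-! ### The symbol of a Fourier multiplier -/

section Multiplier

variable {a : ℝ → ℝ} {h : ℝ}

theorem isSymbol_rmul (ha : RBdd a) : IsSymbol (rmul a) fun ξ y => a ξ * phase (-(ξ * y)) where
  measurable := (ha.1.comp measurable_fst).mul (by fun_prop)
  memLp := .of_forall fun ξ =>
    MemLp.of_bound (by fun_prop : Measurable _).aestronglyMeasurable ‖(a ξ : ℂ)‖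
      (.of_forall fun y => by rw [norm_mul, norm_phase, mul_one])
  coeff n := by
    filter_upwards [coeFn_FT_rmul ha (cellBasis n), coeFn_FT_box 0 n] with ξ h1 h2
    rw [h1, ← box_zero, h2, ← integral_const_mul, ← integral_indicator measurableSet_Ico]
    congr 1; funext y
    rw [boxFun]
    simp only [Int.cast_zero, zero_add]
    by_cases hy : y ∈ Ico (0 : ℝ) 1
    · rw [indicator_of_mem hy, indicator_of_mem hy]; ring
    · rw [indicator_of_notMem hy, indicator_of_notMem hy, mul_zero, mul_zero]

theorem sqSym_rmul (ha : RBdd a) : ∀ᵐ ξ : ℝ, sqSym (rmul a) ξ = a ξ ^ 2 := by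
  have h1 : adjoint (rmul a) = rmul a := by
    rw [adjoint_fmul ha]; simp only [Complex.conj_ofReal]
  rw [sqSym, h1]
  filter_upwards [diagSym_fmul_comp ha (rmul a), diagSym_rmul ha] with ξ e1 e2
  rw [e1, e2, sq]

theorem diagSq_rmul (hh : 0 < h) (ha : RBdd a) (hi : Integrable fun ξ => weight h ξ * a ξ ^ 2) :
    diagSq (rmul a) = (∫ ξ, a ξ) ^ 2 := by
  have hi' : Integrable fun ξ => weight h ξ * sqSym (rmul a) ξ := by
    refine hi.congr ?_
    filter_upwards [sqSym_rmul ha] with ξ e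
    rw [e]
  have h1 := (isSymbol_rmul ha).hasSum_diagSq hh (isPeriodicOp_rmul ha) hi'
  have h2 : ∀ m : ℤ, ‖∫ ξ, symCoef (fun ξ y => a ξ * phase (-(ξ * y))) m ξ‖ ^ 2 =
      if m = 0 then (∫ ξ, a ξ) ^ 2 else 0 := by
    intro m
    have h3 : ∀ ξ, symCoef (fun ξ y => a ξ * phase (-(ξ * y))) m ξ =
        a ξ * (if -m = 0 then 1 else 0) := by
      intro ξ
      rw [← integral_cell_phase, symCoef, ← integral_const_mul]
      congr 1; funext y
      rw [show (ξ - m) * y = ξ * y + ((-m : ℤ) : ℝ) * y by push_cast; ring, phase_add]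
      have := phase_neg_mul (ξ * y)
      linear_combination (a ξ : ℂ) * phase (((-m : ℤ) : ℝ) * y) * this
    simp_rw [h3, integral_mul_const]
    by_cases hm : m = 0
    · rw [if_pos hm, if_pos (by omega), mul_one, integral_complex_ofReal, Complex.norm_real,
        Real.norm_eq_abs, sq_abs]
    · rw [if_neg hm, if_neg (by omega), mul_zero, norm_zero, zero_pow two_ne_zero]
  simp_rw [h2] at h1
  exact h1.unique (hasSum_ite_eq 0 _)

end Multiplier

/-! ### Absolutely convergent Fourier series -/

/-- The Fourier series with coefficients `z`. -/
def trigSeries (z : ℤ → ℂ) (y : ℝ) : ℂ := ∑' m : ℤ, z m * phase (m * y)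

section TrigSeries

variable {z : ℤ → ℂ}

theorem norm_mul_phase (w : ℂ) (t : ℝ) : ‖w * phase t‖ = ‖w‖ := by
  rw [norm_mul, norm_phase, mul_one]

theorem hasSum_trigSeries (hz : Summable fun m => ‖z m‖) (y : ℝ) :
    HasSum (fun m : ℤ => z m * phase (m * y)) (trigSeries z y) :=
  (Summable.of_norm (by simp_rw [norm_mul_phase]; exact hz)).hasSum

theorem continuous_trigSeries (hz : Summable fun m => ‖z m‖) : Continuous (trigSeries z) := by
  have := continuous_phase
  refine continuous_tsum (fun m => by fun_prop) hz fun m y => ?_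
  rw [norm_mul_phase]

theorem norm_trigSeries_le (hz : Summable fun m => ‖z m‖) (y : ℝ) :
    ‖trigSeries z y‖ ≤ ∑' m, ‖z m‖ := by
  refine (norm_tsum_le_tsum_norm (by simp_rw [norm_mul_phase]; exact hz)).trans (le_of_eq ?_)
  simp_rw [norm_mul_phase]

theorem bddMeas_trigSeries (hz : Summable fun m => ‖z m‖) : BddMeas (trigSeries z) :=
  ⟨(continuous_trigSeries hz).measurable, _, norm_trigSeries_le hz⟩

theorem periodic_trigSeries (z : ℤ → ℂ) : Function.Periodic (trigSeries z) 1 := by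
  intro y
  simp only [trigSeries]
  congr 1; funext m
  have := phase_mul_add_int y m 1
  rw [Int.cast_one] at this
  rw [this]

theorem integral_phase_mul_tsum (hz : Summable fun m => ‖z m‖) (k : ℤ) :
    ∫ y, (∑' m : ℤ, z m * phase ((m - k : ℤ) * y)) ∂cellVol = z k := by
  have h1 := hasSum_integral_of_summable_integral_norm (μ := cellVol)
    (F := fun (m : ℤ) y => z m * phase ((m - k : ℤ) * y))
    (fun m => Integrable.of_bound (by fun_prop : Measurable _).aestronglyMeasurable ‖z m‖
      (.of_forall fun y => (norm_mul_phase _ _).le))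
    (by simpa only [norm_mul_phase, integral_const, probReal_univ, one_smul] using hz)
  rw [← h1.tsum_eq]
  simp_rw [integral_const_mul, integral_cell_phase]
  rw [tsum_eq_single k (fun m hm => by rw [if_neg (by omega), mul_zero])]
  simp

theorem integral_phase_mul_trigSeries (hz : Summable fun m => ‖z m‖) (k : ℤ) :
    ∫ y, phase (-(k * y)) * trigSeries z y ∂cellVol = z k := by
  rw [← integral_phase_mul_tsum hz k]
  congr 1; funext y
  rw [trigSeries, ← tsum_mul_left]
  congr 1; funext m
  rw [show ((m - k : ℤ) : ℝ) * y = -(k * y) + m * y by push_cast; ring, phase_add]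
  ring

theorem fourierCoef_eq (ψ : ℝ → ℂ) (k : ℤ) :
    fourierCoef ψ k = ∫ y, phase (-(k * y)) * ψ y ∂cellVol := by
  rw [fourierCoef, intervalIntegral.integral_of_le zero_le_one, ← restrict_Ico_eq_restrict_Ioc]
  congr 1; funext y
  rw [phase]
  congr 2; push_cast; ring

theorem fourierCoef_trigSeries (hz : Summable fun m => ‖z m‖) (k : ℤ) :
    fourierCoef (trigSeries z) k = z k := by
  rw [fourierCoef_eq, integral_phase_mul_trigSeries hz]

/-- A sum in `L²` agrees almost everywhere with the pointwise sum. -/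
theorem ae_eq_of_hasSum {f : ℤ → L2} {F : L2} (hF : HasSum f F) {g : ℤ → ℝ → ℂ} {G : ℝ → ℂ}
    (hg : ∀ m, f m =ᵐ[volume] g m) (hG : ∀ᵐ x : ℝ, HasSum (fun m => g m x) (G x)) :
    F =ᵐ[volume] G := by
  have hs : ∀ s : Finset ℤ, (∑ m ∈ s, f m : L2) =ᵐ[volume] fun x => ∑ m ∈ s, g m x := by
    intro s
    induction s using Finset.induction_on with
    | empty => simp only [Finset.sum_empty]; exact Lp.coeFn_zero _ _ _
    | insert m s hm ih =>
      simp only [Finset.sum_insert hm]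
      filter_upwards [Lp.coeFn_add (f m) (∑ k ∈ s, f k), hg m, ih] with x h1 h2 h3
      rw [h1, Pi.add_apply, h2, h3]
  obtain ⟨ns, hns, hae⟩ := (tendstoInMeasure_of_tendsto_Lp hF).exists_seq_tendsto_ae'
  filter_upwards [hae, hG, ae_all_iff.2 fun n => hs (ns n)] with x h1 h2 h3
  refine tendsto_nhds_unique h1 ?_
  simp only [h3]
  exact Filter.Tendsto.comp (f := ns) (g := fun s => ∑ m ∈ s, g m x) h2 hns

theorem hasSum_mulOp_trigSeries (hz : Summable fun m => ‖z m‖) (f : L2) :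
    HasSum (fun m : ℤ => z m • mulOp (fun x => phase (m * x)) f) (mulOp (trigSeries z) f) := by
  have h1 : Summable fun m : ℤ => z m • mulOp (fun x => phase (m * x)) f := by
    refine Summable.of_norm_bounded (g := fun m => ‖z m‖ * ‖f‖) (hz.mul_right _) fun m => ?_
    rw [norm_smul]
    gcongr
    have := norm_mulOp_apply_le (bddMeas_phase m) (M := 1) (fun x => (norm_phase _).le) f
    rwa [one_mul] at this
  have h2 : (∑' m : ℤ, z m • mulOp (fun x => phase (m * x)) f : L2) = mulOp (trigSeries z) f := by
    apply Lp.ext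
    have h3 := ae_eq_of_hasSum h1.hasSum (g := fun m x => z m * phase (m * x) * f x)
      (G := fun x => trigSeries z x * f x) (fun m => ?_)
      (.of_forall fun x => (hasSum_trigSeries hz x).mul_right _)
    · filter_upwards [h3, mulOp_coeFn (bddMeas_trigSeries hz) f] with x e1 e2
      rw [e1, e2]
    · filter_upwards [Lp.coeFn_smul (z m) (mulOp (fun x => phase (m * x)) f),
        mulOp_coeFn (bddMeas_phase m) f] with x e1 e2
      rw [e1, Pi.smul_apply, e2, smul_eq_mul, mul_assoc]
  rw [← h2]
  exact h1.hasSum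

end TrigSeries

/-! ### Centre-of-mass Fourier coefficients of operators -/

/-- `c m ξ` are the centre-of-mass Fourier coefficients of (a symbol of) the operator `A`. -/
def HasCoef (A : Op) (c : ℤ → ℝ → ℂ) : Prop :=
  ∃ B, IsSymbol A B ∧ ∀ᵐ ξ : ℝ, ∀ m, symCoef B m ξ = c m ξ

theorem integrable_phase_mul {B : ℝ → ℝ → ℂ} {ξ : ℝ} (h : MemLp (B ξ) 2 cellVol)
    (t : ℝ) : Integrable (fun y => phase (t * y) * B ξ y) cellVol := by
  refine (h.integrable one_le_two).norm.mono' ((by fun_prop : Measurable fun y =>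
    phase (t * y)).aestronglyMeasurable.mul h.1) (.of_forall fun y => ?_)
  rw [norm_mul, norm_phase, one_mul]

section HasCoef

variable {A A' : Op} {c c' : ℤ → ℝ → ℂ}

theorem HasCoef.hasSum (hA : IsPeriodicOp A) (hc : HasCoef A c) :
    ∀ᵐ ξ : ℝ, HasSum (fun m => ‖c m ξ‖ ^ 2) (sqSym A ξ) := by
  obtain ⟨B, hB, hc⟩ := hc
  filter_upwards [hB.hasSum_symCoef hA, hc] with ξ h1 h2
  simpa only [h2] using h1

theorem HasCoef.add (hc : HasCoef A c) (hc' : HasCoef A' c') :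
    HasCoef (A + A') fun m ξ => c m ξ + c' m ξ := by
  obtain ⟨B, hB, hc⟩ := hc
  obtain ⟨B', hB', hc'⟩ := hc'
  refine ⟨fun ξ y => B ξ y + B' ξ y, ⟨hB.measurable.add hB'.measurable, ?_, fun n => ?_⟩, ?_⟩
  · filter_upwards [hB.memLp, hB'.memLp] with ξ h1 h2 using h1.add h2
  · filter_upwards [hB.memLp, hB'.memLp, hB.coeff n, hB'.coeff n,
      Lp.coeFn_add (FT (A (cellBasis n))) (FT (A' (cellBasis n)))] with ξ h1 h2 h3 h4 h5
    rw [add_apply, map_add, h5, Pi.add_apply, h3, h4, ← integral_add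
      (integrable_phase_mul h1 _) (integrable_phase_mul h2 _)]
    congr 1; funext y; ring
  · filter_upwards [hB.memLp, hB'.memLp, hc, hc'] with ξ h1 h2 h3 h4 m
    rw [← h3, ← h4, symCoef, symCoef, symCoef, ← integral_add
      (integrable_phase_mul h1 _) (integrable_phase_mul h2 _)]
    congr 1; funext y; ring

theorem HasCoef.smul (hc : HasCoef A c) (w : ℂ) : HasCoef (w • A) fun m ξ => w * c m ξ := by
  obtain ⟨B, hB, hc⟩ := hc
  refine ⟨fun ξ y => w * B ξ y, ⟨hB.measurable.const_mul w, ?_, fun n => ?_⟩, ?_⟩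
  · filter_upwards [hB.memLp] with ξ h1 using h1.const_mul w
  · filter_upwards [hB.coeff n, Lp.coeFn_smul w (FT (A (cellBasis n)))] with ξ h3 h5
    rw [smul_apply, map_smul, h5, Pi.smul_apply, h3, smul_eq_mul, ← integral_const_mul]
    congr 1; funext y; ring
  · filter_upwards [hc] with ξ h3 m
    rw [← h3, symCoef, symCoef, ← integral_const_mul]
    congr 1; funext y; ring

theorem HasCoef.sub (hc : HasCoef A c) (hc' : HasCoef A' c') :
    HasCoef (A - A') fun m ξ => c m ξ - c' m ξ := by
  have h := hc.add (hc'.smul (-1))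
  rw [show A + (-1 : ℂ) • A' = A - A' by rw [neg_one_smul, sub_eq_add_neg]] at h
  simpa only [neg_one_mul, ← sub_eq_add_neg] using h

theorem hasCoef_rmul_comp_mulOp {a : ℝ → ℝ} (ha : RBdd a) {ψ : ℝ → ℂ} (hψ : BddMeas ψ) :
    HasCoef (rmul a ∘L mulOp ψ) fun m ξ => a ξ * fourierCoef ψ m := by
  have hψ2 : MemLp ψ 2 cellVol := hψ.memLp.restrict _ |>.mono_exponent (by simp)
  refine ⟨fun ξ y => a ξ * phase (-(ξ * y)) * ψ y, ⟨?_, .of_forall fun ξ => ?_,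
    fun n => ?_⟩, .of_forall fun ξ m => ?_⟩
  · exact ((ha.1.comp measurable_fst).mul (by fun_prop)).mul (hψ.1.comp measurable_snd)
  · obtain ⟨hm, C, hC⟩ := hψ
    refine MemLp.of_bound ((by fun_prop : Measurable fun y : ℝ =>
      (a ξ : ℂ) * phase (-(ξ * y))).mul hm).aestronglyMeasurable (‖(a ξ : ℂ)‖ * C)
      (.of_forall fun y => ?_)
    rw [norm_mul, norm_mul_phase]
    gcongr
    exact hC y
  · obtain ⟨hm, C, hC⟩ := id hψ
    have hb : ∀ p : ℝ≥0∞, MemLp (fun y => ψ y * boxFun 0 n y) p volume := fun p => by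
      refine (memLp_boxFun p 0 n).of_le_mul (c := C)
        (hm.mul (measurable_boxFun 0 n)).aestronglyMeasurable
        (.of_forall fun y => ?_)
      rw [norm_mul]
      gcongr
      exact hC y
    have h1 : mulOp ψ (cellBasis n) = (hb 2).toLp _ := by
      apply Lp.ext
      rw [← box_zero]
      filter_upwards [mulOp_coeFn hψ (box 0 n), coeFn_box 0 n, (hb 2).coeFn_toLp] with y e1 e2 e3
      rw [e1, e2, e3]
    filter_upwards [coeFn_FT_rmul ha (mulOp ψ (cellBasis n)),
      coeFn_FT_toLp (hb 2) (memLp_one_iff_integrable.1 (hb 1))] with ξ e1 e2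
    rw [comp_apply, e1, h1, e2, ← integral_const_mul,
      ← integral_indicator measurableSet_Ico]
    congr 1; funext y
    rw [boxFun]
    simp only [Int.cast_zero, zero_add]
    by_cases hy : y ∈ Ico (0 : ℝ) 1
    · rw [indicator_of_mem hy, indicator_of_mem hy]; ring
    · rw [indicator_of_notMem hy, indicator_of_notMem hy, mul_zero, mul_zero, mul_zero]
  · simp only
    rw [fourierCoef_eq, symCoef, ← integral_const_mul]
    congr 1; funext y
    rw [show (ξ - m) * y = ξ * y + -(m * y) by ring, phase_add]
    have := phase_neg_mul (ξ * y)
    linear_combination (a ξ : ℂ) * phase (-(m * y)) * ψ y * this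

theorem hasCoef_mulOp_comp_rmul {a : ℝ → ℝ} (ha : RBdd a) {z : ℤ → ℂ}
    (hz : Summable fun m => ‖z m‖) :
    HasCoef (mulOp (trigSeries z) ∘L rmul a) fun m ξ => z m * a (ξ - m) := by
  obtain ⟨ham, C, hC⟩ := id ha
  have hza : ∀ ξ : ℝ, Summable fun m : ℤ => ‖z m * a (ξ - m)‖ := by
    intro ξ
    refine Summable.of_nonneg_of_le (fun _ => norm_nonneg _) (fun m => ?_) (hz.mul_right C)
    rw [norm_mul]
    gcongr
    exact hC _
  set B : ℝ → ℝ → ℂ := fun ξ y => phase (-(ξ * y)) * trigSeries (fun m => z m * a (ξ - m)) y with hB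
  have hBn : ∀ ξ (t : ℝ) y, phase ((ξ - t) * y) * B ξ y =
      phase (-(t * y)) * trigSeries (fun m => z m * a (ξ - m)) y := by
    intro ξ t y
    simp only [hB]
    rw [← mul_assoc, ← phase_add]
    congr 2; ring
  have hBm : Measurable (Function.uncurry B) := by
    refine Measurable.mul (f := fun p : ℝ × ℝ => phase (-(p.1 * p.2))) (by fun_prop) ?_
    have h1 : ∀ m : ℤ, Measurable fun p : ℝ × ℝ => z m * a (p.1 - m) * phase (m * p.2) := by
      intro m
      exact ((ham.comp (g := fun ξ => (a ξ : ℂ)) (by fun_prop :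
        Measurable fun p : ℝ × ℝ => p.1 - (m : ℝ))).const_mul _).mul (by fun_prop)
    exact Measurable.tsum h1
  have hBc : ∀ ξ, Continuous (B ξ) := fun ξ => by
    have h1 := continuous_trigSeries (hza ξ)
    have h2 := continuous_phase
    simp only [hB]
    fun_prop
  refine ⟨B, ⟨hBm, .of_forall fun ξ => ?_, fun n => ?_⟩,
    .of_forall fun ξ m => ?_⟩
  · refine MemLp.of_bound (hBc ξ).aestronglyMeasurable (∑' m : ℤ, ‖z m * a (ξ - m)‖)
      (.of_forall fun y => ?_)
    simp only [hB]
    rw [norm_mul, norm_phase, one_mul]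
    exact norm_trigSeries_le (hza ξ) y
  · set g : L2 := rmul a (cellBasis n) with hg
    have h1 : HasSum (fun m : ℤ => FT (z m • mulOp (fun x => phase (m * x)) g))
        (FT (mulOp (trigSeries z) g)) :=
      (hasSum_mulOp_trigSeries hz g).mapL FT.toLinearIsometry.toContinuousLinearMap
    refine ae_eq_of_hasSum h1 (g := fun m ξ => z m * ∫ y, phase (n * y) *
      ((a (ξ - m) : ℂ) * phase (-((ξ - m) * y))) ∂cellVol) (fun m => ?_)
      (.of_forall fun ξ => ?_)
    · rw [map_smul, FT_mulOp_phase]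
      have h2 := (measurePreserving_add_right volume (((-m : ℤ) : ℝ))).quasiMeasurePreserving.ae
        ((isSymbol_rmul ha).coeff n)
      filter_upwards [Lp.coeFn_smul (z m) (transl (-m) (FT g)), transl_coeFn (-m) (FT g), h2]
        with ξ e1 e2 e3
      rw [e1, Pi.smul_apply, smul_eq_mul, e2, e3]
      simp only [Int.cast_neg, ← sub_eq_add_neg]
    · have h2 := hasSum_integral_of_summable_integral_norm (μ := cellVol)
        (F := fun (m : ℤ) y => z m * (phase (n * y) *
          ((a (ξ - m) : ℂ) * phase (-((ξ - m) * y)))))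
        (fun m => Integrable.of_bound (by fun_prop : Measurable _).aestronglyMeasurable
          ‖z m * a (ξ - m)‖ (.of_forall fun y => by
            rw [norm_mul, norm_mul, norm_phase, one_mul, norm_mul_phase, norm_mul]))
        (by
          simp only [norm_mul, norm_phase, one_mul, mul_one, integral_const, probReal_univ,
            one_smul]
          simpa only [norm_mul] using hza ξ)
      simp_rw [integral_const_mul (z _)] at h2
      have e : ∀ y, (∑' m : ℤ, z m * (phase (n * y) * ((a (ξ - m) : ℂ) *
          phase (-((ξ - m) * y))))) = phase (n * y) * B ξ y := by
        intro y
        simp only [hB]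
        rw [← mul_assoc, trigSeries, ← tsum_mul_left]
        congr 1; funext m
        rw [show -((ξ - m) * y) = -(ξ * y) + m * y by ring, phase_add]
        ring
      simp_rw [e] at h2
      exact h2
  · simp only [symCoef, hBn]
    exact integral_phase_mul_trigSeries (hza ξ) m

end HasCoef

/-! ### Transposition -/

theorem conjOp_apply (A : Op) (f : L2) : conjOp A f = conjL2 (A (conjL2 f)) := rfl

theorem conjOp_comp (A B : Op) : conjOp (A ∘L B) = conjOp A ∘L conjOp B := by
  ext1 f
  simp only [conjOp_apply, comp_apply, conjL2_conjL2]

theorem conjOp_add (A B : Op) : conjOp (A + B) = conjOp A + conjOp B := by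
  ext1 f
  simp only [conjOp_apply, add_apply, map_add]

theorem conjOp_smul (w : ℂ) (A : Op) : conjOp (w • A) = conj w • conjOp A := by
  ext1 f
  simp only [conjOp_apply, smul_apply, map_smulₛₗ]

theorem conjOp_mulOp {ψ : ℝ → ℂ} (hψ : BddMeas ψ) :
    conjOp (mulOp ψ) = mulOp fun x => conj (ψ x) := by
  ext1 f
  apply Lp.ext
  rw [conjOp_apply]
  filter_upwards [conjL2_coeFn (mulOp ψ (conjL2 f)), mulOp_coeFn hψ (conjL2 f), conjL2_coeFn f,
    mulOp_coeFn hψ.conj f] with x e1 e2 e3 e4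
  rw [e1, e2, e3, e4, map_mul, Complex.conj_conj]

/-- The transpose of an operator: the kernel `k(x, y)` becomes `k(y, x)`. -/
def transpose (A : Op) : Op := conjOp (adjoint A)

theorem transpose_add_smul (A B : Op) (w : ℂ) :
    transpose (A + w • B) = transpose A + w • transpose B := by
  rw [transpose, map_add, map_smulₛₗ, conjOp_add, conjOp_smul, Complex.conj_conj]
  rfl

theorem transpose_mulOp_comp_rmul {a : ℝ → ℝ} (ha : RBdd a) (he : ∀ ξ, a (-ξ) = a ξ) {ψ : ℝ → ℂ}
    (hψ : BddMeas ψ) : transpose (mulOp ψ ∘L rmul a) = rmul a ∘L mulOp ψ := by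
  have h1 : adjoint (rmul a) = rmul a := by
    rw [adjoint_fmul ha]; simp only [Complex.conj_ofReal]
  rw [transpose, ContinuousLinearMap.adjoint_comp, h1, adjoint_mulOp hψ, conjOp_comp,
    conjOp_rmul ha he, conjOp_mulOp hψ.conj]
  simp only [Complex.conj_conj]

theorem tsum_enorm_transpose {A : Op} (hA : IsPeriodicOp A) :
    ∑' n, ‖transpose A (cellBasis n)‖ₑ ^ 2 = ∑' n, ‖A (cellBasis n)‖ₑ ^ 2 := by
  rw [← tsum_enorm_sq_adjoint_cell hA, ← (Equiv.neg ℤ).tsum_eq]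
  congr 1; funext n
  have h1 : conjL2 (cellBasis (Equiv.neg ℤ n)) = cellBasis n := by
    rw [← box_zero, conjL2_box, ← box_zero]; simp
  have h2 : ∀ f : L2, ‖conjL2 f‖ₑ = ‖f‖ₑ := fun f => by
    rw [← ofReal_norm, ← ofReal_norm]
    rw [@norm_eq_sqrt_re_inner ℂ, inner_conjL2, ← @norm_eq_sqrt_re_inner ℂ]
  rw [transpose, conjOp_apply, h1, h2]

theorem integral_sqSym_transpose {A : Op} (hA : IsPeriodicOp A) :
    ∫ ξ, sqSym (transpose A) ξ = ∫ ξ, sqSym A ξ := by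
  have hA' : IsPeriodicOp (transpose A) := hA.adjoint.conjOp
  rw [integral_eq_lintegral_of_nonneg_ae (sqSym_nonneg hA)
      (measurable_sqSym A).aestronglyMeasurable,
    integral_eq_lintegral_of_nonneg_ae (sqSym_nonneg hA')
      (measurable_sqSym _).aestronglyMeasurable]
  have h1 := tsum_enorm_cell_eq_lintegral hA
  have h2 := tsum_enorm_cell_eq_lintegral hA'
  rw [tsum_enorm_transpose hA, h1] at h2
  exact congrArg ENNReal.toReal h2.symm

theorem HasCoef.memLp {A : Op} {c : ℤ → ℝ → ℂ} (hA : IsPeriodicOp A) (hc : HasCoef A c)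
    (hi : Integrable (sqSym A)) (m : ℤ) : MemLp (c m) 2 := by
  have hm : AEStronglyMeasurable (c m) := by
    obtain ⟨B, hB, hc⟩ := hc
    refine (measurable_symCoef hB.measurable m).aestronglyMeasurable.congr ?_
    filter_upwards [hc] with ξ h using h m
  rw [memLp_two_iff_integrable_sq_norm hm]
  refine hi.mono' (hm.norm.pow 2) ?_
  filter_upwards [hc.hasSum hA] with ξ h
  rw [Real.norm_of_nonneg (by positivity)]
  exact le_hasSum h m fun _ _ => by positivity

/-- The polarization of the Hilbert–Schmidt norm at an operator with one nonzero coefficient. -/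
theorem integral_sqSym_add_smul {A A' : Op} {c : ℤ → ℝ → ℂ} {v : ℝ → ℝ} {m : ℤ}
    (hA : IsPeriodicOp A) (hA' : IsPeriodicOp A') (hc : HasCoef A c)
    (hc' : HasCoef A' fun k ξ => if k = m then (v ξ : ℂ) else 0) (hi : Integrable (sqSym A))
    (hv : MemLp v 2) (w : ℂ) :
    ∫ ξ, sqSym (A + w • A') ξ = (∫ ξ, sqSym A ξ) + ‖w‖ ^ 2 * (∫ ξ, v ξ ^ 2) +
      2 * (conj w * ∫ ξ, (v ξ : ℂ) * c m ξ).re := by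
  have h1 : ∀ᵐ ξ : ℝ, sqSym (A + w • A') ξ = sqSym A ξ + ‖w‖ ^ 2 * v ξ ^ 2 +
      2 * (conj w * ((v ξ : ℂ) * c m ξ)).re := by
    filter_upwards [hc.hasSum hA, (hc.add (hc'.smul w)).hasSum (hA.add (hA'.smul w))] with ξ e1 e2
    refine e2.unique ?_
    have e3 := e1.add (hasSum_ite_eq m (‖w‖ ^ 2 * v ξ ^ 2 +
      2 * (conj w * ((v ξ : ℂ) * c m ξ)).re))
    rw [← add_assoc] at e3
    have e4 : ∀ k, ‖c k ξ + w * (if k = m then (v ξ : ℂ) else 0)‖ ^ 2 = ‖c k ξ‖ ^ 2 +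
        (if k = m then ‖w‖ ^ 2 * v ξ ^ 2 +
          2 * (conj w * ((v ξ : ℂ) * c m ξ)).re else 0) := by
      intro k
      by_cases hk : k = m
      · subst hk
        simp only [if_true]
        rw [← Complex.normSq_eq_norm_sq, ← Complex.normSq_eq_norm_sq, ← Complex.normSq_eq_norm_sq,
          Complex.normSq_apply, Complex.normSq_apply, Complex.normSq_apply]
        simp only [Complex.add_re, Complex.add_im, Complex.mul_re, Complex.mul_im,
          Complex.conj_re, Complex.conj_im, Complex.ofReal_re, Complex.ofReal_im]
        ring
      · simp only [if_neg hk, mul_zero, add_zero]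
    simp_rw [e4]
    exact e3
  have hvc : MemLp (fun ξ => (v ξ : ℂ)) 2 := hv.ofReal
  have hint : Integrable fun ξ => (v ξ : ℂ) * c m ξ := hvc.integrable_mul (hc.memLp hA hi m)
  have hint2 : Integrable fun ξ => conj w * ((v ξ : ℂ) * c m ξ) := hint.const_mul _
  rw [integral_congr_ae h1, integral_add, integral_add hi (hv.integrable_sq.const_mul _),
    integral_const_mul, integral_const_mul, ← integral_const_mul (conj w)]
  · congr 2
    exact integral_re hint2
  · exact hi.add (hv.integrable_sq.const_mul _)
  · exact hint2.re.const_mul 2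

/-- For a symmetric operator, `c m` has the same integral against `a` and against `a (· - m)`.
Transposition exchanges `e^{2πimx} a` with `a e^{2πimx}` and preserves the Hilbert–Schmidt norm;
polarization gives the identity. -/
theorem HasCoef.integral_shift_mul {A : Op} {c : ℤ → ℝ → ℂ} (hA : IsPeriodicOp A)
    (hc : HasCoef A c) (hsym : transpose A = A) (hi : Integrable (sqSym A)) {a : ℝ → ℝ}
    (ha : RBdd a) (he : ∀ ξ, a (-ξ) = a ξ) (ha2 : MemLp a 2) (m : ℤ) :
    ∫ ξ, (a (ξ - m) : ℂ) * c m ξ = ∫ ξ, (a ξ : ℂ) * c m ξ := by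
  set z : ℤ → ℂ := fun k => if k = m then 1 else 0 with hz
  have hzs : Summable fun k => ‖z k‖ := by
    refine summable_of_ne_finset_zero (s := {m}) fun k hk => ?_
    rw [Finset.mem_singleton] at hk
    simp [hz, hk]
  have hψ := bddMeas_trigSeries hzs
  have hψp := periodic_trigSeries z
  set X := mulOp (trigSeries z) ∘L rmul a with hX
  set Y := rmul a ∘L mulOp (trigSeries z) with hY
  have hXp : IsPeriodicOp X := (isPeriodicOp_mulOp hψ hψp).comp (isPeriodicOp_rmul ha)
  have hYp : IsPeriodicOp Y := (isPeriodicOp_rmul ha).comp (isPeriodicOp_mulOp hψ hψp)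
  have hXc : HasCoef X fun k ξ => if k = m then ((a (ξ - m) : ℝ) : ℂ) else 0 := by
    have h := hasCoef_mulOp_comp_rmul ha hzs
    convert h using 3 with k ξ
    by_cases hk : k = m
    · subst hk; simp [hz]
    · simp [hz, hk]
  have hYc : HasCoef Y fun k ξ => if k = m then (a ξ : ℂ) else 0 := by
    have h := hasCoef_rmul_comp_mulOp ha hψ
    simp_rw [fourierCoef_trigSeries hzs] at h
    convert h using 3 with k ξ
    by_cases hk : k = m
    · subst hk; simp [hz]
    · simp [hz, hk]
  have hshift : MemLp (fun ξ => a (ξ - m)) 2 :=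
    ha2.comp_measurePreserving (measurePreserving_sub_right volume (m : ℝ))
  have key : ∀ w : ℂ, (conj w * ∫ ξ, ((a (ξ - m) : ℝ) : ℂ) * c m ξ).re =
      (conj w * ∫ ξ, (a ξ : ℂ) * c m ξ).re := by
    intro w
    have h1 := integral_sqSym_add_smul (v := fun ξ => a (ξ - m)) hA hXp hc hXc hi hshift w
    have h2 := integral_sqSym_add_smul (v := a) hA hYp hc hYc hi ha2 w
    have h3 : transpose (A + w • X) = A + w • Y := by
      rw [transpose_add_smul, hsym, hX, transpose_mulOp_comp_rmul ha he hψ]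
    have h4 := integral_sqSym_transpose (hA.add (hXp.smul w))
    have h5 : ∫ ξ, a (ξ - m) ^ 2 = ∫ ξ, a ξ ^ 2 :=
      integral_sub_right_eq_self (fun ξ => a ξ ^ 2) (m : ℝ)
    rw [h3, h1, h2, h5] at h4
    linarith
  have k1 := key 1
  have k2 := key Complex.I
  rw [map_one, one_mul, one_mul] at k1
  refine Complex.ext k1 ?_
  simpa using k2

/-! ### The kernel of the pair wave function -/

/-- Parseval's identity for inverse Fourier integrals. -/
theorem integral_conj_mul_fourierInv {f g : ℝ → ℂ} (hf : MemLp f 2) (hf1 : Integrable f)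
    (hg : MemLp g 2) (hg1 : Integrable g) :
    ∫ x, conj (∫ ξ, phase (ξ * x) * f ξ) * (∫ ξ, phase (ξ * x) * g ξ) =
      ∫ ξ, conj (f ξ) * g ξ := by
  have h1 := FT.symm.inner_map_map (hf.toLp f) (hg.toLp g)
  rw [L2.inner_def, L2.inner_def] at h1
  have h2 : ∫ x, conj (∫ ξ, phase (ξ * x) * f ξ) * (∫ ξ, phase (ξ * x) * g ξ) =
      ∫ x, (inner ℂ (FT.symm (hf.toLp f) x) (FT.symm (hg.toLp g) x) : ℂ) := by
    apply integral_congr_ae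
    filter_upwards [coeFn_FT_symm_toLp hf hf1, coeFn_FT_symm_toLp hg hg1] with x e1 e2
    rw [e1, e2, RCLike.inner_apply, mul_comm]
  rw [h2, h1]
  apply integral_congr_ae
  filter_upwards [hf.coeFn_toLp, hg.coeFn_toLp] with ξ e1 e2
  rw [e1, e2, RCLike.inner_apply, mul_comm]

section IsKernel

variable {A A' : Op} {k k' : ℝ → ℝ → ℂ}

theorem IsKernel.add (hk : IsKernel A k) (hk' : IsKernel A' k') :
    IsKernel (A + A') fun x y => k x y + k' x y := by
  refine ⟨hk.1.add hk'.1, fun f => ?_⟩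
  filter_upwards [hk.2 f, hk'.2 f, Lp.coeFn_add (A f) (A' f)] with x h1 h2 h3
  simp_rw [add_mul]
  refine ⟨h1.1.add h2.1, ?_⟩
  rw [add_apply, h3, Pi.add_apply, h1.2, h2.2, integral_add h1.1 h2.1]

theorem IsKernel.smul (hk : IsKernel A k) (w : ℂ) : IsKernel (w • A) fun x y => w * k x y := by
  refine ⟨hk.1.const_mul w, fun f => ?_⟩
  filter_upwards [hk.2 f, Lp.coeFn_smul w (A f)] with x h1 h3
  simp_rw [mul_assoc]
  refine ⟨h1.1.const_mul w, ?_⟩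
  rw [smul_apply, h3, Pi.smul_apply, h1.2, smul_eq_mul, integral_const_mul]

theorem IsKernel.sub (hk : IsKernel A k) (hk' : IsKernel A' k') :
    IsKernel (A - A') fun x y => k x y - k' x y := by
  have h := hk.add (hk'.smul (-1))
  rw [show A + (-1 : ℂ) • A' = A - A' by rw [neg_one_smul, sub_eq_add_neg]] at h
  simpa only [neg_one_mul, ← sub_eq_add_neg] using h

theorem IsKernel.mulOp_comp (hk : IsKernel A k) {ψ : ℝ → ℂ} (hψ : BddMeas ψ) :
    IsKernel (mulOp ψ ∘L A) fun x y => ψ x * k x y := by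
  refine ⟨((hψ.1.comp measurable_fst).aestronglyMeasurable).mul hk.1, fun f => ?_⟩
  filter_upwards [hk.2 f, mulOp_coeFn hψ (A f)] with x h1 h3
  simp_rw [mul_assoc]
  refine ⟨h1.1.const_mul _, ?_⟩
  rw [comp_apply, h3, h1.2, integral_const_mul]

theorem IsKernel.comp_mulOp (hk : IsKernel A k) {ψ : ℝ → ℂ} (hψ : BddMeas ψ) :
    IsKernel (A ∘L mulOp ψ) fun x y => k x y * ψ y := by
  refine ⟨hk.1.mul ((hψ.1.comp measurable_snd).aestronglyMeasurable), fun f => ?_⟩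
  filter_upwards [hk.2 (mulOp ψ f)] with x h1
  have e : (fun y => k x y * ψ y * f y) =ᵐ[volume] fun y => k x y * mulOp ψ f y := by
    filter_upwards [mulOp_coeFn hψ f] with y h2
    rw [h2, mul_assoc]
  exact ⟨h1.1.congr e.symm, by rw [comp_apply, h1.2, integral_congr_ae e]⟩

end IsKernel

section PairSym

variable {μ T Δ₀ h : ℝ}

theorem pairSym_neg (ξ : ℝ) : pairSym μ T Δ₀ h (-ξ) = pairSym μ T Δ₀ h ξ := by
  rw [pairSym, pairSym, show h * (2 * π * -ξ) = -(h * (2 * π * ξ)) by ring, KT_neg]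

variable (hT : 0 < T) (hΔ : 0 < Δ₀)
include hT hΔ

theorem exists_pairSym_le (μ h : ℝ) :
    ∃ C : ℝ, 0 < C ∧ ∀ ξ, pairSym μ T Δ₀ h ξ ≤ C * (weight h ξ)⁻¹ := by
  refine ⟨Δ₀ * (1 + (1 + |μ|) / Δ₀), by positivity, fun ξ => ?_⟩
  have h1 := one_add_sq_le_dispersion (μ := μ) hΔ (h * (2 * π * ξ))
  have h2 := dispersion_le_KT (μ := μ) hT hΔ (h * (2 * π * ξ))
  have h3 := KT_pos (μ := μ) hT hΔ (h * (2 * π * ξ))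
  have hw := weight_pos h ξ
  rw [← weight_eq] at h1
  have hc : 0 < 1 + (1 + |μ|) / Δ₀ := by positivity
  rw [pairSym, ← div_eq_mul_inv, div_le_div_iff₀ (by positivity) hw, mul_assoc]
  gcongr
  calc weight h ξ ≤ (1 + (1 + |μ|) / Δ₀) * KT μ T Δ₀ (h * (2 * π * ξ)) := h1.trans (by gcongr)
    _ ≤ _ := by nlinarith [mul_pos hc h3]

variable (hh : 0 < h)
include hh

theorem integrable_pairSym : Integrable (pairSym μ T Δ₀ h) := by
  obtain ⟨C, -, hC⟩ := exists_pairSym_le hT hΔ μ h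
  refine ((integrable_inv_weight hh).const_mul C).mono'
    (continuous_pairSym hT hΔ).aestronglyMeasurable (.of_forall fun ξ => ?_)
  rw [Real.norm_of_nonneg (pairSym_pos hT hΔ ξ).le]
  exact hC ξ

theorem integrable_weight_pairSym_sq :
    Integrable fun ξ => weight h ξ * pairSym μ T Δ₀ h ξ ^ 2 := by
  obtain ⟨C, hC0, hC⟩ := exists_pairSym_le hT hΔ μ h
  refine ((integrable_inv_weight hh).const_mul (C ^ 2)).mono'
    ((continuous_weight h).mul ((continuous_pairSym hT hΔ).pow 2)).aestronglyMeasurable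
    (.of_forall fun ξ => ?_)
  have hw := weight_pos h ξ
  rw [Real.norm_of_nonneg (by positivity)]
  have h1 : pairSym μ T Δ₀ h ξ ^ 2 ≤ (C * (weight h ξ)⁻¹) ^ 2 :=
    pow_le_pow_left₀ (pairSym_pos hT hΔ ξ).le (hC ξ) 2
  calc weight h ξ * pairSym μ T Δ₀ h ξ ^ 2 ≤ weight h ξ * (C * (weight h ξ)⁻¹) ^ 2 := by gcongr
    _ = C ^ 2 * (weight h ξ)⁻¹ := by field_simp

theorem memLp_pairSym : MemLp (pairSym μ T Δ₀ h) 2 := by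
  rw [memLp_two_iff_integrable_sq (continuous_pairSym hT hΔ).aestronglyMeasurable]
  exact integrable_of_weight ((continuous_pairSym hT hΔ).pow 2).measurable
    (integrable_weight_pairSym_sq hT hΔ hh)

theorem alpha0_div (x : ℝ) :
    alpha0 μ T Δ₀ h (x / h) = ∫ ξ, phase (ξ * x) * (pairSym μ T Δ₀ h ξ : ℂ) := by
  set g : ℝ → ℂ := fun p => ((1 / KT μ T Δ₀ (h * p) : ℝ) : ℂ) *
    Complex.exp (p * (h * (x / h : ℝ)) * Complex.I) / (2 * π) with hg
  have h1 := Measure.integral_comp_mul_left g (2 * π)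
  rw [abs_of_pos (by positivity)] at h1
  have h2 : ∫ p, g p = (2 * π : ℝ) • ∫ ξ, g (2 * π * ξ) := by
    rw [h1, smul_smul, mul_inv_cancel₀ (by positivity), one_smul]
  rw [alpha0, h2, ← integral_smul, ← integral_const_mul]
  congr 1; funext ξ
  simp only [hg, pairSym, phase, Complex.real_smul]
  have e : ((2 * π * ξ : ℝ) : ℂ) * (h * (x / h : ℝ)) * Complex.I =
      ((2 * π * (ξ * x) : ℝ) : ℂ) * Complex.I := by
    have : (h : ℂ) ≠ 0 := Complex.ofReal_ne_zero.2 hh.ne'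
    push_cast; field_simp
  rw [e]
  have hp : (π : ℂ) ≠ 0 := Complex.ofReal_ne_zero.2 Real.pi_ne_zero
  have hK : (KT μ T Δ₀ (h * (2 * π * ξ)) : ℂ) ≠ 0 :=
    Complex.ofReal_ne_zero.2 (KT_pos hT hΔ _).ne'
  push_cast
  field_simp

theorem conj_alpha0_div (x : ℝ) :
    conj (alpha0 μ T Δ₀ h (x / h)) = alpha0 μ T Δ₀ h (x / h) := by
  rw [alpha0_div hT hΔ hh, ← integral_conj,
    ← integral_neg_eq_self (fun ξ => phase (ξ * x) * (pairSym μ T Δ₀ h ξ : ℂ))]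
  congr 1; funext ξ
  rw [map_mul, conj_phase, Complex.conj_ofReal, pairSym_neg, neg_mul]

theorem isKernel_alpha0 :
    IsKernel (rmul (pairSym μ T Δ₀ h)) fun x y => alpha0 μ T Δ₀ h ((x - y) / h) := by
  have ha : RBdd (pairSym μ T Δ₀ h) := rBdd_pairSym hT hΔ
  have hi : Integrable fun ξ => weight h ξ * sqSym (rmul (pairSym μ T Δ₀ h)) ξ := by
    refine (integrable_weight_pairSym_sq (μ := μ) hT hΔ hh).congr ?_
    filter_upwards [sqSym_rmul ha] with ξ e
    rw [e]
  have h1 := (isSymbol_rmul ha).isKernel hh (isPeriodicOp_rmul ha) hi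
  convert h1 using 3 with x y
  rw [alpha0_div hT hΔ hh, cellKernel]
  congr 1; funext ξ
  have e : phase (ξ * (x - y)) = phase (ξ * (x - ⌊y⌋)) * phase (-(ξ * Int.fract y)) := by
    rw [← phase_add]; congr 1; rw [Int.fract]; ring
  rw [e]; ring

theorem integral_norm_alpha0_sq :
    h * ∫ x : ℝ, ‖alpha0 μ T Δ₀ h x‖ ^ 2 = ∫ ξ, pairSym μ T Δ₀ h ξ ^ 2 := by
  have h1 := Measure.integral_comp_div (fun x => ‖alpha0 μ T Δ₀ h x‖ ^ 2) h
  rw [abs_of_pos hh, smul_eq_mul] at h1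
  rw [← h1]
  have h2 : MemLp (fun ξ => (pairSym μ T Δ₀ h ξ : ℂ)) 2 := (memLp_pairSym hT hΔ hh).ofReal
  have h3 := integral_conj_mul_fourierInv h2 (integrable_pairSym (μ := μ) hT hΔ hh).ofReal h2
    (integrable_pairSym (μ := μ) hT hΔ hh).ofReal
  simp_rw [← alpha0_div hT hΔ hh, Complex.conj_ofReal, ← Complex.normSq_eq_conj_mul_self,
    Complex.normSq_eq_norm_sq, ← Complex.ofReal_mul] at h3
  rw [integral_complex_ofReal, integral_complex_ofReal] at h3
  rw [Complex.ofReal_injective h3]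
  congr 1; funext ξ; ring

/-- The projection `ψ₀` in terms of the symbol of `α`. -/
theorem IsSymbol.psi0_eq {A : Op} {B : ℝ → ℝ → ℂ} (hA : IsPeriodicOp A) (hB : IsSymbol A B)
    (hi : Integrable fun ξ => weight h ξ * sqSym A ξ) : ∀ᵐ y ∂cellVol,
    psi0 μ T Δ₀ h (cellKernel B) y = ((∫ ξ, pairSym μ T Δ₀ h ξ ^ 2 : ℝ) : ℂ)⁻¹ *
      ∫ ξ, (pairSym μ T Δ₀ h ξ : ℂ) * (phase (ξ * y) * B ξ y) := by
  filter_upwards [hB.ae_memLp hh hA hi, ae_restrict_mem measurableSet_Ico] with y hy hm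
  rw [psi0, integral_norm_alpha0_sq hT hΔ hh]
  congr 1
  have h2 : MemLp (fun ξ => (pairSym μ T Δ₀ h ξ : ℂ)) 2 := (memLp_pairSym hT hΔ hh).ofReal
  have h1 : Integrable (fun ξ => (pairSym μ T Δ₀ h ξ : ℂ)) :=
    (integrable_pairSym (μ := μ) hT hΔ hh).ofReal
  have hph : AEStronglyMeasurable (fun ξ : ℝ => phase (-(ξ * y))) :=
    (by fun_prop : Measurable fun ξ : ℝ => phase (-(ξ * y))).aestronglyMeasurable
  have h4 : MemLp (fun ξ => phase (-(ξ * y)) * (pairSym μ T Δ₀ h ξ : ℂ)) 2 :=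
    h2.congr_norm (hph.mul h2.1) (.of_forall fun ξ => by
      rw [norm_mul, norm_phase, one_mul])
  have h5 : Integrable (fun ξ => phase (-(ξ * y)) * (pairSym μ T Δ₀ h ξ : ℂ)) :=
    h1.congr' (hph.mul h1.1) (.of_forall fun ξ => by
      rw [norm_mul, norm_phase, one_mul])
  have h3 := integral_conj_mul_fourierInv h4 h5 hy.2 hy.1
  have e1 : ∀ x, ∫ ξ, phase (ξ * x) * (phase (-(ξ * y)) * (pairSym μ T Δ₀ h ξ : ℂ)) =
      alpha0 μ T Δ₀ h ((x - y) / h) := by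
    intro x
    rw [alpha0_div hT hΔ hh]
    congr 1; funext ξ
    rw [show ξ * (x - y) = ξ * x + -(ξ * y) by ring, phase_add, mul_assoc]
  simp_rw [e1, conj_alpha0_div hT hΔ hh, ← cellKernel_eq hm] at h3
  rw [h3]
  congr 1; funext ξ
  rw [map_mul, conj_phase, neg_neg, Complex.conj_ofReal]
  ring

omit hT hΔ hh in
theorem periodic_psi0 (B : ℝ → ℝ → ℂ) (y : ℝ) (j : ℤ) :
    psi0 μ T Δ₀ h (cellKernel B) (y + j) = psi0 μ T Δ₀ h (cellKernel B) y := by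
  simp only [psi0]
  congr 1
  rw [← integral_add_right_eq_self _ (j : ℝ)]
  congr 1; funext x
  rw [cellKernel_add_int, add_sub_add_right_eq_sub]

end PairSym

/-! ### Coercivity of the pair form -/

section Coercive

variable {K a₀ : ℝ → ℝ} {δ τ β : ℝ} {c : ℝ → ℂ}

/-- Cauchy–Schwarz, since `1 / K` is a multiple of `a₀`. -/
theorem integrable_of_form (hτ : 0 < τ) (hK : ∀ ξ, τ ≤ K ξ) (hδ : 0 < δ)
    (hKa : ∀ ξ, K ξ * a₀ ξ = δ) (ha : Integrable a₀) (hc : AEStronglyMeasurable c)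
    (hi : Integrable fun ξ => K ξ * ‖c ξ‖ ^ 2) : Integrable c := by
  refine ((ha.const_mul δ⁻¹).add hi).mono' hc (.of_forall fun ξ => ?_)
  have hk : 0 < K ξ := hτ.trans_le (hK ξ)
  have e : δ⁻¹ * a₀ ξ = (K ξ)⁻¹ := by
    have : a₀ ξ = δ / K ξ := by rw [eq_div_iff hk.ne', mul_comm]; exact hKa ξ
    rw [this]; field_simp
  simp only [Pi.add_apply, e]
  have e2 : (K ξ)⁻¹ + K ξ * ‖c ξ‖ ^ 2 - ‖c ξ‖ =
      (K ξ)⁻¹ * (1 - K ξ * ‖c ξ‖ + (K ξ * ‖c ξ‖) ^ 2) := by field_simp; ring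
  have : 0 ≤ (K ξ)⁻¹ * (1 - K ξ * ‖c ξ‖ + (K ξ * ‖c ξ‖) ^ 2) :=
    mul_nonneg (inv_pos.2 hk).le (by nlinarith [sq_nonneg (K ξ * ‖c ξ‖ - 1)])
  linarith

/-- The form `∫ K |x|² - β |∫ x|²` is coercive on the orthogonal complement of its kernel, which
is spanned by `a₀ = δ / K`. The idea is to replace `∫ x` by `∫ (1 - τ / K) x`. -/
theorem form_coercive_orthogonal (hτ : 0 < τ) (hK : ∀ ξ, τ ≤ K ξ) (hKm : Measurable K) (hδ : 0 < δ)
    (hKa : ∀ ξ, K ξ * a₀ ξ = δ) (ha : Integrable a₀) (hβ : 0 < β) (hgap : β * ∫ ξ, a₀ ξ = δ)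
    (hc : AEStronglyMeasurable c) (hi : Integrable fun ξ => K ξ * ‖c ξ‖ ^ 2)
    (h0 : ∫ ξ, (a₀ ξ : ℂ) * c ξ = 0) :
    β * τ / δ ^ 2 * (∫ ξ, a₀ ξ ^ 2) * (∫ ξ, K ξ * ‖c ξ‖ ^ 2) ≤
      (∫ ξ, K ξ * ‖c ξ‖ ^ 2) - β * ‖∫ ξ, c ξ‖ ^ 2 := by
  have hci := integrable_of_form hτ hK hδ hKa ha hc hi
  have hk : ∀ ξ, 0 < K ξ := fun ξ => hτ.trans_le (hK ξ)
  have ea : ∀ ξ, a₀ ξ = δ / K ξ := fun ξ => by rw [eq_div_iff (hk ξ).ne', mul_comm]; exact hKa ξ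
  have ha0 : ∀ ξ, 0 < a₀ ξ := fun ξ => by rw [ea]; exact div_pos hδ (hk ξ)
  have hle : ∀ ξ, τ / δ * a₀ ξ ≤ 1 := fun ξ => by
    rw [ea]
    calc τ / δ * (δ / K ξ) = τ / K ξ := by field_simp
      _ ≤ 1 := (div_le_one (hk ξ)).2 (hK ξ)
  have ham : Measurable a₀ := by
    have : a₀ = fun ξ => δ / K ξ := funext ea
    rw [this]; fun_prop
  have ha2 : Integrable fun ξ => a₀ ξ ^ 2 := by
    refine (ha.const_mul (δ / τ)).mono' (ham.pow_const 2).aestronglyMeasurable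
      (.of_forall fun ξ => ?_)
    rw [Real.norm_of_nonneg (by positivity), sq]
    have h1 := hle ξ
    have h2 : a₀ ξ ≤ δ / τ := by
      rw [le_div_iff₀ hτ]
      calc a₀ ξ * τ = τ / δ * a₀ ξ * δ := by field_simp
        _ ≤ 1 * δ := by gcongr
        _ = δ := one_mul δ
    exact mul_le_mul_of_nonneg_right h2 (ha0 ξ).le
  -- The weight `(1 - τ / K)² / K`, together with the bound `(1 - τ / K) / K`.
  set φ : ℝ → ℝ := fun ξ => (1 - τ / δ * a₀ ξ) * sqrt (a₀ ξ / δ) with hφ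
  set f : ℝ → ℂ := fun ξ => ((sqrt (K ξ) : ℝ) : ℂ) * c ξ with hf
  have e1 : ∀ ξ, φ ξ ^ 2 ≤ δ⁻¹ * a₀ ξ - τ / δ ^ 2 * a₀ ξ ^ 2 := fun ξ => by
    rw [hφ, mul_pow, Real.sq_sqrt (div_pos (ha0 ξ) hδ).le]
    have h1 := hle ξ
    have h2 : 0 < τ / δ * a₀ ξ := mul_pos (div_pos hτ hδ) (ha0 ξ)
    have h3 : (1 - τ / δ * a₀ ξ) ^ 2 ≤ 1 - τ / δ * a₀ ξ := by nlinarith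
    calc (1 - τ / δ * a₀ ξ) ^ 2 * (a₀ ξ / δ) ≤ (1 - τ / δ * a₀ ξ) * (a₀ ξ / δ) :=
          mul_le_mul_of_nonneg_right h3 (div_pos (ha0 ξ) hδ).le
      _ = _ := by field_simp
  have hφm : Measurable φ := by fun_prop
  have hφ2 : MemLp φ 2 := by
    rw [memLp_two_iff_integrable_sq hφm.aestronglyMeasurable]
    refine ((ha.const_mul δ⁻¹).sub (ha2.const_mul (τ / δ ^ 2))).mono'
      (hφm.pow_const 2).aestronglyMeasurable (.of_forall fun ξ => ?_)
    rw [Real.norm_of_nonneg (sq_nonneg _)]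
    exact e1 ξ
  have e2 : ∀ ξ, ‖f ξ‖ ^ 2 = K ξ * ‖c ξ‖ ^ 2 := fun ξ => by
    rw [hf, norm_mul, mul_pow, Complex.norm_real, Real.norm_eq_abs, sq_abs,
      Real.sq_sqrt (hk ξ).le]
  have hfm : AEStronglyMeasurable f :=
    (by fun_prop : Measurable fun ξ => ((sqrt (K ξ) : ℝ) : ℂ)).aestronglyMeasurable.mul hc
  have hf2 : MemLp f 2 := by
    rw [memLp_two_iff_integrable_sq_norm hfm]
    simp_rw [e2]
    exact hi
  have h1 := norm_sq_integral_mul_le (f := fun ξ => (φ ξ : ℂ)) hφ2.ofReal hf2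
  simp_rw [e2, Complex.norm_real, Real.norm_eq_abs, sq_abs] at h1
  have h2 : ∫ ξ, (φ ξ : ℂ) * f ξ = ∫ ξ, c ξ := by
    have e3 : ∀ ξ, (φ ξ : ℂ) * f ξ = c ξ - (τ / δ : ℝ) * ((a₀ ξ : ℂ) * c ξ) := fun ξ => by
      have h3 : sqrt (a₀ ξ / δ) * sqrt (K ξ) = 1 := by
        rw [← Real.sqrt_mul (div_pos (ha0 ξ) hδ).le, div_mul_eq_mul_div, mul_comm, hKa ξ,
          div_self hδ.ne', Real.sqrt_one]
      have h4 : ((sqrt (a₀ ξ / δ) : ℝ) : ℂ) * ((sqrt (K ξ) : ℝ) : ℂ) = 1 := by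
        rw [← Complex.ofReal_mul, h3, Complex.ofReal_one]
      simp only [hφ, hf]
      push_cast
      linear_combination (1 - (τ : ℂ) / δ * a₀ ξ) * c ξ * h4
    have hac : Integrable fun ξ => (a₀ ξ : ℂ) * c ξ := by
      refine (hci.norm.const_mul (δ / τ)).mono' ((by fun_prop : Measurable fun ξ =>
        (a₀ ξ : ℂ)).aestronglyMeasurable.mul hc) (.of_forall fun ξ => ?_)
      rw [norm_mul, Complex.norm_real, Real.norm_of_nonneg (ha0 ξ).le]
      have h2 : a₀ ξ ≤ δ / τ := by
        rw [le_div_iff₀ hτ]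
        calc a₀ ξ * τ = τ / δ * a₀ ξ * δ := by field_simp
          _ ≤ 1 * δ := by have := hle ξ; gcongr
          _ = δ := one_mul δ
      gcongr
    simp_rw [e3]
    rw [integral_sub hci (hac.const_mul _), integral_const_mul, h0, mul_zero, sub_zero]
  rw [h2] at h1
  have h3 : ∫ ξ, φ ξ ^ 2 ≤ δ⁻¹ * (∫ ξ, a₀ ξ) - τ / δ ^ 2 * ∫ ξ, a₀ ξ ^ 2 := by
    rw [← integral_const_mul, ← integral_const_mul, ← integral_sub (ha.const_mul _)
      (ha2.const_mul _)]
    exact integral_mono hφ2.integrable_sq ((ha.const_mul _).sub (ha2.const_mul _)) e1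
  have hI : 0 ≤ ∫ ξ, K ξ * ‖c ξ‖ ^ 2 :=
    integral_nonneg fun ξ => mul_nonneg (hk ξ).le (sq_nonneg _)
  have h4 : β * ‖∫ ξ, c ξ‖ ^ 2 ≤ β * ((δ⁻¹ * (∫ ξ, a₀ ξ) - τ / δ ^ 2 * ∫ ξ, a₀ ξ ^ 2) *
      ∫ ξ, K ξ * ‖c ξ‖ ^ 2) := by
    refine mul_le_mul_of_nonneg_left (h1.trans ?_) hβ.le
    exact mul_le_mul_of_nonneg_right h3 hI
  have h5 : β * (δ⁻¹ * ∫ ξ, a₀ ξ) = 1 := by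
    rw [mul_left_comm, hgap, inv_mul_cancel₀ hδ.ne']
  have h6 : β * ((δ⁻¹ * (∫ ξ, a₀ ξ) - τ / δ ^ 2 * ∫ ξ, a₀ ξ ^ 2) * ∫ ξ, K ξ * ‖c ξ‖ ^ 2) =
      (∫ ξ, K ξ * ‖c ξ‖ ^ 2) -
        β * τ / δ ^ 2 * (∫ ξ, a₀ ξ ^ 2) * ∫ ξ, K ξ * ‖c ξ‖ ^ 2 := by
    linear_combination (∫ ξ, K ξ * ‖c ξ‖ ^ 2) * h5
  linarith

/-- Adding a multiple of `a₀` does not change the form `∫ K |c|² - β |∫ c|²`, so that the form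
controls the part of `c` orthogonal to `a₀`. -/
theorem form_coercive (hτ : 0 < τ) (hK : ∀ ξ, τ ≤ K ξ) (hKm : Measurable K) (hδ : 0 < δ)
    (hKa : ∀ ξ, K ξ * a₀ ξ = δ) (ha : Integrable a₀) (ha2 : MemLp a₀ 2) (hβ : 0 < β)
    (hgap : β * ∫ ξ, a₀ ξ = δ)
    (hc : AEStronglyMeasurable c) (hi : Integrable fun ξ => K ξ * ‖c ξ‖ ^ 2) {z : ℂ}
    (hz : ((∫ ξ, a₀ ξ ^ 2 : ℝ) : ℂ) * z = ∫ ξ, (a₀ ξ : ℂ) * c ξ) :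
    Integrable (fun ξ => K ξ * ‖c ξ - z * a₀ ξ‖ ^ 2) ∧
    ∫ ξ, (a₀ ξ : ℂ) * (c ξ - z * a₀ ξ) = 0 ∧
    β * τ / δ ^ 2 * (∫ ξ, a₀ ξ ^ 2) * (∫ ξ, K ξ * ‖c ξ - z * a₀ ξ‖ ^ 2) ≤
      (∫ ξ, K ξ * ‖c ξ‖ ^ 2) - β * ‖∫ ξ, c ξ‖ ^ 2 := by
  have hk : ∀ ξ, 0 < K ξ := fun ξ => hτ.trans_le (hK ξ)
  have hci := integrable_of_form hτ hK hδ hKa ha hc hi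
  have hac : AEStronglyMeasurable (fun ξ => (a₀ ξ : ℂ)) := ha.ofReal.1
  have hxm : AEStronglyMeasurable (fun ξ => c ξ - z * a₀ ξ) := hc.sub (hac.const_mul z)
  have hre : ∀ ξ, K ξ * ‖c ξ - z * a₀ ξ‖ ^ 2 = K ξ * ‖c ξ‖ ^ 2 + ‖z‖ ^ 2 * δ * a₀ ξ -
      2 * δ * (conj z * c ξ).re := by
    intro ξ
    rw [← Complex.normSq_eq_norm_sq, ← Complex.normSq_eq_norm_sq, ← Complex.normSq_eq_norm_sq,
      Complex.normSq_apply, Complex.normSq_apply, Complex.normSq_apply]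
    simp only [Complex.sub_re, Complex.sub_im, Complex.mul_re, Complex.mul_im,
      Complex.conj_re, Complex.conj_im, Complex.ofReal_re, Complex.ofReal_im]
    have := hKa ξ
    rw [← this]
    ring
  have hzc : Integrable fun ξ => conj z * c ξ := hci.const_mul _
  have hi1 : Integrable fun ξ => K ξ * ‖c ξ‖ ^ 2 + ‖z‖ ^ 2 * δ * a₀ ξ :=
    hi.add (ha.const_mul _)
  have hi2 : Integrable fun ξ => 2 * δ * (conj z * c ξ).re := hzc.re.const_mul _
  have hxi : Integrable fun ξ => K ξ * ‖c ξ - z * a₀ ξ‖ ^ 2 := by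
    simp_rw [hre]
    exact hi1.sub hi2
  have hcc : MemLp c 2 := by
    rw [memLp_two_iff_integrable_sq_norm hc]
    refine (hi.const_mul τ⁻¹).mono' (hc.norm.pow 2) (.of_forall fun ξ => ?_)
    rw [Real.norm_of_nonneg (by positivity), ← mul_assoc]
    refine le_mul_of_one_le_left (by positivity) ?_
    rw [inv_mul_eq_div, one_le_div hτ]
    exact hK ξ
  have hx0 : ∫ ξ, (a₀ ξ : ℂ) * (c ξ - z * a₀ ξ) = 0 := by
    have e : ∀ ξ, (a₀ ξ : ℂ) * (c ξ - z * a₀ ξ) = (a₀ ξ : ℂ) * c ξ - z * ((a₀ ξ ^ 2 : ℝ) : ℂ) := by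
      intro ξ; push_cast; ring
    simp_rw [e]
    have i1 : Integrable fun ξ => (a₀ ξ : ℂ) * c ξ := ha2.ofReal.integrable_mul hcc
    have i2 : Integrable fun ξ => z * ((a₀ ξ ^ 2 : ℝ) : ℂ) :=
      ha2.integrable_sq.ofReal.const_mul z
    rw [integral_sub i1 i2,
      integral_const_mul, integral_complex_ofReal, ← hz]
    ring
  refine ⟨hxi, hx0, ?_⟩
  refine (form_coercive_orthogonal hτ hK hKm hδ hKa ha hβ hgap hxm hxi hx0).trans (le_of_eq ?_)
  have h1 : ∫ ξ, K ξ * ‖c ξ - z * a₀ ξ‖ ^ 2 = (∫ ξ, K ξ * ‖c ξ‖ ^ 2) + ‖z‖ ^ 2 * δ * (∫ ξ, a₀ ξ) -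
      2 * δ * (conj z * ∫ ξ, c ξ).re := by
    simp_rw [hre]
    rw [integral_sub hi1 hi2, integral_add hi (ha.const_mul _), integral_const_mul,
      integral_const_mul, ← integral_const_mul (conj z)]
    congr 2
    exact integral_re hzc
  have h2 : ∫ ξ, (c ξ - z * a₀ ξ) = (∫ ξ, c ξ) - z * ((∫ ξ, a₀ ξ : ℝ) : ℂ) := by
    have i2 : Integrable fun ξ => z * (a₀ ξ : ℂ) := ha.ofReal.const_mul z
    rw [integral_sub hci i2, integral_const_mul, integral_complex_ofReal]
  rw [h1, h2, ← Complex.normSq_eq_norm_sq, ← Complex.normSq_eq_norm_sq,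
    ← Complex.normSq_eq_norm_sq, Complex.normSq_apply, Complex.normSq_apply, Complex.normSq_apply]
  simp only [Complex.sub_re, Complex.sub_im, Complex.mul_re, Complex.mul_im,
    Complex.conj_re, Complex.conj_im, Complex.ofReal_re, Complex.ofReal_im]
  rw [← hgap]
  ring

end Coercive

/-! ### Sums over the centre-of-mass coefficients -/

theorem HasCoef.hasSum_integral {A : Op} {c : ℤ → ℝ → ℂ} (hA : IsPeriodicOp A) (hc : HasCoef A c)
    {φ : ℝ → ℝ} (hφ : Continuous φ) (hφ0 : ∀ ξ, 0 < φ ξ)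
    (hs : Integrable (sqSym A)) (hi : Integrable fun ξ => φ ξ * sqSym A ξ) :
    (∀ m, Integrable fun ξ => φ ξ * ‖c m ξ‖ ^ 2) ∧
      HasSum (fun m => ∫ ξ, φ ξ * ‖c m ξ‖ ^ 2) (∫ ξ, φ ξ * sqSym A ξ) := by
  have h1 : ∀ᵐ ξ : ℝ, HasSum (fun m => φ ξ * ‖c m ξ‖ ^ 2) (φ ξ * sqSym A ξ) := by
    filter_upwards [hc.hasSum hA] with ξ h using h.mul_left _
  have hpos : ∀ m ξ, 0 ≤ φ ξ * ‖c m ξ‖ ^ 2 := fun m ξ => mul_nonneg (hφ0 ξ).le (by positivity)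
  have hm : ∀ m, Integrable fun ξ => φ ξ * ‖c m ξ‖ ^ 2 := by
    intro m
    refine hi.mono' (hφ.aestronglyMeasurable.mul ((hc.memLp hA hs m).1.norm.pow 2)) ?_
    filter_upwards [h1] with ξ h
    rw [Real.norm_of_nonneg (hpos m ξ)]
    exact le_hasSum h m fun k _ => hpos k ξ
  refine ⟨hm, ?_⟩
  have h2 : Summable fun m => ∫ ξ, ‖φ ξ * ‖c m ξ‖ ^ 2‖ := by
    refine summable_of_sum_le (c := ∫ ξ, φ ξ * sqSym A ξ)
      (fun m => integral_nonneg fun ξ => norm_nonneg _) fun s => ?_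
    simp_rw [fun m ξ => Real.norm_of_nonneg (hpos m ξ)]
    rw [← integral_finsetSum _ fun m _ => hm m]
    refine integral_mono_ae (integrable_finsetSum _ fun m _ => hm m) hi ?_
    filter_upwards [h1] with ξ h
    exact sum_le_hasSum s (fun m _ => hpos m ξ) h
  have h3 := hasSum_integral_of_summable_integral_norm hm h2
  have h4 : ∫ ξ, ∑' m, φ ξ * ‖c m ξ‖ ^ 2 = ∫ ξ, φ ξ * sqSym A ξ := by
    apply integral_congr_ae
    filter_upwards [h1] with ξ h using h.tsum_eq
  rwa [h4] at h3

theorem HasCoef.h1NormSq_le {A : Op} {c : ℤ → ℝ → ℂ} (hA : IsPeriodicOp A) (hc : HasCoef A c)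
    {h : ℝ} (hm : ∀ m, Integrable fun ξ => weight h ξ * ‖c m ξ‖ ^ 2)
    {b : ℤ → ℝ} (hle : ∀ m, ∫ ξ, weight h ξ * ‖c m ξ‖ ^ 2 ≤ b m) {S : ℝ} (hb : Summable b)
    (hS : ∑' m, b m ≤ S) : h1NormSq h A ≤ ENNReal.ofReal S := by
  have hpos : ∀ m ξ, 0 ≤ weight h ξ * ‖c m ξ‖ ^ 2 :=
    fun m ξ => mul_nonneg (weight_pos h ξ).le (by positivity)
  rw [h1NormSq, trForm_eq_lintegral hA (by fun_prop)]
  have h1 : ∫⁻ ξ, ENNReal.ofReal (1 + h ^ 2 * (2 * π * ξ) ^ 2) *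
      ENNReal.ofReal (diagSym (A ∘L adjoint A) ξ) =
      ∫⁻ ξ, ∑' m, ENNReal.ofReal (weight h ξ * ‖c m ξ‖ ^ 2) := by
    apply lintegral_congr_ae
    filter_upwards [hc.hasSum hA] with ξ h2
    change ENNReal.ofReal (weight h ξ) * ENNReal.ofReal (sqSym A ξ) = _
    rw [← ENNReal.ofReal_mul (weight_pos h ξ).le, ← ENNReal.ofReal_tsum_of_nonneg (hpos · ξ)
      (h2.mul_left (weight h ξ)).summable, (h2.mul_left (weight h ξ)).tsum_eq]
  rw [h1, lintegral_tsum fun m => (hm m).1.aemeasurable.ennreal_ofReal]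
  have h3 : ∀ m, ∫⁻ ξ, ENNReal.ofReal (weight h ξ * ‖c m ξ‖ ^ 2) ≤ ENNReal.ofReal (b m) := by
    intro m
    rw [← ofReal_integral_eq_lintegral_ofReal (hm m) (.of_forall (hpos m))]
    exact ENNReal.ofReal_le_ofReal (hle m)
  refine (ENNReal.tsum_le_tsum h3).trans ?_
  rw [← ENNReal.ofReal_tsum_of_nonneg (fun m => (integral_nonneg (hpos m)).trans (hle m)) hb]
  exact ENNReal.ofReal_le_ofReal hS

/-! ### Consequences of the energy inequality -/

/-- Bounds for the pair symbol `a₀` and the symbol `K`, with a constant that does not depend on `h`: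
`a₀` has size of order `h` and lives on the momentum scale `1 / h`. Here `β` is the coupling, and `τ`
and `δ` are the constants with `τ ≤ K` and `K a₀ = δ`. -/
structure PairBounds (C h β τ δ : ℝ) (K a₀ : ℝ → ℝ) : Prop where
  weight_le : ∀ ξ, weight h ξ ≤ C * K ξ
  mass_le : ∫ ξ, weight h ξ * a₀ ξ ^ 2 ≤ C * h
  mass_ge : h ≤ C * ∫ ξ, (weight h ξ)⁻¹ * a₀ ξ ^ 2
  shift_le : ∀ m : ℤ, Integrable (fun ξ => weight h ξ * (a₀ ξ - a₀ (ξ - m)) ^ 2) ∧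
    ∫ ξ, weight h ξ * (a₀ ξ - a₀ (ξ - m)) ^ 2 ≤ C * h * (h * (2 * π * m)) ^ 2
  shift_ge : ∀ m : ℤ, h * min 1 ((h * (2 * π * m)) ^ 2) ≤
    C * ∫ ξ, (a₀ ξ - a₀ (ξ - m)) ^ 2
  far_le : ∀ m : ℤ, (1 + (h * (2 * π * m)) ^ 2) *
    ∫ ξ, (weight h ξ)⁻¹ * a₀ (ξ - m) ^ 2 ≤ C * h
  coercive : 1 ≤ C * (β * τ / δ ^ 2 * ∫ ξ, a₀ ξ ^ 2)

theorem mul_integral_pairSym {μ a T Δ₀ h : ℝ} (ha : 0 < a) (hh : 0 < h)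
    (hgap : IsGap μ a T Δ₀) : a * h * ∫ ξ, pairSym μ T Δ₀ h ξ = Δ₀ / 2 := by
  have h1 := Measure.integral_comp_mul_left (fun p => Δ₀ / (2 * KT μ T Δ₀ p)) (h * (2 * π))
  have h2 : ∫ ξ, pairSym μ T Δ₀ h ξ = ∫ ξ, Δ₀ / (2 * KT μ T Δ₀ (h * (2 * π) * ξ)) := by
    simp only [pairSym, mul_assoc]
  have h3 : ∫ p, Δ₀ / (2 * KT μ T Δ₀ p) = Δ₀ * π * (1 / a) := by
    rw [hgap.2, ← integral_const_mul]
    congr 1; funext p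
    have := Real.pi_pos
    field_simp
  rw [h2, h1, h3, abs_of_pos (by positivity), smul_eq_mul]
  have := Real.pi_pos
  field_simp

section Energy

variable {μ a T Δ₀ h C M : ℝ} {W : ℝ → ℝ} {Γ : SumOp}

/-- Bounds on the terms of the energy inequality of `energy_gap_le`, when the potential term is
absorbed. -/
theorem energy_bounds (ha : 0 < a) (hT : 0 < T) (hh : 0 < h) (hgap : IsGap μ a T Δ₀)
    (hC : 0 < C) (hP : PairBounds C h (a * h) (2 * T) (Δ₀ / 2)
      (fun ξ => KT μ T Δ₀ (h * (2 * π * ξ))) (pairSym μ T Δ₀ h))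
    (hW : RBdd W) (hWp : Function.Periodic W 1) (hWM : ∀ x, |W x| ≤ M) (hΓ : Admissible Γ)
    (hE : energy μ a T h W Γ ≤ energy μ a T h W (Gamma0 μ T Δ₀ h)) :
    Integrable (fun ξ => weight h ξ * sqSym (entry12 Γ) ξ) ∧
    Integrable (fun ξ => weight h ξ * sqSym (entry11 Γ - rmul (densSym μ T Δ₀ h)) ξ) ∧
    Integrable (fun ξ => (devSym Γ ξ - gapTanh μ T Δ₀ h ξ ^ 2) ^ 2) ∧
    (∫ ξ, weight h ξ * sqSym (entry11 Γ - rmul (densSym μ T Δ₀ h)) ξ) / (2 * C) +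
      ((∫ ξ, KT μ T Δ₀ (h * (2 * π * ξ)) * sqSym (entry12 Γ) ξ) -
        a * h * diagSq (entry12 Γ)) +
      T / 12 * (∫ ξ, (devSym Γ ξ - gapTanh μ T Δ₀ h ξ ^ 2) ^ 2) ≤ C * M ^ 2 * h ^ 3 := by
  have hΔ := hgap.1
  have hs := hΓ.isState
  obtain ⟨hG, hA, hR, hle⟩ := energy_gap_le hT hΔ hh hW hWp hΓ hE
  refine ⟨hA, hG, hR, ?_⟩
  have hgb := rBdd_densSym (μ := μ) (h := h) hT hΔ
  have hab := rBdd_pairSym (μ := μ) (h := h) hT hΔ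
  have hper : IsPeriodicOp (entry11 Γ - rmul (densSym μ T Δ₀ h)) :=
    hs.periodic11.sub (isPeriodicOp_rmul hgb)
  have hi := mul_integral_pairSym ha hh hgap
  -- By the gap equation, `a₀` lies in the kernel of the pair form.
  have h0 : (∫ ξ, KT μ T Δ₀ (h * (2 * π * ξ)) * pairSym μ T Δ₀ h ξ ^ 2) -
      a * h * diagSq (rmul (pairSym μ T Δ₀ h)) = 0 := by
    rw [diagSq_rmul hh hab (integrable_weight_pairSym_sq hT hΔ hh)]
    have e : ∀ ξ, KT μ T Δ₀ (h * (2 * π * ξ)) * pairSym μ T Δ₀ h ξ ^ 2 =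
        Δ₀ / 2 * pairSym μ T Δ₀ h ξ := fun ξ => by
      have := KT_pos (μ := μ) hT hΔ (h * (2 * π * ξ))
      rw [pairSym]; field_simp
    simp_rw [e]
    rw [integral_const_mul, ← hi]
    ring
  rw [h0, zero_add] at hle
  set G := ∫ ξ, weight h ξ * sqSym (entry11 Γ - rmul (densSym μ T Δ₀ h)) ξ with hGdef
  have hn := sqSym_nonneg hper
  have hKG : G ≤ C * ∫ ξ, KT μ T Δ₀ (h * (2 * π * ξ)) *
      sqSym (entry11 Γ - rmul (densSym μ T Δ₀ h)) ξ := by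
    rw [← integral_const_mul]
    have hKm : Measurable fun ξ => KT μ T Δ₀ (h * (2 * π * ξ)) :=
      ((continuous_KT (μ := μ) hT hΔ).comp
        (by fun_prop : Continuous fun ξ : ℝ => h * (2 * π * ξ))).measurable
    have hKi : Integrable fun ξ => KT μ T Δ₀ (h * (2 * π * ξ)) *
        sqSym (entry11 Γ - rmul (densSym μ T Δ₀ h)) ξ := by
      refine (hG.const_mul (1 + |μ| + Δ₀ + 2 * T)).mono' (hKm.mul (measurable_sqSym _)).aestronglyMeasurable ?_
      filter_upwards [hn] with ξ f1
      rw [Real.norm_of_nonneg (mul_nonneg (KT_pos hT hΔ _).le f1)]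
      exact (mul_le_mul_of_nonneg_right (KT_le_weight hT hΔ ξ) f1).trans (mul_assoc _ _ _).le
    refine integral_mono_ae hG (hKi.const_mul C) ?_
    filter_upwards [hn] with ξ f1
    exact (mul_le_mul_of_nonneg_right (hP.weight_le ξ) f1).trans (mul_assoc _ _ _).le
  -- With this weight, half of the kinetic term absorbs the Hilbert–Schmidt part of the potential.
  have ht : 0 < 2 * h ^ 2 * C := by positivity
  have htr := norm_trPV_mulOp_le hper hh hW (fun x => by simp only [hWp x]) (M := M)
    (fun x => by rw [Complex.norm_real]; exact hWM x) hG ht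
  change _ ≤ _ + _ * G at htr
  have h1 : h ^ 2 * ‖trPV (mulOp (fun x => (W x : ℂ)) ∘L
      (entry11 Γ - rmul (densSym μ T Δ₀ h)))‖ ≤ C * M ^ 2 * h ^ 3 + G / (2 * C) := by
    refine (mul_le_mul_of_nonneg_left htr (sq_nonneg h)).trans (le_of_eq ?_)
    field_simp
  have h2 : G / C ≤ ∫ ξ, KT μ T Δ₀ (h * (2 * π * ξ)) *
      sqSym (entry11 Γ - rmul (densSym μ T Δ₀ h)) ξ := by
    rw [div_le_iff₀ hC, mul_comm]; exact hKG
  have h3 : G / C = G / (2 * C) + G / (2 * C) := by field_simp; ring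
  linarith

/-- The pair density `α α*` is bounded in a weak norm. The identity `IsState.devSym_eq` expresses it
by `(1 - 2Γ)²`, which the quadratic term of the entropy inequality controls, and by `γ`. -/
theorem integral_inv_weight_sqSym_le (hT : 0 < T) (hΔ : 0 < Δ₀) (hh : 0 < h) (hΓ : Admissible Γ)
    (hA : Integrable (fun ξ => weight h ξ * sqSym (entry12 Γ) ξ))
    (hG : Integrable (fun ξ => weight h ξ * sqSym (entry11 Γ - rmul (densSym μ T Δ₀ h)) ξ))
    (hR : Integrable (fun ξ => (devSym Γ ξ - gapTanh μ T Δ₀ h ξ ^ 2) ^ 2)) :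
    Integrable (fun ξ => (weight h ξ)⁻¹ * sqSym (entry12 Γ) ξ) ∧
    ∫ ξ, (weight h ξ)⁻¹ * sqSym (entry12 Γ) ξ ≤
      (∫ ξ, (devSym Γ ξ - gapTanh μ T Δ₀ h ξ ^ 2) ^ 2) / (8 * h ^ 2) +
      (∫ ξ, weight h ξ * sqSym (entry11 Γ - rmul (densSym μ T Δ₀ h)) ξ) / (2 * h ^ 2) +
      (∫ ξ, weight h ξ * pairSym μ T Δ₀ h ξ ^ 2) + h := by
  have hs := hΓ.isState
  have hgb := rBdd_densSym (μ := μ) (h := h) hT hΔ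
  have hper : IsPeriodicOp (entry11 Γ - rmul (densSym μ T Δ₀ h)) :=
    hs.periodic11.sub (isPeriodicOp_rmul hgb)
  have hsa : adjoint (entry11 Γ) = entry11 Γ :=
    adjoint_entry11 hs.nonneg.isSelfAdjoint
  have hsa' : adjoint (entry11 Γ - rmul (densSym μ T Δ₀ h)) =
      entry11 Γ - rmul (densSym μ T Δ₀ h) := by
    rw [map_sub, hsa, rmul, adjoint_fmul hgb]
    simp only [Complex.conj_ofReal]
  -- `sqSym (γ - γ₀ - r) ≥ 0` bounds the diagonal of `γ - γ₀` by its square and a constant.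
  set r : ℝ → ℝ := fun ξ => h ^ 2 * (1 - 2 * densSym μ T Δ₀ h ξ) with hr
  have hd : ∀ ξ, |1 - 2 * densSym μ T Δ₀ h ξ| ≤ 1 := fun ξ => by
    have := densSym_mem (μ := μ) (h := h) hT hΔ ξ
    rw [abs_le]; constructor <;> linarith [this.1, this.2]
  have hrb : RBdd r := by
    refine rBdd_of_le (C := h ^ 2) ?_ fun ξ => ?_
    · exact (measurable_const.sub ((continuous_densSym hT hΔ).measurable.const_mul 2)).const_mul _
    · rw [hr, abs_mul, abs_of_nonneg (sq_nonneg h)]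
      exact mul_le_of_le_one_right (sq_nonneg h) (hd ξ)
  have hn1 := sqSym_nonneg hs.periodic12
  have hpt : ∀ᵐ ξ : ℝ, (weight h ξ)⁻¹ * sqSym (entry12 Γ) ξ ≤
      (devSym Γ ξ - gapTanh μ T Δ₀ h ξ ^ 2) ^ 2 / (8 * h ^ 2) +
      weight h ξ * sqSym (entry11 Γ - rmul (densSym μ T Δ₀ h)) ξ / (2 * h ^ 2) +
      weight h ξ * pairSym μ T Δ₀ h ξ ^ 2 + 2 * h ^ 2 * (weight h ξ)⁻¹ := by
    filter_upwards [hs.devSym_eq, sqSym_sub_rmul hs.periodic11 hsa hgb,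
      sqSym_sub_rmul hper hsa' hrb, sqSym_nonneg (hper.sub (isPeriodicOp_rmul hrb)),
      diagSym_sub (entry11 Γ) (rmul (densSym μ T Δ₀ h)), diagSym_rmul hgb, hn1,
      sqSym_nonneg hper] with ξ f1 f2 f3 f4 f5 f6 f7 f8
    rw [f3, f5, f6] at f4
    have hg2 := gapTanh_sq (μ := μ) (h := h) hT hΔ ξ
    set d := densSym μ T Δ₀ h ξ
    set p := pairSym μ T Δ₀ h ξ
    set g := sqSym (entry11 Γ - rmul (densSym μ T Δ₀ h)) ξ
    set q := sqSym (entry12 Γ) ξ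
    set ρ := devSym Γ ξ - gapTanh μ T Δ₀ h ξ ^ 2 with hρ
    simp only [hr] at f4
    have hdd : (1 - 2 * d) ^ 2 ≤ 1 := (sq_le_one_iff_abs_le_one _).2 (hd ξ)
    have e1 : ρ = 4 * (g - (1 - 2 * d) * (dens Γ ξ - d) + q - p ^ 2) := by
      rw [hρ, f1, ← hg2, f2]; simp only [dens]; ring
    have hh2 : 0 < h ^ 2 := by positivity
    have e2 : (1 - 2 * d) * (dens Γ ξ - d) ≤ g / (2 * h ^ 2) + h ^ 2 / 2 := by
      have e3 : 2 * h ^ 2 * ((1 - 2 * d) * (dens Γ ξ - d)) ≤ g + (h ^ 2) ^ 2 := by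
        simp only [dens]
        have : (h ^ 2 * (1 - 2 * d)) ^ 2 ≤ (h ^ 2) ^ 2 := by
          rw [mul_pow]; exact mul_le_of_le_one_right (sq_nonneg _) hdd
        linarith
      rw [← mul_le_mul_iff_right₀ (by positivity : 0 < 2 * h ^ 2)]
      refine e3.trans (le_of_eq ?_)
      field_simp
    have e4 : ρ / 4 ≤ ρ ^ 2 / (8 * h ^ 2) + h ^ 2 := by
      have : ρ ^ 2 / (8 * h ^ 2) + h ^ 2 - ρ / 4 =
          ((ρ - h ^ 2) ^ 2 + 7 * (h ^ 2) ^ 2) / (8 * h ^ 2) := by field_simp; ring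
      have h0 : 0 ≤ ((ρ - h ^ 2) ^ 2 + 7 * (h ^ 2) ^ 2) / (8 * h ^ 2) := by positivity
      linarith
    have e5 : q ≤ ρ ^ 2 / (8 * h ^ 2) + g / (2 * h ^ 2) + p ^ 2 + 2 * h ^ 2 := by linarith
    have hw1 := one_le_weight h ξ
    have hw : (weight h ξ)⁻¹ ≤ 1 := inv_le_one_of_one_le₀ hw1
    have hw0 : 0 < (weight h ξ)⁻¹ := inv_pos.2 (weight_pos h ξ)
    calc (weight h ξ)⁻¹ * q ≤ (weight h ξ)⁻¹ * (ρ ^ 2 / (8 * h ^ 2) + g / (2 * h ^ 2) + p ^ 2 +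
          2 * h ^ 2) := by gcongr
      _ = (weight h ξ)⁻¹ * (ρ ^ 2 / (8 * h ^ 2) + g / (2 * h ^ 2) + p ^ 2) +
          2 * h ^ 2 * (weight h ξ)⁻¹ := by ring
      _ ≤ (ρ ^ 2 / (8 * h ^ 2) + g / (2 * h ^ 2) + p ^ 2) + 2 * h ^ 2 * (weight h ξ)⁻¹ := by
          gcongr
          exact mul_le_of_le_one_left (by positivity) hw
      _ ≤ _ := by
          have e6 : g / (2 * h ^ 2) ≤ weight h ξ * g / (2 * h ^ 2) := by
            gcongr; exact le_mul_of_one_le_left f8 hw1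
          have e7 : p ^ 2 ≤ weight h ξ * p ^ 2 := le_mul_of_one_le_left (sq_nonneg _) hw1
          linarith
  have hia := integrable_weight_pairSym_sq (μ := μ) hT hΔ hh
  have hiw : Integrable fun ξ => 2 * h ^ 2 * (weight h ξ)⁻¹ := (integrable_inv_weight hh).const_mul _
  have hi1 := hR.div_const (8 * h ^ 2)
  have hi2 := hG.div_const (2 * h ^ 2)
  have hiA : Integrable (fun ξ => (weight h ξ)⁻¹ * sqSym (entry12 Γ) ξ) := by
    refine hA.mono' ((continuous_weight h).measurable.inv.mul
      (measurable_sqSym _)).aestronglyMeasurable ?_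
    filter_upwards [hn1] with ξ f1
    have hw1 := one_le_weight h ξ
    rw [Real.norm_of_nonneg (mul_nonneg (inv_pos.2 (weight_pos h ξ)).le f1)]
    exact mul_le_mul_of_nonneg_right ((inv_le_one_of_one_le₀ hw1).trans hw1) f1
  refine ⟨hiA, ?_⟩
  have := integral_mono_ae hiA (((hi1.add hi2).add hia).add hiw) hpt
  refine this.trans (le_of_eq ?_)
  rw [integral_add' ((hi1.add hi2).add hia) hiw, integral_add' (hi1.add hi2) hia,
    integral_add' hi1 hi2, integral_div, integral_div, integral_const_mul]
  have h4 : ∫ ξ, (weight h ξ)⁻¹ = (2 * h)⁻¹ := (integral_weight hh).2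
  rw [h4]
  congr 1
  field_simp

end Energy

/-! ### Bounds on the centre-of-mass coefficients -/

theorem norm_sq_integral_ofReal_mul_le {h : ℝ} {f : ℝ → ℝ} {x : ℝ → ℂ} (hf : MemLp f 2)
    (hx : AEStronglyMeasurable x) (hi : Integrable fun ξ => weight h ξ * ‖x ξ‖ ^ 2) :
    ‖∫ ξ, (f ξ : ℂ) * x ξ‖ ^ 2 ≤
      (∫ ξ, (weight h ξ)⁻¹ * f ξ ^ 2) * ∫ ξ, weight h ξ * ‖x ξ‖ ^ 2 := by
  have hw : Measurable (weight h) := (continuous_weight h).measurable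
  set u : ℝ → ℂ := fun ξ => ((sqrt (weight h ξ)⁻¹ * f ξ : ℝ) : ℂ) with hu
  set v : ℝ → ℂ := fun ξ => ((sqrt (weight h ξ) : ℝ) : ℂ) * x ξ with hv
  have e1 : ∀ ξ, ‖u ξ‖ ^ 2 = (weight h ξ)⁻¹ * f ξ ^ 2 := fun ξ => by
    rw [hu, Complex.norm_real, Real.norm_eq_abs, sq_abs, mul_pow,
      Real.sq_sqrt (inv_pos.2 (weight_pos h ξ)).le]
  have e2 : ∀ ξ, ‖v ξ‖ ^ 2 = weight h ξ * ‖x ξ‖ ^ 2 := fun ξ => by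
    rw [hv, norm_mul, mul_pow, Complex.norm_real, Real.norm_eq_abs, sq_abs,
      Real.sq_sqrt (weight_pos h ξ).le]
  have hum : AEStronglyMeasurable u := Complex.continuous_ofReal.comp_aestronglyMeasurable
    ((by fun_prop : Measurable fun ξ => sqrt (weight h ξ)⁻¹).aestronglyMeasurable.mul hf.1)
  have hvm : AEStronglyMeasurable v :=
    (by fun_prop : Measurable fun ξ => ((sqrt (weight h ξ) : ℝ) : ℂ)).aestronglyMeasurable.mul
      hx
  have hu2 : MemLp u 2 := by
    rw [memLp_two_iff_integrable_sq_norm hum]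
    simp_rw [e1]
    refine hf.integrable_sq.mono' (hw.inv.aestronglyMeasurable.mul (hf.1.pow 2))
      (.of_forall fun ξ => ?_)
    have h1 := weight_pos h ξ
    rw [Real.norm_of_nonneg (by positivity)]
    exact mul_le_of_le_one_left (sq_nonneg _) (inv_le_one_of_one_le₀ (one_le_weight h ξ))
  have hv2 : MemLp v 2 := by
    rw [memLp_two_iff_integrable_sq_norm hvm]
    simp_rw [e2]
    exact hi
  have h1 := norm_sq_integral_mul_le hu2 hv2
  simp_rw [e1, e2] at h1
  refine le_trans (le_of_eq ?_) h1
  congr 2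
  congr 1; funext ξ
  have h3 : ((sqrt (weight h ξ)⁻¹ : ℝ) : ℂ) * ((sqrt (weight h ξ) : ℝ) : ℂ) = 1 := by
    rw [← Complex.ofReal_mul, Real.sqrt_inv, inv_mul_cancel₀ (Real.sqrt_pos.2 (weight_pos h ξ)).ne',
      Complex.ofReal_one]
  simp only [hu, hv, Complex.ofReal_mul]
  linear_combination -(f ξ : ℂ) * x ξ * h3

section Coefficients

variable {C h β τ δ : ℝ} {K a₀ : ℝ → ℝ} {c : ℝ → ℂ} {z : ℂ} {m : ℤ}

/-- The part of a coefficient orthogonal to `a₀` is bounded by the pair form. -/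
theorem coef_orthogonal_le (hC : 0 < C) (hP : PairBounds C h β τ δ K a₀) (hτ : 0 < τ)
    (hK : ∀ ξ, τ ≤ K ξ) (hKm : Measurable K) (hδ : 0 < δ) (hKa : ∀ ξ, K ξ * a₀ ξ = δ)
    (ha : Integrable a₀) (ha2 : MemLp a₀ 2) (hβ : 0 < β) (hgap : β * ∫ ξ, a₀ ξ = δ)
    (hc : AEStronglyMeasurable c) (hi : Integrable fun ξ => K ξ * ‖c ξ‖ ^ 2)
    (hz : ((∫ ξ, a₀ ξ ^ 2 : ℝ) : ℂ) * z = ∫ ξ, (a₀ ξ : ℂ) * c ξ) :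
    Integrable (fun ξ => weight h ξ * ‖c ξ - z * a₀ ξ‖ ^ 2) ∧
    ∫ ξ, (a₀ ξ : ℂ) * (c ξ - z * a₀ ξ) = 0 ∧
    ∫ ξ, weight h ξ * ‖c ξ - z * a₀ ξ‖ ^ 2 ≤
      C ^ 2 * ((∫ ξ, K ξ * ‖c ξ‖ ^ 2) - β * ‖∫ ξ, c ξ‖ ^ 2) := by
  obtain ⟨h1, h2, h3⟩ := form_coercive hτ hK hKm hδ hKa ha ha2 hβ hgap hc hi hz
  have hxm : AEStronglyMeasurable (fun ξ => c ξ - z * a₀ ξ) :=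
    hc.sub ((Complex.continuous_ofReal.comp_aestronglyMeasurable ha.1).const_mul z)
  have hle : ∀ ξ, weight h ξ * ‖c ξ - z * a₀ ξ‖ ^ 2 ≤ C * (K ξ * ‖c ξ - z * a₀ ξ‖ ^ 2) := by
    intro ξ
    rw [← mul_assoc]
    exact mul_le_mul_of_nonneg_right (hP.weight_le ξ) (sq_nonneg _)
  have hwi : Integrable (fun ξ => weight h ξ * ‖c ξ - z * a₀ ξ‖ ^ 2) := by
    refine (h1.const_mul C).mono' ((continuous_weight h).aestronglyMeasurable.mul
      (hxm.norm.pow 2)) (.of_forall fun ξ => ?_)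
    rw [Real.norm_of_nonneg (mul_nonneg (weight_pos h ξ).le (sq_nonneg _))]
    exact hle ξ
  refine ⟨hwi, h2, ?_⟩
  have h4 : ∫ ξ, weight h ξ * ‖c ξ - z * a₀ ξ‖ ^ 2 ≤
      C * ∫ ξ, K ξ * ‖c ξ - z * a₀ ξ‖ ^ 2 := by
    rw [← integral_const_mul]
    exact integral_mono hwi (h1.const_mul C) hle
  set I := ∫ ξ, K ξ * ‖c ξ - z * a₀ ξ‖ ^ 2
  have hI : 0 ≤ I := integral_nonneg fun ξ => mul_nonneg (hτ.le.trans (hK ξ)) (sq_nonneg _)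
  have h5 := mul_le_mul_of_nonneg_right hP.coercive hI
  have h6 := mul_le_mul_of_nonneg_left h3 hC.le
  have h7 : I ≤ C * ((∫ ξ, K ξ * ‖c ξ‖ ^ 2) - β * ‖∫ ξ, c ξ‖ ^ 2) := by linarith
  calc _ ≤ C * I := h4
    _ ≤ C * (C * ((∫ ξ, K ξ * ‖c ξ‖ ^ 2) - β * ‖∫ ξ, c ξ‖ ^ 2)) := by gcongr
    _ = _ := by ring

/-- The size of the projection, from a weak norm of the coefficient. -/
theorem coef_projection_le (hC : 0 < C) (hP : PairBounds C h β τ δ K a₀) (ha2 : MemLp a₀ 2)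
    (hi : Integrable fun ξ => (weight h ξ)⁻¹ * ‖c ξ‖ ^ 2)
    (hx : Integrable fun ξ => weight h ξ * ‖c ξ - z * a₀ ξ‖ ^ 2) :
    h * ‖z‖ ^ 2 ≤ C * (2 * (∫ ξ, (weight h ξ)⁻¹ * ‖c ξ‖ ^ 2) +
      2 * ∫ ξ, weight h ξ * ‖c ξ - z * a₀ ξ‖ ^ 2) := by
  have h1 := mul_le_mul_of_nonneg_right hP.mass_ge (sq_nonneg ‖z‖)
  refine h1.trans ?_
  rw [mul_assoc]
  gcongr
  rw [← integral_mul_const, ← integral_const_mul, ← integral_const_mul, ← integral_add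
    (hi.const_mul 2) (hx.const_mul 2)]
  have hw : Measurable (weight h) := (continuous_weight h).measurable
  refine integral_mono (Integrable.mul_const ?_ _) ((hi.const_mul 2).add (hx.const_mul 2)) fun ξ => ?_
  · refine ha2.integrable_sq.mono' (hw.inv.aestronglyMeasurable.mul (ha2.1.pow 2))
      (.of_forall fun ξ => ?_)
    have h1 := weight_pos h ξ
    rw [Real.norm_of_nonneg (by positivity)]
    exact mul_le_of_le_one_left (sq_nonneg _) (inv_le_one_of_one_le₀ (one_le_weight h ξ))
  · have h2 : ‖z * a₀ ξ‖ ^ 2 ≤ 2 * ‖c ξ‖ ^ 2 + 2 * ‖c ξ - z * a₀ ξ‖ ^ 2 := by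
      have h3 : ‖z * a₀ ξ‖ ≤ ‖c ξ‖ + ‖c ξ - z * a₀ ξ‖ := by
        have := norm_sub_le (c ξ) (c ξ - z * a₀ ξ)
        rwa [sub_sub_cancel] at this
      nlinarith [norm_nonneg (z * a₀ ξ), sq_nonneg (‖c ξ‖ - ‖c ξ - z * a₀ ξ‖)]
    rw [norm_mul, mul_pow, Complex.norm_real, Real.norm_eq_abs, sq_abs] at h2
    have hw0 := inv_pos.2 (weight_pos h ξ)
    have hw1 : (weight h ξ)⁻¹ ≤ weight h ξ :=
      (inv_le_one_of_one_le₀ (one_le_weight h ξ)).trans (one_le_weight h ξ)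
    calc (weight h ξ)⁻¹ * a₀ ξ ^ 2 * ‖z‖ ^ 2 = (weight h ξ)⁻¹ * (‖z‖ ^ 2 * a₀ ξ ^ 2) := by ring
      _ ≤ (weight h ξ)⁻¹ * (2 * ‖c ξ‖ ^ 2 + 2 * ‖c ξ - z * a₀ ξ‖ ^ 2) := by gcongr
      _ = 2 * ((weight h ξ)⁻¹ * ‖c ξ‖ ^ 2) + 2 * ((weight h ξ)⁻¹ * ‖c ξ - z * a₀ ξ‖ ^ 2) := by ring
      _ ≤ _ := by gcongr

/-- The symmetry of `α` bounds the derivative of the projection: comparing the projections of `α`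
onto `a₀` and onto its translate `a₀(· - m)` shows that `ψ̂₀(m)` is small where the two differ. -/
theorem coef_deriv_le (hC : 1 ≤ C) (hh : 0 < h) (hP : PairBounds C h β τ δ K a₀)
    (ha2 : MemLp a₀ 2) (hc : MemLp c 2)
    (hx : Integrable fun ξ => weight h ξ * ‖c ξ - z * a₀ ξ‖ ^ 2)
    (h0 : ∫ ξ, (a₀ ξ : ℂ) * (c ξ - z * a₀ ξ) = 0)
    (hs : ∫ ξ, (a₀ (ξ - m) : ℂ) * c ξ = ∫ ξ, (a₀ ξ : ℂ) * c ξ) :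
    h * (h * (2 * π * m)) ^ 2 * ‖z‖ ^ 2 ≤
      4 * C ^ 3 * ∫ ξ, weight h ξ * ‖c ξ - z * a₀ ξ‖ ^ 2 := by
  set x : ℝ → ℂ := fun ξ => c ξ - z * a₀ ξ with hxdef
  set X := ∫ ξ, weight h ξ * ‖x ξ‖ ^ 2 with hX
  have hX0 : 0 ≤ X := integral_nonneg fun ξ => mul_nonneg (weight_pos h ξ).le (sq_nonneg _)
  set s := h * (2 * π * m) with hsdef
  have has : MemLp (fun ξ => a₀ (ξ - m)) 2 :=
    ha2.comp_measurePreserving (measurePreserving_sub_right volume (m : ℝ))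
  have hac : MemLp (fun ξ => (a₀ ξ : ℂ)) 2 := ha2.ofReal
  have hasc : MemLp (fun ξ => (a₀ (ξ - m) : ℂ)) 2 := has.ofReal
  have hx2 : MemLp x 2 := hc.sub (hac.const_mul z)
  have hdf : MemLp (fun ξ => a₀ ξ - a₀ (ξ - m)) 2 := ha2.sub has
  set d := ∫ ξ, (a₀ ξ - a₀ (ξ - m)) ^ 2 with hd
  have i1 : Integrable fun ξ => (a₀ (ξ - m) : ℂ) * x ξ := hasc.integrable_mul hx2
  have i2 : Integrable fun ξ => (a₀ ξ : ℂ) * x ξ := hac.integrable_mul hx2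
  have i3 : Integrable fun ξ => a₀ ξ * a₀ (ξ - m) := ha2.integrable_mul has
  have i5 : Integrable fun ξ => z * ((a₀ ξ * a₀ (ξ - m) : ℝ) : ℂ) := i3.ofReal.const_mul z
  have i6 : Integrable fun ξ => z * ((a₀ ξ ^ 2 : ℝ) : ℂ) := ha2.integrable_sq.ofReal.const_mul z
  have hd2 : d = 2 * (∫ ξ, a₀ ξ ^ 2) - 2 * ∫ ξ, a₀ ξ * a₀ (ξ - m) := by
    have e : ∀ ξ, (a₀ ξ - a₀ (ξ - m)) ^ 2 =
        a₀ ξ ^ 2 + a₀ (ξ - m) ^ 2 - 2 * (a₀ ξ * a₀ (ξ - m)) := fun ξ => by ring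
    rw [hd]
    simp_rw [e]
    have i4 : Integrable fun ξ => a₀ ξ ^ 2 + a₀ (ξ - m) ^ 2 := ha2.integrable_sq.add has.integrable_sq
    rw [integral_sub i4 (i3.const_mul 2), integral_add ha2.integrable_sq has.integrable_sq,
      integral_const_mul, integral_sub_right_eq_self (fun ξ => a₀ ξ ^ 2) (m : ℝ)]
    ring
  -- The symmetry, rewritten in terms of the orthogonal part of `c`.
  have hkey : ∫ ξ, (a₀ (ξ - m) : ℂ) * x ξ = z * ((d / 2 : ℝ) : ℂ) := by
    have e1 : ∫ ξ, (a₀ (ξ - m) : ℂ) * c ξ = (∫ ξ, (a₀ (ξ - m) : ℂ) * x ξ) +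
        z * ((∫ ξ, a₀ ξ * a₀ (ξ - m) : ℝ) : ℂ) := by
      rw [← integral_complex_ofReal, ← integral_const_mul, ← integral_add i1 i5]
      congr 1; funext ξ
      simp only [hxdef]
      push_cast
      ring
    have e2 : ∫ ξ, (a₀ ξ : ℂ) * c ξ = (∫ ξ, (a₀ ξ : ℂ) * x ξ) +
        z * ((∫ ξ, a₀ ξ ^ 2 : ℝ) : ℂ) := by
      rw [← integral_complex_ofReal, ← integral_const_mul, ← integral_add i2 i6]
      congr 1; funext ξ
      simp only [hxdef]
      push_cast
      ring
    rw [e1, e2, h0, zero_add] at hs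
    rw [hd2]
    push_cast
    linear_combination hs
  have hnorm : ∀ t : ℂ, t = z * ((d / 2 : ℝ) : ℂ) → ‖t‖ ^ 2 = ‖z‖ ^ 2 * d ^ 2 / 4 := by
    rintro t rfl
    rw [norm_mul, mul_pow, Complex.norm_real, Real.norm_eq_abs, sq_abs]
    ring
  have hd0 : 0 ≤ d := integral_nonneg fun ξ => sq_nonneg _
  have hge := hP.shift_ge m
  rw [← hsdef, ← hd] at hge
  rcases le_total (s ^ 2) 1 with hs1 | hs1
  · rw [min_eq_right hs1] at hge
    have e1 : ∫ ξ, ((a₀ ξ - a₀ (ξ - m) : ℝ) : ℂ) * x ξ = -(z * ((d / 2 : ℝ) : ℂ)) := by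
      rw [← hkey, ← zero_sub, ← h0, ← integral_sub i2 i1]
      congr 1; funext ξ
      push_cast; ring
    have e2 := norm_sq_integral_ofReal_mul_le (h := h) hdf hx2.1 hx
    rw [e1, norm_neg, hnorm _ rfl, ← hX] at e2
    have e3 : ∫ ξ, (weight h ξ)⁻¹ * (a₀ ξ - a₀ (ξ - m)) ^ 2 ≤ d := by
      refine integral_mono_of_nonneg (.of_forall fun ξ => ?_) hdf.integrable_sq
        (.of_forall fun ξ => ?_)
      · exact mul_nonneg (inv_pos.2 (weight_pos h ξ)).le (sq_nonneg _)
      · exact mul_le_of_le_one_left (sq_nonneg _) (inv_le_one_of_one_le₀ (one_le_weight h ξ))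
    have e4 : ‖z‖ ^ 2 * d ^ 2 / 4 ≤ d * X := e2.trans (mul_le_mul_of_nonneg_right e3 hX0)
    have e5 : ‖z‖ ^ 2 * d ≤ 4 * X := by
      rcases hd0.eq_or_lt with h1 | h1
      · rw [← h1, mul_zero]; positivity
      · rw [← mul_le_mul_iff_left₀ h1]
        linarith
    calc h * s ^ 2 * ‖z‖ ^ 2 ≤ C * d * ‖z‖ ^ 2 := by gcongr
      _ = C * (‖z‖ ^ 2 * d) := by ring
      _ ≤ C * (4 * X) := by gcongr
      _ ≤ C ^ 3 * (4 * X) := by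
          gcongr
          exact le_self_pow₀ hC (by norm_num)
      _ = _ := by ring
  · rw [min_eq_left hs1, mul_one] at hge
    have e2 := norm_sq_integral_ofReal_mul_le (h := h) has hx2.1 hx
    rw [hkey, hnorm _ rfl, ← hX] at e2
    have e3 := hP.far_le m
    rw [← hsdef] at e3
    set F := ∫ ξ, (weight h ξ)⁻¹ * a₀ (ξ - m) ^ 2
    have e4 : h ^ 2 ≤ C ^ 2 * d ^ 2 := by
      rw [← mul_pow]; exact pow_le_pow_left₀ hh.le hge 2
    have e5 : (1 + s ^ 2) * (h ^ 2 * ‖z‖ ^ 2) ≤ 4 * C ^ 3 * h * X := by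
      calc (1 + s ^ 2) * (h ^ 2 * ‖z‖ ^ 2) ≤ (1 + s ^ 2) * (C ^ 2 * d ^ 2 * ‖z‖ ^ 2) := by gcongr
        _ = 4 * C ^ 2 * (1 + s ^ 2) * (‖z‖ ^ 2 * d ^ 2 / 4) := by ring
        _ ≤ 4 * C ^ 2 * (1 + s ^ 2) * (F * X) := by gcongr
        _ = 4 * C ^ 2 * ((1 + s ^ 2) * F) * X := by ring
        _ ≤ 4 * C ^ 2 * (C * h) * X := by gcongr
        _ = _ := by ring
    have e6 : h * (h * s ^ 2 * ‖z‖ ^ 2) ≤ h * (4 * C ^ 3 * X) := by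
      have : 0 ≤ h ^ 2 * ‖z‖ ^ 2 := by positivity
      calc h * (h * s ^ 2 * ‖z‖ ^ 2) ≤ (1 + s ^ 2) * (h ^ 2 * ‖z‖ ^ 2) := by
            linarith
        _ ≤ _ := e5
        _ = _ := by ring
    exact le_of_mul_le_mul_left e6 hh

end Coefficients

/-! ### Summed bounds on the Cooper-pair wave function -/

/-- The coefficient of the projection of `c` onto the real function `a₀`. -/
def projCoef (a₀ : ℝ → ℝ) (c : ℝ → ℂ) : ℂ :=
  ((∫ ξ, a₀ ξ ^ 2 : ℝ) : ℂ)⁻¹ * ∫ ξ, (a₀ ξ : ℂ) * c ξ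

theorem Admissible.transpose_entry12 {Γ : SumOp} (hΓ : Admissible Γ) :
    transpose (entry12 Γ) = entry12 Γ := by
  have h1 : adjoint Γ = Γ := hΓ.nonneg.isSelfAdjoint
  rw [transpose, adjoint_entry12 h1, hΓ.entry21_eq, conjOp_conjOp]

theorem integral_pairSym_sq_pos {μ T Δ₀ h : ℝ} (hT : 0 < T) (hΔ : 0 < Δ₀) (hh : 0 < h) :
    0 < ∫ ξ, pairSym μ T Δ₀ h ξ ^ 2 := by
  have hm := (memLp_pairSym (μ := μ) hT hΔ hh).integrable_sq
  have hp : ∀ ξ, 0 < pairSym μ T Δ₀ h ξ ^ 2 := fun ξ => pow_pos (pairSym_pos hT hΔ ξ) 2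
  rw [integral_pos_iff_support_of_nonneg (fun ξ => (hp ξ).le) hm]
  have : Function.support (fun ξ => pairSym μ T Δ₀ h ξ ^ 2) = Set.univ := by
    ext ξ; simp [(pairSym_pos (μ := μ) (h := h) hT hΔ ξ).ne']
  rw [this]
  simp

section Sums

variable {μ a T Δ₀ h C M : ℝ} {W : ℝ → ℝ} {Γ : SumOp} {c : ℤ → ℝ → ℂ}

/-- The Fourier coefficients `c m` of the Cooper-pair wave function are, up to remainders of order
`h ^ 3`, multiples `z m • a₀` of the translation-invariant one, and the function with the Fourier
coefficients `z m` is bounded in `H¹`. -/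
theorem sum_projCoef_le (ha : 0 < a) (hT : 0 < T) (hh : 0 < h) (hh1 : h ≤ 1)
    (hgap : IsGap μ a T Δ₀) (hC : 1 ≤ C) (hTC : 1 / T ≤ C)
    (hP : PairBounds C h (a * h) (2 * T) (Δ₀ / 2)
      (fun ξ => KT μ T Δ₀ (h * (2 * π * ξ))) (pairSym μ T Δ₀ h))
    (hW : RBdd W) (hWp : Function.Periodic W 1) (hWM : ∀ x, |W x| ≤ M) (hΓ : Admissible Γ)
    (hE : energy μ a T h W Γ ≤ energy μ a T h W (Gamma0 μ T Δ₀ h))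
    (hc : HasCoef (entry12 Γ) c) :
    ∃ X b : ℤ → ℝ,
      (∀ m, Integrable (fun ξ => weight h ξ *
        ‖c m ξ - projCoef (pairSym μ T Δ₀ h) (c m) * pairSym μ T Δ₀ h ξ‖ ^ 2) ∧
        ∫ ξ, weight h ξ *
          ‖c m ξ - projCoef (pairSym μ T Δ₀ h) (c m) * pairSym μ T Δ₀ h ξ‖ ^ 2 ≤ X m) ∧
      Summable X ∧ ∑' m, X m ≤ C ^ 3 * M ^ 2 * h ^ 3 ∧
      (∀ m : ℤ, (1 + (2 * π * m) ^ 2) *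
        ‖projCoef (pairSym μ T Δ₀ h) (c m)‖ ^ 2 ≤ b m) ∧
      Summable b ∧ ∑' m, b m ≤ 2 * C * (3 * C ^ 2 * M ^ 2 + 2 * C) + 2 * C ^ 4 * M ^ 2 +
        4 * C ^ 6 * M ^ 2 := by
  have hΔ := hgap.1
  have hC0 : 0 < C := one_pos.trans_le hC
  have hs := hΓ.isState
  have hper := hs.periodic12
  obtain ⟨hA, hG, hR, hle⟩ := energy_bounds ha hT hh hgap hC0 hP hW hWp hWM hΓ hE
  obtain ⟨hA', hle'⟩ := integral_inv_weight_sqSym_le hT hΔ hh hΓ hA hG hR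
  have hn := sqSym_nonneg hper
  have hsq : Integrable (sqSym (entry12 Γ)) := by
    refine hA.mono' (measurable_sqSym _).aestronglyMeasurable ?_
    filter_upwards [hn] with ξ f1
    rw [Real.norm_of_nonneg f1]
    exact le_mul_of_one_le_left f1 (one_le_weight h ξ)
  set K : ℝ → ℝ := fun ξ => KT μ T Δ₀ (h * (2 * π * ξ)) with hKdef
  set a₀ := pairSym μ T Δ₀ h with ha₀
  have hKc : Continuous K := (continuous_KT hT hΔ).comp
    (by fun_prop : Continuous fun ξ : ℝ => h * (2 * π * ξ))
  have hK0 : ∀ ξ, 0 < K ξ := fun ξ => KT_pos hT hΔ _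
  have hKi : Integrable fun ξ => K ξ * sqSym (entry12 Γ) ξ := by
    refine (hA.const_mul (1 + |μ| + Δ₀ + 2 * T)).mono'
      (hKc.measurable.mul (measurable_sqSym _)).aestronglyMeasurable ?_
    filter_upwards [hn] with ξ f1
    rw [Real.norm_of_nonneg (mul_nonneg (hK0 ξ).le f1)]
    exact (mul_le_mul_of_nonneg_right (KT_le_weight hT hΔ ξ) f1).trans (mul_assoc _ _ _).le
  have ha1 : Integrable a₀ := integrable_pairSym hT hΔ hh
  have ha2 : MemLp a₀ 2 := memLp_pairSym hT hΔ hh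
  have hN : 0 < ∫ ξ, a₀ ξ ^ 2 := integral_pairSym_sq_pos hT hΔ hh
  set z : ℤ → ℂ := fun m => projCoef a₀ (c m) with hzdef
  have hz : ∀ m, ((∫ ξ, a₀ ξ ^ 2 : ℝ) : ℂ) * z m = ∫ ξ, (a₀ ξ : ℂ) * c m ξ := fun m => by
    rw [hzdef]
    exact mul_inv_cancel_left₀ (Complex.ofReal_ne_zero.2 hN.ne') _
  obtain ⟨hKm, hKs⟩ := hc.hasSum_integral hper hKc hK0 hsq hKi
  obtain ⟨hYm, hYs⟩ := hc.hasSum_integral hper (φ := fun ξ => (weight h ξ)⁻¹)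
    ((continuous_weight h).inv₀ fun ξ => (weight_pos h ξ).ne') (fun ξ => inv_pos.2 (weight_pos h ξ))
    hsq hA'
  have hDs : HasSum (fun m => ‖∫ ξ, c m ξ‖ ^ 2) (diagSq (entry12 Γ)) := by
    obtain ⟨B, hB, hBc⟩ := hc
    have h1 := hB.hasSum_diagSq hh hper hA
    convert h1 using 4 with m
    refine integral_congr_ae ?_
    filter_upwards [hBc] with ξ f1
    rw [f1 m]
  have hcm : ∀ m, MemLp (c m) 2 := hc.memLp hper hsq
  -- The pair form decouples over the centre-of-mass frequencies.
  have hQs := hKs.sub (hDs.mul_left (a * h))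
  set Q : ℤ → ℝ := fun m => (∫ ξ, K ξ * ‖c m ξ‖ ^ 2) - a * h * ‖∫ ξ, c m ξ‖ ^ 2 with hQ
  have hX : ∀ m, _ := fun m => coef_orthogonal_le (c := c m) (z := z m) hC0 hP
    (by positivity : 0 < 2 * T) (fun ξ => two_mul_le_KT hT hΔ _) hKc.measurable (half_pos hΔ)
    (fun ξ => by
      have h1 := hK0 ξ
      change K ξ * (Δ₀ / (2 * K ξ)) = Δ₀ / 2
      field_simp) ha1 ha2 (mul_pos ha hh)
    (mul_integral_pairSym ha hh hgap) (hcm m).1 (hKm m) (hz m)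
  set x : ℤ → ℝ := fun m => ∫ ξ, weight h ξ * ‖c m ξ - z m * a₀ ξ‖ ^ 2 with hx
  have hx0 : ∀ m, 0 ≤ x m := fun m => integral_nonneg fun ξ =>
    mul_nonneg (weight_pos h ξ).le (sq_nonneg _)
  have hxs : Summable x :=
    .of_nonneg_of_le hx0 (fun m => (hX m).2.2) (hQs.summable.mul_left (C ^ 2))
  have hxle : ∑' m, x m ≤ C ^ 2 * ((∫ ξ, K ξ * sqSym (entry12 Γ) ξ) -
      a * h * diagSq (entry12 Γ)) := by
    rw [← hQs.tsum_eq, ← tsum_mul_left]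
    exact hxs.tsum_le_tsum (fun m => (hX m).2.2) (hQs.summable.mul_left (C ^ 2))
  set E := (∫ ξ, K ξ * sqSym (entry12 Γ) ξ) - a * h * diagSq (entry12 Γ)
  set G := ∫ ξ, weight h ξ * sqSym (entry11 Γ - rmul (densSym μ T Δ₀ h)) ξ
  set R := ∫ ξ, (devSym Γ ξ - gapTanh μ T Δ₀ h ξ ^ 2) ^ 2
  have hG0 : 0 ≤ G := by
    refine integral_nonneg_of_ae ?_
    filter_upwards [sqSym_nonneg (hs.periodic11.sub (isPeriodicOp_rmul (rBdd_densSym (μ := μ)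
      (h := h) hT hΔ)))] with ξ f1
    exact mul_nonneg (weight_pos h ξ).le f1
  have hR0 : 0 ≤ R := integral_nonneg fun ξ => sq_nonneg _
  have hxt0 : 0 ≤ ∑' m, x m := tsum_nonneg hx0
  have hE0 : 0 ≤ E := by
    have : 0 ≤ C ^ 2 * E := hxt0.trans hxle
    exact nonneg_of_mul_nonneg_right this (by positivity)
  have hGC : 0 ≤ G / (2 * C) := by positivity
  have hRT : 0 ≤ T / 12 * R := by positivity
  have hEle : E ≤ C * M ^ 2 * h ^ 3 := by linarith
  have hxS : ∑' m, x m ≤ C ^ 3 * M ^ 2 * h ^ 3 :=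
    hxle.trans ((mul_le_mul_of_nonneg_left hEle (sq_nonneg C)).trans (le_of_eq (by ring)))
  have hG1 : G / (2 * h ^ 2) ≤ C ^ 2 * M ^ 2 * h := by
    have h1 : G / (2 * C) ≤ C * M ^ 2 * h ^ 3 := by linarith
    rw [div_le_iff₀ (by positivity)] at h1 ⊢
    linarith
  have hR1 : R / (8 * h ^ 2) ≤ 3 / 2 * (C ^ 2 * M ^ 2 * h) := by
    have h1 : T / 12 * R ≤ C * M ^ 2 * h ^ 3 := by linarith
    have h2 : R ≤ 12 * (1 / T) * (C * M ^ 2 * h ^ 3) := by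
      calc R = 12 * (1 / T) * (T / 12 * R) := by field_simp
        _ ≤ _ := by gcongr
    have h3 : R ≤ 12 * C * (C * M ^ 2 * h ^ 3) := h2.trans (by gcongr)
    rw [div_le_iff₀ (by positivity)]
    linarith
  set Y := ∫ ξ, (weight h ξ)⁻¹ * sqSym (entry12 Γ) ξ
  have hY : Y ≤ (3 * C ^ 2 * M ^ 2 + 2 * C) * h := by
    have h1 := hP.mass_le
    have h2 : h ≤ C * h := le_mul_of_one_le_left hh.le hC
    have h3 : 0 ≤ C ^ 2 * M ^ 2 * h := by positivity
    linarith
  set y : ℤ → ℝ := fun m => ∫ ξ, (weight h ξ)⁻¹ * ‖c m ξ‖ ^ 2 with hy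
  have hsb : HasSum (fun m => h⁻¹ * (C * (2 * y m + 2 * x m)) + h⁻¹ ^ 3 * (4 * C ^ 3 * x m))
      (h⁻¹ * (C * (2 * Y + 2 * ∑' m, x m)) + h⁻¹ ^ 3 * (4 * C ^ 3 * ∑' m, x m)) :=
    ((((hYs.mul_left 2).add (hxs.hasSum.mul_left 2)).mul_left C).mul_left h⁻¹).add
      ((hxs.hasSum.mul_left (4 * C ^ 3)).mul_left (h⁻¹ ^ 3))
  refine ⟨x, fun m => h⁻¹ * (C * (2 * y m + 2 * x m)) + h⁻¹ ^ 3 * (4 * C ^ 3 * x m),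
    fun m => ⟨(hX m).1, le_rfl⟩, hxs, hxS, fun m => ?_, hsb.summable, ?_⟩
  · have h1 := coef_projection_le hC0 hP ha2 (hYm m) (hX m).1
    have h2 := coef_deriv_le (m := m) hC hh hP ha2 (hcm m) (hX m).1 (hX m).2.1
      (hc.integral_shift_mul hper hΓ.transpose_entry12 hsq (rBdd_pairSym hT hΔ)
        (fun ξ => pairSym_neg ξ) ha2 m)
    have h3 : h⁻¹ * (h * ‖z m‖ ^ 2) ≤ h⁻¹ * (C * (2 * y m + 2 * x m)) :=
      mul_le_mul_of_nonneg_left h1 (by positivity)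
    have h4 : h⁻¹ ^ 3 * (h * (h * (2 * π * m)) ^ 2 * ‖z m‖ ^ 2) ≤
        h⁻¹ ^ 3 * (4 * C ^ 3 * x m) := mul_le_mul_of_nonneg_left h2 (by positivity)
    have h5 : h⁻¹ * (h * ‖z m‖ ^ 2) = ‖z m‖ ^ 2 := by field_simp
    have h6 : h⁻¹ ^ 3 * (h * (h * (2 * π * m)) ^ 2 * ‖z m‖ ^ 2) =
        (2 * π * m) ^ 2 * ‖z m‖ ^ 2 := by field_simp
    rw [h5] at h3
    rw [h6] at h4
    change (1 + (2 * π * m) ^ 2) * ‖z m‖ ^ 2 ≤ _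
    linarith
  · rw [hsb.tsum_eq]
    have h1 : h⁻¹ ^ 3 * (4 * C ^ 3 * ∑' m, x m) ≤ 4 * C ^ 6 * M ^ 2 := by
      calc h⁻¹ ^ 3 * (4 * C ^ 3 * ∑' m, x m) ≤ h⁻¹ ^ 3 * (4 * C ^ 3 * (C ^ 3 * M ^ 2 * h ^ 3)) := by
            gcongr
        _ = _ := by field_simp
    have h2 : h⁻¹ * (C * (2 * Y + 2 * ∑' m, x m)) ≤
        2 * C * (3 * C ^ 2 * M ^ 2 + 2 * C) + 2 * C ^ 4 * M ^ 2 := by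
      have h4 : h ^ 3 ≤ h := pow_le_of_le_one hh.le hh1 (by norm_num)
      have h3 : ∑' m, x m ≤ C ^ 3 * M ^ 2 * h := hxS.trans (by gcongr)
      calc h⁻¹ * (C * (2 * Y + 2 * ∑' m, x m)) ≤
          h⁻¹ * (C * (2 * ((3 * C ^ 2 * M ^ 2 + 2 * C) * h) + 2 * (C ^ 3 * M ^ 2 * h))) := by
            gcongr
        _ = _ := by field_simp
    linarith

end Sums

/-! ### Uniform bounds on the function `1 / K_T⁰` -/

section Reciprocal

variable {μ T T₁ T₂ Δ₀ : ℝ}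

theorem one_add_sq_le_add_dispersion (hT₁ : 0 < T₁) (hT : T₁ ≤ T) (hΔ : 0 < Δ₀) (p : ℝ) :
    1 + p ^ 2 ≤ (1 + (|μ| + 1) / (2 * T₁)) * (2 * T + dispersion μ Δ₀ p) := by
  have h1 := abs_le_dispersion μ Δ₀ p
  have h2 := le_abs_self (p ^ 2 - μ)
  have h3 := le_abs_self μ
  have h4 := dispersion_pos (μ := μ) hΔ p
  have h5 : |μ| + 1 = (|μ| + 1) / (2 * T₁) * (2 * T₁) := by field_simp
  have h6 : (|μ| + 1) / (2 * T₁) * (2 * T₁) ≤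
      (|μ| + 1) / (2 * T₁) * (2 * T + dispersion μ Δ₀ p) := by
    gcongr; linarith
  linarith

theorem one_add_sq_le_KT (hT₁ : 0 < T₁) (hT : T₁ ≤ T) (hΔ : 0 < Δ₀) (p : ℝ) :
    1 + p ^ 2 ≤ (1 + (|μ| + 1) / (2 * T₁)) * KT μ T Δ₀ p := by
  have hT0 := hT₁.trans_le hT
  have h1 := abs_le_dispersion μ Δ₀ p
  have h2 := le_abs_self (p ^ 2 - μ)
  have h3 := le_abs_self μ
  have h4 := dispersion_le_KT (μ := μ) hT0 hΔ p
  have h7 := two_mul_le_KT (μ := μ) hT0 hΔ p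
  have h5 : |μ| + 1 = (|μ| + 1) / (2 * T₁) * (2 * T₁) := by field_simp
  have h6 : (|μ| + 1) / (2 * T₁) * (2 * T₁) ≤ (|μ| + 1) / (2 * T₁) * KT μ T Δ₀ p := by
    gcongr; linarith
  linarith

theorem inv_KT_le (hT₁ : 0 < T₁) (hT : T₁ ≤ T) (hΔ : 0 < Δ₀) (p : ℝ) :
    (KT μ T Δ₀ p)⁻¹ ≤ (1 + (|μ| + 1) / (2 * T₁)) * (1 + p ^ 2)⁻¹ := by
  have h1 := one_add_sq_le_KT (μ := μ) hT₁ hT hΔ p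
  have h2 := KT_pos (μ := μ) (hT₁.trans_le hT) hΔ p
  have h3 : 0 < 1 + p ^ 2 := by positivity
  rw [← div_eq_mul_inv, inv_eq_one_div, div_le_div_iff₀ h2 h3]
  linarith

theorem integrable_inv_KT (hT : 0 < T) (hΔ : 0 < Δ₀) : Integrable fun p => (KT μ T Δ₀ p)⁻¹ := by
  refine (integrable_inv_one_add_sq.const_mul (1 + (|μ| + 1) / (2 * T))).mono'
    ((continuous_KT hT hΔ).inv₀ fun p => (KT_pos hT hΔ p).ne').aestronglyMeasurable
    (.of_forall fun p => ?_)
  rw [Real.norm_of_nonneg (inv_pos.2 (KT_pos hT hΔ p)).le]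
  exact inv_KT_le hT le_rfl hΔ p

theorem memLp_inv_KT (hT : 0 < T) (hΔ : 0 < Δ₀) : MemLp (fun p => (KT μ T Δ₀ p)⁻¹) 2 := by
  have hm : AEStronglyMeasurable (fun p => (KT μ T Δ₀ p)⁻¹) :=
    ((continuous_KT hT hΔ).inv₀ fun p => (KT_pos hT hΔ p).ne').aestronglyMeasurable
  rw [memLp_two_iff_integrable_sq hm]
  refine ((integrable_inv_KT (μ := μ) hT hΔ).const_mul (2 * T)⁻¹).mono' (hm.pow 2)
    (.of_forall fun p => ?_)
  have h1 := inv_pos.2 (KT_pos (μ := μ) hT hΔ p)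
  rw [Real.norm_of_nonneg (by positivity), sq]
  gcongr
  exact two_mul_le_KT hT hΔ p

/-- The factor `(1 + q²)⁻¹` is kept: the decay in both variables makes translates of `1 / K_T⁰`
close in the norm weighted with `1 + p²`. -/
theorem abs_inv_KT_sub_le (hT₁ : 0 < T₁) (hT : T₁ ≤ T) (hΔ : 0 < Δ₀) (p q : ℝ) :
    |(KT μ T Δ₀ p)⁻¹ - (KT μ T Δ₀ q)⁻¹| ≤
      16 * (1 + |μ|) * (1 + (|μ| + 1) / (2 * T₁)) ^ 3 *
        (|p ^ 2 - q ^ 2| / ((1 + p ^ 2) * (1 + q ^ 2))) := by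
  wlog hpq : dispersion μ Δ₀ p ≤ dispersion μ Δ₀ q generalizing p q
  · have := this q p (le_of_not_ge hpq)
    rwa [abs_sub_comm, abs_sub_comm (q ^ 2), mul_comm (1 + q ^ 2)] at this
  have hT0 := hT₁.trans_le hT
  set A := 1 + (|μ| + 1) / (2 * T₁) with hA
  have hA0 : 0 < A := by positivity
  set x := dispersion μ Δ₀ p / (2 * T) with hx
  set y := dispersion μ Δ₀ q / (2 * T) with hy
  have hx0 : 0 < x := div_pos (dispersion_pos hΔ p) (by positivity)
  have hxy : x ≤ y := div_le_div_of_nonneg_right hpq (by positivity)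
  have hy0 : 0 < y := hx0.trans_le hxy
  have h1 := tanhRatio_sub_le hx0 hxy
  have h2 := tanhRatio_antitone hx0 hxy
  have ex : 2 * T + dispersion μ Δ₀ p = 2 * T * (1 + x) := by rw [hx]; field_simp
  have ey : 2 * T + dispersion μ Δ₀ q = 2 * T * (1 + y) := by rw [hy]; field_simp
  have hpx := one_add_sq_le_add_dispersion (μ := μ) hT₁ hT hΔ p
  have hqy := one_add_sq_le_add_dispersion (μ := μ) hT₁ hT hΔ q
  rw [ex, ← hA] at hpx
  rw [ey, ← hA] at hqy
  have hd : y ^ 2 - x ^ 2 ≤ |p ^ 2 - q ^ 2| * ((1 + |μ|) * (2 + p ^ 2 + q ^ 2)) / (4 * T ^ 2) := by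
    have e : y ^ 2 - x ^ 2 = (q ^ 2 - p ^ 2) * (p ^ 2 + q ^ 2 - 2 * μ) / (4 * T ^ 2) := by
      rw [hx, hy, div_pow, div_pow, dispersion_sq, dispersion_sq]; field_simp; ring
    rw [e]
    refine div_le_div_of_nonneg_right ((le_abs_self _).trans ?_) (by positivity)
    rw [abs_mul, abs_sub_comm]
    refine mul_le_mul_of_nonneg_left ?_ (abs_nonneg _)
    rw [abs_le]
    have h3 := neg_abs_le μ
    have h4 := le_abs_self μ
    have h5 : 0 ≤ |μ| * (p ^ 2 + q ^ 2) := by positivity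
    constructor <;> nlinarith [sq_nonneg p, sq_nonneg q]
  rw [inv_KT hT0, inv_KT hT0, ← hx, ← hy, ← sub_div, abs_div, abs_of_nonneg (sub_nonneg.2 h2),
    abs_of_pos (by positivity : 0 < 2 * T), div_le_iff₀ (by positivity)]
  refine h1.trans ?_
  have h6 : (1 + p ^ 2) * (1 + q ^ 2) * (2 + p ^ 2 + q ^ 2) ≤
      (A * (2 * T * (1 + x))) * (A * (2 * T * (1 + y))) * (A * (4 * T * (1 + x + y))) := by
    gcongr
    have : 0 ≤ A * T * (x + y) := by positivity
    nlinarith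
  have hP : 0 < (1 + p ^ 2) * (1 + q ^ 2) := by positivity
  have hS : 0 < 2 + p ^ 2 + q ^ 2 := by positivity
  have h7 : ((1 + x) * (1 + y) * (1 + x + y))⁻¹ ≤
      16 * A ^ 3 * T ^ 3 * ((1 + p ^ 2) * (1 + q ^ 2) * (2 + p ^ 2 + q ^ 2))⁻¹ := by
    rw [← div_eq_mul_inv, inv_eq_one_div, div_le_div_iff₀ (by positivity) (by positivity)]
    linarith
  calc 8 * (y ^ 2 - x ^ 2) / ((1 + x) * (1 + y) * (1 + x + y))
      ≤ 8 * (|p ^ 2 - q ^ 2| * ((1 + |μ|) * (2 + p ^ 2 + q ^ 2)) / (4 * T ^ 2)) *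
        (16 * A ^ 3 * T ^ 3 * ((1 + p ^ 2) * (1 + q ^ 2) * (2 + p ^ 2 + q ^ 2))⁻¹) := by
        rw [div_eq_mul_inv]
        gcongr
    _ = _ := by field_simp; ring

theorem sq_inv_KT_sub_le (hT₁ : 0 < T₁) (hT : T₁ ≤ T) (hΔ : 0 < Δ₀) (p q : ℝ) :
    (1 + p ^ 2) * ((KT μ T Δ₀ p)⁻¹ - (KT μ T Δ₀ q)⁻¹) ^ 2 ≤
      2 * (16 * (1 + |μ|) * (1 + (|μ| + 1) / (2 * T₁)) ^ 3) ^ 2 * (p - q) ^ 2 *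
        (1 + q ^ 2)⁻¹ := by
  set B := 16 * (1 + |μ|) * (1 + (|μ| + 1) / (2 * T₁)) ^ 3
  have h1 := pow_le_pow_left₀ (abs_nonneg _) (abs_inv_KT_sub_le (μ := μ) hT₁ hT hΔ p q) 2
  rw [sq_abs, mul_pow, div_pow, sq_abs] at h1
  have h2 : (p ^ 2 - q ^ 2) ^ 2 ≤ (p - q) ^ 2 * (2 * ((1 + p ^ 2) * (1 + q ^ 2))) := by
    have e : (p ^ 2 - q ^ 2) ^ 2 = (p - q) ^ 2 * (p + q) ^ 2 := by ring
    rw [e]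
    gcongr
    nlinarith [sq_nonneg (p - q), sq_nonneg (p * q)]
  calc (1 + p ^ 2) * ((KT μ T Δ₀ p)⁻¹ - (KT μ T Δ₀ q)⁻¹) ^ 2
      ≤ (1 + p ^ 2) * (B ^ 2 * ((p - q) ^ 2 * (2 * ((1 + p ^ 2) * (1 + q ^ 2))) /
        ((1 + p ^ 2) * (1 + q ^ 2)) ^ 2)) := by
        gcongr
        refine h1.trans ?_
        gcongr
    _ = _ := by field_simp

/-- On the half-line where `p² ≥ μ`, the function `1 / K_T⁰` decreases, and it does so at a positive
rate on compact sets. -/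
theorem exists_le_inv_KT_sub (μ : ℝ) (hT₁ : 0 < T₁) (T₂ : ℝ) : ∃ c : ℝ, 0 < c ∧
    ∀ T Δ₀ s p : ℝ, T₁ ≤ T → T ≤ T₂ → 0 < Δ₀ → Δ₀ ≤ 1 → 0 ≤ s → |μ| + 1 ≤ p → p ≤ |μ| + 2 →
      c * min 1 s ≤ (KT μ T Δ₀ p)⁻¹ - (KT μ T Δ₀ (p + s))⁻¹ := by
  rcases lt_or_ge T₂ T₁ with h | h12
  · exact ⟨1, one_pos, fun T Δ₀ s p h1 h2 => absurd (h1.trans h2) h.not_ge⟩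
  have hT₂ : 0 < T₂ := hT₁.trans_le h12
  set L := ((|μ| + 3) ^ 2 + |μ| + 1) / (2 * T₁) with hL
  have hcosh := Real.cosh_pos L
  refine ⟨(2 * T₂)⁻¹ * ((4 * T₂ ^ 2)⁻¹ / (3 * cosh L ^ 2)), by positivity, ?_⟩
  intro T Δ₀ s p h1 h2 hΔ hΔ1 hs hp1 hp2
  have hT0 := hT₁.trans_le h1
  set t := min 1 s with ht
  have ht0 : 0 ≤ t := le_min zero_le_one hs
  have ht1 : t ≤ 1 := min_le_left _ _
  have hts : t ≤ s := min_le_right _ _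
  have hμ := abs_nonneg μ
  have hμ' := le_abs_self μ
  have hμ'' := neg_abs_le μ
  have hp0 : 0 < p := by linarith
  have hpμ : μ ≤ p ^ 2 := by nlinarith
  have hmono : ∀ q r : ℝ, p ≤ q → q ≤ r → dispersion μ Δ₀ q ≤ dispersion μ Δ₀ r := by
    intro q r hq hqr
    refine Real.sqrt_le_sqrt ?_
    have hq2 : p ^ 2 ≤ q ^ 2 := by gcongr
    have hr2 : q ^ 2 ≤ r ^ 2 := pow_le_pow_left₀ (by linarith) hqr 2
    have : (q ^ 2 - μ) ^ 2 ≤ (r ^ 2 - μ) ^ 2 := pow_le_pow_left₀ (by linarith) (by linarith) 2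
    linarith
  set x := dispersion μ Δ₀ p / (2 * T) with hx
  set y := dispersion μ Δ₀ (p + t) / (2 * T) with hy
  set v := dispersion μ Δ₀ (p + s) / (2 * T) with hv
  have hx0 : 0 < x := div_pos (dispersion_pos hΔ p) (by positivity)
  have hxy : x ≤ y :=
    div_le_div_of_nonneg_right (hmono _ _ le_rfl (by linarith)) (by positivity)
  have hyv : y ≤ v :=
    div_le_div_of_nonneg_right (hmono _ _ (by linarith) (by linarith)) (by positivity)
  have hyL : y ≤ L := by
    rw [hy, hL]
    have h3 := dispersion_le (μ := μ) hΔ (p + t)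
    have h4 : |(p + t) ^ 2 - μ| ≤ (|μ| + 3) ^ 2 + |μ| := by
      have h5 : (p + t) ^ 2 ≤ (|μ| + 3) ^ 2 := pow_le_pow_left₀ (by linarith) (by linarith) 2
      rw [abs_le]; constructor <;> nlinarith [sq_nonneg (p + t)]
    have h6 : dispersion μ Δ₀ (p + t) ≤ (|μ| + 3) ^ 2 + |μ| + 1 := by linarith
    exact div_le_div₀ (by positivity) h6 (by positivity) (by linarith)
  have h3 := sub_le_tanhRatio_sub hx0 hxy hyL
  have h4 := tanhRatio_antitone (hx0.trans_le hxy) hyv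
  have hd : (4 * T₂ ^ 2)⁻¹ * t ≤ y ^ 2 - x ^ 2 := by
    have e : y ^ 2 - x ^ 2 = (4 * T ^ 2)⁻¹ * ((2 * p + t) * t * (p ^ 2 + (p + t) ^ 2 - 2 * μ)) := by
      rw [hx, hy, div_pow, div_pow, dispersion_sq, dispersion_sq]; field_simp; ring
    rw [e]
    have h5 : 1 ≤ 2 * p + t := by linarith
    have h6 : 1 ≤ p ^ 2 + (p + t) ^ 2 - 2 * μ := by nlinarith
    have h7 : t ≤ (2 * p + t) * t * (p ^ 2 + (p + t) ^ 2 - 2 * μ) := by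
      have h8 : t ≤ (2 * p + t) * t := le_mul_of_one_le_left ht0 h5
      exact h8.trans (le_mul_of_one_le_right (ht0.trans h8) h6)
    gcongr
  rw [inv_KT hT0, inv_KT hT0, ← hx, ← hv, ← sub_div,
    div_eq_inv_mul (tanhRatio x - tanhRatio v)]
  have h5 : (4 * T₂ ^ 2)⁻¹ * t / (3 * cosh L ^ 2) ≤ tanhRatio x - tanhRatio v := by
    have : (4 * T₂ ^ 2)⁻¹ * t / (3 * cosh L ^ 2) ≤ (y ^ 2 - x ^ 2) / (3 * cosh L ^ 2) := by
      gcongr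
    linarith
  calc (2 * T₂)⁻¹ * ((4 * T₂ ^ 2)⁻¹ / (3 * cosh L ^ 2)) * t
      = (2 * T₂)⁻¹ * ((4 * T₂ ^ 2)⁻¹ * t / (3 * cosh L ^ 2)) := by ring
    _ ≤ (2 * T₂)⁻¹ * (tanhRatio x - tanhRatio v) := by gcongr
    _ ≤ _ := by
      have : 0 ≤ tanhRatio x - tanhRatio v := le_trans (by positivity) h5
      gcongr

theorem le_integral_of_le_on_Icc {f : ℝ → ℝ} (hf : Integrable f) (h0 : 0 ≤ᵐ[volume] f) {k P : ℝ}
    (hk : ∀ p ∈ Icc P (P + 1), k ≤ f p) : k ≤ ∫ p, f p := by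
  have h1 : ∫ p in Icc P (P + 1), k ≤ ∫ p in Icc P (P + 1), f p :=
    setIntegral_mono_on (integrableOn_const (by simp)) hf.integrableOn measurableSet_Icc hk
  have h2 : ∫ _ in Icc P (P + 1), k = k := by
    simp
  exact (h2 ▸ h1).trans (setIntegral_le_integral hf h0)

theorem exists_le_integral_sq_inv_KT_sub (μ : ℝ) (hT₁ : 0 < T₁) (T₂ : ℝ) : ∃ c : ℝ, 0 < c ∧
    ∀ T Δ₀ s : ℝ, T₁ ≤ T → T ≤ T₂ → 0 < Δ₀ → Δ₀ ≤ 1 →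
      c * min 1 (s ^ 2) ≤ ∫ p, ((KT μ T Δ₀ p)⁻¹ - (KT μ T Δ₀ (p - s))⁻¹) ^ 2 := by
  obtain ⟨c, hc, hle⟩ := exists_le_inv_KT_sub μ hT₁ T₂
  refine ⟨c ^ 2, by positivity, fun T Δ₀ s h1 h2 hΔ hΔ1 => ?_⟩
  have hT0 := hT₁.trans_le h1
  have key : ∀ r : ℝ, 0 ≤ r → c ^ 2 * min 1 (r ^ 2) ≤
      ∫ p, ((KT μ T Δ₀ p)⁻¹ - (KT μ T Δ₀ (p + r))⁻¹) ^ 2 := by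
    intro r hr
    have hm := memLp_inv_KT (μ := μ) hT0 hΔ
    have hm' : MemLp (fun p => (KT μ T Δ₀ (p + r))⁻¹) 2 :=
      hm.comp_measurePreserving (measurePreserving_add_right volume r)
    refine le_integral_of_le_on_Icc (P := |μ| + 1) (hm.sub hm').integrable_sq
      (.of_forall fun p => sq_nonneg _) fun p hp => ?_
    have h3 := hle T Δ₀ r p h1 h2 hΔ hΔ1 hr hp.1 (by linarith [hp.2])
    have h4 : min 1 (r ^ 2) = (min 1 r) ^ 2 := by
      rcases le_total r 1 with h5 | h5
      · rw [min_eq_right h5, min_eq_right (pow_le_one₀ hr h5)]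
      · rw [min_eq_left h5, min_eq_left (one_le_pow₀ h5), one_pow]
    rw [h4, ← mul_pow]
    exact pow_le_pow_left₀ (mul_nonneg hc.le (le_min zero_le_one hr)) h3 2
  rcases le_total 0 s with hs | hs
  · have h3 := key s hs
    rw [← integral_sub_right_eq_self _ s] at h3
    simp only [sub_add_cancel] at h3
    refine h3.trans (le_of_eq ?_)
    congr 1; funext p; ring
  · have h3 := key (-s) (neg_nonneg.2 hs)
    rwa [neg_sq] at h3

end Reciprocal

/-! ### The size of the gap below the critical temperature -/

section Gap

variable {μ T Δ₀ : ℝ}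

theorem tanh_div_eq_tanhRatio {k : ℝ} (hT : 0 < T) (hk : k ≠ 0) :
    tanh (k / (2 * T)) / k = tanhRatio (|k| / (2 * T)) / (2 * T) := by
  rcases hk.lt_or_gt with h | h
  · rw [abs_of_neg h, tanhRatio, neg_div, Real.tanh_neg]
    field_simp
  · rw [abs_of_pos h, tanhRatio]
    field_simp

theorem ae_sq_sub_ne_zero (μ : ℝ) : ∀ᵐ p : ℝ, p ^ 2 - μ ≠ 0 := by
  have h1 : ({sqrt μ, -sqrt μ} : Set ℝ).Finite := Set.toFinite _
  have h2 := h1.measure_zero (volume : Measure ℝ)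
  rw [measure_eq_zero_iff_ae_notMem] at h2
  filter_upwards [h2] with p hp h0
  refine hp ?_
  have h3 : |p| = sqrt μ := by
    rw [← Real.sqrt_sq_eq_abs, sub_eq_zero.1 h0]
  exact eq_or_eq_neg_of_abs_eq h3

theorem tanh_div_nonneg (hT : 0 < T) (p : ℝ) :
    0 ≤ tanh ((p ^ 2 - μ) / (2 * T)) / (p ^ 2 - μ) := by
  rcases eq_or_ne (p ^ 2 - μ) 0 with h | h
  · rw [h, div_zero]
  · rw [tanh_div_eq_tanhRatio hT h]
    have := tanhRatio_pos (div_pos (abs_pos.2 h) (by positivity : 0 < 2 * T))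
    positivity

theorem inv_KT_le_tanh_div (hT : 0 < T) {p : ℝ} (hp : p ^ 2 - μ ≠ 0) :
    (KT μ T Δ₀ p)⁻¹ ≤ tanh ((p ^ 2 - μ) / (2 * T)) / (p ^ 2 - μ) := by
  rw [tanh_div_eq_tanhRatio hT hp, inv_KT hT]
  gcongr
  exact tanhRatio_antitone (div_pos (abs_pos.2 hp) (by positivity))
    (div_le_div_of_nonneg_right (abs_le_dispersion μ Δ₀ p) (by positivity))

theorem tanh_div_sub_inv_KT_le (hT : 0 < T) (hΔ : 0 < Δ₀) (p : ℝ) :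
    tanh ((p ^ 2 - μ) / (2 * T)) / (p ^ 2 - μ) - (KT μ T Δ₀ p)⁻¹ ≤
      2 * (1 + (|μ| + 1) / (2 * T)) * Δ₀ ^ 2 / T ^ 2 * (1 + p ^ 2)⁻¹ := by
  rcases eq_or_ne (p ^ 2 - μ) 0 with h | h
  · rw [h, div_zero, zero_sub]
    have := KT_pos (μ := μ) hT hΔ p
    exact (neg_nonpos.2 (by positivity)).trans (by positivity)
  rw [tanh_div_eq_tanhRatio hT h, inv_KT hT, ← sub_div, div_le_iff₀ (by positivity)]
  set x := |p ^ 2 - μ| / (2 * T) with hx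
  set y := dispersion μ Δ₀ p / (2 * T) with hy
  have hx0 : 0 < x := div_pos (abs_pos.2 h) (by positivity)
  have hxy : x ≤ y := div_le_div_of_nonneg_right (abs_le_dispersion μ Δ₀ p) (by positivity)
  have h1 := tanhRatio_sub_le hx0 hxy
  have e : y ^ 2 - x ^ 2 = Δ₀ ^ 2 / (4 * T ^ 2) := by
    rw [hx, hy, div_pow, div_pow, dispersion_sq, sq_abs]; field_simp; ring
  rw [e] at h1
  have h2 := one_add_sq_le_add_dispersion (μ := μ) hT le_rfl hΔ p
  have ey : 2 * T + dispersion μ Δ₀ p = 2 * T * (1 + y) := by rw [hy]; field_simp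
  rw [ey] at h2
  set A := 1 + (|μ| + 1) / (2 * T) with hA
  have hA0 : 0 < A := by positivity
  have h3 : (1 + y)⁻¹ ≤ 2 * T * A * (1 + p ^ 2)⁻¹ := by
    rw [← div_eq_mul_inv, inv_eq_one_div, div_le_div_iff₀ (by linarith) (by positivity)]
    linarith
  have h4 : 1 + y ≤ (1 + x) * (1 + y) * (1 + x + y) := by
    have hy0 := hx0.trans_le hxy
    nlinarith [mul_pos hx0 hy0, mul_pos (mul_pos hx0 hy0) hx0, mul_pos (mul_pos hx0 hy0) hy0]
  calc _ ≤ 8 * (Δ₀ ^ 2 / (4 * T ^ 2)) / ((1 + x) * (1 + y) * (1 + x + y)) := h1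
    _ ≤ 8 * (Δ₀ ^ 2 / (4 * T ^ 2)) * (1 + y)⁻¹ := by
      rw [div_eq_mul_inv]
      have : 0 < 1 + y := by linarith
      gcongr
    _ ≤ 8 * (Δ₀ ^ 2 / (4 * T ^ 2)) * (2 * T * A * (1 + p ^ 2)⁻¹) := by gcongr
    _ = _ := by field_simp; ring

theorem integrable_tanh_div (μ : ℝ) (hT : 0 < T) :
    Integrable fun p => tanh ((p ^ 2 - μ) / (2 * T)) / (p ^ 2 - μ) := by
  have hm : Measurable fun p : ℝ => tanh ((p ^ 2 - μ) / (2 * T)) / (p ^ 2 - μ) :=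
    (continuous_tanh.measurable.comp (by fun_prop : Measurable fun p : ℝ =>
      (p ^ 2 - μ) / (2 * T))).div (by fun_prop)
  refine ((integrable_inv_KT (μ := μ) hT one_pos).add (integrable_inv_one_add_sq.const_mul
    (2 * (1 + (|μ| + 1) / (2 * T)) * 1 ^ 2 / T ^ 2))).mono' hm.aestronglyMeasurable
    (.of_forall fun p => ?_)
  rw [Real.norm_of_nonneg (tanh_div_nonneg hT p), Pi.add_apply]
  linarith [tanh_div_sub_inv_KT_le (μ := μ) hT one_pos p]

theorem exists_le_tanh_div_sub_inv_KT (μ : ℝ) (hT : 0 < T) : ∃ c : ℝ, 0 < c ∧ ∀ Δ₀ p : ℝ, 0 < Δ₀ →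
    |μ| + 1 ≤ p → p ≤ |μ| + 2 → c * min 1 Δ₀ ^ 2 ≤
      tanh ((p ^ 2 - μ) / (2 * T)) / (p ^ 2 - μ) - (KT μ T Δ₀ p)⁻¹ := by
  set L := ((|μ| + 2) ^ 2 + |μ| + 1) / (2 * T) with hL
  have hcosh := Real.cosh_pos L
  refine ⟨(2 * T)⁻¹ * ((4 * T ^ 2)⁻¹ / (3 * cosh L ^ 2)), by positivity, ?_⟩
  intro Δ₀ p hΔ hp1 hp2
  have hμ := abs_nonneg μ
  have hμ' := le_abs_self μ
  have hμ'' := neg_abs_le μ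
  have hk : 0 < p ^ 2 - μ := by nlinarith
  set d := min 1 Δ₀ with hd
  have hd0 : 0 < d := lt_min one_pos hΔ
  rw [tanh_div_eq_tanhRatio hT hk.ne', inv_KT hT, ← sub_div, div_eq_inv_mul (_ - _)]
  set x := |p ^ 2 - μ| / (2 * T) with hx
  set y := dispersion μ d p / (2 * T) with hy
  set v := dispersion μ Δ₀ p / (2 * T) with hv
  have hx0 : 0 < x := div_pos (abs_pos.2 hk.ne') (by positivity)
  have hxy : x ≤ y := div_le_div_of_nonneg_right (abs_le_dispersion μ d p) (by positivity)
  have hyv : y ≤ v := by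
    refine div_le_div_of_nonneg_right (Real.sqrt_le_sqrt ?_) (by positivity)
    have : d ^ 2 ≤ Δ₀ ^ 2 := pow_le_pow_left₀ hd0.le (min_le_right _ _) 2
    linarith
  have hyL : y ≤ L := by
    refine div_le_div_of_nonneg_right ?_ (by positivity)
    have h3 := dispersion_le (μ := μ) hd0 p
    rw [abs_of_pos hk] at h3
    have h4 : d ≤ 1 := min_le_left _ _
    have h5 : p ^ 2 ≤ (|μ| + 2) ^ 2 := pow_le_pow_left₀ (by linarith) hp2 2
    linarith
  have h3 := sub_le_tanhRatio_sub hx0 hxy hyL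
  have h4 := tanhRatio_antitone (hx0.trans_le hxy) hyv
  have e : y ^ 2 - x ^ 2 = d ^ 2 / (4 * T ^ 2) := by
    rw [hx, hy, div_pow, div_pow, dispersion_sq, sq_abs]; field_simp; ring
  rw [e] at h3
  calc (2 * T)⁻¹ * ((4 * T ^ 2)⁻¹ / (3 * cosh L ^ 2)) * d ^ 2
      = (2 * T)⁻¹ * (d ^ 2 / (4 * T ^ 2) / (3 * cosh L ^ 2)) := by ring
    _ ≤ _ := by gcongr; linarith

theorem inv_KT_sub_le {Tc : ℝ} (hT : 0 < T) (hTc : T ≤ Tc) (hΔ : 0 < Δ₀) (p : ℝ) :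
    (KT μ T Δ₀ p)⁻¹ - (KT μ Tc Δ₀ p)⁻¹ ≤ (1 - T / Tc) * (KT μ T Δ₀ p)⁻¹ := by
  have hTc0 := hT.trans_le hTc
  have h1 : T / Tc * (KT μ T Δ₀ p)⁻¹ ≤ (KT μ Tc Δ₀ p)⁻¹ := by
    rw [inv_KT hT, inv_KT hTc0]
    have hE := dispersion_pos (μ := μ) hΔ p
    calc T / Tc * (tanhRatio (dispersion μ Δ₀ p / (2 * T)) / (2 * T))
        = tanhRatio (dispersion μ Δ₀ p / (2 * T)) / (2 * Tc) := by field_simp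
      _ ≤ _ := by
        gcongr
        exact tanhRatio_antitone (by positivity) (by gcongr)
  linarith

theorem le_inv_KT_sub {Tc L : ℝ} (hT : 0 < T) (hTc : T ≤ Tc) (hΔ : 0 < Δ₀) {p : ℝ}
    (hL : dispersion μ Δ₀ p / (2 * T) ≤ L) :
    (1 / (2 * T) - 1 / (2 * Tc)) / cosh L ^ 2 ≤
      (KT μ T Δ₀ p)⁻¹ - (KT μ Tc Δ₀ p)⁻¹ := by
  have hTc0 := hT.trans_le hTc
  have hE := dispersion_pos (μ := μ) hΔ p
  rw [KT, KT, inv_div, inv_div, ← sub_div, le_div_iff₀ hE]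
  set E := dispersion μ Δ₀ p with hEdef
  set x := E / (2 * T) with hx
  set y := E / (2 * Tc) with hy
  have hy0 : 0 < y := by positivity
  have hyx : y ≤ x := by rw [hx, hy]; gcongr
  have h1 : tanh x - tanh y = sinh (x - y) / (cosh x * cosh y) := by
    rw [Real.tanh_eq_sinh_div_cosh, Real.tanh_eq_sinh_div_cosh, Real.sinh_sub,
      div_sub_div _ _ (Real.cosh_pos x).ne' (Real.cosh_pos y).ne']
  have h2 : x - y ≤ sinh (x - y) := Real.self_le_sinh_iff.2 (sub_nonneg.2 hyx)
  have hcx : cosh x ≤ cosh L := by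
    rw [Real.cosh_le_cosh, abs_of_pos (hy0.trans_le hyx),
      abs_of_pos ((hy0.trans_le hyx).trans_le hL)]; exact hL
  have hcy : cosh y ≤ cosh L := by
    rw [Real.cosh_le_cosh, abs_of_pos hy0,
      abs_of_pos ((hy0.trans_le hyx).trans_le hL)]; exact hyx.trans hL
  have hx0 := Real.cosh_pos x
  have hy0' := Real.cosh_pos y
  rw [h1]
  calc (1 / (2 * T) - 1 / (2 * Tc)) / cosh L ^ 2 * E = (x - y) / (cosh L ^ 2) := by
        rw [hx, hy]; ring
    _ ≤ (x - y) / (cosh x * cosh y) := by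
        rw [sq]
        have := sub_nonneg.2 hyx
        gcongr
    _ ≤ _ := by gcongr

end Gap

theorem integral_inv_KT_eq {μ a T Δ₀ : ℝ} (hgap : IsGap μ a T Δ₀) :
    ∫ p, (KT μ T Δ₀ p)⁻¹ = 2 * π / a := by
  have h1 := hgap.2
  rw [integral_div] at h1
  have := Real.pi_pos
  simp only [one_div] at h1
  rw [eq_div_iff (by positivity)] at h1
  rw [← h1]; ring

theorem integral_tanh_div_eq {μ a Tc : ℝ} (hTc : IsCriticalTemperature μ a Tc) :
    ∫ p, tanh ((p ^ 2 - μ) / (2 * Tc)) / (p ^ 2 - μ) = 2 * π / a := by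
  have h1 := hTc.2
  rw [integral_div] at h1
  have := Real.pi_pos
  rw [eq_div_iff (by positivity)] at h1
  rw [← h1]; ring

/-- Below the critical temperature, `Δ₀` is of the order `h`: subtracting the equation for the
critical temperature from the gap equation balances a term of order `Δ₀ ^ 2` with a term of order
`h ^ 2`. -/
theorem exists_gap_bounds {μ a D Tc : ℝ} (ha : 0 < a) (hD : 0 < D)
    (hTc : IsCriticalTemperature μ a Tc) : ∃ C h₀ : ℝ, 0 < C ∧ 0 < h₀ ∧ h₀ ≤ 1 ∧
      ∀ h T Δ₀ : ℝ, 0 < h → h ≤ h₀ → T = Tc * (1 - D * h ^ 2) → IsGap μ a T Δ₀ →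
        Tc / 2 ≤ T ∧ T ≤ Tc ∧ Δ₀ ≤ 1 ∧ Δ₀ ≤ C * h ∧ h ≤ C * Δ₀ := by
  have hTc0 := hTc.1
  have hπ := Real.pi_pos
  obtain ⟨c, hc, hcle⟩ := exists_le_tanh_div_sub_inv_KT μ hTc0
  set L := ((|μ| + 2) ^ 2 + |μ| + 1) / Tc with hL
  have hcosh := Real.cosh_pos L
  set k₁ := 2 * π * D / (a * c) with hk₁
  set k₂ := 2 * (1 + (|μ| + 1) / (2 * Tc)) / Tc ^ 2 * π * (2 * Tc * cosh L ^ 2 / D)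
    with hk₂
  have hk₁0 : 0 < k₁ := by positivity
  have hk₂0 : 0 < k₂ := by positivity
  refine ⟨1 + k₁ + k₂, min 1 (min (1 / (1 + 2 * D)) (1 / (1 + k₁))), by positivity,
    by positivity, min_le_left _ _, ?_⟩
  rintro h T Δ₀ hh hh0 hT hgap
  have hΔ := hgap.1
  have hh1 : h ≤ 1 := hh0.trans (min_le_left _ _)
  have hsq : h ^ 2 ≤ h := pow_le_of_le_one hh.le hh1 (by norm_num)
  have hDh : D * h ^ 2 ≤ 1 / 2 := by
    have h1 : h ≤ 1 / (1 + 2 * D) := hh0.trans ((min_le_right _ _).trans (min_le_left _ _))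
    rw [le_div_iff₀ (by positivity)] at h1
    nlinarith
  have hkh : k₁ * h ^ 2 < 1 := by
    have h1 : h ≤ 1 / (1 + k₁) := hh0.trans ((min_le_right _ _).trans (min_le_right _ _))
    rw [le_div_iff₀ (by positivity)] at h1
    nlinarith
  have hDh0 : 0 < D * h ^ 2 := by positivity
  have hT1 : Tc / 2 ≤ T := by rw [hT]; nlinarith
  have hT2 : T ≤ Tc := by rw [hT]; nlinarith
  have hT0 : 0 < T := by linarith
  have hTT : 1 - T / Tc = D * h ^ 2 := by rw [hT]; field_simp; ring
  have i1 := integrable_inv_KT (μ := μ) hT0 hΔ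
  have i2 := integrable_inv_KT (μ := μ) hTc0 hΔ
  have i3 := integrable_tanh_div μ hTc0
  have hbal : ∫ p, (tanh ((p ^ 2 - μ) / (2 * Tc)) / (p ^ 2 - μ) - (KT μ Tc Δ₀ p)⁻¹) =
      ∫ p, ((KT μ T Δ₀ p)⁻¹ - (KT μ Tc Δ₀ p)⁻¹) := by
    rw [integral_sub i3 i2, integral_sub i1 i2, integral_tanh_div_eq hTc, integral_inv_KT_eq hgap]
  set I := ∫ p, (tanh ((p ^ 2 - μ) / (2 * Tc)) / (p ^ 2 - μ) - (KT μ Tc Δ₀ p)⁻¹)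
  have hI1 : c * min 1 Δ₀ ^ 2 ≤ I := by
    refine le_integral_of_le_on_Icc (P := |μ| + 1) (i3.sub i2) ?_ fun p hp =>
      hcle Δ₀ p hΔ hp.1 (by linarith [hp.2])
    filter_upwards [ae_sq_sub_ne_zero μ] with p hp
    exact sub_nonneg.2 (inv_KT_le_tanh_div hTc0 hp)
  have hI2 : I ≤ D * h ^ 2 * (2 * π / a) := by
    rw [hbal, ← integral_inv_KT_eq hgap, ← integral_const_mul, ← hTT]
    exact integral_mono (i1.sub i2) (i1.const_mul _) fun p => inv_KT_sub_le hT0 hT2 hΔ p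
  have hI3 : I ≤ 2 * (1 + (|μ| + 1) / (2 * Tc)) * Δ₀ ^ 2 / Tc ^ 2 * π := by
    rw [← integral_univ_inv_one_add_sq, ← integral_const_mul]
    exact integral_mono (i3.sub i2) (integrable_inv_one_add_sq.const_mul _) fun p =>
      tanh_div_sub_inv_KT_le hTc0 hΔ p
  have hmin : min 1 Δ₀ ^ 2 ≤ k₁ * h ^ 2 := by
    have h1 : c * min 1 Δ₀ ^ 2 ≤ c * (k₁ * h ^ 2) := by
      refine (hI1.trans hI2).trans (le_of_eq ?_)
      rw [hk₁]; field_simp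
    exact le_of_mul_le_mul_left h1 hc
  have hΔ1 : Δ₀ ≤ 1 := by
    by_contra hcon
    rw [min_eq_left (not_le.1 hcon).le] at hmin
    linarith
  rw [min_eq_right hΔ1] at hmin
  have hI4 : D * h ^ 2 / (2 * Tc * cosh L ^ 2) ≤ I := by
    rw [hbal]
    refine le_integral_of_le_on_Icc (P := |μ| + 1) (i1.sub i2)
      (.of_forall fun p => ?_) fun p hp => ?_
    · have h1 := le_inv_KT_sub (μ := μ) hT0 hT2 hΔ (p := p) le_rfl
      refine le_trans ?_ h1
      have : 1 / (2 * Tc) ≤ 1 / (2 * T) := by gcongr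
      exact div_nonneg (sub_nonneg.2 this) (sq_nonneg _)
    · refine le_trans ?_ (le_inv_KT_sub (μ := μ) hT0 hT2 hΔ (p := p) (L := L) ?_)
      · have h1 : D * h ^ 2 / (2 * Tc) ≤ 1 / (2 * T) - 1 / (2 * Tc) := by
          have : 1 / (2 * T) - 1 / (2 * Tc) = D * h ^ 2 / (2 * T) := by
            rw [← hTT]; field_simp
          rw [this]; gcongr
        rw [← div_div]
        gcongr
      · have h3 := dispersion_le (μ := μ) hΔ p
        have h5 : p ^ 2 ≤ (|μ| + 2) ^ 2 :=
          pow_le_pow_left₀ (by linarith [hp.1, abs_nonneg μ]) (by linarith [hp.2]) 2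
        have h4 : |p ^ 2 - μ| ≤ (|μ| + 2) ^ 2 + |μ| := by
          rw [abs_le]
          constructor <;> nlinarith [neg_abs_le μ, le_abs_self μ, sq_nonneg p, abs_nonneg μ]
        refine div_le_div₀ (by positivity) (by linarith) hTc0 (by linarith)
  have hlow : h ^ 2 ≤ k₂ * Δ₀ ^ 2 := by
    have h1 := hI4.trans hI3
    rw [div_le_iff₀ (by positivity)] at h1
    have h2 : D * h ^ 2 ≤ D * (k₂ * Δ₀ ^ 2) := by
      refine h1.trans (le_of_eq ?_)
      rw [hk₂]; field_simp
    exact le_of_mul_le_mul_left h2 hD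
  have hC1 : (1 : ℝ) ≤ 1 + k₁ + k₂ := by linarith
  refine ⟨hT1, hT2, hΔ1, ?_, ?_⟩
  · refine (pow_le_pow_iff_left₀ hΔ.le (by positivity) two_ne_zero).1 ?_
    rw [mul_pow]
    refine hmin.trans ?_
    gcongr
    exact le_trans (by linarith) (le_self_pow₀ hC1 two_ne_zero)
  · refine (pow_le_pow_iff_left₀ hh.le (by positivity) two_ne_zero).1 ?_
    rw [mul_pow]
    refine hlow.trans ?_
    gcongr
    exact le_trans (by linarith) (le_self_pow₀ hC1 two_ne_zero)

/-! ### Uniform bounds on the translation-invariant pair function -/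

theorem integral_comp_scale {h : ℝ} (hh : 0 < h) (F : ℝ → ℝ) :
    ∫ ξ, F (h * (2 * π * ξ)) = (2 * π * h)⁻¹ * ∫ p, F p := by
  have hπ := Real.pi_pos
  have h1 := Measure.integral_comp_mul_left F (h * (2 * π))
  simp only [mul_assoc] at h1 ⊢
  rw [h1, abs_of_pos (by positivity), smul_eq_mul]
  congr 2
  ring

theorem integrable_comp_scale {h : ℝ} (hh : 0 < h) {F : ℝ → ℝ} (hF : Integrable F) :
    Integrable fun ξ => F (h * (2 * π * ξ)) := by
  have hπ := Real.pi_pos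
  have h1 := hF.comp_mul_left' (R := h * (2 * π)) (by positivity)
  simpa only [mul_assoc] using h1

theorem pairSym_eq {μ T Δ₀ h : ℝ} (ξ : ℝ) :
    pairSym μ T Δ₀ h ξ = Δ₀ / 2 * (KT μ T Δ₀ (h * (2 * π * ξ)))⁻¹ := by
  rw [pairSym, div_mul_eq_div_div, div_eq_mul_inv]

theorem pairSym_sub_eq {μ T Δ₀ h : ℝ} (ξ m : ℝ) : pairSym μ T Δ₀ h (ξ - m) =
    Δ₀ / 2 * (KT μ T Δ₀ (h * (2 * π * ξ) - h * (2 * π * m)))⁻¹ := by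
  rw [pairSym_eq, mul_sub, mul_sub]

set_option maxHeartbeats 1000000 in
/-- The translation-invariant pair function satisfies `PairBounds` with a constant that does not
depend on `h`. -/
theorem exists_pairBounds {μ a D Tc : ℝ} (ha : 0 < a) (hD : 0 < D)
    (hTc : IsCriticalTemperature μ a Tc) : ∃ C h₀ : ℝ, 1 ≤ C ∧ 0 < h₀ ∧ h₀ ≤ 1 ∧
      ∀ h T Δ₀ : ℝ, 0 < h → h ≤ h₀ → T = Tc * (1 - D * h ^ 2) → IsGap μ a T Δ₀ →
        0 < T ∧ 1 / T ≤ C ∧ PairBounds C h (a * h) (2 * T) (Δ₀ / 2)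
          (fun ξ => KT μ T Δ₀ (h * (2 * π * ξ))) (pairSym μ T Δ₀ h) := by
  have hTc0 := hTc.1
  have hπ := Real.pi_pos
  obtain ⟨g, h₀, hg, hh₀, hh₀1, hgap⟩ := exists_gap_bounds ha hD hTc
  obtain ⟨c, hc, hshift⟩ := exists_le_integral_sq_inv_KT_sub μ (half_pos hTc0) Tc
  set A := 1 + (|μ| + 1) / (2 * (Tc / 2)) with hA
  set B := 16 * (1 + |μ|) * A ^ 3 with hB
  set K₁ := |μ| + 2 + 2 * Tc with hK₁
  have hA0 : 0 < A := by positivity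
  have hK₁0 : 0 < K₁ := by positivity
  set C := 1 + 2 / Tc + A + g ^ 2 * A ^ 2 + 16 * π * K₁ ^ 2 * g ^ 2 + g ^ 2 * B ^ 2 +
    8 * π * g ^ 2 / c + 2 * π * K₁ ^ 2 / (a * Tc) with hC
  have p1 : 0 < 2 / Tc := by positivity
  have p2 : 0 ≤ g ^ 2 * A ^ 2 := by positivity
  have p3 : 0 ≤ 16 * π * K₁ ^ 2 * g ^ 2 := by positivity
  have p4 : 0 ≤ g ^ 2 * B ^ 2 := by positivity
  have p5 : 0 ≤ 8 * π * g ^ 2 / c := by positivity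
  have p6 : 0 ≤ 2 * π * K₁ ^ 2 / (a * Tc) := by positivity
  refine ⟨C, h₀, by linarith, hh₀, hh₀1, fun h T Δ₀ hh hhh hT hG => ?_⟩
  obtain ⟨hT1, hT2, hΔ1, hΔh, hhΔ⟩ := hgap h T Δ₀ hh hhh hT hG
  have hΔ := hG.1
  have hT0 : 0 < T := by linarith
  have hΔh2 : Δ₀ ^ 2 ≤ g ^ 2 * h ^ 2 := by
    rw [← mul_pow]; exact pow_le_pow_left₀ hΔ.le hΔh 2
  have hhΔ2 : h ^ 2 ≤ g ^ 2 * Δ₀ ^ 2 := by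
    rw [← mul_pow]; exact pow_le_pow_left₀ hh.le hhΔ 2
  have hJ0 : ∀ p, 0 < (KT μ T Δ₀ p)⁻¹ := fun p => inv_pos.2 (KT_pos hT0 hΔ p)
  have hJ := fun p => inv_KT_le (μ := μ) (half_pos hTc0) hT1 hΔ p
  have hJc : Continuous fun p => (KT μ T Δ₀ p)⁻¹ :=
    (continuous_KT hT0 hΔ).inv₀ fun p => (KT_pos hT0 hΔ p).ne'
  have hJ2 := (memLp_inv_KT (μ := μ) hT0 hΔ).integrable_sq
  have hJlow : ∀ p ∈ Icc (0 : ℝ) (0 + 1), K₁⁻¹ ≤ (KT μ T Δ₀ p)⁻¹ := by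
    intro p hp
    have h1 := KT_le (μ := μ) hT0 hΔ p
    have h2 : |p ^ 2 - μ| ≤ 1 + |μ| := by
      have : p ^ 2 ≤ 1 := pow_le_one₀ hp.1 (by linarith [hp.2])
      rw [abs_le]; constructor <;> linarith [neg_abs_le μ, le_abs_self μ, sq_nonneg p]
    exact inv_anti₀ (KT_pos hT0 hΔ p) (by linarith)
  have hpp : ∀ p : ℝ, 0 < 1 + p ^ 2 := fun p => by positivity
  have hJsq : ∀ p, (KT μ T Δ₀ p)⁻¹ ^ 2 ≤ A ^ 2 * ((1 + p ^ 2)⁻¹) ^ 2 := fun p => by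
    rw [← mul_pow]; exact pow_le_pow_left₀ (hJ0 p).le (hJ p) 2
  -- The bounds in momentum space, where `p = 2 π h ξ`.
  have b1 : ∫ p, (1 + p ^ 2) * (KT μ T Δ₀ p)⁻¹ ^ 2 ≤ A ^ 2 * π := by
    rw [← integral_univ_inv_one_add_sq, ← integral_const_mul]
    refine integral_mono_of_nonneg (.of_forall fun p => ?_)
      (integrable_inv_one_add_sq.const_mul _) (.of_forall fun p => ?_)
    · exact mul_nonneg (hpp p).le (sq_nonneg _)
    · calc (1 + p ^ 2) * (KT μ T Δ₀ p)⁻¹ ^ 2 ≤ (1 + p ^ 2) * (A ^ 2 * ((1 + p ^ 2)⁻¹) ^ 2) :=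
            mul_le_mul_of_nonneg_left (hJsq p) (hpp p).le
        _ = _ := by
          have := (hpp p).ne'
          field_simp
  have b2 : 1 / (2 * K₁ ^ 2) ≤ ∫ p, (1 + p ^ 2)⁻¹ * (KT μ T Δ₀ p)⁻¹ ^ 2 := by
    refine le_integral_of_le_on_Icc (P := 0) ?_ (.of_forall fun p => ?_)
      fun p hp => ?_
    · refine hJ2.mono' ?_ (.of_forall fun p => ?_)
      · exact (((by fun_prop : Continuous fun p : ℝ => 1 + p ^ 2).inv₀
          fun p => (hpp p).ne').mul (hJc.pow 2)).aestronglyMeasurable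
      · rw [Real.norm_of_nonneg (mul_nonneg (inv_pos.2 (hpp p)).le (sq_nonneg _))]
        exact mul_le_of_le_one_left (sq_nonneg _)
          (inv_le_one_of_one_le₀ (by nlinarith [sq_nonneg p]))
    · exact mul_nonneg (inv_pos.2 (hpp p)).le (sq_nonneg _)
    · have h1 : (2 : ℝ)⁻¹ ≤ (1 + p ^ 2)⁻¹ := by
        refine inv_anti₀ (hpp p) ?_
        have : p ^ 2 ≤ 1 := pow_le_one₀ hp.1 (by linarith [hp.2])
        linarith
      calc 1 / (2 * K₁ ^ 2) = 2⁻¹ * K₁⁻¹ ^ 2 := by field_simp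
        _ ≤ _ := by
          have := hJlow p hp
          gcongr
  have b3 : 1 / K₁ ^ 2 ≤ ∫ p, (KT μ T Δ₀ p)⁻¹ ^ 2 := by
    refine le_integral_of_le_on_Icc (P := 0) hJ2 (.of_forall fun p => sq_nonneg _)
      fun p hp => ?_
    rw [one_div, ← inv_pow]
    exact pow_le_pow_left₀ (by positivity) (hJlow p hp) 2
  have b4 : ∀ s : ℝ, Integrable (fun p => (1 + p ^ 2) *
      ((KT μ T Δ₀ p)⁻¹ - (KT μ T Δ₀ (p - s))⁻¹) ^ 2) ∧
      ∫ p, (1 + p ^ 2) * ((KT μ T Δ₀ p)⁻¹ - (KT μ T Δ₀ (p - s))⁻¹) ^ 2 ≤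
        2 * B ^ 2 * s ^ 2 * π := by
    intro s
    have h1 : ∀ p, (1 + p ^ 2) * ((KT μ T Δ₀ p)⁻¹ - (KT μ T Δ₀ (p - s))⁻¹) ^ 2 ≤
        2 * B ^ 2 * s ^ 2 * (1 + (p - s) ^ 2)⁻¹ := fun p => by
      have := sq_inv_KT_sub_le (μ := μ) (half_pos hTc0) hT1 hΔ p (p - s)
      rwa [sub_sub_cancel] at this
    have h2 : Integrable fun p : ℝ => 2 * B ^ 2 * s ^ 2 * (1 + (p - s) ^ 2)⁻¹ :=
      (integrable_inv_one_add_sq.comp_sub_right s).const_mul _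
    have h3 : Integrable (fun p => (1 + p ^ 2) *
        ((KT μ T Δ₀ p)⁻¹ - (KT μ T Δ₀ (p - s))⁻¹) ^ 2) := by
      refine h2.mono' ?_ (.of_forall fun p => ?_)
      · exact ((by fun_prop : Continuous fun p : ℝ => 1 + p ^ 2).mul
          ((hJc.sub (hJc.comp (continuous_sub_right s))).pow 2)).aestronglyMeasurable
      · rw [Real.norm_of_nonneg (mul_nonneg (hpp p).le (sq_nonneg _))]
        exact h1 p
    refine ⟨h3, (integral_mono h3 h2 h1).trans (le_of_eq ?_)⟩
    rw [integral_const_mul, integral_sub_right_eq_self (fun p : ℝ => (1 + p ^ 2)⁻¹) s,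
      integral_univ_inv_one_add_sq]
  have b5 : ∀ s : ℝ, (1 + s ^ 2) * ∫ p, (1 + p ^ 2)⁻¹ * (KT μ T Δ₀ (p - s))⁻¹ ^ 2 ≤
      2 * A ^ 2 * π := by
    intro s
    rw [← integral_univ_inv_one_add_sq,
      ← integral_sub_right_eq_self (fun p : ℝ => (1 + p ^ 2)⁻¹) s, ← integral_const_mul,
      ← integral_const_mul]
    refine integral_mono_of_nonneg (.of_forall fun p => ?_)
      ((integrable_inv_one_add_sq.comp_sub_right s).const_mul _)
      (.of_forall fun p => ?_)
    · have := inv_pos.2 (hpp p)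
      have := hpp s
      positivity
    · have h1 := hpp p
      have h2 := hpp (p - s)
      -- `1 + s² ≤ 2 (1 + p²) (1 + (p - s)²)`
      have h3 : (1 + s ^ 2) ≤ 2 * ((1 + p ^ 2) * (1 + (p - s) ^ 2)) := by
        nlinarith [sq_nonneg (2 * p - s), sq_nonneg (p * (p - s))]
      calc (1 + s ^ 2) * ((1 + p ^ 2)⁻¹ * (KT μ T Δ₀ (p - s))⁻¹ ^ 2)
          ≤ 2 * ((1 + p ^ 2) * (1 + (p - s) ^ 2)) *
            ((1 + p ^ 2)⁻¹ * (A ^ 2 * ((1 + (p - s) ^ 2)⁻¹) ^ 2)) := by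
            have := hJsq (p - s)
            have := inv_pos.2 h1
            gcongr
        _ = _ := by field_simp
  have ew : ∀ ξ, weight h ξ = 1 + (h * (2 * π * ξ)) ^ 2 := weight_eq h
  refine ⟨hT0, ?_, ?_, ?_, ?_, ?_, ?_, ?_, ?_⟩
  · refine le_trans ?_ (by linarith : 2 / Tc ≤ C)
    rw [div_le_div_iff₀ hT0 hTc0]
    linarith
  · intro ξ
    rw [ew]
    refine (one_add_sq_le_KT (μ := μ) (half_pos hTc0) hT1 hΔ _).trans ?_
    have := KT_pos (μ := μ) hT0 hΔ (h * (2 * π * ξ))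
    gcongr
    linarith
  · have e : ∫ ξ, weight h ξ * pairSym μ T Δ₀ h ξ ^ 2 =
        Δ₀ ^ 2 / 4 * ((2 * π * h)⁻¹ * ∫ p, (1 + p ^ 2) * (KT μ T Δ₀ p)⁻¹ ^ 2) := by
      rw [← integral_comp_scale hh, ← integral_const_mul]
      congr 1; funext ξ
      rw [ew, pairSym_eq]; ring
    rw [e]
    calc _ ≤ g ^ 2 * h ^ 2 / 4 * ((2 * π * h)⁻¹ * (A ^ 2 * π)) := by gcongr
      _ = g ^ 2 * A ^ 2 / 8 * h := by field_simp; ring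
      _ ≤ _ := by gcongr; linarith
  · have e : ∫ ξ, (weight h ξ)⁻¹ * pairSym μ T Δ₀ h ξ ^ 2 =
        Δ₀ ^ 2 / 4 * ((2 * π * h)⁻¹ * ∫ p, (1 + p ^ 2)⁻¹ * (KT μ T Δ₀ p)⁻¹ ^ 2) := by
      rw [← integral_comp_scale hh, ← integral_const_mul]
      congr 1; funext ξ
      rw [ew, pairSym_eq]; ring
    rw [e]
    calc h = h⁻¹ * h ^ 2 := by field_simp
      _ ≤ h⁻¹ * (g ^ 2 * Δ₀ ^ 2) := by gcongr
      _ = 16 * π * K₁ ^ 2 * g ^ 2 *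
          (Δ₀ ^ 2 / 4 * ((2 * π * h)⁻¹ * (1 / (2 * K₁ ^ 2)))) := by field_simp; ring
      _ ≤ _ := by gcongr; linarith
  · intro m
    have e1 : ∀ ξ, weight h ξ * (pairSym μ T Δ₀ h ξ - pairSym μ T Δ₀ h (ξ - m)) ^ 2 =
        Δ₀ ^ 2 / 4 * ((1 + (h * (2 * π * ξ)) ^ 2) *
          ((KT μ T Δ₀ (h * (2 * π * ξ)))⁻¹ -
            (KT μ T Δ₀ (h * (2 * π * ξ) - h * (2 * π * m)))⁻¹) ^ 2) := fun ξ => by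
      rw [ew, pairSym_eq, pairSym_sub_eq]; ring
    obtain ⟨h1, h2⟩ := b4 (h * (2 * π * m))
    simp_rw [e1]
    refine ⟨(integrable_comp_scale hh h1).const_mul _, ?_⟩
    rw [integral_const_mul, integral_comp_scale hh (fun p => (1 + p ^ 2) *
      ((KT μ T Δ₀ p)⁻¹ - (KT μ T Δ₀ (p - h * (2 * π * m)))⁻¹) ^ 2)]
    calc _ ≤ g ^ 2 * h ^ 2 / 4 * ((2 * π * h)⁻¹ *
          (2 * B ^ 2 * (h * (2 * π * m)) ^ 2 * π)) := by gcongr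
      _ = g ^ 2 * B ^ 2 / 4 * h * (h * (2 * π * m)) ^ 2 := by
        field_simp; try ring
      _ ≤ _ := by gcongr; linarith
  · intro m
    have e1 : ∀ ξ, (pairSym μ T Δ₀ h ξ - pairSym μ T Δ₀ h (ξ - m)) ^ 2 =
        Δ₀ ^ 2 / 4 * ((KT μ T Δ₀ (h * (2 * π * ξ)))⁻¹ -
            (KT μ T Δ₀ (h * (2 * π * ξ) - h * (2 * π * m)))⁻¹) ^ 2 := fun ξ => by
      rw [pairSym_eq, pairSym_sub_eq]; ring
    have h2 := hshift T Δ₀ (h * (2 * π * m)) hT1 hT2 hΔ hΔ1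
    simp_rw [e1]
    rw [integral_const_mul, integral_comp_scale hh (fun p =>
      ((KT μ T Δ₀ p)⁻¹ - (KT μ T Δ₀ (p - h * (2 * π * m)))⁻¹) ^ 2)]
    set n := min 1 ((h * (2 * π * m)) ^ 2)
    have hn : 0 ≤ n := le_min zero_le_one (sq_nonneg _)
    calc h * n = h⁻¹ * h ^ 2 * n := by field_simp
      _ ≤ h⁻¹ * (g ^ 2 * Δ₀ ^ 2) * n := by gcongr
      _ = 8 * π * g ^ 2 / c * (Δ₀ ^ 2 / 4 * ((2 * π * h)⁻¹ * (c * n))) := by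
        field_simp; try ring
      _ ≤ _ := by gcongr; linarith
  · intro m
    have e : ∫ ξ, (weight h ξ)⁻¹ * pairSym μ T Δ₀ h (ξ - m) ^ 2 =
        Δ₀ ^ 2 / 4 * ((2 * π * h)⁻¹ * ∫ p, (1 + p ^ 2)⁻¹ *
          (KT μ T Δ₀ (p - h * (2 * π * m)))⁻¹ ^ 2) := by
      rw [← integral_comp_scale hh, ← integral_const_mul]
      congr 1; funext ξ
      rw [ew, pairSym_sub_eq]; ring
    have h5 := b5 (h * (2 * π * m))
    rw [e]
    calc _ = Δ₀ ^ 2 / 4 * ((2 * π * h)⁻¹ * ((1 + (h * (2 * π * m)) ^ 2) *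
          ∫ p, (1 + p ^ 2)⁻¹ * (KT μ T Δ₀ (p - h * (2 * π * m)))⁻¹ ^ 2)) := by ring
      _ ≤ g ^ 2 * h ^ 2 / 4 * ((2 * π * h)⁻¹ * (2 * A ^ 2 * π)) := by
        have : 0 ≤ (1 + (h * (2 * π * m)) ^ 2) *
            ∫ p, (1 + p ^ 2)⁻¹ * (KT μ T Δ₀ (p - h * (2 * π * m)))⁻¹ ^ 2 :=
          mul_nonneg (hpp _).le (integral_nonneg fun p =>
            mul_nonneg (inv_pos.2 (hpp p)).le (sq_nonneg _))
        gcongr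
      _ = g ^ 2 * A ^ 2 / 4 * h := by field_simp; try ring
      _ ≤ _ := by gcongr; linarith
  · have e : ∫ ξ, pairSym μ T Δ₀ h ξ ^ 2 =
        Δ₀ ^ 2 / 4 * ((2 * π * h)⁻¹ * ∫ p, (KT μ T Δ₀ p)⁻¹ ^ 2) := by
      rw [← integral_comp_scale hh, ← integral_const_mul]
      congr 1; funext ξ
      rw [pairSym_eq]; ring
    rw [e]
    calc (1 : ℝ) = 2 * π * K₁ ^ 2 / (a * Tc) *
          (a * (Tc / 2) / π * (1 / K₁ ^ 2)) := by field_simp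
      _ ≤ C * (a * T / π * ∫ p, (KT μ T Δ₀ p)⁻¹ ^ 2) := by
        gcongr
        linarith
      _ = _ := by field_simp; norm_num

/-! ### The decomposition -/

theorem summable_norm_of_summable_weighted {z : ℤ → ℂ} {b : ℤ → ℝ}
    (hz : ∀ m : ℤ, (1 + (2 * π * m) ^ 2) * ‖z m‖ ^ 2 ≤ b m) (hb : Summable b) :
    Summable fun m => ‖z m‖ := by
  have h1 : Summable fun m : ℤ => 1 / (m : ℝ) ^ 2 := Real.summable_one_div_int_pow.2 one_lt_two
  refine (hb.add h1).of_norm_bounded_eventually ?_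
  have h2 : ∀ᶠ m : ℤ in Filter.cofinite, m ≠ 0 := by
    simpa using (Set.finite_singleton (0 : ℤ)).compl_mem_cofinite
  filter_upwards [h2] with m hm
  rw [norm_norm]
  have hm' : (m : ℝ) ≠ 0 := Int.cast_ne_zero.2 hm
  refine le_trans ?_ (add_le_add_left (hz m) _)
  have hπ : (1 : ℝ) ≤ 2 * π := by linarith [Real.pi_gt_three]
  have h3 : (m : ℝ) ^ 2 ≤ 1 + (2 * π * m) ^ 2 := by
    rw [mul_pow]
    have := one_le_pow₀ hπ (n := 2)
    nlinarith [sq_nonneg (m : ℝ)]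
  have h4 : (m : ℝ) ^ 2 * ‖z m‖ ^ 2 ≤ (1 + (2 * π * m) ^ 2) * ‖z m‖ ^ 2 := by gcongr
  have h5 : 1 / (m : ℝ) ^ 2 = (1 / |(m : ℝ)|) ^ 2 := by rw [div_pow, sq_abs, one_pow]
  have h6 : ‖z m‖ = (|(m : ℝ)| * ‖z m‖) * (1 / |(m : ℝ)|) := by
    have := abs_pos.2 hm'
    field_simp
  have h7 : (|(m : ℝ)| * ‖z m‖) ^ 2 = (m : ℝ) ^ 2 * ‖z m‖ ^ 2 := by rw [mul_pow, sq_abs]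
  rw [h5]
  nlinarith [sq_nonneg (|(m : ℝ)| * ‖z m‖ - 1 / |(m : ℝ)|), sq_nonneg (|(m : ℝ)| * ‖z m‖),
    sq_nonneg (1 / |(m : ℝ)|)]

theorem memPerSobolev_trigSeries {z : ℤ → ℂ} (hz : Summable fun m => ‖z m‖) {s : ℕ}
    (hs : Summable fun m : ℤ => (1 + (2 * π * m) ^ 2) ^ s * ‖z m‖ ^ 2) :
    MemPerSobolev s (trigSeries z) := by
  refine ⟨periodic_trigSeries z, ?_, ?_⟩
  · have : IsFiniteMeasure ((volume : Measure ℝ).restrict (Ioc (0 : ℝ) 1)) := ⟨by simp⟩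
    exact MemLp.of_bound (continuous_trigSeries hz).aestronglyMeasurable _
      (.of_forall (norm_trigSeries_le hz))
  · simpa only [fourierCoef_trigSeries hz] using hs

/-- The operator with the kernel `½ (ψ (x) + ψ (y)) a (x - y)`, where `ψ` has the Fourier
coefficients `z` and `a (x - y)` is the kernel of the multiplier with the symbol `a₀`. -/
def pairOp (a₀ : ℝ → ℝ) (z : ℤ → ℂ) : Op :=
  (1 / 2 : ℂ) • (mulOp (trigSeries z) ∘L rmul a₀ + rmul a₀ ∘L mulOp (trigSeries z))

section PairOp

variable {a₀ : ℝ → ℝ} {z : ℤ → ℂ}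

theorem hasCoef_pairOp (ha : RBdd a₀) (hz : Summable fun m => ‖z m‖) :
    HasCoef (pairOp a₀ z) fun m ξ => 1 / 2 * (z m * a₀ (ξ - m) + a₀ ξ * z m) := by
  have h1 := ((hasCoef_mulOp_comp_rmul ha hz).add
    (hasCoef_rmul_comp_mulOp ha (bddMeas_trigSeries hz))).smul (1 / 2)
  simp only [fourierCoef_trigSeries hz] at h1
  exact h1

theorem isPeriodicOp_pairOp (ha : RBdd a₀) (hz : Summable fun m => ‖z m‖) :
    IsPeriodicOp (pairOp a₀ z) := by
  have h1 := isPeriodicOp_mulOp (bddMeas_trigSeries hz) (periodic_trigSeries z)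
  exact ((h1.comp (isPeriodicOp_rmul ha)).add ((isPeriodicOp_rmul ha).comp h1)).smul _

theorem isKernel_pairOp {μ T Δ₀ h : ℝ} (hT : 0 < T) (hΔ : 0 < Δ₀) (hh : 0 < h)
    (hz : Summable fun m => ‖z m‖) :
    IsKernel (pairOp (pairSym μ T Δ₀ h) z) (pairKernel μ T Δ₀ h (trigSeries z)) := by
  have hk := isKernel_alpha0 (μ := μ) hT hΔ hh
  have hψ := bddMeas_trigSeries hz
  rw [pairOp]
  convert ((hk.mulOp_comp hψ).add (hk.comp_mulOp hψ)).smul (1 / 2) using 1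
  funext x y
  rw [pairKernel]
  ring

end PairOp

/-- The function `ψ₀` has the Fourier coefficients `projCoef a₀ (c m)`. -/
theorem IsSymbol.ae_psi0_eq {μ T Δ₀ h : ℝ} (hT : 0 < T) (hΔ : 0 < Δ₀) (hh : 0 < h) {A : Op}
    {B : ℝ → ℝ → ℂ} (hA : IsPeriodicOp A) (hB : IsSymbol A B)
    (hi : Integrable fun ξ => weight h ξ * sqSym A ξ)
    (hz : Summable fun m => ‖projCoef (pairSym μ T Δ₀ h) (symCoef B m)‖) :
    ∀ᵐ y : ℝ, psi0 μ T Δ₀ h (cellKernel B) y =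
      trigSeries (fun m => projCoef (pairSym μ T Δ₀ h) (symCoef B m)) y := by
  set a₀ := pairSym μ T Δ₀ h with ha₀
  have hab : RBdd a₀ := rBdd_pairSym hT hΔ
  set z : ℤ → ℂ := fun m => projCoef a₀ (symCoef B m) with hzdef
  set n : ℂ := ((∫ ξ, a₀ ξ ^ 2 : ℝ) : ℂ)⁻¹ with hn
  set f : ℝ → ℂ := fun y => n * ∫ ξ, (a₀ ξ : ℂ) * (phase (ξ * y) * B ξ y) with hf
  have hfm : MemLp f 2 cellVol := (hB.memLp_projection hh hA hi hab).const_mul n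
  have htm : MemLp (trigSeries z) 2 cellVol :=
    MemLp.of_bound (continuous_trigSeries hz).aestronglyMeasurable _
      (.of_forall (norm_trigSeries_le hz))
  have h1 := hasSum_norm_sq_cell (hfm.sub htm)
  have h2 : ∀ m : ℤ, ∫ y, phase (-(m * y)) * (f - trigSeries z) y ∂cellVol = 0 := by
    intro m
    have i1 := integrable_phase_mul (B := fun _ => f) (ξ := 0) hfm (-m)
    have i2 := integrable_phase_mul (B := fun _ => trigSeries z) (ξ := 0) htm (-m)
    simp only [neg_mul] at i1 i2
    simp only [Pi.sub_apply, mul_sub]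
    rw [integral_sub i1 i2, integral_phase_mul_trigSeries hz]
    have e : ∀ y, phase (-(m * y)) * f y =
        n * (phase (-(m * y)) * ∫ ξ, (a₀ ξ : ℂ) * (phase (ξ * y) * B ξ y)) := fun y => by
      rw [hf]; ring
    simp_rw [e]
    rw [integral_const_mul, hB.integral_symCoef hh hA hi hab, sub_eq_zero]
    rfl
  simp only [h2, norm_zero, ne_eq, OfNat.ofNat_ne_zero, not_false_eq_true, zero_pow] at h1
  have h3 := h1.unique hasSum_zero
  rw [integral_eq_zero_iff_of_nonneg (fun y => sq_nonneg _)
    ((memLp_two_iff_integrable_sq_norm (hfm.sub htm).1).1 (hfm.sub htm))] at h3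
  have h4 : ∀ᵐ y ∂cellVol, psi0 μ T Δ₀ h (cellKernel B) y = trigSeries z y := by
    filter_upwards [h3, hB.psi0_eq (μ := μ) hT hΔ hh hA hi] with y g1 g2
    rw [g2]
    exact sub_eq_zero.1 (norm_eq_zero.1 (pow_eq_zero_iff two_ne_zero |>.1 g1))
  filter_upwards [ae_fract (P := fun y => psi0 μ T Δ₀ h (cellKernel B) y = trigSeries z y) h4]
    with y hy
  have e1 := periodic_psi0 (μ := μ) (T := T) (Δ₀ := Δ₀) (h := h) B (Int.fract y) ⌊y⌋
  have e2 := (periodic_trigSeries z).int_mul ⌊y⌋ (Int.fract y)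
  rw [mul_one] at e2
  rw [Int.fract_add_floor] at e1 e2
  rw [e1, e2, hy]

section Remainder

variable {h C β τ δ X b : ℝ} {K a₀ : ℝ → ℝ} {c : ℝ → ℂ} {z : ℂ} {m : ℤ}

theorem norm_add_sq_le_two_mul (u v : ℂ) : ‖u + v‖ ^ 2 ≤ 2 * ‖u‖ ^ 2 + 2 * ‖v‖ ^ 2 := by
  have h1 := pow_le_pow_left₀ (norm_nonneg _) (norm_add_le u v) 2
  nlinarith [sq_nonneg (‖u‖ - ‖v‖)]

/-- The remainder after subtracting the symmetrized product of the full projection. -/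
theorem remainder_le (hh : 0 < h) (hC : 0 < C) (hP : PairBounds C h β τ δ K a₀)
    (ha : Measurable a₀) (hc : AEStronglyMeasurable c)
    (hx : Integrable fun ξ => weight h ξ * ‖c ξ - z * a₀ ξ‖ ^ 2)
    (hX : ∫ ξ, weight h ξ * ‖c ξ - z * a₀ ξ‖ ^ 2 ≤ X)
    (hz : (1 + (2 * π * m) ^ 2) * ‖z‖ ^ 2 ≤ b) :
    Integrable (fun ξ => weight h ξ * ‖c ξ - 1 / 2 * (z * a₀ (ξ - m) + a₀ ξ * z)‖ ^ 2) ∧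
    ∫ ξ, weight h ξ * ‖c ξ - 1 / 2 * (z * a₀ (ξ - m) + a₀ ξ * z)‖ ^ 2 ≤
      2 * X + C / 2 * h ^ 3 * b := by
  obtain ⟨h1, h2⟩ := hP.shift_le m
  have hw := fun ξ => (weight_pos h ξ).le
  have hle : ∀ ξ, weight h ξ * ‖c ξ - 1 / 2 * (z * a₀ (ξ - m) + a₀ ξ * z)‖ ^ 2 ≤
      2 * (weight h ξ * ‖c ξ - z * a₀ ξ‖ ^ 2) +
        1 / 2 * ‖z‖ ^ 2 * (weight h ξ * (a₀ ξ - a₀ (ξ - m)) ^ 2) := by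
    intro ξ
    have e : c ξ - 1 / 2 * (z * a₀ (ξ - m) + a₀ ξ * z) =
        (c ξ - z * a₀ ξ) + z / 2 * ((a₀ ξ - a₀ (ξ - m) : ℝ) : ℂ) := by push_cast; ring
    have h3 := norm_add_sq_le_two_mul (c ξ - z * a₀ ξ) (z / 2 * ((a₀ ξ - a₀ (ξ - m) : ℝ) : ℂ))
    rw [← e, norm_mul, mul_pow, Complex.norm_real, Real.norm_eq_abs, sq_abs, norm_div, div_pow,
      Complex.norm_ofNat] at h3
    calc _ ≤ weight h ξ * (2 * ‖c ξ - z * a₀ ξ‖ ^ 2 +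
          2 * (‖z‖ ^ 2 / 2 ^ 2 * (a₀ ξ - a₀ (ξ - m)) ^ 2)) := mul_le_mul_of_nonneg_left h3 (hw ξ)
      _ = _ := by ring
  have hi : Integrable fun ξ => 2 * (weight h ξ * ‖c ξ - z * a₀ ξ‖ ^ 2) +
      1 / 2 * ‖z‖ ^ 2 * (weight h ξ * (a₀ ξ - a₀ (ξ - m)) ^ 2) :=
    (hx.const_mul 2).add (h1.const_mul _)
  have hm : AEStronglyMeasurable fun ξ => c ξ - 1 / 2 * (z * a₀ (ξ - m) + a₀ ξ * z) :=
    hc.sub (by fun_prop : Measurable fun ξ =>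
      (1 / 2 : ℂ) * (z * a₀ (ξ - m) + a₀ ξ * z)).aestronglyMeasurable
  have hint : Integrable
      (fun ξ => weight h ξ * ‖c ξ - 1 / 2 * (z * a₀ (ξ - m) + a₀ ξ * z)‖ ^ 2) := by
    refine hi.mono' ((continuous_weight h).aestronglyMeasurable.mul (hm.norm.pow 2))
      (.of_forall fun ξ => ?_)
    rw [Real.norm_of_nonneg (mul_nonneg (hw ξ) (sq_nonneg _))]
    exact hle ξ
  refine ⟨hint, (integral_mono hint hi hle).trans ?_⟩
  rw [integral_add (hx.const_mul 2) (h1.const_mul _), integral_const_mul, integral_const_mul]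
  have h4 : (2 * π * m) ^ 2 * ‖z‖ ^ 2 ≤ b := by
    have := sq_nonneg ‖z‖
    linarith
  have h5 : 1 / 2 * ‖z‖ ^ 2 * ∫ ξ, weight h ξ * (a₀ ξ - a₀ (ξ - m)) ^ 2 ≤ C / 2 * h ^ 3 * b := by
    calc _ ≤ 1 / 2 * ‖z‖ ^ 2 * (C * h * (h * (2 * π * m)) ^ 2) := by gcongr
      _ = C / 2 * h ^ 3 * ((2 * π * m) ^ 2 * ‖z‖ ^ 2) := by ring
      _ ≤ _ := by gcongr
  linarith

/-- The symmetrized product with a single frequency `m`, in terms of the projection at `m`. -/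
theorem pair_le (hP : PairBounds C h β τ δ K a₀) (ha : Measurable a₀)
    (hi : Integrable fun ξ => weight h ξ * a₀ ξ ^ 2) :
    Integrable (fun ξ => weight h ξ * ‖1 / 2 * (z * a₀ (ξ - m) + a₀ ξ * z)‖ ^ 2) ∧
    ∫ ξ, weight h ξ * ‖1 / 2 * (z * a₀ (ξ - m) + a₀ ξ * z)‖ ^ 2 ≤
      C * h * (2 + (h * (2 * π * m)) ^ 2 / 2) * ‖z‖ ^ 2 := by
  obtain ⟨h1, h2⟩ := hP.shift_le m
  have hw := fun ξ => (weight_pos h ξ).le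
  have hle : ∀ ξ, weight h ξ * ‖1 / 2 * (z * a₀ (ξ - m) + a₀ ξ * z)‖ ^ 2 ≤
      2 * ‖z‖ ^ 2 * (weight h ξ * a₀ ξ ^ 2) +
        1 / 2 * ‖z‖ ^ 2 * (weight h ξ * (a₀ ξ - a₀ (ξ - m)) ^ 2) := by
    intro ξ
    have e : 1 / 2 * (z * a₀ (ξ - m) + a₀ ξ * z) =
        z / 2 * ((a₀ ξ + a₀ (ξ - m) : ℝ) : ℂ) := by push_cast; ring
    rw [e, norm_mul, mul_pow, Complex.norm_real, Real.norm_eq_abs, sq_abs, norm_div, div_pow,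
      Complex.norm_ofNat]
    have h3 : (a₀ ξ + a₀ (ξ - m)) ^ 2 ≤ 8 * a₀ ξ ^ 2 + 2 * (a₀ ξ - a₀ (ξ - m)) ^ 2 := by
      nlinarith [sq_nonneg (3 * a₀ ξ - a₀ (ξ - m))]
    have h4 := mul_nonneg (hw ξ) (sq_nonneg ‖z‖)
    calc _ = weight h ξ * ‖z‖ ^ 2 / 4 * (a₀ ξ + a₀ (ξ - m)) ^ 2 := by ring
      _ ≤ weight h ξ * ‖z‖ ^ 2 / 4 * (8 * a₀ ξ ^ 2 + 2 * (a₀ ξ - a₀ (ξ - m)) ^ 2) := by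
        gcongr
      _ = _ := by ring
  have hi' : Integrable fun ξ => 2 * ‖z‖ ^ 2 * (weight h ξ * a₀ ξ ^ 2) +
      1 / 2 * ‖z‖ ^ 2 * (weight h ξ * (a₀ ξ - a₀ (ξ - m)) ^ 2) :=
    (hi.const_mul _).add (h1.const_mul _)
  have hint : Integrable (fun ξ => weight h ξ * ‖1 / 2 * (z * a₀ (ξ - m) + a₀ ξ * z)‖ ^ 2) := by
    refine hi'.mono' ((continuous_weight h).aestronglyMeasurable.mul
      ((by fun_prop : Measurable fun ξ =>
        (1 / 2 : ℂ) * (z * a₀ (ξ - m) + a₀ ξ * z)).aestronglyMeasurable.norm.pow 2))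
      (.of_forall fun ξ => ?_)
    rw [Real.norm_of_nonneg (mul_nonneg (hw ξ) (sq_nonneg _))]
    exact hle ξ
  refine ⟨hint, (integral_mono hint hi' hle).trans ?_⟩
  rw [integral_add (hi.const_mul _) (h1.const_mul _), integral_const_mul, integral_const_mul]
  calc _ ≤ 2 * ‖z‖ ^ 2 * (C * h) + 1 / 2 * ‖z‖ ^ 2 * (C * h * (h * (2 * π * m)) ^ 2) := by
        gcongr
        exact hP.mass_le
    _ = _ := by ring

end Remainder

/-- The decomposition of a periodic operator `A` whose symbol has coefficients close to multiples
of the translation-invariant pair function. -/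
theorem exists_decomposition {μ T Δ₀ h ε β τ δ C C' S₁ S₂ : ℝ} {K : ℝ → ℝ} {A : Op}
    {B : ℝ → ℝ → ℂ} {X b : ℤ → ℝ} (hT : 0 < T) (hΔ : 0 < Δ₀) (hh : 0 < h) (hhε : h ≤ ε)
    (hε : ε ≤ 1) (hC : 0 < C) (hP : PairBounds C h β τ δ K (pairSym μ T Δ₀ h))
    (hA : IsPeriodicOp A) (hB : IsSymbol A B)
    (hi : Integrable fun ξ => weight h ξ * sqSym A ξ)
    (hX : ∀ m, Integrable (fun ξ => weight h ξ * ‖symCoef B m ξ -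
        projCoef (pairSym μ T Δ₀ h) (symCoef B m) * pairSym μ T Δ₀ h ξ‖ ^ 2) ∧
      ∫ ξ, weight h ξ * ‖symCoef B m ξ -
        projCoef (pairSym μ T Δ₀ h) (symCoef B m) * pairSym μ T Δ₀ h ξ‖ ^ 2 ≤ X m)
    (hXs : Summable X) (hXS : ∑' m, X m ≤ S₁ * h ^ 3)
    (hb : ∀ m : ℤ, (1 + (2 * π * m) ^ 2) *
      ‖projCoef (pairSym μ T Δ₀ h) (symCoef B m)‖ ^ 2 ≤ b m)
    (hbs : Summable b) (hbS : ∑' m, b m ≤ S₂)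
    (hC1 : 1 ≤ C') (hC2 : 2 * S₂ ≤ C') (hC3 : 4 * S₁ + 6 * C * S₂ ≤ C') :
    ∃ (α : ℝ → ℝ → ℂ) (ψ ψ' : ℝ → ℂ) (σ σ₁ σ₂ : Op) (s : ℝ → ℝ → ℂ),
      IsKernel A α ∧ IsKernel σ s ∧
      (∀ x y : ℝ, α x y = pairKernel μ T Δ₀ h ψ x y + s x y) ∧
      MemPerSobolev 2 ψ ∧ perSobolevNorm 1 ψ ≤ C' ∧ perSobolevNorm 2 ψ ≤ C' * ε / h ∧
      (∀ n : ℤ, ε / h ≤ |2 * π * n| → fourierCoef ψ n = 0) ∧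
      h1NormSq h σ ≤ ENNReal.ofReal (C' * h ^ 3 / ε ^ 2) ∧
      σ = σ₁ + σ₂ ∧
      h1NormSq h σ₁ ≤ ENNReal.ofReal (C' * h ^ 3) ∧
      IsKernel σ₂ (pairKernel μ T Δ₀ h ψ') ∧
      MemPerSobolev 1 ψ' ∧
      (∀ n : ℤ, |2 * π * n| < ε / h → fourierCoef ψ' n = 0) ∧
      (∀ᵐ y : ℝ, psi0 μ T Δ₀ h α y = ψ y + ψ' y) := by
  classical
  set a₀ := pairSym μ T Δ₀ h with ha₀
  set z : ℤ → ℂ := fun m => projCoef a₀ (symCoef B m) with hzdef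
  have hε0 : 0 < ε := hh.trans_le hhε
  have hab : RBdd a₀ := rBdd_pairSym hT hΔ
  have ham : Measurable a₀ := (continuous_pairSym hT hΔ).measurable
  have hai := integrable_weight_pairSym_sq (μ := μ) hT hΔ hh
  have hz : Summable fun m => ‖z m‖ := summable_norm_of_summable_weighted hb hbs
  have hcm : ∀ m, AEStronglyMeasurable (symCoef B m) := fun m =>
    (measurable_symCoef hB.measurable m).aestronglyMeasurable
  have hc : HasCoef A (symCoef B) := ⟨B, hB, .of_forall fun ξ m => rfl⟩
  set zl : ℤ → ℂ := fun m => if |2 * π * m| < ε / h then z m else 0 with hzl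
  set zr : ℤ → ℂ := fun m => if |2 * π * m| < ε / h then 0 else z m with hzr
  have hlr : ∀ m, zl m + zr m = z m := fun m => by
    simp only [hzl, hzr]; split_ifs <;> simp
  have hl : ∀ m, ‖zl m‖ ≤ ‖z m‖ := fun m => by
    simp only [hzl]; split_ifs <;> simp
  have hr : ∀ m, ‖zr m‖ ≤ ‖z m‖ := fun m => by
    simp only [hzr]; split_ifs <;> simp
  have hzls : Summable fun m => ‖zl m‖ := hz.of_nonneg_of_le (fun m => norm_nonneg _) hl
  have hzrs : Summable fun m => ‖zr m‖ := hz.of_nonneg_of_le (fun m => norm_nonneg _) hr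
  have hw0 : ∀ m : ℤ, 0 < 1 + (2 * π * m) ^ 2 := fun m => by positivity
  have hb0 : ∀ m, 0 ≤ b m := fun m =>
    (mul_nonneg (hw0 m).le (sq_nonneg _)).trans (hb m)
  have hS₂ : 0 ≤ S₂ := (tsum_nonneg hb0).trans hbS
  have hX0 : ∀ m, 0 ≤ X m := fun m => le_trans
    (integral_nonneg fun ξ => mul_nonneg (weight_pos h ξ).le (sq_nonneg _)) (hX m).2
  have hS₁ : 0 ≤ S₁ :=
    nonneg_of_mul_nonneg_left ((tsum_nonneg hX0).trans hXS) (by positivity)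
  have hbl : ∀ m : ℤ, (1 + (2 * π * m) ^ 2) ^ 1 * ‖zl m‖ ^ 2 ≤ b m := fun m => by
    rw [pow_one]
    refine le_trans ?_ (hb m)
    have := hl m
    have := (hw0 m).le
    gcongr
  have hbr : ∀ m : ℤ, (1 + (2 * π * m) ^ 2) ^ 1 * ‖zr m‖ ^ 2 ≤ b m := fun m => by
    rw [pow_one]
    refine le_trans ?_ (hb m)
    have := hr m
    have := (hw0 m).le
    gcongr
  have hrat : 1 ≤ ε / h := (one_le_div hh).2 hhε
  have hbl2 : ∀ m : ℤ, (1 + (2 * π * m) ^ 2) ^ 2 * ‖zl m‖ ^ 2 ≤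
      2 * (ε / h) ^ 2 * b m := fun m => by
    by_cases hm : |2 * π * m| < ε / h
    · have h1 : (2 * π * m) ^ 2 ≤ (ε / h) ^ 2 := sq_le_sq.2 (hm.le.trans (le_abs_self _))
      have h2 : 1 ≤ (ε / h) ^ 2 := one_le_pow₀ hrat
      have h3 := hbl m
      rw [pow_one] at h3
      calc _ = (1 + (2 * π * m) ^ 2) * ((1 + (2 * π * m) ^ 2) * ‖zl m‖ ^ 2) := by ring
        _ ≤ 2 * (ε / h) ^ 2 * b m :=
          mul_le_mul (by linarith) h3 (mul_nonneg (hw0 m).le (sq_nonneg _)) (by positivity)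
    · have h1 : zl m = 0 := if_neg hm
      rw [h1, norm_zero, zero_pow two_ne_zero, mul_zero]
      exact mul_nonneg (by positivity) (hb0 m)
  have hbr2 : ∀ m : ℤ, ‖zr m‖ ^ 2 ≤ (h / ε) ^ 2 * b m := fun m => by
    by_cases hm : |2 * π * m| < ε / h
    · have h1 : zr m = 0 := if_pos hm
      rw [h1, norm_zero, zero_pow two_ne_zero]
      exact mul_nonneg (by positivity) (hb0 m)
    · have h1 : (ε / h) ^ 2 ≤ (2 * π * m) ^ 2 :=
        sq_le_sq.2 ((abs_of_pos (by positivity)).le.trans (not_lt.1 hm))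
      have h3 := hbr m
      rw [pow_one] at h3
      calc ‖zr m‖ ^ 2 = (h / ε) ^ 2 * ((ε / h) ^ 2 * ‖zr m‖ ^ 2) := by field_simp
        _ ≤ (h / ε) ^ 2 * ((1 + (2 * π * m) ^ 2) * ‖zr m‖ ^ 2) := by
          gcongr
          linarith
        _ ≤ _ := by gcongr
  have hsl : ∀ {s : ℕ} {d : ℝ}, (∀ m : ℤ, (1 + (2 * π * m) ^ 2) ^ s * ‖zl m‖ ^ 2 ≤
      d * b m) → Summable fun m : ℤ => (1 + (2 * π * m) ^ 2) ^ s * ‖zl m‖ ^ 2 :=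
    fun hd => (hbs.mul_left _).of_nonneg_of_le
      (fun m => mul_nonneg (pow_nonneg (hw0 m).le _) (sq_nonneg _)) hd
  have hnorm : ∀ {s : ℕ} {d : ℝ}, 0 ≤ d → (∀ m : ℤ, (1 + (2 * π * m) ^ 2) ^ s *
      ‖zl m‖ ^ 2 ≤ d ^ 2 * b m) → perSobolevNorm s (trigSeries zl) ≤ d * sqrt S₂ := by
    intro s d hd hle
    rw [perSobolevNorm, ← Real.sqrt_sq hd, ← Real.sqrt_mul (sq_nonneg d)]
    refine Real.sqrt_le_sqrt ?_
    simp only [fourierCoef_trigSeries hzls]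
    refine ((hsl hle).tsum_le_tsum hle (hbs.mul_left _)).trans ?_
    rw [tsum_mul_left]
    gcongr
  have hsqrt : sqrt 2 * sqrt S₂ ≤ C' := by
    rw [← Real.sqrt_mul zero_le_two, Real.sqrt_le_left (by linarith)]
    exact hC2.trans (le_self_pow₀ hC1 two_ne_zero)
  have hσc := hc.sub (hasCoef_pairOp hab hzls)
  have hσ₁c := hσc.sub (hasCoef_pairOp hab hzrs)
  have hσp := hA.sub (isPeriodicOp_pairOp hab hzls)
  have hσ₁p := hσp.sub (isPeriodicOp_pairOp hab hzrs)
  -- The coefficients of `σ₁` involve the full projection only.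
  have hrem : ∀ m : ℤ, Integrable (fun ξ => weight h ξ *
      ‖symCoef B m ξ - 1 / 2 * (zl m * a₀ (ξ - m) + a₀ ξ * zl m) -
        1 / 2 * (zr m * a₀ (ξ - m) + a₀ ξ * zr m)‖ ^ 2) ∧
      ∫ ξ, weight h ξ * ‖symCoef B m ξ - 1 / 2 * (zl m * a₀ (ξ - m) + a₀ ξ * zl m) -
        1 / 2 * (zr m * a₀ (ξ - m) + a₀ ξ * zr m)‖ ^ 2 ≤ 2 * X m + C / 2 * h ^ 3 * b m := by
    intro m
    have h1 := remainder_le hh hC hP ham (hcm m) (hX m).1 (hX m).2 (hb m)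
    have e : ∀ ξ : ℝ, symCoef B m ξ - 1 / 2 * (zl m * a₀ (ξ - m) + a₀ ξ * zl m) -
        1 / 2 * (zr m * a₀ (ξ - m) + a₀ ξ * zr m) =
        symCoef B m ξ - 1 / 2 * (z m * a₀ (ξ - m) + a₀ ξ * z m) := fun ξ => by
      rw [← hlr m]; ring
    simp only [e]
    exact h1
  -- Above the cut-off, `|z m|² ≤ (h / ε)² (2πm)² |z m|²`.
  have hpair : ∀ m : ℤ, Integrable (fun ξ => weight h ξ *
      ‖1 / 2 * (zr m * a₀ (ξ - m) + a₀ ξ * zr m)‖ ^ 2) ∧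
      ∫ ξ, weight h ξ * ‖1 / 2 * (zr m * a₀ (ξ - m) + a₀ ξ * zr m)‖ ^ 2 ≤
        5 / 2 * C * h ^ 3 / ε ^ 2 * b m := by
    intro m
    obtain ⟨h1, h2⟩ := pair_le (z := zr m) (m := m) hP ham hai
    refine ⟨h1, h2.trans ?_⟩
    have h3 := hbr2 m
    have h4 : (2 * π * m) ^ 2 * ‖zr m‖ ^ 2 ≤ b m := by
      have h5 := hbr m
      rw [pow_one] at h5
      linarith [sq_nonneg ‖zr m‖]
    have h6 : 1 ≤ 1 / ε ^ 2 := by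
      rw [one_le_div (by positivity)]; exact pow_le_one₀ hε0.le hε
    calc _ = C * h * (2 * ‖zr m‖ ^ 2) + C / 2 * h ^ 3 * ((2 * π * m) ^ 2 * ‖zr m‖ ^ 2) * 1 := by
          ring
      _ ≤ C * h * (2 * ((h / ε) ^ 2 * b m)) + C / 2 * h ^ 3 * b m * (1 / ε ^ 2) := by
          have := hb0 m
          gcongr
      _ = _ := by field_simp; ring
  refine ⟨cellKernel B, trigSeries zl, trigSeries zr, A - pairOp a₀ zl,
    A - pairOp a₀ zl - pairOp a₀ zr, pairOp a₀ zr,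
    fun x y => cellKernel B x y - pairKernel μ T Δ₀ h (trigSeries zl) x y,
    hB.isKernel hh hA hi, (hB.isKernel hh hA hi).sub (isKernel_pairOp hT hΔ hh hzls),
    fun x y => (add_sub_cancel _ _).symm, memPerSobolev_trigSeries hzls (hsl hbl2), ?_, ?_, ?_, ?_,
    (sub_add_cancel _ _).symm, ?_, isKernel_pairOp hT hΔ hh hzrs,
    memPerSobolev_trigSeries hzrs ?_, ?_, ?_⟩
  · refine (hnorm zero_le_one fun m => ?_).trans (le_trans ?_ hsqrt)
    · rw [one_pow, one_mul]; exact hbl m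
    · gcongr
      exact Real.one_le_sqrt.2 one_le_two
  · have h1 := hnorm (s := 2) (d := sqrt 2 * (ε / h)) (by positivity) fun m => by
      rw [mul_pow (sqrt 2), Real.sq_sqrt zero_le_two]; exact hbl2 m
    refine h1.trans ?_
    calc sqrt 2 * (ε / h) * sqrt S₂ = sqrt 2 * sqrt S₂ * (ε / h) := by ring
      _ ≤ C' * (ε / h) := by gcongr
      _ = _ := by ring
  · intro n hn
    rw [fourierCoef_trigSeries hzls]
    exact if_neg hn.not_gt
  · have hsplit : ∀ m : ℤ, ∀ ξ : ℝ, weight h ξ *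
        ‖symCoef B m ξ - 1 / 2 * (zl m * a₀ (ξ - m) + a₀ ξ * zl m)‖ ^ 2 ≤
        2 * (weight h ξ * ‖symCoef B m ξ - 1 / 2 * (zl m * a₀ (ξ - m) + a₀ ξ * zl m) -
          1 / 2 * (zr m * a₀ (ξ - m) + a₀ ξ * zr m)‖ ^ 2) +
        2 * (weight h ξ * ‖1 / 2 * (zr m * a₀ (ξ - m) + a₀ ξ * zr m)‖ ^ 2) := by
      intro m ξ
      have h1 := norm_add_sq_le_two_mul
        (symCoef B m ξ - 1 / 2 * (zl m * a₀ (ξ - m) + a₀ ξ * zl m) -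
          1 / 2 * (zr m * a₀ (ξ - m) + a₀ ξ * zr m))
        (1 / 2 * (zr m * a₀ (ξ - m) + a₀ ξ * zr m))
      rw [sub_add_cancel] at h1
      have h2 := mul_le_mul_of_nonneg_left h1 (weight_pos h ξ).le
      linarith
    have hsi : ∀ m : ℤ, Integrable (fun ξ =>
        2 * (weight h ξ * ‖symCoef B m ξ - 1 / 2 * (zl m * a₀ (ξ - m) + a₀ ξ * zl m) -
          1 / 2 * (zr m * a₀ (ξ - m) + a₀ ξ * zr m)‖ ^ 2) +
        2 * (weight h ξ * ‖1 / 2 * (zr m * a₀ (ξ - m) + a₀ ξ * zr m)‖ ^ 2)) := fun m =>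
      ((hrem m).1.const_mul 2).add ((hpair m).1.const_mul 2)
    have hint : ∀ m : ℤ, Integrable (fun ξ => weight h ξ *
        ‖symCoef B m ξ - 1 / 2 * (zl m * a₀ (ξ - m) + a₀ ξ * zl m)‖ ^ 2) := fun m => by
      refine (hsi m).mono' ((continuous_weight h).aestronglyMeasurable.mul
        (((hcm m).sub (by fun_prop : Measurable fun ξ =>
          (1 / 2 : ℂ) * (zl m * a₀ (ξ - m) + a₀ ξ * zl m)).aestronglyMeasurable).norm.pow 2))
        (.of_forall fun ξ => ?_)
      rw [Real.norm_of_nonneg (mul_nonneg (weight_pos h ξ).le (sq_nonneg _))]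
      exact hsplit m ξ
    refine hσc.h1NormSq_le hσp hint (b := fun m => 2 * (2 * X m + C / 2 * h ^ 3 * b m) +
      2 * (5 / 2 * C * h ^ 3 / ε ^ 2 * b m)) (fun m => ?_) ?_ ?_
    · refine (integral_mono (hint m) (hsi m) (hsplit m)).trans ?_
      rw [integral_add ((hrem m).1.const_mul 2) ((hpair m).1.const_mul 2), integral_const_mul,
        integral_const_mul]
      linarith [(hrem m).2, (hpair m).2]
    · exact (((hXs.mul_left 2).add (hbs.mul_left _)).mul_left 2).add ((hbs.mul_left _).mul_left 2)
    · have h1 := ((((hXs.hasSum.mul_left 2).add (hbs.hasSum.mul_left (C / 2 * h ^ 3))).mul_left 2).add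
        ((hbs.hasSum.mul_left (5 / 2 * C * h ^ 3 / ε ^ 2)).mul_left 2)).tsum_eq
      rw [h1]
      have h6 : 1 ≤ 1 / ε ^ 2 := by
        rw [one_le_div (by positivity)]; exact pow_le_one₀ hε0.le hε
      calc _ ≤ 2 * (2 * (S₁ * h ^ 3) + C / 2 * h ^ 3 * S₂) +
            2 * (5 / 2 * C * h ^ 3 / ε ^ 2 * S₂) := by gcongr
        _ = (4 * S₁ + C * S₂) * h ^ 3 * 1 + 5 * C * S₂ * h ^ 3 / ε ^ 2 := by ring
        _ ≤ (4 * S₁ + C * S₂) * h ^ 3 * (1 / ε ^ 2) + 5 * C * S₂ * h ^ 3 / ε ^ 2 := by gcongr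
        _ = (4 * S₁ + 6 * C * S₂) * h ^ 3 / ε ^ 2 := by ring
        _ ≤ _ := by gcongr
  · refine hσ₁c.h1NormSq_le hσ₁p (fun m => (hrem m).1) (b := fun m => 2 * X m + C / 2 * h ^ 3 * b m)
      (fun m => (hrem m).2) ((hXs.mul_left 2).add (hbs.mul_left _)) ?_
    rw [((hXs.hasSum.mul_left 2).add (hbs.hasSum.mul_left (C / 2 * h ^ 3))).tsum_eq]
    have h1 : 0 ≤ C * S₂ := mul_nonneg hC.le hS₂
    calc _ ≤ 2 * (S₁ * h ^ 3) + C / 2 * h ^ 3 * S₂ := by gcongr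
      _ = (2 * S₁ + C * S₂ / 2) * h ^ 3 := by ring
      _ ≤ _ := by gcongr; linarith
  · exact hbs.of_nonneg_of_le
      (fun m => mul_nonneg (pow_nonneg (hw0 m).le _) (sq_nonneg _)) hbr
  · intro n hn
    rw [fourierCoef_trigSeries hzrs]
    exact if_pos hn
  · filter_upwards [hB.ae_psi0_eq (μ := μ) hT hΔ hh hA hi hz] with y hy
    rw [hy]
    have h1 := ((hasSum_trigSeries hzls y).add (hasSum_trigSeries hzrs y)).tsum_eq
    rw [← h1, trigSeries]
    congr 1; funext m
    rw [← add_mul, hlr]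

end BCS

end

theorem mainTheorem5 (μ a D Tc : ℝ) (W : ℝ → ℝ) (ha : 0 < a) (hD : 0 < D)
    (hTc : BCS.IsCriticalTemperature μ a Tc)
    (hW_meas : Measurable W) (hW_bdd : ∃ M : ℝ, ∀ x, |W x| ≤ M)
    (hW_per : Function.Periodic W 1) (hW_mean : ∫ x in (0 : ℝ)..1, W x = 0) :
    ∃ C ε₀ : ℝ, 0 < C ∧ 0 < ε₀ ∧
      ∀ h ε T Δ₀ : ℝ, 0 < h → h ≤ ε → ε ≤ ε₀ →
        T = Tc * (1 - D * h ^ 2) → BCS.IsGap μ a T Δ₀ →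
        ∀ Γ : BCS.SumOp, BCS.Admissible Γ →
          BCS.energy μ a T h W Γ ≤ BCS.energy μ a T h W (BCS.Gamma0 μ T Δ₀ h) →
          ∃ (α : ℝ → ℝ → ℂ) (ψ ψ' : ℝ → ℂ) (σ σ₁ σ₂ : BCS.Op) (s : ℝ → ℝ → ℂ),
            BCS.IsKernel (BCS.entry12 Γ) α ∧
            BCS.IsKernel σ s ∧
            (∀ x y : ℝ, α x y = BCS.pairKernel μ T Δ₀ h ψ x y + s x y) ∧
            BCS.MemPerSobolev 2 ψ ∧
            BCS.perSobolevNorm 1 ψ ≤ C ∧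
            BCS.perSobolevNorm 2 ψ ≤ C * ε / h ∧
            (∀ n : ℤ, ε / h ≤ |2 * Real.pi * n| → BCS.fourierCoef ψ n = 0) ∧
            BCS.h1NormSq h σ ≤ ENNReal.ofReal (C * h ^ 3 / ε ^ 2) ∧
            σ = σ₁ + σ₂ ∧
            BCS.h1NormSq h σ₁ ≤ ENNReal.ofReal (C * h ^ 3) ∧
            BCS.IsKernel σ₂ (BCS.pairKernel μ T Δ₀ h ψ') ∧
            BCS.MemPerSobolev 1 ψ' ∧
            (∀ n : ℤ, |2 * Real.pi * n| < ε / h → BCS.fourierCoef ψ' n = 0) ∧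
            (∀ᵐ y : ℝ, BCS.psi0 μ T Δ₀ h α y = ψ y + ψ' y) := by
  obtain ⟨M, hM⟩ := hW_bdd
  obtain ⟨C, h₀, hC, hh₀, hh₀1, hPB⟩ := BCS.exists_pairBounds ha hD hTc
  set S₁ := C ^ 3 * M ^ 2 with hS₁
  set S₂ := 2 * C * (3 * C ^ 2 * M ^ 2 + 2 * C) + 2 * C ^ 4 * M ^ 2 + 4 * C ^ 6 * M ^ 2 with hS₂
  have hC0 : 0 < C := one_pos.trans_le hC
  have q1 : 0 ≤ S₁ := by positivity
  have q2 : 0 ≤ S₂ := by positivity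
  have q3 : 0 ≤ 6 * C * S₂ := by positivity
  refine ⟨1 + 2 * S₂ + (4 * S₁ + 6 * C * S₂), h₀, by positivity, hh₀, ?_⟩
  intro h ε T Δ₀ hh hhε hε hT hgap Γ hΓ hE
  have hh0 : h ≤ h₀ := hhε.trans hε
  obtain ⟨hT0, hTC, hP⟩ := hPB h T Δ₀ hh hh0 hT hgap
  have hW : BCS.RBdd W := BCS.rBdd_of_le hW_meas hM
  have hper := hΓ.isState.periodic12
  obtain ⟨hA, -⟩ := BCS.energy_bounds ha hT0 hh hgap hC0 hP hW hW_per hM hΓ hE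
  have hsq : Integrable (BCS.sqSym (BCS.entry12 Γ)) := by
    refine hA.mono' (BCS.measurable_sqSym _).aestronglyMeasurable ?_
    filter_upwards [BCS.sqSym_nonneg hper] with ξ f1
    rw [Real.norm_of_nonneg f1]
    exact le_mul_of_one_le_left f1 (BCS.one_le_weight h ξ)
  obtain ⟨B, hB⟩ := BCS.exists_isSymbol hper hsq
  obtain ⟨X, b, hX, hXs, hXS, hb, hbs, hbS⟩ := BCS.sum_projCoef_le ha hT0 hh (hh0.trans hh₀1) hgap
    hC hTC hP hW hW_per hM hΓ hE ⟨B, hB, Filter.Eventually.of_forall fun ξ m => rfl⟩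
  exact BCS.exists_decomposition hT0 hgap.1 hh hhε (hε.trans hh₀1) hC0 hP hper hB hA hX hXs hXS hb
    hbs hbS (by linarith) (by linarith) (by linarith)
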